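/- **Setting.** Let $\mathbb{B}^d$ be the open Euclidean unit ball of $\mathbb{C}^d$. For $\mu>-1$ let $dv_\mu(z)=\frac{\Gamma(d+\mu+1)}{\pi^d\,\Gamma(\mu+1)}(1-|z|^2)^\mu\,dv(z)$, where $v$ is Lebesgue measure, and let $\mathcal{A}^2_\mu(\mathbb{B}^d)$ be the Hilbert space of holomorphic functions in $L^2(\mathbb{B}^d,v_\mu)$, with the orthonormal basis $e^\mu_\alpha(z)=\sqrt{\tfrac{\Gamma(d+|\alpha|+\mu+1)}{\alpha!\,\Gamma(d+\mu+1)}}\;z^\alpha$, $\alpha\in\mathbb{Z}_+^d$. For $f\in L^\infty(\mathbb{B}^d)$ the Toeplitz operator is $T^\mu_f h=P_\mu(fh)$, with $P_\mu$ the orthogonal projection of $L^2(\mathbb{B}^d,v_\mu)$ onto $\mathcal{A}^2_\mu(\mathbb{B}^d)$. The Berezin transform of a bounded operator $A$ on $\mathcal{A}^2_\mu(\mathbb{B}^d)$ is $\mathcal{B}_\mu[A](z)=\langle Ak^\mu_z,k^\mu_z\rangle$, where $k^\mu_z(w)=(1-|z|^2)^{(d+\mu+1)/2}(1-w\cdot\overline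 z)^{-(d+\mu+1)}$. Let $\mathrm{BUC}(\mathbb{B}^d)$ be the $C^*$-algebra (supremum norm) of bounded functions on $\mathbb{B}^d$ that are uniformly continuous with respect to the Bergman metric, let $M(\mathrm{BUC})$ be its compact space of maximal ideals (characters), and identify $\mathrm{BUC}(\mathbb{B}^d)=C(M(\mathrm{BUC}))$ by the Gelfand transform. Let $1\le \ell\le n-1$, $\lambda>-1$, and let $k=(k_1,\dots,k_m)$ be positive integers with $k_1+\dots+k_m=\ell$. Write $z=(z',z'')\in\mathbb{C}^\ell\times\mathbb{C}^{n-\ell}$, divide the first $\ell$ coordinates into $m$ consecutive groups of sizes $k_1,\dots,k_m$, and write $\alpha'=(\alpha_{(1)},\dots,\alpha_{(m)})$ for $\alpha'\in\mathbb{Z}_+^\ell$ accordingly. For $\rho\in\mathbb{Z}_+^m$ let $\mathscr{H}_\rho=\mathrm{span}\{e^\lambda_{\alpha'}: |\alpha_{(j)}|=\rho_j,\ j=1,\dots,m\}\subset\mathcal{A}^2_\lambda(\mathbb{B}^\ell)$. Let $$U:\mathcal{A}^2_\lambda(\mathbb{B}^n)\to\bigoplus_{\rho\in\mathbb{Z}_+^m}\mathscr{H}_\rho\otimes\mathcal{A}^2_{\lambda+|\rho|+\ell}(\mathbb{B}^{n-\ell})$$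 be the unitary operator with $U e^\lambda_{(\alpha',\alpha'')}=e^\lambda_{\alpha'}\otimes e^{\lambda+|\rho|+\ell}_{\alpha''}$ for $\rho=(|\alpha_{(1)}|,\dots,|\alpha_{(m)}|)$, and write $\mathbf{T}\asymp\bigoplus_\rho T_\rho$ for $U\mathbf{T}U^*=\bigoplus_\rho T_\rho$. Let $\boldsymbol{\mathcal{T}}_\lambda(1,\mathrm{BUC}(\mathbb{B}^{n-\ell}))$ be the $C^*$-algebra generated by all Toeplitz operators on $\mathcal{A}^2_\lambda(\mathbb{B}^n)$ with symbols $f_c(z)=c(z'')$, $c\in\mathrm{BUC}(\mathbb{B}^{n-\ell})$, and let $\mathcal{T}_\mu(\mathrm{BUC}(\mathbb{B}^{n-\ell}))$ be the $C^*$-algebra generated by all $T^\mu_c$ on $\mathcal{A}^2_\mu(\mathbb{B}^{n-\ell})$, $c\in\mathrm{BUC}(\mathbb{B}^{n-\ell})$. **Statement.** 1. Every $\mathbf{T}^\lambda\in\boldsymbol{\mathcal{T}}_\lambda(1,\mathrm{BUC}(\mathbb{B}^{n-\ell}))$ can be written as $\mathbf{T}^\lambda\asymp\bigoplus_{\rho}I\otimes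 T^{\lambda+|\rho|+\ell}$ for exactly one family of bounded operators $T^{\lambda+p+\ell}$ on $\mathcal{A}^2_{\lambda+p+\ell}(\mathbb{B}^{n-\ell})$, $p\in\mathbb{Z}_+$, and $T^{\lambda+p+\ell}\in\mathcal{T}_{\lambda+p+\ell}(\mathrm{BUC}(\mathbb{B}^{n-\ell}))$ for all $p$. The limit $$\nu(\mathbf{T}^\lambda)=\lim_{|\rho|\to\infty}\mathcal{B}_{\lambda+|\rho|+\ell}\big[T^{\lambda+|\rho|+\ell}\big]$$ exists uniformly on $\mathbb{B}^{n-\ell}$ and belongs to $\mathrm{BUC}(\mathbb{B}^{n-\ell})$, and $\nu$ is a continuous unital $*$-homomorphism of $\boldsymbol{\mathcal{T}}_\lambda(1,\mathrm{BUC}(\mathbb{B}^{n-\ell}))$ onto $\mathrm{BUC}(\mathbb{B}^{n-\ell})=C(M(\mathrm{BUC}))$. 2. For each $\eta\in M(\mathrm{BUC})$ the map $\nu_\eta:\mathbf{T}^\lambda\mapsto c(\eta)$, where $c=\nu(\mathbf{T}^\lambda)\in C(M(\mathrm{BUC}))$, is a (continuous, unital) one-dimensional representation of $\boldsymbol{\mathcal{T}}_\lambda(1,\mathrm{BUC}(\mathbb{B}^{n-\ell}))$.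 3. In contrast, for every $\mu>-1$ the algebra $\mathcal{T}_\mu(\mathrm{BUC}(\mathbb{B}^{n-\ell}))$ has no non-trivial one-dimensional representation: every $*$-homomorphism from it to $\mathbb{C}$ is zero. -/

import Mathlib

open MeasureTheory Filter Topology
open scoped ENNReal TensorProduct BoundedContinuousFunction

namespace WeightedBergman

/-- `ℂ^d` with its Euclidean norm. -/
abbrev Cn (d : ℕ) : Type := EuclideanSpace ℂ (Fin d)

/-- The open Euclidean unit ball of `ℂ^d`. -/
abbrev 𝔹 (d : ℕ) : Type := ↥(Metric.ball (0 : Cn d) 1)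

/-- The function `(1 - |z|²)^μ` times the normalizing constant
`c_μ = Γ(d+μ+1) / (π^d Γ(μ+1))`. -/
noncomputable def weight (d : ℕ) (μ : ℝ) (z : Cn d) : ℝ :=
  Real.Gamma (d + μ + 1) / (Real.pi ^ d * Real.Gamma (μ + 1)) * (1 - ‖z‖ ^ 2) ^ μ

/-- The weighted measure `dv_μ` on the ball; `volume` is Lebesgue measure. -/
noncomputable def vol (d : ℕ) (μ : ℝ) : Measure (𝔹 d) :=
  (Measure.comap Subtype.val (volume : Measure (Cn d))).withDensity fun z => ENNReal.ofReal (weight d μ z)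

/-- Holomorphic functions on the ball. -/
def Holo {d : ℕ} (f : 𝔹 d → ℂ) : Prop :=
  ∃ g : Cn d → ℂ, DifferentiableOn ℂ g (Metric.ball 0 1) ∧ ∀ z : 𝔹 d, f z = g z

theorem enorm_mul_volume_le {d : ℕ} {g : Cn d → ℂ}
    (hg : DifferentiableOn ℂ g (Metric.ball 0 1)) {z : Cn d} {r : ℝ}
    (hzr : Metric.ball z r ⊆ Metric.ball 0 1) :
    ‖g z‖ₑ * volume (Metric.ball (0 : Cn d) r) ≤ ∫⁻ w in Metric.ball z r, ‖g w‖ₑ := by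
  set G : Cn d → ℝ≥0∞ := (Metric.ball z r).indicator fun w => ‖g w‖ₑ with hG
  have hGm : Measurable G := by
    have hc : ContinuousOn (fun w => ‖g w‖ₑ) (Metric.ball z r) :=
      continuous_enorm.comp_continuousOn (hg.continuousOn.mono hzr)
    classical
    rw [hG, ← Set.piecewise_eq_indicator]
    exact hc.measurable_piecewise continuousOn_const measurableSet_ball
  -- the mean value property on complex lines
  have key : ∀ w ∈ Metric.ball (0 : Cn d) r,
      ENNReal.ofReal (2 * Real.pi) * ‖g z‖ₑ ≤
        ∫⁻ θ in Set.Ioc (0 : ℝ) (2 * Real.pi), G (z + circleMap 0 1 θ • w) := by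
    intro w hw
    have hline : ∀ t ∈ Metric.closedBall (0 : ℂ) 1, z + t • w ∈ Metric.ball z r := by
      intro t ht
      simp only [Metric.mem_ball, dist_self_add_left, norm_smul] at hw ⊢
      simp only [Metric.mem_closedBall, dist_zero_right] at ht hw
      nlinarith [norm_nonneg w, norm_nonneg t]
    have hdiff : DiffContOnCl ℂ (fun t : ℂ => g (z + t • w)) (Metric.ball 0 |1|) := by
      apply DifferentiableOn.diffContOnCl
      have : closure (Metric.ball (0 : ℂ) |1|) ⊆ Metric.closedBall 0 1 := by
        simpa using Metric.closure_ball_subset_closedBall (x := (0 : ℂ)) (ε := 1)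
      intro t ht
      have h1 : DifferentiableAt ℂ g (z + t • w) :=
        hg.differentiableAt (Metric.isOpen_ball.mem_nhds (hzr (hline t (this ht))))
      have h2 : DifferentiableAt ℂ (fun t : ℂ => z + t • w) t := by fun_prop
      exact (DifferentiableAt.comp t h1 h2).differentiableWithinAt
    have havg := hdiff.circleAverage
    rw [Real.circleAverage_def] at havg
    simp only [zero_smul, add_zero] at havg
    have hpi : (0 : ℝ) < 2 * Real.pi := by positivity
    have h3 : (2 * Real.pi) • g z =
        ∫ θ in (0 : ℝ)..2 * Real.pi, g (z + circleMap 0 1 θ • w) := by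
      rw [← havg, smul_smul, mul_inv_cancel₀ hpi.ne', one_smul]
    calc ENNReal.ofReal (2 * Real.pi) * ‖g z‖ₑ = ‖(2 * Real.pi) • g z‖ₑ := by
          rw [enorm_smul, Real.enorm_of_nonneg hpi.le]
      _ = ‖∫ θ in Set.Ioc (0 : ℝ) (2 * Real.pi), g (z + circleMap 0 1 θ • w)‖ₑ := by
          rw [h3, intervalIntegral.integral_of_le hpi.le]
      _ ≤ ∫⁻ θ in Set.Ioc (0 : ℝ) (2 * Real.pi), ‖g (z + circleMap 0 1 θ • w)‖ₑ :=
          enorm_integral_le_lintegral_enorm _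
      _ = _ := by
          refine lintegral_congr fun θ => ?_
          rw [hG, Set.indicator_of_mem]
          exact hline _ (by simp)
  have hmeas : Measurable fun p : Cn d × ℝ => G (z + circleMap 0 1 p.2 • p.1) := by
    apply hGm.comp
    have : Continuous fun p : Cn d × ℝ => z + circleMap 0 1 p.2 • p.1 := by
      have := continuous_circleMap (0 : ℂ) 1
      fun_prop
    exact this.measurable
  have hrot : ∀ θ : ℝ, ∫⁻ w in Metric.ball (0 : Cn d) r, G (z + circleMap 0 1 θ • w) ≤
      ∫⁻ w in Metric.ball z r, ‖g w‖ₑ := by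
    intro θ
    let u : Circle := Circle.exp θ
    have hu : (circleMap 0 1 θ : ℂ) = u := by simp [u, circleMap, Circle.coe_exp]
    let e : Cn d ≃ₗᵢ[ℝ] Cn d :=
      { toLinearEquiv := 
          { toFun := fun w => (u : ℂ) • w
            invFun := fun w => (u : ℂ)⁻¹ • w
            map_add' := by intro x y; simp
            map_smul' := fun c x => smul_comm _ c x
            left_inv := by intro x; simp [smul_smul]
            right_inv := by intro x; simp [smul_smul] }
        norm_map' := fun x => (norm_smul (u : ℂ) x).trans (by rw [Circle.norm_coe, one_mul]) }
    have he : MeasurePreserving e volume volume := e.measurePreserving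
    calc ∫⁻ w in Metric.ball (0 : Cn d) r, G (z + circleMap 0 1 θ • w)
        ≤ ∫⁻ w, G (z + circleMap 0 1 θ • w) := setLIntegral_le_lintegral _ _
      _ = ∫⁻ w, G (z + e w) := by rw [hu]; rfl
      _ = ∫⁻ w, G (z + w) :=
          he.lintegral_comp (f := fun w => G (z + w)) (hGm.comp (measurable_const_add z))
      _ = ∫⁻ w, G w := lintegral_add_left_eq_self G z
      _ = _ := by rw [hG, lintegral_indicator measurableSet_ball]
  have hpi : ENNReal.ofReal (2 * Real.pi) ≠ 0 := by
    simp [Real.pi_pos]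
  rw [← ENNReal.mul_le_mul_iff_right hpi ENNReal.ofReal_ne_top]
  calc ENNReal.ofReal (2 * Real.pi) * (‖g z‖ₑ * volume (Metric.ball (0 : Cn d) r))
      = ∫⁻ _w in Metric.ball (0 : Cn d) r, ENNReal.ofReal (2 * Real.pi) * ‖g z‖ₑ := by
        rw [setLIntegral_const, mul_assoc]
    _ ≤ ∫⁻ w in Metric.ball (0 : Cn d) r,
          ∫⁻ θ in Set.Ioc (0 : ℝ) (2 * Real.pi), G (z + circleMap 0 1 θ • w) :=
        setLIntegral_mono' measurableSet_ball key
    _ = ∫⁻ θ in Set.Ioc (0 : ℝ) (2 * Real.pi),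
          ∫⁻ w in Metric.ball (0 : Cn d) r, G (z + circleMap 0 1 θ • w) :=
        lintegral_lintegral_swap hmeas.aemeasurable
    _ ≤ ∫⁻ _θ in Set.Ioc (0 : ℝ) (2 * Real.pi), ∫⁻ w in Metric.ball z r, ‖g w‖ₑ :=
        lintegral_mono hrot
    _ = _ := by
        rw [setLIntegral_const, Real.volume_Ioc, sub_zero, mul_comm]


theorem measurable_weight (d : ℕ) (μ : ℝ) : Measurable (weight d μ) := by
  unfold weight; fun_prop

theorem lintegral_vol {d : ℕ} {μ : ℝ} {f : Cn d → ℝ≥0∞}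
    (hf : Measurable fun z : 𝔹 d => f z) :
    ∫⁻ z : 𝔹 d, f z ∂vol d μ =
      ∫⁻ z in Metric.ball (0 : Cn d) 1, ENNReal.ofReal (weight d μ z) * f z := by
  have hw : Measurable fun z : 𝔹 d => ENNReal.ofReal (weight d μ z) :=
    ((measurable_weight d μ).comp measurable_subtype_coe).ennreal_ofReal
  rw [vol, lintegral_withDensity_eq_lintegral_mul _ hw hf]
  exact lintegral_subtype_comap measurableSet_ball
    (fun z => ENNReal.ofReal (weight d μ z) * f z)

theorem exists_weight_ge {d : ℕ} {μ : ℝ}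
    (hc : 0 < Real.Gamma (d + μ + 1) / (Real.pi ^ d * Real.Gamma (μ + 1))) {R : ℝ}
    (hR : R < 1) : ∃ δ > 0, ∀ z : Cn d, ‖z‖ ≤ R → δ ≤ weight d μ z := by
  rcases le_or_gt R 0 with h0 | h0
  · refine ⟨_, hc, fun z hz => ?_⟩
    have : ‖z‖ = 0 := le_antisymm (hz.trans h0) (norm_nonneg z)
    simp [weight, this]
  have ha : 0 < 1 - R ^ 2 := by nlinarith
  refine ⟨_, mul_pos hc (lt_min one_pos (Real.rpow_pos_of_pos ha μ)), fun z hz => ?_⟩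
  have h1 : 1 - R ^ 2 ≤ 1 - ‖z‖ ^ 2 := by nlinarith [norm_nonneg z]
  refine mul_le_mul_of_nonneg_left ?_ hc.le
  rcases le_or_gt 0 μ with hμ | hμ
  · exact (min_le_right _ _).trans (Real.rpow_le_rpow ha.le h1 hμ)
  · exact (min_le_left _ _).trans
      (Real.one_le_rpow_of_pos_of_le_one_of_nonpos (ha.trans_le h1)
        (by nlinarith [norm_nonneg z]) hμ.le)

theorem Holo.continuous {d : ℕ} {f : 𝔹 d → ℂ} (hf : Holo f) : Continuous f := by
  obtain ⟨g, hg, hfg⟩ := hf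
  rw [show f = fun z : 𝔹 d => g z from funext hfg]
  exact continuousOn_iff_continuous_domRestrict.1 hg.continuousOn

/-- Point evaluations are locally uniformly bounded on square integrable holomorphic functions. -/
theorem exists_eval_bound {d : ℕ} {μ : ℝ}
    (hc : 0 < Real.Gamma (d + μ + 1) / (Real.pi ^ d * Real.Gamma (μ + 1))) {R : ℝ}
    (hR : R < 1) : ∃ C : ℝ≥0∞, C ≠ ∞ ∧ ∀ g : Cn d → ℂ,
      DifferentiableOn ℂ g (Metric.ball 0 1) → ∀ z : Cn d, ‖z‖ ≤ R →
        ‖g z‖ₑ ^ 2 ≤ C * eLpNorm (fun w : 𝔹 d => g w) 2 (vol d μ) ^ 2 := by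
  set r : ℝ := (1 - R) / 2 with hr
  have hr0 : 0 < r := by rw [hr]; linarith
  obtain ⟨δ, hδ, hw⟩ := exists_weight_ge (d := d) hc (R := (1 + R) / 2) (by linarith)
  set V := volume (Metric.ball (0 : Cn d) r) with hV
  have hV0 : V ≠ 0 := (Metric.measure_ball_pos _ _ hr0).ne'
  have hVt : V ≠ ∞ := measure_ball_lt_top.ne
  have hδ0 : ENNReal.ofReal δ ≠ 0 := by simpa using hδ
  refine ⟨(ENNReal.ofReal δ)⁻¹ * V⁻¹, ENNReal.mul_ne_top (by simpa using hδ) (by simpa using hV0),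
    fun g hg z hz => ?_⟩
  have hsub : ∀ w ∈ Metric.ball z r, ‖w‖ ≤ (1 + R) / 2 := by
    intro w hw
    have : ‖w‖ ≤ ‖w - z‖ + ‖z‖ := by simpa using norm_add_le (w - z) z
    rw [mem_ball_iff_norm] at hw
    linarith
  have hsub' : Metric.ball z r ⊆ Metric.ball (0 : Cn d) 1 := by
    intro w hw
    have := hsub w hw
    rw [mem_ball_zero_iff]; linarith
  have h1 := enorm_mul_volume_le (hg.pow 2) hsub'
  have hm : Measurable fun w : 𝔹 d => ‖g w‖ₑ ^ 2 :=
    ((continuous_enorm.comp (Holo.continuous ⟨g, hg, fun _ => rfl⟩)).measurable).pow_const 2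
  have h2 : eLpNorm (fun w : 𝔹 d => g w) 2 (vol d μ) ^ 2 =
      ∫⁻ w in Metric.ball (0 : Cn d) 1, ENNReal.ofReal (weight d μ w) * ‖g w‖ₑ ^ 2 := by
    rw [← lintegral_vol (f := fun w => ‖g w‖ₑ ^ 2) hm]
    have := eLpNorm_nnreal_pow_eq_lintegral (f := fun w : 𝔹 d => g w) (μ := vol d μ)
      (p := 2) two_ne_zero
    simpa using this
  have h3 : ENNReal.ofReal δ * ∫⁻ w in Metric.ball z r, ‖g w‖ₑ ^ 2 ≤
      eLpNorm (fun w : 𝔹 d => g w) 2 (vol d μ) ^ 2 := by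
    rw [h2, ← lintegral_const_mul' _ _ ENNReal.ofReal_ne_top]
    refine le_trans ?_ (lintegral_mono_set hsub')
    refine setLIntegral_mono' measurableSet_ball fun w hw' => ?_
    gcongr
    exact hw w (hsub w hw')
  calc ‖g z‖ₑ ^ 2 = V⁻¹ * (‖g z ^ 2‖ₑ * V) := by
        rw [enorm_pow, mul_comm _ V, ← mul_assoc, ENNReal.inv_mul_cancel hV0 hVt, one_mul]
    _ ≤ V⁻¹ * ∫⁻ w in Metric.ball z r, ‖g w‖ₑ ^ 2 := by
        gcongr
        simpa [enorm_pow] using h1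
    _ = (ENNReal.ofReal δ)⁻¹ * V⁻¹ *
          (ENNReal.ofReal δ * ∫⁻ w in Metric.ball z r, ‖g w‖ₑ ^ 2) := by
        rw [mul_comm _ V⁻¹, mul_assoc, ← mul_assoc _ (ENNReal.ofReal δ),
          ENNReal.inv_mul_cancel hδ0 ENNReal.ofReal_ne_top, one_mul]
    _ ≤ _ := by gcongr

/-- The weighted Bergman space `A²_μ(𝔹^d)`: the (classes of) holomorphic functions
in `L²(𝔹^d, v_μ)`. -/
noncomputable def bergmanSubmodule (d : ℕ) (μ : ℝ) : Submodule ℂ (Lp ℂ 2 (vol d μ)) where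
  carrier := {F | ∃ f : 𝔹 d → ℂ, Holo f ∧ F =ᵐ[vol d μ] f}
  zero_mem' := ⟨0, ⟨0, differentiableOn_const 0, fun _ => rfl⟩, Lp.coeFn_zero _ _ _⟩
  add_mem' := by
    rintro F G ⟨f, ⟨f', hf', hff⟩, hF⟩ ⟨g, ⟨g', hg', hgg⟩, hG⟩
    exact ⟨f + g, ⟨f' + g', hf'.add hg', fun z => by simp [hff, hgg]⟩,
      (Lp.coeFn_add F G).trans (hF.add hG)⟩
  smul_mem' := by
    rintro c F ⟨f, ⟨f', hf', hff⟩, hF⟩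
    exact ⟨c • f, ⟨c • f', hf'.const_smul c, fun z => by simp [hff]⟩,
      (Lp.coeFn_smul c F).trans (hF.const_smul c)⟩

theorem isClosed_bergmanSubmodule (d : ℕ) (μ : ℝ) :
    IsClosed (bergmanSubmodule d μ : Set (Lp ℂ 2 (vol d μ))) := by
  rcases le_or_gt (Real.Gamma (d + μ + 1) / (Real.pi ^ d * Real.Gamma (μ + 1))) 0 with hc | hc
  · have hv : vol d μ = 0 := by
      have : ∀ z : 𝔹 d, ENNReal.ofReal (weight d μ z) = 0 := by
        intro z
        have hz := mem_ball_zero_iff.1 z.2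
        rw [ENNReal.ofReal_eq_zero]
        exact mul_nonpos_of_nonpos_of_nonneg hc
          (Real.rpow_nonneg (by nlinarith [norm_nonneg (z : Cn d)]) _)
      rw [vol, funext this]
      exact withDensity_zero
    have : (bergmanSubmodule d μ : Set (Lp ℂ 2 (vol d μ))) = Set.univ := by
      refine Set.eq_univ_of_forall fun F => ⟨0, ⟨0, differentiableOn_const 0, fun _ => rfl⟩, ?_⟩
      have : ae (vol d μ) = ⊥ := ae_eq_bot.2 hv
      rw [Filter.EventuallyEq, this]
      exact Filter.eventually_bot
    rw [this]
    exact isClosed_univ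
  rw [← isSeqClosed_iff_isClosed]
  intro F L hF hL
  choose f hf hFf using hF
  choose g hg hfg using hf
  have hFg : ∀ n, F n =ᵐ[vol d μ] fun w : 𝔹 d => g n w := fun n =>
    (hFf n).trans (Filter.Eventually.of_forall (hfg n))
  have hcau : CauchySeq F := hL.cauchySeq
  -- uniform Cauchy property on smaller balls
  have hunif : ∀ R < 1, ∀ ε > 0, ∃ N, ∀ m ≥ N, ∀ n ≥ N, ∀ z : Cn d, ‖z‖ ≤ R →
      ‖g m z - g n z‖ ≤ ε := by
    intro R hR ε hε
    obtain ⟨C, hC, hbound⟩ := exists_eval_bound (d := d) (μ := μ) hc hR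
    obtain ⟨N, hN⟩ := Metric.cauchySeq_iff.1 hcau (ε / (C.toReal + 1).sqrt)
      (div_pos hε (Real.sqrt_pos.2 (by positivity)))
    refine ⟨N, fun m hm n hn z hz => ?_⟩
    have h1 := hbound (g m - g n) ((hg m).sub (hg n)) z hz
    have h2 : eLpNorm (fun w : 𝔹 d => (g m - g n) w) 2 (vol d μ) = ‖F m - F n‖ₑ := by
      rw [Lp.enorm_def]
      refine eLpNorm_congr_ae ?_
      filter_upwards [hFg m, hFg n, Lp.coeFn_sub (F m) (F n)] with w a b c
      rw [c, Pi.sub_apply, Pi.sub_apply, a, b]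
    rw [h2] at h1
    have h3 : ‖g m z - g n z‖ ^ 2 ≤ C.toReal * ‖F m - F n‖ ^ 2 := by
      have := ENNReal.toReal_mono
        (ENNReal.mul_ne_top hC (ENNReal.pow_ne_top enorm_ne_top)) h1
      simpa using this
    have h4 : ‖F m - F n‖ < ε / (C.toReal + 1).sqrt := by
      rw [← dist_eq_norm]; exact hN m hm n hn
    have h5 : (0 : ℝ) < C.toReal + 1 := by positivity
    have h6 : ‖F m - F n‖ ^ 2 ≤ ε ^ 2 / (C.toReal + 1) := by
      calc ‖F m - F n‖ ^ 2 ≤ (ε / (C.toReal + 1).sqrt) ^ 2 := by gcongr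
        _ = _ := by rw [div_pow, Real.sq_sqrt h5.le]
    have h7 : ‖g m z - g n z‖ ^ 2 ≤ ε ^ 2 := by
      calc _ ≤ C.toReal * ‖F m - F n‖ ^ 2 := h3
        _ ≤ (C.toReal + 1) * (ε ^ 2 / (C.toReal + 1)) := by gcongr; linarith
        _ = ε ^ 2 := by field_simp
    exact (pow_le_pow_iff_left₀ (norm_nonneg _) hε.le two_ne_zero).1 h7
  have hptc : ∀ z ∈ Metric.ball (0 : Cn d) 1, CauchySeq fun n => g n z := by
    intro z hz
    rw [mem_ball_zero_iff] at hz
    rw [Metric.cauchySeq_iff]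
    intro ε hε
    obtain ⟨N, hN⟩ := hunif ‖z‖ hz (ε / 2) (by positivity)
    refine ⟨N, fun m hm n hn => ?_⟩
    rw [dist_eq_norm]
    linarith [hN m hm n hn z le_rfl]
  have hderiv : ∀ R < 1, ∀ ε > 0, ∃ N, ∀ m ≥ N, ∀ n ≥ N, ∀ z : Cn d, ‖z‖ ≤ R →
      ‖fderiv ℂ (g m) z - fderiv ℂ (g n) z‖ ≤ ε := by
    intro R hR ε hε
    set r : ℝ := (1 - R) / 2 with hr
    have hr0 : 0 < r := by rw [hr]; linarith
    obtain ⟨N, hN⟩ := hunif ((1 + R) / 2) (by linarith) (r * ε / 4) (by positivity)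
    refine ⟨N, fun m hm n hn z hz => ?_⟩
    have hsub : ∀ w ∈ Metric.ball z r, ‖w‖ ≤ (1 + R) / 2 := by
      intro w hw
      have : ‖w‖ ≤ ‖w - z‖ + ‖z‖ := by simpa using norm_add_le (w - z) z
      rw [mem_ball_iff_norm] at hw
      linarith
    have hsub' : Metric.ball z r ⊆ Metric.ball (0 : Cn d) 1 := by
      intro w hw
      have := hsub w hw
      rw [mem_ball_zero_iff]; linarith
    have hz1 : z ∈ Metric.ball (0 : Cn d) 1 := hsub' (Metric.mem_ball_self hr0)
    have hd : ∀ n, DifferentiableAt ℂ (g n) z := fun n =>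
      (hg n).differentiableAt (Metric.isOpen_ball.mem_nhds hz1)
    have hmap : Set.MapsTo (g m - g n) (Metric.ball z r)
        (Metric.ball ((g m - g n) z) (r * ε)) := by
      intro w hw
      rw [mem_ball_iff_norm]
      calc ‖(g m - g n) w - (g m - g n) z‖ ≤ ‖g m w - g n w‖ + ‖g m z - g n z‖ := norm_sub_le _ _
        _ ≤ r * ε / 4 + r * ε / 4 :=
            add_le_add (hN m hm n hn w (hsub w hw))
              (hN m hm n hn z (hsub z (Metric.mem_ball_self hr0)))
        _ < r * ε := by have : 0 < r * ε := by positivity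
                        linarith
    have := Complex.norm_fderiv_le_div_of_mapsTo_ball
      (((hg m).sub (hg n)).mono hsub') (hmap.mono_right Metric.ball_subset_closedBall) hr0
    rw [fderiv_sub (hd m) (hd n)] at this
    calc _ ≤ r * ε / r := this
      _ = ε := by field_simp
  have hderivc : ∀ z ∈ Metric.ball (0 : Cn d) 1, CauchySeq fun n => fderiv ℂ (g n) z := by
    intro z hz
    rw [mem_ball_zero_iff] at hz
    rw [Metric.cauchySeq_iff]
    intro ε hε
    obtain ⟨N, hN⟩ := hderiv ‖z‖ hz (ε / 2) (by positivity)
    refine ⟨N, fun m hm n hn => ?_⟩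
    rw [dist_eq_norm]
    linarith [hN m hm n hn z le_rfl]
  have hex : ∀ z : Cn d, ∃ a : ℂ, z ∈ Metric.ball (0 : Cn d) 1 →
      Tendsto (fun n => g n z) atTop (𝓝 a) := by
    intro z
    by_cases hz : z ∈ Metric.ball (0 : Cn d) 1
    · obtain ⟨a, ha⟩ := cauchySeq_tendsto_of_complete (hptc z hz)
      exact ⟨a, fun _ => ha⟩
    · exact ⟨0, fun h => absurd h hz⟩
  have hex' : ∀ z : Cn d, ∃ a : Cn d →L[ℂ] ℂ, z ∈ Metric.ball (0 : Cn d) 1 →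
      Tendsto (fun n => fderiv ℂ (g n) z) atTop (𝓝 a) := by
    intro z
    by_cases hz : z ∈ Metric.ball (0 : Cn d) 1
    · obtain ⟨a, ha⟩ := cauchySeq_tendsto_of_complete (hderivc z hz)
      exact ⟨a, fun _ => ha⟩
    · exact ⟨0, fun h => absurd h hz⟩
  choose G hG using hex
  choose G' hG' using hex'
  have hloc : TendstoLocallyUniformlyOn (fun n => fderiv ℂ (g n)) G' atTop
      (Metric.ball (0 : Cn d) 1) := by
    rw [Metric.tendstoLocallyUniformlyOn_iff]
    intro ε hε z hz
    rw [mem_ball_zero_iff] at hz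
    obtain ⟨N, hN⟩ := hderiv ((1 + ‖z‖) / 2) (by linarith) (ε / 2) (by positivity)
    refine ⟨Metric.ball 0 ((1 + ‖z‖) / 2), mem_nhdsWithin_of_mem_nhds
      (Metric.isOpen_ball.mem_nhds (by rw [mem_ball_zero_iff]; linarith)),
      eventually_atTop.2 ⟨N, fun n hn w hw => ?_⟩⟩
    rw [mem_ball_zero_iff] at hw
    have hw1 : w ∈ Metric.ball (0 : Cn d) 1 := by rw [mem_ball_zero_iff]; linarith
    have hlim : Tendsto (fun m => ‖fderiv ℂ (g m) w - fderiv ℂ (g n) w‖) atTop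
        (𝓝 ‖G' w - fderiv ℂ (g n) w‖) := ((hG' w hw1).sub_const _).norm
    have := le_of_tendsto hlim (eventually_atTop.2 ⟨N, fun m hm => hN m hm n hn w hw.le⟩)
    rw [dist_eq_norm]
    linarith
  have hGd : DifferentiableOn ℂ G (Metric.ball 0 1) := fun z hz =>
    (hasFDerivAt_of_tendstoLocallyUniformlyOn Metric.isOpen_ball hloc
      (fun n w hw => ((hg n).differentiableAt (Metric.isOpen_ball.mem_nhds hw)).hasFDerivAt)
      (fun w hw => hG w hw) hz).differentiableAt.differentiableWithinAt
  refine ⟨fun w => G w, ⟨G, hGd, fun _ => rfl⟩, ?_⟩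
  obtain ⟨φ, hφ, hae⟩ := (tendstoInMeasure_of_tendsto_Lp hL).exists_seq_tendsto_ae
  filter_upwards [hae, ae_all_iff.2 hFg] with w hw1 hw2
  refine tendsto_nhds_unique hw1 ?_
  simp only [hw2]
  exact (hG w w.2).comp hφ.tendsto_atTop

/-- The weighted Bergman space `A²_μ(𝔹^d)` as a Hilbert space, with the inner product of
`L²(𝔹^d, v_μ)`. -/
def Bergman (d : ℕ) (μ : ℝ) : Type := bergmanSubmodule d μ

noncomputable instance (d : ℕ) (μ : ℝ) : NormedAddCommGroup (Bergman d μ) :=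
  inferInstanceAs (NormedAddCommGroup (bergmanSubmodule d μ))

noncomputable instance (d : ℕ) (μ : ℝ) : InnerProductSpace ℂ (Bergman d μ) :=
  inferInstanceAs (InnerProductSpace ℂ (bergmanSubmodule d μ))

instance (d : ℕ) (μ : ℝ) : CompleteSpace (bergmanSubmodule d μ) :=
  (isClosed_bergmanSubmodule d μ).completeSpace_coe

instance (d : ℕ) (μ : ℝ) : CompleteSpace (Bergman d μ) :=
  inferInstanceAs (CompleteSpace (bergmanSubmodule d μ))

/-- The inclusion of `A²_μ(𝔹^d)` into `L²(𝔹^d, v_μ)`. -/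
noncomputable def inclusion (d : ℕ) (μ : ℝ) : Bergman d μ →L[ℂ] Lp ℂ 2 (vol d μ) :=
  (bergmanSubmodule d μ).subtypeL

/-- The Bergman projection, i.e. the orthogonal projection of `L²(𝔹^d, v_μ)` onto `A²_μ(𝔹^d)`. -/
noncomputable def projection (d : ℕ) (μ : ℝ) : Lp ℂ 2 (vol d μ) →L[ℂ] Bergman d μ :=
  (bergmanSubmodule d μ).orthogonalProjectionOnto

/-- An element of `L²(𝔹^d, v_μ)` that lies in the Bergman space, as an element of the latter. -/
def Bergman.mk {d : ℕ} {μ : ℝ} (F : Lp ℂ 2 (vol d μ)) (hF : F ∈ bergmanSubmodule d μ) :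
    Bergman d μ :=
  (⟨F, hF⟩ : bergmanSubmodule d μ)

theorem inclusion_mk {d : ℕ} {μ : ℝ} (F : Lp ℂ 2 (vol d μ)) (hF : F ∈ bergmanSubmodule d μ) :
    inclusion d μ (Bergman.mk F hF) = F :=
  rfl

theorem toLp_mem_bergmanSubmodule {d : ℕ} {μ : ℝ} {f : 𝔹 d → ℂ} (hf : Holo f)
    (h : MemLp f 2 (vol d μ)) : h.toLp f ∈ bergmanSubmodule d μ :=
  ⟨f, hf, h.coeFn_toLp⟩

open Classical in
/-- The element of `A²_μ(𝔹^d)` given by a holomorphic, `v_μ`-square integrable function `f`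
(and `0` if `f` is not of this kind; see `toBergman_spec` for the functions used below). -/
noncomputable def toBergman (d : ℕ) (μ : ℝ) (f : 𝔹 d → ℂ) : Bergman d μ :=
  if h : Holo f ∧ MemLp f 2 (vol d μ) then
    Bergman.mk (h.2.toLp f) (toLp_mem_bergmanSubmodule h.1 h.2) else 0

theorem isFiniteMeasure_vol (d : ℕ) {μ : ℝ} (hμ : -1 < μ) : IsFiniteMeasure (vol d μ) := by
  refine ⟨?_⟩
  rw [← lintegral_one, lintegral_vol (f := fun _ => 1) measurable_const]
  simp only [mul_one]
  have hint : IntegrableOn (weight d μ) (Metric.ball (0 : Cn d) 1) := by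
    refine Integrable.const_mul ?_ _
    rcases Nat.eq_zero_or_pos d with rfl | hd
    · have : Subsingleton (Cn 0) := inferInstance
      have h0 : (fun z : Cn 0 => (1 - ‖z‖ ^ 2) ^ μ) = fun _ => 1 := by
        funext z
        simp [Subsingleton.elim z 0]
      rw [h0]
      exact (integrableOn_const measure_ball_lt_top.ne)
    have : Nonempty (Fin d) := ⟨⟨0, hd⟩⟩
    have : Nontrivial (Cn d) := inferInstance
    have := (integrableOn_fun_norm_addHaar (volume : Measure (Cn d))
      (f := fun y : ℝ => (1 - y ^ 2) ^ μ) (r := 1)).2 ?_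
    · exact this
    have hbase : IntegrableOn (fun y : ℝ => (1 - y) ^ μ) (Set.Ioo 0 1) := by
      have h1 : IntervalIntegrable (fun x : ℝ => x ^ μ) volume 0 1 :=
        intervalIntegral.intervalIntegrable_rpow' hμ
      have h2 := (h1.comp_sub_left 1).symm
      simp only [sub_zero, sub_self] at h2
      exact ((intervalIntegrable_iff_integrableOn_Ioo_of_le zero_le_one).1 h2)
    have h2μ : (0 : ℝ) < 2 ^ |μ| := by positivity
    refine Integrable.mono' (hbase.const_mul (2 ^ |μ|)) ?_ ?_
    · apply Measurable.aestronglyMeasurable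
      fun_prop
    · refine (ae_restrict_iff' measurableSet_Ioo).2 (Eventually.of_forall fun y hy => ?_)
      obtain ⟨hy0, hy1⟩ := hy
      have e1 : (1 : ℝ) - y ^ 2 = (1 - y) * (1 + y) := by ring
      rw [smul_eq_mul, norm_mul, e1, Real.mul_rpow (by linarith) (by linarith)]
      have hA : ‖y ^ (Module.finrank ℝ (Cn d) - 1)‖ ≤ 1 := by
        rw [norm_pow, Real.norm_of_nonneg hy0.le]
        exact pow_le_one₀ hy0.le hy1.le
      have hB : (1 + y) ^ μ ≤ 2 ^ |μ| := by
        calc (1 + y) ^ μ ≤ (1 + y) ^ |μ| :=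
              Real.rpow_le_rpow_of_exponent_le (by linarith) (le_abs_self μ)
          _ ≤ 2 ^ |μ| := Real.rpow_le_rpow (by linarith) (by linarith) (abs_nonneg μ)
      have hP : 0 ≤ (1 - y) ^ μ := Real.rpow_nonneg (by linarith) _
      have hQ : 0 ≤ (1 + y) ^ μ := Real.rpow_nonneg (by linarith) _
      rw [Real.norm_of_nonneg (mul_nonneg hP hQ)]
      calc _ ≤ 1 * ((1 - y) ^ μ * 2 ^ |μ|) := by gcongr
        _ = _ := by ring
  exact hint.lintegral_lt_top

/-- A bounded holomorphic function is an element of every weighted Bergman space of weight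
`μ > -1`. -/
theorem toBergman_spec {d : ℕ} {μ : ℝ} (hμ : -1 < μ) {f : 𝔹 d → ℂ} (hf : Holo f) {C : ℝ}
    (hC : ∀ z, ‖f z‖ ≤ C) : inclusion d μ (toBergman d μ f) =ᵐ[vol d μ] f := by
  have := isFiniteMeasure_vol d hμ
  have h : Holo f ∧ MemLp f 2 (vol d μ) :=
    ⟨hf, MemLp.of_bound hf.continuous.aestronglyMeasurable C (Eventually.of_forall hC)⟩
  rw [toBergman, dif_pos h, inclusion_mk]
  exact h.2.coeFn_toLp

/-- The normalized monomials
`e_α(z) = (Γ(d+|α|+μ+1) / (α! Γ(d+μ+1)))^{1/2} z^α`. -/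
noncomputable def monomialFun (d : ℕ) (μ : ℝ) (α : Fin d → ℕ) (z : 𝔹 d) : ℂ :=
  (Real.sqrt (Real.Gamma (d + ((∑ i, α i : ℕ) : ℝ) + μ + 1) /
    (((∏ i, (α i).factorial : ℕ) : ℝ) * Real.Gamma (d + μ + 1))) : ℂ) *
      ∏ i, (z : Cn d) i ^ α i

/-- The normalized monomials as elements of `A²_μ(𝔹^d)`. -/
noncomputable def normMonomial (d : ℕ) (μ : ℝ) (α : Fin d → ℕ) : Bergman d μ :=
  toBergman d μ (monomialFun d μ α)

theorem normMonomial_ae_eq {d : ℕ} {μ : ℝ} (hμ : -1 < μ) (α : Fin d → ℕ) :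
    inclusion d μ (normMonomial d μ α) =ᵐ[vol d μ] monomialFun d μ α := by
  refine toBergman_spec hμ (C := ‖(Real.sqrt (Real.Gamma (d + ((∑ i, α i : ℕ) : ℝ) + μ + 1) /
    (((∏ i, (α i).factorial : ℕ) : ℝ) * Real.Gamma (d + μ + 1))) : ℂ)‖)
    ⟨fun z => _ * ∏ i, z i ^ α i, ?_, fun _ => rfl⟩ fun z => ?_
  · apply Differentiable.differentiableOn
    fun_prop
  · rw [monomialFun, norm_mul, norm_prod]
    refine mul_le_of_le_one_right (norm_nonneg _) (Finset.prod_le_one (fun _ _ => norm_nonneg _)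
      fun i _ => ?_)
    rw [norm_pow]
    exact pow_le_one₀ (norm_nonneg _)
      ((PiLp.norm_apply_le (z : Cn d) i).trans (mem_ball_zero_iff.1 z.2).le)

/-- The normalized reproducing kernel
`k_z(w) = (1 - |z|²)^{(d+μ+1)/2} / (1 - w · z̄)^{d+μ+1}`. -/
noncomputable def kernelFun (d : ℕ) (μ : ℝ) (z w : 𝔹 d) : ℂ :=
  (((1 - ‖(z : Cn d)‖ ^ 2) ^ ((d + μ + 1) / 2) : ℝ) : ℂ) /
    (1 - inner ℂ (z : Cn d) (w : Cn d)) ^ ((d + μ + 1 : ℝ) : ℂ)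

/-- The normalized reproducing kernel as an element of `A²_μ(𝔹^d)`. -/
noncomputable def bergmanKernel (d : ℕ) (μ : ℝ) (z : 𝔹 d) : Bergman d μ :=
  toBergman d μ (kernelFun d μ z)

theorem bergmanKernel_ae_eq {d : ℕ} {μ : ℝ} (hμ : -1 < μ) (z : 𝔹 d) :
    inclusion d μ (bergmanKernel d μ z) =ᵐ[vol d μ] kernelFun d μ z := by
  have hz := mem_ball_zero_iff.1 z.2
  have hin : ∀ w : Cn d, ‖w‖ < 1 → ‖inner ℂ (z : Cn d) w‖ ≤ ‖(z : Cn d)‖ := fun w hw =>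
    (norm_inner_le_norm _ _).trans (mul_le_of_le_one_right (norm_nonneg _) hw.le)
  have hslit : ∀ w : Cn d, ‖w‖ < 1 → 1 - inner ℂ (z : Cn d) w ∈ Complex.slitPlane := by
    intro w hw
    left
    have := (Complex.re_le_norm (inner ℂ (z : Cn d) w)).trans (hin w hw)
    simp only [Complex.sub_re, Complex.one_re]
    linarith
  have hlow : ∀ w : Cn d, ‖w‖ < 1 → 1 - ‖(z : Cn d)‖ ≤ ‖1 - inner ℂ (z : Cn d) w‖ := by
    intro w hw
    have := norm_sub_norm_le (1 : ℂ) (inner ℂ (z : Cn d) w)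
    rw [norm_one] at this
    linarith [hin w hw]
  have hs : 0 ≤ (d : ℝ) + μ + 1 := by
    have : (0 : ℝ) ≤ d := by positivity
    linarith
  refine toBergman_spec hμ (C := ((1 - ‖(z : Cn d)‖ ^ 2) ^ ((d + μ + 1) / 2)) /
    (1 - ‖(z : Cn d)‖) ^ (d + μ + 1)) ⟨fun w => _ / (1 - inner ℂ (z : Cn d) w) ^ _, ?_, fun _ => rfl⟩
    fun w => ?_
  · intro w hw
    rw [mem_ball_zero_iff] at hw
    have hne := Complex.slitPlane_ne_zero (hslit w hw)
    have h1 : DifferentiableAt ℂ (fun w : Cn d => 1 - inner ℂ (z : Cn d) w) w :=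
      (differentiableAt_const _).sub (innerSL ℂ (z : Cn d)).differentiableAt
    have h2 := h1.cpow (differentiableAt_const ((d + μ + 1 : ℝ) : ℂ)) (hslit w hw)
    refine DifferentiableAt.differentiableWithinAt ?_
    have h3 : (1 - inner ℂ (z : Cn d) w) ^ ((d + μ + 1 : ℝ) : ℂ) ≠ 0 := by
      simp [Complex.cpow_eq_zero_iff, hne]
    simpa only [div_eq_mul_inv] using (h2.fun_inv h3).const_mul _
  · have hw := mem_ball_zero_iff.1 w.2
    have hne := Complex.slitPlane_ne_zero (hslit w hw)
    have hnum : 0 ≤ (1 - ‖(z : Cn d)‖ ^ 2) ^ ((d + μ + 1) / 2) :=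
      Real.rpow_nonneg (by nlinarith [norm_nonneg (z : Cn d)]) _
    rw [kernelFun, norm_div, Complex.norm_real, Real.norm_of_nonneg hnum, 
      Complex.norm_cpow_real]
    have h1z : 0 < 1 - ‖(z : Cn d)‖ := by linarith
    exact div_le_div_of_nonneg_left hnum (Real.rpow_pos_of_pos h1z _)
      (Real.rpow_le_rpow h1z.le (hlow w hw) hs)

/-- The Toeplitz operator `T_F h = P(F h)` on `A²_μ(𝔹^d)` with symbol `F ∈ L^∞`, where `P` is the
orthogonal projection of `L²` onto `A²_μ(𝔹^d)`. -/
noncomputable def toeplitz (d : ℕ) (μ : ℝ) (F : Lp ℂ ∞ (vol d μ)) :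
    Bergman d μ →L[ℂ] Bergman d μ :=
  projection d μ ∘L
    (ContinuousLinearMap.mul ℂ ℂ).holderL (vol d μ) ∞ 2 2 F ∘L inclusion d μ

/-- A bounded continuous function on the ball, as an element of `L^∞`. -/
noncomputable def symbol {d : ℕ} (μ : ℝ) (c : 𝔹 d →ᵇ ℂ) : Lp ℂ ∞ (vol d μ) :=
  MemLp.toLp (p := ∞) c (memLp_top_of_bound c.continuous.aestronglyMeasurable ‖c‖
    (Eventually.of_forall c.norm_coe_le_norm))

/-- The Berezin transform `B_μ[A](z) = ⟨A k_z, k_z⟩` (the inner product of Mathlib is linear in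
the second variable). -/
noncomputable def berezin {d : ℕ} {μ : ℝ} (A : Bergman d μ →L[ℂ] Bergman d μ) (z : 𝔹 d) : ℂ :=
  inner ℂ (bergmanKernel d μ z) (A (bergmanKernel d μ z))

/-- The automorphism `φ_z` of the ball that interchanges `0` and `z`:
`φ_z(w) = (z - P_z w - (1 - |z|²)^{1/2} (w - P_z w)) / (1 - w · z̄)`, with `P_z` the orthogonal
projection onto the span of `z`. -/
noncomputable def mobius {d : ℕ} (z w : Cn d) : Cn d :=
  (1 - inner ℂ z w)⁻¹ •
    (z - (ℂ ∙ z).starProjection w -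
      (Real.sqrt (1 - ‖z‖ ^ 2) : ℂ) • (w - (ℂ ∙ z).starProjection w))

/-- The distance of the Bergman metric on the ball,
`β(z,w) = ½ log ((1 + |φ_z(w)|) / (1 - |φ_z(w)|))`. -/
noncomputable def bergmanDist {d : ℕ} (z w : 𝔹 d) : ℝ :=
  1 / 2 * Real.log ((1 + ‖mobius (z : Cn d) w‖) / (1 - ‖mobius (z : Cn d) w‖))

/-- Uniform continuity with respect to the Bergman metric. -/
def BergmanUniformlyContinuous {d : ℕ} (f : 𝔹 d → ℂ) : Prop :=
  ∀ ε > 0, ∃ δ > 0, ∀ z w : 𝔹 d, bergmanDist z w < δ → ‖f z - f w‖ < ε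

/-- `BUC(𝔹^d)`: the bounded functions on the ball that are uniformly continuous with respect to
the Bergman metric, with the supremum norm and the pointwise operations. -/
def BUC (d : ℕ) : StarSubalgebra ℂ (𝔹 d →ᵇ ℂ) where
  carrier := {f | BergmanUniformlyContinuous f}
  mul_mem' := by
    intro f g hf hg ε hε
    have hF : 0 < ‖f‖ + 1 := by positivity
    have hG : 0 < ‖g‖ + 1 := by positivity
    obtain ⟨δ, hδ, h1⟩ := hf (ε / 2 / (‖g‖ + 1)) (by positivity)
    obtain ⟨δ', hδ', h2⟩ := hg (ε / 2 / (‖f‖ + 1)) (by positivity)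
    refine ⟨min δ δ', lt_min hδ hδ', fun z w hzw => ?_⟩
    have a := h1 z w (hzw.trans_le (min_le_left _ _))
    have b := h2 z w (hzw.trans_le (min_le_right _ _))
    rw [lt_div_iff₀ hG] at a
    rw [lt_div_iff₀ hF] at b
    calc ‖(f * g) z - (f * g) w‖ = ‖f z * (g z - g w) + (f z - f w) * g w‖ := by
          rw [BoundedContinuousFunction.mul_apply, BoundedContinuousFunction.mul_apply]
          congr 1; ring
      _ ≤ ‖f z‖ * ‖g z - g w‖ + ‖f z - f w‖ * ‖g w‖ := by
          rw [← norm_mul, ← norm_mul]; exact norm_add_le _ _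
      _ ≤ (‖f‖ + 1) * ‖g z - g w‖ + ‖f z - f w‖ * (‖g‖ + 1) := by
          gcongr
          · exact (f.norm_coe_le_norm z).trans (by linarith)
          · exact (g.norm_coe_le_norm w).trans (by linarith)
      _ < ε := by linarith
  add_mem' := by
    intro f g hf hg ε hε
    obtain ⟨δ, hδ, h1⟩ := hf (ε / 2) (by positivity)
    obtain ⟨δ', hδ', h2⟩ := hg (ε / 2) (by positivity)
    refine ⟨min δ δ', lt_min hδ hδ', fun z w hzw => ?_⟩
    have a := h1 z w (hzw.trans_le (min_le_left _ _))
    have b := h2 z w (hzw.trans_le (min_le_right _ _))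
    calc ‖(f + g) z - (f + g) w‖ = ‖(f z - f w) + (g z - g w)‖ := by
          rw [BoundedContinuousFunction.add_apply, BoundedContinuousFunction.add_apply]
          congr 1; ring
      _ ≤ _ := norm_add_le _ _
      _ < ε := by linarith
  algebraMap_mem' := by
    intro c ε hε
    exact ⟨1, one_pos, fun z w _ => by simpa using hε⟩
  star_mem' := by
    intro f hf ε hε
    obtain ⟨δ, hδ, h⟩ := hf ε hε
    refine ⟨δ, hδ, fun z w hzw => ?_⟩
    rw [BoundedContinuousFunction.star_apply, BoundedContinuousFunction.star_apply, ← star_sub,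
      norm_star]
    exact h z w hzw

instance isClosed_BUC (d : ℕ) : IsClosed (BUC d : Set (𝔹 d →ᵇ ℂ)) := by
  rw [← isSeqClosed_iff_isClosed]
  intro F f hF hf ε hε
  obtain ⟨n, hn⟩ := ((Metric.tendsto_nhds.1 hf) (ε / 3) (by positivity)).exists
  obtain ⟨δ, hδ, h⟩ := hF n (ε / 3) (by positivity)
  refine ⟨δ, hδ, fun z w hzw => ?_⟩
  have a := h z w hzw
  have b := ((F n).dist_coe_le_dist (g := f) z).trans_lt hn
  have c := ((F n).dist_coe_le_dist (g := f) w).trans_lt hn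
  rw [dist_comm] at b
  rw [← dist_eq_norm] at a ⊢
  calc dist (f z) (f w) ≤ dist (f z) (F n z) + dist (F n z) (F n w) + dist (F n w) (f w) :=
        dist_triangle4 _ _ _ _
    _ < ε := by linarith

noncomputable instance (d : ℕ) : CommCStarAlgebra (𝔹 d →ᵇ ℂ) where

noncomputable instance (d : ℕ) : CommCStarAlgebra (BUC d) :=
  StarSubalgebra.commCStarAlgebra (BUC d)

/-- The projection `z = (z', z'') ↦ z''` of the ball of `ℂ^ℓ × ℂ^d` onto the ball of `ℂ^d`. -/
def lastCoords (ℓ d : ℕ) : C(𝔹 (ℓ + d), 𝔹 d) where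
  toFun z := ⟨WithLp.toLp 2 fun i => (z : Cn (ℓ + d)) (Fin.natAdd ℓ i), by
    have hz := mem_ball_zero_iff.1 z.2
    rw [mem_ball_zero_iff]
    refine lt_of_le_of_lt ?_ hz
    rw [EuclideanSpace.norm_eq, EuclideanSpace.norm_eq]
    apply Real.sqrt_le_sqrt
    rw [Fin.sum_univ_add]
    exact le_add_of_nonneg_left (Finset.sum_nonneg fun _ _ => sq_nonneg _)⟩
  continuous_toFun := by
    refine Continuous.subtype_mk ?_ _
    refine (PiLp.continuous_toLp 2 _).comp (continuous_pi fun i => ?_)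
    exact (continuous_apply _).comp ((PiLp.continuous_ofLp 2 _).comp continuous_subtype_val)

/-- The `C*`-algebra `𝓣_μ(BUC(𝔹^d))` generated by the Toeplitz operators `T_c` on `A²_μ(𝔹^d)` with
`c ∈ BUC(𝔹^d)`. -/
noncomputable def toeplitzAlg (d : ℕ) (μ : ℝ) :
    StarSubalgebra ℂ (Bergman d μ →L[ℂ] Bergman d μ) :=
  (StarAlgebra.adjoin ℂ {T | ∃ c ∈ BUC d, T = toeplitz d μ (symbol μ c)}).topologicalClosure

/-- With `n = ℓ + d`: the `C*`-algebra `𝓣_λ(1, BUC(𝔹^d))` generated by the Toeplitz operators on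
`A²_λ(𝔹^n)` with symbols `f_c(z) = c(z'')`, `c ∈ BUC(𝔹^d)`. -/
noncomputable def bigToeplitzAlg (ℓ d : ℕ) (lam : ℝ) :
    StarSubalgebra ℂ (Bergman (ℓ + d) lam →L[ℂ] Bergman (ℓ + d) lam) :=
  (StarAlgebra.adjoin ℂ {T | ∃ c ∈ BUC d,
    T = toeplitz (ℓ + d) lam (symbol lam (c.compContinuous (lastCoords ℓ d)))}).topologicalClosure

/-- The first `ℓ` coordinates are divided into `m` consecutive groups of sizes `k_1, …, k_m`;
`groupDegree k α = (|α_(1)|, …, |α_(m)|)`. -/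
def groupDegree {ℓ m : ℕ} (k : Fin m → ℕ) (α : Fin ℓ → ℕ) (j : Fin m) : ℕ :=
  ∑ i : Fin ℓ with (∑ a with a < j, k a) ≤ i.val ∧ i.val < (∑ a with a ≤ j, k a), α i

/-- The finite-dimensional space spanned by those `e_α ∈ A²_λ(𝔹^ℓ)` with `|α_(j)| = ρ_j` for
all `j`. -/
noncomputable def levelSpace {m : ℕ} (ℓ : ℕ) (lam : ℝ) (k : Fin m → ℕ) (ρ : Fin m → ℕ) :
    Submodule ℂ (Bergman ℓ lam) :=
  Submodule.span ℂ {f | ∃ α : Fin ℓ → ℕ, groupDegree k α = ρ ∧ f = normMonomial ℓ lam α}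

theorem normMonomial_mem_levelSpace {m : ℕ} (ℓ : ℕ) (lam : ℝ) (k : Fin m → ℕ) (α : Fin ℓ → ℕ) :
    normMonomial ℓ lam α ∈ levelSpace ℓ lam k (groupDegree k α) :=
  Submodule.subset_span ⟨α, rfl, rfl⟩

/-- The space `A²_{λ+p+ℓ}(𝔹^d)`. -/
abbrev Fiber (ℓ d : ℕ) (lam : ℝ) (p : ℕ) : Type := Bergman d (lam + p + ℓ)

/-- The Hilbert space `ℋ_ρ ⊗ A²_{λ+|ρ|+ℓ}(𝔹^d)`; the algebraic tensor product is complete since the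
first factor is finite-dimensional. -/
abbrev Summand {m : ℕ} (ℓ d : ℕ) (lam : ℝ) (k : Fin m → ℕ) (ρ : Fin m → ℕ) : Type :=
  levelSpace ℓ lam k ρ ⊗[ℂ] Fiber ℓ d lam (∑ j, ρ j)

/-- The Hilbert space direct sum of the spaces `ℋ_ρ ⊗ A²_{λ+|ρ|+ℓ}(𝔹^d)`. -/
abbrev DirectSumSpace {m : ℕ} (ℓ d : ℕ) (lam : ℝ) (k : Fin m → ℕ) : Type :=
  lp (fun ρ : Fin m → ℕ => Summand ℓ d lam k ρ) 2

/-- `U` is the unitary operator determined by `U e_α = e_α' ⊗ e_α''`, `α = (α', α'')`, the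
right-hand side belonging to the summand with index `(|α_(1)|, …, |α_(m)|)`. -/
def IsSplitting {m : ℕ} (ℓ d : ℕ) (lam : ℝ) (k : Fin m → ℕ)
    (U : Bergman (ℓ + d) lam ≃ₗᵢ[ℂ] DirectSumSpace ℓ d lam k) : Prop :=
  ∀ (α' : Fin ℓ → ℕ) (α'' : Fin d → ℕ),
    U (normMonomial (ℓ + d) lam (Fin.append α' α'')) =
      lp.single 2 (groupDegree k α')
        ((⟨normMonomial ℓ lam α', normMonomial_mem_levelSpace ℓ lam k α'⟩ :
            levelSpace ℓ lam k (groupDegree k α')) ⊗ₜ[ℂ]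
          (normMonomial d (lam + ((∑ j, groupDegree k α' j : ℕ) : ℝ) + ℓ) α'' :
            Fiber ℓ d lam (∑ j, groupDegree k α' j)))

/-- `T ≍ ⨁_ρ I ⊗ S_{|ρ|}`: the unitary operator `U` exists and carries `T` to this direct sum. -/
def IsDirectSumOf {m : ℕ} {ℓ d : ℕ} {lam : ℝ} (k : Fin m → ℕ)
    (T : Bergman (ℓ + d) lam →L[ℂ] Bergman (ℓ + d) lam)
    (S : ∀ p : ℕ, Fiber ℓ d lam p →L[ℂ] Fiber ℓ d lam p) : Prop :=
  ∃ U : Bergman (ℓ + d) lam ≃ₗᵢ[ℂ] DirectSumSpace ℓ d lam k, IsSplitting ℓ d lam k U ∧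
    ∀ (f : Bergman (ℓ + d) lam) (ρ : Fin m → ℕ),
      (U (T f) : ∀ ρ, Summand ℓ d lam k ρ) ρ =
        LinearMap.lTensor (levelSpace ℓ lam k ρ) (S (∑ j, ρ j)).toLinearMap
          ((U f : ∀ ρ, Summand ℓ d lam k ρ) ρ)

end WeightedBergman

open WeightedBergman

/-!
For a multi-index `α` of `z'` let `W_α : A²_{λ+|α|+ℓ}(𝔹^d) → A²_λ(𝔹^{ℓ+d})` be the isometry
`e_{α''} ↦ e_{(α,α'')}` (`fiberMap`), a multiple of multiplication by `z'^α`. The ranges of the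
`W_α` decompose the large space, and grouping them by the degrees of the groups of coordinates gives
the unitary operator `U` (`exists_isSplitting`). Integration along the fibres of `z ↦ z''` turns the
measure `|e_{(α,0)}|² v_λ` into `v_{λ+|α|+ℓ}`, so a Toeplitz operator whose symbol depends on `z''`
only acts on the range of `W_α` as the Toeplitz operator with the same symbol and the weight
`λ+|α|+ℓ` (`toeplitz_lastCoords_fiberMap`). Thus all operators of the algebra decompose along the
fibres, with components that depend on `|α|` only.

As the weight `μ` grows, the measures `v_μ` concentrate at the origin. Moving the origin to `z` by
the involutive automorphism `φ_z` gives `‖T_c k_z - c(z) k_z‖ → 0` uniformly in `z` for every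
`c ∈ BUC` (`exists_norm_toeplitz_bergmanKernel_sub_le`). The operators with an asymptotic symbol,
that is, a function `a ∈ BUC` such that `‖T_p k_z - a(z) k_z‖ → 0` uniformly in `z` for the
components `T_p`, are closed under sums, products and norm limits, and asymptotic symbols add and
multiply (`IsSymbolic`, `HasSymbol.mul`, `isClosed_isSymbolic`). Therefore all elements of the large
algebra have asymptotic symbols, which are the uniform limits of the Berezin transforms, and `ν`
maps an operator to its asymptotic symbol (`symbolHom`).

For a fixed weight `μ` the algebra generated by the `T_c` has no characters. A nonzero character `π`
would satisfy `π 1 = 1`, hence be positive. By Schur's test the normalized kernels at points whose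
mutual Bergman distances are large are almost orthonormal
(`exists_separated_almost_orthonormal`), so that their frame operator `∑ k_y ⊗ k_y` is almost a
projection and `π` maps it to `0` or to a number close to `1`. These frame operators belong to the
algebra, being limits of Toeplitz operators whose symbols are sums of narrow tents over the points
(`IsFrameOp.mem_toeplitzAlg`). They change little in norm when all points are moved by a small
distance, so the value of `π` does not jump when the points are moved further and further, in small
steps. Once the points and the moved points together form a separated family, the sum of the two
frame operators is still almost a projection, and `π` cannot be close to `1` on both. So `π` vanishes
on the frame operators of all sufficiently separated families
(`IsSparseRadius.re_character_eq_zero`). But finitely many such families suffice to obtain a sum of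
frame operators that is bounded below (`exists_frame`), on which `π` is positive; this contradiction
proves `character_eq_zero`.
-/

namespace WeightedBergman

/-! ### The involutive automorphisms of the ball -/

section MobiusAlgebra

variable {d : ℕ}

theorem one_sub_inner_ne_zero {z w : Cn d} (hz : ‖z‖ < 1) (hw : ‖w‖ < 1) :
    1 - inner ℂ z w ≠ 0 := by
  intro h
  have h1 : ‖inner ℂ z w‖ = 1 := by rw [← sub_eq_zero.1 h]; simp
  have h2 := norm_inner_le_norm (𝕜 := ℂ) z w
  nlinarith [norm_nonneg z, norm_nonneg w]

theorem ofReal_sqrt_sq {z : Cn d} (hz : ‖z‖ < 1) :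
    ((Real.sqrt (1 - ‖z‖ ^ 2) : ℝ) : ℂ) ^ 2 = 1 - inner ℂ z z := by
  rw [inner_self_eq_norm_sq_to_K, ← Complex.ofReal_pow, Real.sq_sqrt (by nlinarith [norm_nonneg z])]
  push_cast; rfl

theorem one_add_sqrt_ne_zero (z : Cn d) : (1 + (Real.sqrt (1 - ‖z‖ ^ 2) : ℝ) : ℂ) ≠ 0 := by
  have : 0 < 1 + Real.sqrt (1 - ‖z‖ ^ 2) := by positivity
  exact_mod_cast this.ne'

theorem sqrt_ne_zero {z : Cn d} (hz : ‖z‖ < 1) : ((Real.sqrt (1 - ‖z‖ ^ 2) : ℝ) : ℂ) ≠ 0 := by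
  have : 0 < Real.sqrt (1 - ‖z‖ ^ 2) := Real.sqrt_pos.2 (by nlinarith [norm_nonneg z])
  exact_mod_cast this.ne'

/-- A formula for `φ_z` without projections; it uses `(1 - s) / |z|² = 1 / (1 + s)` for
`s = (1 - |z|²)^{1/2}`. -/
theorem mobius_eq {z : Cn d} (hz : ‖z‖ < 1) (w : Cn d) :
    mobius z w = (1 - inner ℂ z w)⁻¹ •
      ((1 - inner ℂ z w / (1 + (Real.sqrt (1 - ‖z‖ ^ 2) : ℝ))) • z -
        ((Real.sqrt (1 - ‖z‖ ^ 2) : ℝ) : ℂ) • w) := by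
  have h1 := one_add_sqrt_ne_zero z
  have h2 := ofReal_sqrt_sq hz
  rw [mobius]
  congr 1
  rcases eq_or_ne z 0 with rfl | h0
  · simp
  · have h3 : inner ℂ z z ≠ 0 := inner_self_ne_zero.2 h0
    have hP : (ℂ ∙ z).starProjection w = (inner ℂ z w / inner ℂ z z) • z := by
      rw [Submodule.starProjection_singleton, inner_self_eq_norm_sq_to_K]
      norm_cast
    rw [hP]
    generalize ((Real.sqrt (1 - ‖z‖ ^ 2) : ℝ) : ℂ) = s at *
    have h5 : inner ℂ z z = (1 - s) * (1 + s) := by linear_combination h2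
    rw [h5] at h3 ⊢
    have h6 : (1 - s) ≠ 0 := left_ne_zero_of_mul h3
    match_scalars
    · field_simp
      ring
    · ring

/-- The identity behind the invariance of the metric and of the measure under the automorphisms. -/
theorem one_sub_inner_mobius_mobius {a z w : Cn d} (ha : ‖a‖ < 1) (hz : ‖z‖ < 1) (hw : ‖w‖ < 1) :
    1 - inner ℂ (mobius a z) (mobius a w) =
      (1 - inner ℂ a a) * (1 - inner ℂ z w) / ((1 - inner ℂ z a) * (1 - inner ℂ a w)) := by
  rw [mobius_eq ha, mobius_eq ha]
  have h1 := one_add_sqrt_ne_zero a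
  have h2 := ofReal_sqrt_sq ha
  have h3 := one_sub_inner_ne_zero ha hw
  have h4 := one_sub_inner_ne_zero hz ha
  have h5 : starRingEnd ℂ (inner ℂ a z) = inner ℂ z a := inner_conj_symm _ _
  set s : ℂ := ((Real.sqrt (1 - ‖a‖ ^ 2) : ℝ) : ℂ) with hs
  have hsc : starRingEnd ℂ s = s := Complex.conj_ofReal _
  simp only [inner_smul_left, inner_smul_right, inner_sub_left, inner_sub_right, map_sub, map_div₀,
    map_inv₀, map_one, map_add, h5, hsc]
  have h6 : inner ℂ a a = 1 - s ^ 2 := by linear_combination h2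
  rw [h6]
  field_simp
  ring

theorem one_sub_inner_mobius {a w : Cn d} (ha : ‖a‖ < 1) (hw : ‖w‖ < 1) :
    1 - inner ℂ a (mobius a w) = (1 - inner ℂ a a) / (1 - inner ℂ a w) := by
  rw [mobius_eq ha]
  have h1 := one_add_sqrt_ne_zero a
  have h2 := ofReal_sqrt_sq ha
  have h3 := one_sub_inner_ne_zero ha hw
  set s : ℂ := ((Real.sqrt (1 - ‖a‖ ^ 2) : ℝ) : ℂ) with hs
  simp only [inner_smul_right, inner_sub_right]
  have h6 : inner ℂ a a = 1 - s ^ 2 := by linear_combination h2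
  rw [h6]
  field_simp
  ring

/-- The automorphism `φ_a` is an involution. -/
theorem mobius_mobius {a w : Cn d} (ha : ‖a‖ < 1) (hw : ‖w‖ < 1) :
    mobius a (mobius a w) = w := by
  have h1 := one_add_sqrt_ne_zero a
  have h2 := ofReal_sqrt_sq ha
  have h3 := one_sub_inner_ne_zero ha hw
  have h4 := one_sub_inner_mobius ha hw
  have h0 := sqrt_ne_zero ha
  have h7 : inner ℂ a (mobius a w) = 1 - (1 - inner ℂ a a) / (1 - inner ℂ a w) := by
    rw [← h4]; ring
  rw [mobius_eq ha (mobius a w), h4, h7, mobius_eq ha w]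
  set s : ℂ := ((Real.sqrt (1 - ‖a‖ ^ 2) : ℝ) : ℂ) with hs
  rw [← h2]
  match_scalars
  · field_simp
    ring
  · field_simp

theorem one_sub_norm_mobius_sq {a w : Cn d} (ha : ‖a‖ < 1) (hw : ‖w‖ < 1) :
    1 - ‖mobius a w‖ ^ 2 = (1 - ‖a‖ ^ 2) * (1 - ‖w‖ ^ 2) / ‖1 - inner ℂ a w‖ ^ 2 := by
  have h := one_sub_inner_mobius_mobius ha hw hw
  have h1 : (1 - inner ℂ w a) * (1 - inner ℂ a w) = ((‖1 - inner ℂ a w‖ ^ 2 : ℝ) : ℂ) := by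
    have := Complex.conj_mul' (1 - inner ℂ a w)
    simpa using this
  rw [h1, inner_self_eq_norm_sq_to_K, inner_self_eq_norm_sq_to_K, inner_self_eq_norm_sq_to_K] at h
  have h2 : ((1 - ‖mobius a w‖ ^ 2 : ℝ) : ℂ) =
      (((1 - ‖a‖ ^ 2) * (1 - ‖w‖ ^ 2) / ‖1 - inner ℂ a w‖ ^ 2 : ℝ) : ℂ) := by
    push_cast at h ⊢
    exact h
  exact Complex.ofReal_injective h2

theorem norm_mobius_lt_one {a w : Cn d} (ha : ‖a‖ < 1) (hw : ‖w‖ < 1) : ‖mobius a w‖ < 1 := by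
  have h := one_sub_norm_mobius_sq ha hw
  have h1 : 0 < (1 - ‖a‖ ^ 2) * (1 - ‖w‖ ^ 2) / ‖1 - inner ℂ a w‖ ^ 2 := by
    have := norm_pos_iff.2 (one_sub_inner_ne_zero ha hw)
    have : 0 < 1 - ‖a‖ ^ 2 := by nlinarith [norm_nonneg a]
    have : 0 < 1 - ‖w‖ ^ 2 := by nlinarith [norm_nonneg w]
    positivity
  nlinarith [norm_nonneg (mobius a w)]

@[simp] theorem mobius_zero_right (a : Cn d) : mobius a 0 = a := by simp [mobius]

@[simp] theorem mobius_zero_left (w : Cn d) : mobius 0 w = -w := by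
  rw [mobius_eq (by simp)]; simp

/-- The automorphism `φ_a` as a map of the ball. -/
noncomputable def ballMobius (a w : 𝔹 d) : 𝔹 d :=
  ⟨mobius (a : Cn d) w, mem_ball_zero_iff.2
    (norm_mobius_lt_one (mem_ball_zero_iff.1 a.2) (mem_ball_zero_iff.1 w.2))⟩

theorem norm_coe_lt_one (a : 𝔹 d) : ‖(a : Cn d)‖ < 1 := mem_ball_zero_iff.1 a.2

/-- The centre of the ball. -/
def origin (d : ℕ) : 𝔹 d := ⟨0, Metric.mem_ball_self one_pos⟩

@[simp] theorem coe_origin : (origin d : Cn d) = 0 := rfl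

@[simp] theorem coe_ballMobius (a w : 𝔹 d) : (ballMobius a w : Cn d) = mobius (a : Cn d) w := rfl

@[simp] theorem ballMobius_ballMobius (a w : 𝔹 d) : ballMobius a (ballMobius a w) = w :=
  Subtype.ext (mobius_mobius (norm_coe_lt_one a) (norm_coe_lt_one w))

@[simp] theorem ballMobius_origin (a : 𝔹 d) : ballMobius a (origin d) = a :=
  Subtype.ext (by simp)

theorem continuousOn_mobius :
    ContinuousOn (fun p : Cn d × Cn d => mobius p.1 p.2)
      (Metric.ball 0 1 ×ˢ Metric.ball 0 1) := by
  have h : ContinuousOn (fun p : Cn d × Cn d => (1 - inner ℂ p.1 p.2)⁻¹ •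
      ((1 - inner ℂ p.1 p.2 / (1 + (Real.sqrt (1 - ‖p.1‖ ^ 2) : ℝ))) • p.1 -
        ((Real.sqrt (1 - ‖p.1‖ ^ 2) : ℝ) : ℂ) • p.2)) (Metric.ball 0 1 ×ˢ Metric.ball 0 1) := by
    have hi : Continuous fun p : Cn d × Cn d => inner ℂ p.1 p.2 :=
      continuous_fst.inner continuous_snd
    have hs : Continuous fun p : Cn d × Cn d => ((Real.sqrt (1 - ‖p.1‖ ^ 2) : ℝ) : ℂ) := by
      fun_prop
    have h1 : ∀ p ∈ Metric.ball (0 : Cn d) 1 ×ˢ Metric.ball (0 : Cn d) 1,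
        1 - inner ℂ p.1 p.2 ≠ 0 := by
      rintro ⟨z, w⟩ ⟨hz, hw⟩
      exact one_sub_inner_ne_zero (by simpa using hz) (by simpa using hw)
    have h2 : ∀ p : Cn d × Cn d, (1 + (Real.sqrt (1 - ‖p.1‖ ^ 2) : ℝ) : ℂ) ≠ 0 :=
      fun p => one_add_sqrt_ne_zero p.1
    have h3 : Continuous fun p : Cn d × Cn d =>
        (1 - inner ℂ p.1 p.2 / (1 + (Real.sqrt (1 - ‖p.1‖ ^ 2) : ℝ))) • p.1 -
          ((Real.sqrt (1 - ‖p.1‖ ^ 2) : ℝ) : ℂ) • p.2 :=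
      ((continuous_const.sub (hi.div (continuous_const.add hs) h2)).smul continuous_fst).sub
        (hs.smul continuous_snd)
    exact ((continuous_const.sub hi).continuousOn.inv₀ h1).smul h3.continuousOn
  refine h.congr ?_
  rintro ⟨z, w⟩ ⟨hz, hw⟩
  exact mobius_eq (by simpa using hz) w

theorem continuous_ballMobius : Continuous fun p : 𝔹 d × 𝔹 d => ballMobius p.1 p.2 := by
  refine Continuous.subtype_mk (continuousOn_mobius.comp_continuous
    (f := fun p : 𝔹 d × 𝔹 d => ((p.1 : Cn d), (p.2 : Cn d))) (by fun_prop) ?_) _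
  rintro ⟨z, w⟩
  exact ⟨z.2, w.2⟩

theorem continuous_ballMobius_right (a : 𝔹 d) : Continuous (ballMobius a) :=
  continuous_ballMobius.comp₂ continuous_const continuous_id

end MobiusAlgebra

/-! ### The Bergman metric -/

section BergmanMetric

variable {d : ℕ}

theorem norm_mobius_comm (a w : 𝔹 d) : ‖mobius (a : Cn d) w‖ = ‖mobius (w : Cn d) a‖ := by
  have h1 := one_sub_norm_mobius_sq (norm_coe_lt_one a) (norm_coe_lt_one w)
  have h2 := one_sub_norm_mobius_sq (norm_coe_lt_one w) (norm_coe_lt_one a)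
  have h3 : ‖1 - inner ℂ (a : Cn d) (w : Cn d)‖ = ‖1 - inner ℂ (w : Cn d) (a : Cn d)‖ := by
    rw [← RCLike.norm_conj]; simp
  rw [h3, mul_comm (1 - _), ← h2] at h1
  have : ‖mobius (a : Cn d) w‖ ^ 2 = ‖mobius (w : Cn d) a‖ ^ 2 := by linarith
  exact (pow_left_inj₀ (norm_nonneg _) (norm_nonneg _) two_ne_zero).1 this

theorem norm_mobius_mobius {a z w : Cn d} (ha : ‖a‖ < 1) (hz : ‖z‖ < 1) (hw : ‖w‖ < 1) :
    ‖mobius (mobius a z) (mobius a w)‖ = ‖mobius z w‖ := by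
  have h1 := one_sub_norm_mobius_sq (norm_mobius_lt_one ha hz) (norm_mobius_lt_one ha hw)
  have h2 := one_sub_norm_mobius_sq hz hw
  have h3 : ‖1 - inner ℂ z a‖ = ‖1 - inner ℂ a z‖ := by
    rw [← RCLike.norm_conj]; simp
  have h4 : ‖1 - inner ℂ a a‖ = 1 - ‖a‖ ^ 2 := by
    rw [← ofReal_sqrt_sq ha, norm_pow, Complex.norm_real, Real.norm_of_nonneg (Real.sqrt_nonneg _),
      Real.sq_sqrt (by nlinarith [norm_nonneg a])]
  rw [one_sub_inner_mobius_mobius ha hz hw, one_sub_norm_mobius_sq ha hz,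
    one_sub_norm_mobius_sq ha hw, norm_div, norm_mul, norm_mul, h3, h4] at h1
  have n1 := norm_ne_zero_iff.2 (one_sub_inner_ne_zero ha hz)
  have n2 := norm_ne_zero_iff.2 (one_sub_inner_ne_zero ha hw)
  have n4 : 1 - ‖a‖ ^ 2 ≠ 0 := by nlinarith [norm_nonneg a]
  have aux : ∀ A B C x y v : ℝ, A ≠ 0 → B ≠ 0 → x ≠ 0 →
      x * y / A ^ 2 * (x * v / B ^ 2) / (x * C / (A * B)) ^ 2 = y * v / C ^ 2 := by
    intro A B C x y v hA hB hx
    field_simp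
  rw [aux _ _ _ _ _ _ n1 n2 n4, ← h2] at h1
  have : ‖mobius (mobius a z) (mobius a w)‖ ^ 2 = ‖mobius z w‖ ^ 2 := by linarith
  exact (pow_left_inj₀ (norm_nonneg _) (norm_nonneg _) two_ne_zero).1 this

theorem bergmanDist_eq_artanh (z w : 𝔹 d) :
    bergmanDist z w = Real.artanh ‖mobius (z : Cn d) w‖ := by
  have := norm_coe_lt_one (ballMobius z w)
  rw [coe_ballMobius] at this
  rw [bergmanDist, Real.artanh_eq_half_log ⟨by linarith [norm_nonneg (mobius (z : Cn d) w)],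
    this.le⟩]

theorem bergmanDist_comm (z w : 𝔹 d) : bergmanDist z w = bergmanDist w z := by
  rw [bergmanDist, bergmanDist, norm_mobius_comm]

theorem bergmanDist_ballMobius (a z w : 𝔹 d) :
    bergmanDist (ballMobius a z) (ballMobius a w) = bergmanDist z w := by
  rw [bergmanDist, bergmanDist, coe_ballMobius, coe_ballMobius,
    norm_mobius_mobius (norm_coe_lt_one a) (norm_coe_lt_one z) (norm_coe_lt_one w)]

theorem bergmanDist_self_ballMobius (a ξ : 𝔹 d) :
    bergmanDist a (ballMobius a ξ) = Real.artanh ‖(ξ : Cn d)‖ := by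
  rw [bergmanDist_eq_artanh, ← coe_ballMobius, ballMobius_ballMobius]

theorem bergmanDist_origin (ξ : 𝔹 d) :
    bergmanDist (origin d) ξ = Real.artanh ‖(ξ : Cn d)‖ := by
  rw [bergmanDist_eq_artanh]; simp

theorem bergmanDist_nonneg (z w : 𝔹 d) : 0 ≤ bergmanDist z w := by
  rw [bergmanDist_eq_artanh]
  exact Real.artanh_nonneg (norm_nonneg _)

@[simp] theorem bergmanDist_self (z : 𝔹 d) : bergmanDist z z = 0 := by
  have := bergmanDist_self_ballMobius z (origin d)
  simpa using this

theorem continuous_bergmanDist : Continuous fun p : 𝔹 d × 𝔹 d => bergmanDist p.1 p.2 := by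
  have h : Continuous fun p : 𝔹 d × 𝔹 d => ‖mobius (p.1 : Cn d) p.2‖ :=
    continuous_norm.comp (continuous_subtype_val.comp continuous_ballMobius)
  unfold bergmanDist
  refine continuous_const.mul (Continuous.log ((continuous_const.add h).div
    (continuous_const.sub h) fun p => ?_) fun p => ?_)
  · have := norm_coe_lt_one (ballMobius p.1 p.2)
    rw [coe_ballMobius] at this
    linarith
  · have := norm_coe_lt_one (ballMobius p.1 p.2)
    rw [coe_ballMobius] at this
    have h0 := norm_nonneg (mobius (p.1 : Cn d) p.2)
    exact (div_pos (by linarith) (by linarith)).ne'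

theorem continuous_bergmanDist_right (z : 𝔹 d) : Continuous (bergmanDist z) :=
  continuous_bergmanDist.comp₂ continuous_const continuous_id

/-- The hypothesis on `r` says `r ≤ (x + y) / (1 + x y)`, the addition formula for `tanh`. -/
theorem artanh_le_add {x y r : ℝ} (hx0 : 0 ≤ x) (hy0 : 0 ≤ y) (hr0 : 0 ≤ r) (hx : x < 1)
    (hy : y < 1) (hr : r < 1) (h : r * (1 + x * y) ≤ x + y) :
    Real.artanh r ≤ Real.artanh x + Real.artanh y := by
  have hx1 : 0 < 1 - x := by linarith
  have hy1 : 0 < 1 - y := by linarith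
  have hr1 : 0 < 1 - r := by linarith
  rw [Real.artanh_eq_half_log ⟨by linarith, hx.le⟩, Real.artanh_eq_half_log ⟨by linarith, hy.le⟩,
    Real.artanh_eq_half_log ⟨by linarith, hr.le⟩, ← mul_add,
    ← Real.log_mul (div_pos (by linarith) hx1).ne' (div_pos (by linarith) hy1).ne']
  refine mul_le_mul_of_nonneg_left (Real.log_le_log (div_pos (by linarith) hr1) ?_) (by norm_num)
  rw [div_mul_div_comm, div_le_div_iff₀ hr1 (mul_pos hx1 hy1)]
  linarith

/-- By the formula for `1 - |φ_z(w)|²` and `|1 - ⟨z, w⟩| ≤ 1 + |z| |w|`, the number `|φ_z(w)|` is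
at most `(|z| + |w|) / (1 + |z| |w|)`; this is the triangle inequality through the centre. -/
theorem norm_mobius_mul_le {z w : Cn d} (hz : ‖z‖ < 1) (hw : ‖w‖ < 1) :
    ‖mobius z w‖ * (1 + ‖z‖ * ‖w‖) ≤ ‖z‖ + ‖w‖ := by
  have aux : ∀ n r x y : ℝ, 0 < n → 0 ≤ x → 0 ≤ y → 0 ≤ r → r < 1 → n ≤ 1 + x * y →
      1 - r ^ 2 = (1 - x ^ 2) * (1 - y ^ 2) / n ^ 2 → r * (1 + x * y) ≤ x + y := by
    intro n r x y hn hx hy hr hr1 hn2 h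
    rw [eq_div_iff (by positivity)] at h
    have hr2 : 0 ≤ 1 - r ^ 2 := by nlinarith
    have hxy : n ^ 2 ≤ (1 + x * y) ^ 2 := by gcongr
    have h3 : (r * (1 + x * y)) ^ 2 ≤ (x + y) ^ 2 := by
      have := mul_le_mul_of_nonneg_left hxy hr2
      rw [h] at this
      linarith
    exact (pow_le_pow_iff_left₀ (by positivity) (by positivity) two_ne_zero).1 h3
  have hn2 : ‖1 - inner ℂ z w‖ ≤ 1 + ‖z‖ * ‖w‖ := by
    refine (norm_sub_le _ _).trans ?_
    rw [norm_one]
    gcongr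
    exact norm_inner_le_norm _ _
  exact aux _ _ _ _ (norm_pos_iff.2 (one_sub_inner_ne_zero hz hw)) (norm_nonneg _) (norm_nonneg _)
    (norm_nonneg _) (norm_mobius_lt_one hz hw) hn2 (one_sub_norm_mobius_sq hz hw)

theorem bergmanDist_le_through_origin (z w : 𝔹 d) :
    bergmanDist z w ≤ bergmanDist (origin d) z + bergmanDist (origin d) w := by
  have hr := norm_coe_lt_one (ballMobius z w)
  rw [coe_ballMobius] at hr
  rw [bergmanDist_origin, bergmanDist_origin, bergmanDist_eq_artanh]
  exact artanh_le_add (norm_nonneg _) (norm_nonneg _) (norm_nonneg _) (norm_coe_lt_one z)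
    (norm_coe_lt_one w) hr (norm_mobius_mul_le (norm_coe_lt_one z) (norm_coe_lt_one w))

/-- Moving `y` to the origin by an automorphism reduces this to the triangle inequality through the
origin. -/
theorem bergmanDist_triangle (x y z : 𝔹 d) :
    bergmanDist x z ≤ bergmanDist x y + bergmanDist y z := by
  have h := bergmanDist_le_through_origin (ballMobius y x) (ballMobius y z)
  rw [bergmanDist_ballMobius] at h
  rw [bergmanDist_comm x y, ← bergmanDist_ballMobius y y x, ← bergmanDist_ballMobius y y z]
  have h0 : ballMobius y y = origin d := by
    conv_lhs => rw [← ballMobius_origin y]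
    rw [show ballMobius (ballMobius y (origin d)) = ballMobius y by rw [ballMobius_origin],
      ballMobius_ballMobius]
  rwa [h0]

theorem norm_lt_tanh_iff (ξ : 𝔹 d) (t : ℝ) :
    ‖(ξ : Cn d)‖ < Real.tanh t ↔ bergmanDist (origin d) ξ < t := by
  have h := norm_coe_lt_one ξ
  have h0 := norm_nonneg (ξ : Cn d)
  rw [bergmanDist_origin]
  conv_rhs => rw [← Real.artanh_tanh t]
  exact (Real.artanh_lt_artanh_iff ⟨by linarith, h⟩
    ⟨Real.neg_one_lt_tanh t, Real.tanh_lt_one t⟩).symm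

end BergmanMetric

end WeightedBergman

namespace WeightedBergman

/-! ### The invariant measure and changes of variables -/

section InvariantMeasure

variable {d : ℕ}

/-- The complex derivative of `φ_a` at `w`, a multiple of a transvection. -/
noncomputable def mobiusDeriv (a w : Cn d) : Cn d →L[ℂ] Cn d :=
  (-(((Real.sqrt (1 - ‖a‖ ^ 2) : ℝ) : ℂ) / (1 - inner ℂ a w))) •
    (ContinuousLinearMap.id ℂ (Cn d) + (innerSL ℂ a).smulRight
      ((((Real.sqrt (1 - ‖a‖ ^ 2) : ℝ) : ℂ))⁻¹ •
        ((1 + (Real.sqrt (1 - ‖a‖ ^ 2) : ℝ) : ℂ)⁻¹ • a - mobius a w)))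

theorem hasFDerivAt_mobius {a w : Cn d} (ha : ‖a‖ < 1) (hw : ‖w‖ < 1) :
    HasFDerivAt (mobius a) (mobiusDeriv a w) w := by
  have h0 := sqrt_ne_zero ha
  have h1 := one_add_sqrt_ne_zero a
  have h3 := one_sub_inner_ne_zero ha hw
  rw [mobiusDeriv, mobius_eq ha w, funext (mobius_eq ha)]
  generalize ((Real.sqrt (1 - ‖a‖ ^ 2) : ℝ) : ℂ) = s at *
  have hi : HasFDerivAt (fun w : Cn d => inner ℂ a w) (innerSL ℂ a) w :=
    (innerSL ℂ a).hasFDerivAt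
  have hA : HasFDerivAt (fun w : Cn d => (1 - inner ℂ a w)⁻¹)
      (-((1 - inner ℂ a w) ^ 2)⁻¹ • (0 - innerSL ℂ a)) w :=
    (hasDerivAt_inv h3).comp_hasFDerivAt w ((hasFDerivAt_const (1 : ℂ) w).sub hi)
  have hB := (((hasFDerivAt_const (1 : ℂ) w).sub
    (hi.mul_const (1 + s)⁻¹)).smul_const a).sub ((hasFDerivAt_id (𝕜 := ℂ) w).const_smul s)
  have hC := hA.smul hB
  refine (hC.congr_fderiv ?_).congr_of_eventuallyEq (Eventually.of_forall fun z => ?_)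
  · ext1 h
    simp only [zero_sub, add_apply, smul_apply,
      sub_apply, ContinuousLinearMap.smulRight_apply,
      neg_apply, innerSL_apply_apply, ContinuousLinearMap.id_apply, smul_eq_mul,
      Pi.sub_apply, Pi.smul_apply, id]
    generalize inner ℂ a w = t at *
    generalize inner ℂ a h = u at *
    match_scalars <;> field_simp
    ring
  · simp [div_eq_mul_inv]

/-- The determinant is computed by writing the derivative as a scalar times a transvection. -/
theorem det_mobiusDeriv {a w : Cn d} (ha : ‖a‖ < 1) (hw : ‖w‖ < 1) :
    LinearMap.det (mobiusDeriv a w : Cn d →ₗ[ℂ] Cn d) =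
      (-1) ^ d * (((Real.sqrt (1 - ‖a‖ ^ 2) : ℝ) : ℂ) / (1 - inner ℂ a w)) ^ (d + 1) := by
  have h0 := sqrt_ne_zero ha
  have h1 := one_add_sqrt_ne_zero a
  have h2 := ofReal_sqrt_sq ha
  have h3 := one_sub_inner_ne_zero ha hw
  have h4 := one_sub_inner_mobius ha hw
  have hT : (mobiusDeriv a w : Cn d →ₗ[ℂ] Cn d) =
      (-(((Real.sqrt (1 - ‖a‖ ^ 2) : ℝ) : ℂ) / (1 - inner ℂ a w))) •
      LinearMap.transvection (innerSL ℂ a : Cn d →ₗ[ℂ] ℂ)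
      ((((Real.sqrt (1 - ‖a‖ ^ 2) : ℝ) : ℂ))⁻¹ •
        ((1 + (Real.sqrt (1 - ‖a‖ ^ 2) : ℝ) : ℂ)⁻¹ • a - mobius a w)) := by
    ext1 h
    simp [mobiusDeriv, LinearMap.transvection.apply, add_comm]
  rw [hT, LinearMap.det_smul, LinearMap.transvection.det, finrank_euclideanSpace_fin]
  have h5 : inner ℂ a (mobius a w) = 1 - (1 - inner ℂ a a) / (1 - inner ℂ a w) := by
    rw [← h4]; ring
  generalize ((Real.sqrt (1 - ‖a‖ ^ 2) : ℝ) : ℂ) = s at *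
  have h6 : inner ℂ a a = 1 - s ^ 2 := by linear_combination h2
  have h7 : (1 : ℂ) + (innerSL ℂ a : Cn d →ₗ[ℂ] ℂ) (s⁻¹ • ((1 + s)⁻¹ • a - mobius a w)) =
      s / (1 - inner ℂ a w) := by
    simp only [ContinuousLinearMap.coe_coe, innerSL_apply_apply, inner_smul_right,
      inner_sub_right, h5, h6]
    field_simp
    ring
  rw [h7, neg_eq_neg_one_mul, mul_pow, mul_assoc, ← pow_succ]

/-- The real Jacobian of `φ_a`, as the squared modulus of the complex one. -/
theorem abs_det_mobiusDeriv {a w : Cn d} (ha : ‖a‖ < 1) (hw : ‖w‖ < 1) :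
    |((mobiusDeriv a w).restrictScalars ℝ).det| =
      ((1 - ‖a‖ ^ 2) / ‖1 - inner ℂ a w‖ ^ 2) ^ (d + 1) := by
  have h : ((mobiusDeriv a w).restrictScalars ℝ).det =
      Complex.normSq (LinearMap.det (mobiusDeriv a w : Cn d →ₗ[ℂ] Cn d)) := by
    rw [← Algebra.norm_complex_apply, ← LinearMap.det_restrictScalars]
    rfl
  rw [h, det_mobiusDeriv ha hw, abs_of_nonneg (Complex.normSq_nonneg _), Complex.normSq_eq_norm_sq,
    norm_mul, norm_pow, norm_pow, norm_neg, norm_one, one_pow, one_mul, norm_div,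
    Complex.norm_real, Real.norm_of_nonneg (Real.sqrt_nonneg _), ← pow_mul, mul_comm (d + 1),
    pow_mul, div_pow, Real.sq_sqrt (by nlinarith [norm_nonneg a])]

/-- The measure `(1 - |z|²)^{-(d+1)} dv`, which is invariant under the automorphisms of the
ball. -/
noncomputable def invVol (d : ℕ) : Measure (𝔹 d) :=
  (Measure.comap Subtype.val (volume : Measure (Cn d))).withDensity
    fun z => ENNReal.ofReal (((1 - ‖(z : Cn d)‖ ^ 2) ^ (d + 1))⁻¹)

theorem one_sub_norm_sq_pos (z : 𝔹 d) : 0 < 1 - ‖(z : Cn d)‖ ^ 2 := by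
  nlinarith [norm_coe_lt_one z, norm_nonneg (z : Cn d)]

theorem lintegral_invVol (f : 𝔹 d → ℝ≥0∞) :
    ∫⁻ z, f z ∂invVol d = ∫⁻ z : 𝔹 d, ENNReal.ofReal (((1 - ‖(z : Cn d)‖ ^ 2) ^ (d + 1))⁻¹) * f z
      ∂Measure.comap Subtype.val (volume : Measure (Cn d)) := by
  rw [invVol, lintegral_withDensity_eq_lintegral_mul_non_measurable₀]
  · rfl
  · apply Measurable.aemeasurable
    fun_prop
  · exact Eventually.of_forall fun z => ENNReal.ofReal_lt_top

theorem lintegral_invVol_coe (f : Cn d → ℝ≥0∞) :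
    ∫⁻ z, f z ∂invVol d = ∫⁻ z in Metric.ball (0 : Cn d) 1,
      ENNReal.ofReal (((1 - ‖z‖ ^ 2) ^ (d + 1))⁻¹) * f z := by
  rw [lintegral_invVol]
  exact lintegral_subtype_comap measurableSet_ball
    (fun z => ENNReal.ofReal (((1 - ‖z‖ ^ 2) ^ (d + 1))⁻¹) * f z)

theorem lintegral_invVol_ballMobius (a : 𝔹 d) (G : 𝔹 d → ℝ≥0∞) :
    ∫⁻ z, G (ballMobius a z) ∂invVol d = ∫⁻ z, G z ∂invVol d := by
  have ha := norm_coe_lt_one a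
  classical
  let g : Cn d → ℝ≥0∞ := fun z => if h : z ∈ Metric.ball 0 1 then G ⟨z, h⟩ else 0
  have hg : ∀ z : 𝔹 d, G z = g z := fun z => by simp only [g, dif_pos z.2]
  have e1 : ∀ z : 𝔹 d, G (ballMobius a z) = g (mobius (a : Cn d) z) := fun z => hg _
  rw [lintegral_congr e1, lintegral_congr hg,
    lintegral_invVol_coe (fun z => g (mobius (a : Cn d) z)), lintegral_invVol_coe g]
  have himg : mobius (a : Cn d) '' Metric.ball 0 1 = Metric.ball 0 1 := by
    apply Set.Subset.antisymm
    · rintro _ ⟨w, hw, rfl⟩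
      rw [mem_ball_zero_iff] at hw ⊢
      exact norm_mobius_lt_one ha hw
    · intro w hw
      rw [mem_ball_zero_iff] at hw
      exact ⟨mobius (a : Cn d) w, mem_ball_zero_iff.2 (norm_mobius_lt_one ha hw),
        mobius_mobius ha hw⟩
  have hinj : Set.InjOn (mobius (a : Cn d)) (Metric.ball 0 1) := by
    intro z hz w hw h
    rw [mem_ball_zero_iff] at hz hw
    rw [← mobius_mobius ha hz, h, mobius_mobius ha hw]
  have key := lintegral_image_eq_lintegral_abs_det_fderiv_mul (volume : Measure (Cn d))
    measurableSet_ball (f := mobius (a : Cn d))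
    (f' := fun w => (mobiusDeriv (a : Cn d) w).restrictScalars ℝ)
    (fun w hw => ((hasFDerivAt_mobius ha (mem_ball_zero_iff.1 hw)).restrictScalars
      ℝ).hasFDerivWithinAt) hinj
    (fun z => ENNReal.ofReal (((1 - ‖z‖ ^ 2) ^ (d + 1))⁻¹) * g z)
  rw [himg] at key
  rw [key]
  refine setLIntegral_congr_fun measurableSet_ball fun w hw => ?_
  have hw := mem_ball_zero_iff.1 hw
  have h1 : 0 < 1 - ‖(a : Cn d)‖ ^ 2 := one_sub_norm_sq_pos a
  have h2 : 0 < ‖1 - inner ℂ (a : Cn d) w‖ := norm_pos_iff.2 (one_sub_inner_ne_zero ha hw)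
  have h3 : 0 < 1 - ‖w‖ ^ 2 := by nlinarith [norm_nonneg w]
  change _ = ENNReal.ofReal |((mobiusDeriv (a : Cn d) w).restrictScalars ℝ).det| *
    (ENNReal.ofReal (((1 - ‖mobius (a : Cn d) w‖ ^ 2) ^ (d + 1))⁻¹) * g (mobius (a : Cn d) w))
  rw [← mul_assoc, ← ENNReal.ofReal_mul (abs_nonneg _), abs_det_mobiusDeriv ha hw,
    one_sub_norm_mobius_sq ha hw]
  congr 2
  rw [← inv_pow, ← inv_pow, ← mul_pow]
  congr 1
  field_simp

/-- The normalizing constant of `v_μ`. -/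
noncomputable def volConst (d : ℕ) (μ : ℝ) : ℝ :=
  Real.Gamma (d + μ + 1) / (Real.pi ^ d * Real.Gamma (μ + 1))

theorem volConst_pos (d : ℕ) {μ : ℝ} (hμ : -1 < μ) : 0 < volConst d μ := by
  have h1 : 0 < Real.Gamma (d + μ + 1) := Real.Gamma_pos_of_pos (by
    have : (0 : ℝ) ≤ d := by positivity
    linarith)
  have h2 : 0 < Real.Gamma (μ + 1) := Real.Gamma_pos_of_pos (by linarith)
  have := Real.pi_pos
  unfold volConst
  positivity

theorem weight_eq (d : ℕ) (μ : ℝ) (z : Cn d) :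
    weight d μ z = volConst d μ * (1 - ‖z‖ ^ 2) ^ μ := rfl

/-- The measures `v_μ` have densities with respect to the invariant measure that are powers of `1 -
|z|²`. -/
theorem vol_eq_withDensity (d : ℕ) (μ : ℝ) :
    vol d μ = (invVol d).withDensity fun z =>
      ENNReal.ofReal (volConst d μ * (1 - ‖(z : Cn d)‖ ^ 2) ^ ((d : ℝ) + μ + 1)) := by
  have m1 : Measurable fun z : 𝔹 d => ENNReal.ofReal (((1 - ‖(z : Cn d)‖ ^ 2) ^ (d + 1))⁻¹) := by
    fun_prop
  have m2 : Measurable fun z : 𝔹 d =>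
      ENNReal.ofReal (volConst d μ * (1 - ‖(z : Cn d)‖ ^ 2) ^ ((d : ℝ) + μ + 1)) := by
    fun_prop
  rw [vol, invVol, ← withDensity_mul _ m1 m2]
  congr 1
  funext z
  have h := one_sub_norm_sq_pos z
  rw [Pi.mul_apply, ← ENNReal.ofReal_mul (by positivity), weight_eq]
  congr 1
  have : (1 - ‖(z : Cn d)‖ ^ 2) ^ ((d : ℝ) + μ + 1) =
      (1 - ‖(z : Cn d)‖ ^ 2) ^ (d + 1) * (1 - ‖(z : Cn d)‖ ^ 2) ^ μ := by
    rw [← Real.rpow_natCast (1 - ‖(z : Cn d)‖ ^ 2), ← Real.rpow_add h]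
    congr 1
    push_cast
    ring
  rw [this]
  field_simp

theorem lintegral_vol_eq (d : ℕ) (μ : ℝ) (G : 𝔹 d → ℝ≥0∞) :
    ∫⁻ z, G z ∂vol d μ = ∫⁻ z, ENNReal.ofReal
      (volConst d μ * (1 - ‖(z : Cn d)‖ ^ 2) ^ ((d : ℝ) + μ + 1)) * G z ∂invVol d := by
  rw [vol_eq_withDensity, lintegral_withDensity_eq_lintegral_mul_non_measurable₀]
  · rfl
  · apply Measurable.aemeasurable
    fun_prop
  · exact Eventually.of_forall fun z => ENNReal.ofReal_lt_top

theorem rpow_sq {x : ℝ} (hx : 0 ≤ x) (y : ℝ) : (x ^ y) ^ 2 = x ^ (2 * y) := by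
  rw [mul_comm, ← Nat.cast_two (R := ℝ), Real.rpow_mul_natCast hx]

theorem sq_rpow {x : ℝ} (hx : 0 ≤ x) (y : ℝ) : (x ^ 2) ^ y = x ^ (2 * y) := by
  rw [← Nat.cast_two (R := ℝ), Real.rpow_natCast_mul hx]

theorem norm_kernelFun_sq (μ : ℝ) (z w : 𝔹 d) :
    ‖kernelFun d μ z w‖ ^ 2 = (1 - ‖(z : Cn d)‖ ^ 2) ^ ((d : ℝ) + μ + 1) /
      ‖1 - inner ℂ (z : Cn d) (w : Cn d)‖ ^ (2 * ((d : ℝ) + μ + 1)) := by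
  have h := one_sub_norm_sq_pos z
  rw [kernelFun, norm_div, Complex.norm_real, Complex.norm_cpow_real, div_pow,
    Real.norm_of_nonneg (Real.rpow_nonneg h.le _), rpow_sq h.le, rpow_sq (norm_nonneg _),
    mul_div_cancel₀ _ two_ne_zero]

/-- The normalized kernels are the Radon-Nikodym factors of the automorphisms. -/
theorem one_sub_norm_ballMobius_rpow (μ : ℝ) (z w : 𝔹 d) :
    (1 - ‖(ballMobius z w : Cn d)‖ ^ 2) ^ ((d : ℝ) + μ + 1) =
      (1 - ‖(w : Cn d)‖ ^ 2) ^ ((d : ℝ) + μ + 1) * ‖kernelFun d μ z w‖ ^ 2 := by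
  have h1 := one_sub_norm_sq_pos z
  have h2 := one_sub_norm_sq_pos w
  have h3 : 0 < ‖1 - inner ℂ (z : Cn d) (w : Cn d)‖ :=
    norm_pos_iff.2 (one_sub_inner_ne_zero (norm_coe_lt_one z) (norm_coe_lt_one w))
  rw [norm_kernelFun_sq, coe_ballMobius, one_sub_norm_mobius_sq (norm_coe_lt_one z)
    (norm_coe_lt_one w), Real.div_rpow (by positivity) (by positivity),
    Real.mul_rpow h1.le h2.le, sq_rpow h3.le]
  ring

/-- The change of variables `w = φ_z(ξ)` in integrals with respect to `v_μ`. -/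
theorem lintegral_vol_ballMobius (μ : ℝ) (z : 𝔹 d) (G : 𝔹 d → ℝ≥0∞) :
    ∫⁻ w, G (ballMobius z w) * ‖kernelFun d μ z w‖ₑ ^ 2 ∂vol d μ = ∫⁻ w, G w ∂vol d μ := by
  rw [lintegral_vol_eq, lintegral_vol_eq, ← lintegral_invVol_ballMobius z (fun w => ENNReal.ofReal
    (volConst d μ * (1 - ‖(w : Cn d)‖ ^ 2) ^ ((d : ℝ) + μ + 1)) * G w)]
  refine lintegral_congr fun w => ?_
  have h2 := one_sub_norm_sq_pos w
  have h4 : ‖kernelFun d μ z w‖ₑ ^ 2 = ENNReal.ofReal (‖kernelFun d μ z w‖ ^ 2) := by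
    rw [ENNReal.ofReal_pow (norm_nonneg _), ofReal_norm]
  rw [one_sub_norm_ballMobius_rpow, h4, ← mul_assoc (volConst d μ),
    ENNReal.ofReal_mul' (sq_nonneg _)]
  ring

theorem lintegral_vol_comp_ballMobius (μ : ℝ) (z : 𝔹 d) (G : 𝔹 d → ℝ≥0∞) :
    ∫⁻ w, G (ballMobius z w) ∂vol d μ = ∫⁻ w, G w * ‖kernelFun d μ z w‖ₑ ^ 2 ∂vol d μ := by
  rw [← lintegral_vol_ballMobius μ z (fun w => G (ballMobius z w))]
  simp

end InvariantMeasure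

end WeightedBergman

namespace WeightedBergman

/-! ### Fibration of the ball over a ball of lower dimension -/

section Fibration

/-- The isometry `ℂ^ℓ ⊕ ℂ^d ≃ ℂ^{ℓ+d}`. -/
noncomputable def joinEquiv (ℓ d : ℕ) : WithLp 2 (Cn ℓ × Cn d) ≃ₗᵢ[ℝ] Cn (ℓ + d) where
  toFun p := WithLp.toLp 2 (Fin.append (WithLp.ofLp p.fst) (WithLp.ofLp p.snd))
  invFun z := WithLp.toLp 2 (WithLp.toLp 2 fun i => z (Fin.castAdd d i),
    WithLp.toLp 2 fun i => z (Fin.natAdd ℓ i))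
  map_add' p q := by
    ext i
    refine Fin.addCases (fun i => ?_) (fun i => ?_) i <;> simp
  map_smul' c p := by
    ext i
    refine Fin.addCases (fun i => ?_) (fun i => ?_) i <;> simp
  left_inv p := by
    apply (WithLp.equiv 2 _).injective
    ext i <;> simp
  right_inv z := by
    ext i
    refine Fin.addCases (fun i => ?_) (fun i => ?_) i <;> simp
  norm_map' p := by
    rw [WithLp.prod_norm_eq_of_L2, EuclideanSpace.norm_eq, EuclideanSpace.norm_sq_eq,
      EuclideanSpace.norm_sq_eq]
    simp [Fin.sum_univ_add]

theorem joinEquiv_castAdd {ℓ d : ℕ} (p : WithLp 2 (Cn ℓ × Cn d)) (i : Fin ℓ) :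
    joinEquiv ℓ d p (Fin.castAdd d i) = p.fst i := by
  simp [joinEquiv]

theorem joinEquiv_natAdd {ℓ d : ℕ} (p : WithLp 2 (Cn ℓ × Cn d)) (i : Fin d) :
    joinEquiv ℓ d p (Fin.natAdd ℓ i) = p.snd i := by
  simp [joinEquiv]

theorem lintegral_join (ℓ d : ℕ) {f : Cn (ℓ + d) → ℝ≥0∞} (hf : Measurable f) :
    ∫⁻ z, f z = ∫⁻ y : Cn d, ∫⁻ x : Cn ℓ, f (joinEquiv ℓ d (WithLp.toLp 2 (x, y))) := by
  have h1 : MeasurePreserving (fun p : Cn ℓ × Cn d => joinEquiv ℓ d (WithLp.toLp 2 p)) :=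
    (joinEquiv ℓ d).measurePreserving.comp (WithLp.volume_preserving_toLp (Cn ℓ) (Cn d))
  rw [← h1.lintegral_comp hf]
  exact lintegral_prod_symm _ (hf.comp h1.measurable).aemeasurable

theorem lintegral_comp_smul_Cn (ℓ : ℕ) {f : Cn ℓ → ℝ≥0∞} (hf : Measurable f) {s : ℝ} (hs : 0 < s) :
    ∫⁻ x, f x = ENNReal.ofReal (s ^ (2 * ℓ)) * ∫⁻ x, f (s • x) := by
  have h1 := Measure.map_addHaar_smul (volume : Measure (Cn ℓ)) hs.ne'
  have h2 : ∫⁻ x, f (s • x) = ∫⁻ x, f x ∂(Measure.map (fun x => s • x) volume) :=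
    (lintegral_map hf (measurable_const_smul s)).symm
  have h3 : Module.finrank ℝ (Cn ℓ) = 2 * ℓ := by
    rw [finrank_real_of_complex, finrank_euclideanSpace_fin]
  rw [h2, h1, lintegral_smul_measure, h3, smul_eq_mul, ← mul_assoc,
    ← ENNReal.ofReal_mul (by positivity), abs_of_nonneg (by positivity),
    mul_inv_cancel₀ (by positivity), ENNReal.ofReal_one, one_mul]

/-- The integral of `|z^α|² (1 - |z|²)^μ` over the ball with respect to Lebesgue measure. -/
noncomputable def monomialIntegral (ℓ : ℕ) (α : Fin ℓ → ℕ) (μ : ℝ) : ℝ≥0∞ :=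
  ∫⁻ z in Metric.ball (0 : Cn ℓ) 1,
    ENNReal.ofReal ((∏ i, ‖z i‖ ^ (2 * α i)) * (1 - ‖z‖ ^ 2) ^ μ)

/-- Integration over the ball of `ℂ^ℓ × ℂ^d` along the fibres of `(z', z'') ↦ z''`: the fibre over
`z''` is a ball of radius `(1 - |z''|²)^{1/2}`. -/
theorem lintegral_ball_fibration (ℓ d : ℕ) (α : Fin ℓ → ℕ) (lam : ℝ) {G : Cn d → ℝ≥0∞}
    (hG : Measurable G) :
    ∫⁻ z in Metric.ball (0 : Cn (ℓ + d)) 1,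
        G (WithLp.toLp 2 fun i => z (Fin.natAdd ℓ i)) *
          ENNReal.ofReal ((∏ i, ‖z (Fin.castAdd d i)‖ ^ (2 * α i)) * (1 - ‖z‖ ^ 2) ^ lam) =
      monomialIntegral ℓ α lam * ∫⁻ w in Metric.ball (0 : Cn d) 1,
        G w * ENNReal.ofReal ((1 - ‖w‖ ^ 2) ^ (lam + (∑ i, α i : ℕ) + ℓ)) := by
  have m0 : Measurable fun z : Cn (ℓ + d) => G (WithLp.toLp 2 fun i => z (Fin.natAdd ℓ i)) *
      ENNReal.ofReal ((∏ i, ‖z (Fin.castAdd d i)‖ ^ (2 * α i)) * (1 - ‖z‖ ^ 2) ^ lam) := by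
    fun_prop
  have m1 : Measurable fun x : Cn ℓ =>
      ENNReal.ofReal ((∏ i, ‖x i‖ ^ (2 * α i)) * (1 - ‖x‖ ^ 2) ^ lam) := by fun_prop
  rw [← lintegral_indicator measurableSet_ball,
    lintegral_join ℓ d (m0.indicator measurableSet_ball),
    ← lintegral_const_mul _ (by fun_prop), ← lintegral_indicator measurableSet_ball]
  refine lintegral_congr fun y => ?_
  have hn : ∀ x : Cn ℓ, ‖joinEquiv ℓ d (WithLp.toLp 2 (x, y))‖ ^ 2 = ‖x‖ ^ 2 + ‖y‖ ^ 2 := by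
    intro x
    rw [LinearIsometryEquiv.norm_map, WithLp.prod_norm_sq_eq_of_L2]
    rfl
  have hlt : ∀ x : Cn ℓ, joinEquiv ℓ d (WithLp.toLp 2 (x, y)) ∈ Metric.ball (0 : Cn (ℓ + d)) 1 ↔
      ‖x‖ ^ 2 + ‖y‖ ^ 2 < 1 := by
    intro x
    rw [mem_ball_zero_iff, ← hn x, sq_lt_one_iff₀ (norm_nonneg _)]
  by_cases hy : y ∈ Metric.ball (0 : Cn d) 1
  swap
  · rw [Set.indicator_of_notMem hy, lintegral_eq_zero_of_ae_eq_zero]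
    refine Eventually.of_forall fun x => Set.indicator_of_notMem ?_ _
    rw [hlt]
    rw [mem_ball_zero_iff, ← sq_lt_one_iff₀ (norm_nonneg _)] at hy
    nlinarith [sq_nonneg ‖x‖]
  rw [Set.indicator_of_mem hy]
  have hq : 0 < 1 - ‖y‖ ^ 2 := by
    rw [mem_ball_zero_iff, ← sq_lt_one_iff₀ (norm_nonneg _)] at hy
    linarith
  set q : ℝ := 1 - ‖y‖ ^ 2 with hqdef
  have hs : 0 < Real.sqrt q := Real.sqrt_pos.2 hq
  have hs2 : Real.sqrt q ^ 2 = q := Real.sq_sqrt hq.le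
  have hmeas : Measurable fun x : Cn ℓ => (joinEquiv ℓ d) (WithLp.toLp 2 (x, y)) :=
    (joinEquiv ℓ d).continuous.measurable.comp (by fun_prop)
  have m2 := m0.indicator (measurableSet_ball (x := (0 : Cn (ℓ + d))) (ε := 1))
  refine (lintegral_comp_smul_Cn ℓ (m2.comp hmeas) hs).trans ?_
  rw [monomialIntegral, ← lintegral_indicator measurableSet_ball, mul_comm (lintegral _ _),
    ← lintegral_const_mul _ (m1.indicator measurableSet_ball)]
  refine (lintegral_const_mul _ (m2.comp (hmeas.comp (measurable_const_smul _)))).symm.trans ?_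
  refine lintegral_congr fun u => ?_
  simp only [Function.comp_apply]
  have hnu : ‖Real.sqrt q • u‖ ^ 2 = q * ‖u‖ ^ 2 := by
    rw [norm_smul, mul_pow, Real.norm_of_nonneg hs.le, hs2]
  by_cases hu : u ∈ Metric.ball (0 : Cn ℓ) 1
  swap
  · rw [Set.indicator_of_notMem hu, Set.indicator_of_notMem, mul_zero, mul_zero]
    rw [hlt, hnu]
    rw [mem_ball_zero_iff, ← sq_lt_one_iff₀ (norm_nonneg _)] at hu
    nlinarith
  have hu1 : 0 < 1 - ‖u‖ ^ 2 := by
    rw [mem_ball_zero_iff, ← sq_lt_one_iff₀ (norm_nonneg _)] at hu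
    linarith
  have hmem : joinEquiv ℓ d (WithLp.toLp 2 (Real.sqrt q • u, y)) ∈
      Metric.ball (0 : Cn (ℓ + d)) 1 := by
    rw [hlt, hnu]
    nlinarith
  rw [Set.indicator_of_mem hu, Set.indicator_of_mem hmem, hn, hnu]
  have e1 : (WithLp.toLp 2 fun i => joinEquiv ℓ d (WithLp.toLp 2 (Real.sqrt q • u, y))
      (Fin.natAdd ℓ i)) = y := by
    ext i
    simp only [joinEquiv_natAdd]
    rfl
  have e2 : ∏ i, ‖joinEquiv ℓ d (WithLp.toLp 2 (Real.sqrt q • u, y)) (Fin.castAdd d i)‖ ^ (2 * α i)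
      = q ^ (∑ i, α i) * ∏ i, ‖u i‖ ^ (2 * α i) := by
    simp only [joinEquiv_castAdd]
    rw [← Finset.prod_pow_eq_pow_sum, ← Finset.prod_mul_distrib]
    refine Finset.prod_congr rfl fun i _ => ?_
    change ‖(Real.sqrt q • u) i‖ ^ (2 * α i) = _
    rw [PiLp.smul_apply, norm_smul, mul_pow, Real.norm_of_nonneg hs.le, pow_mul, hs2]
  have e3 : 1 - (q * ‖u‖ ^ 2 + ‖y‖ ^ 2) = q * (1 - ‖u‖ ^ 2) := by rw [hqdef]; ring
  have e4 : q ^ (lam + (∑ i, α i : ℕ) + ℓ) = q ^ lam * q ^ (∑ i, α i) * q ^ ℓ := by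
    rw [Real.rpow_add hq, Real.rpow_add hq, Real.rpow_natCast, Real.rpow_natCast]
  rw [e1, e2, e3, e4, Real.mul_rpow hq.le hu1.le, pow_mul, hs2]
  have hP : 0 ≤ ∏ i, ‖u i‖ ^ (2 * α i) := Finset.prod_nonneg fun i _ => by positivity
  have hA : 0 ≤ q ^ lam := Real.rpow_nonneg hq.le _
  rw [show q ^ (∑ i, α i) * (∏ i, ‖u i‖ ^ (2 * α i)) * (q ^ lam * (1 - ‖u‖ ^ 2) ^ lam) =
      (q ^ lam * q ^ (∑ i, α i)) * ((∏ i, ‖u i‖ ^ (2 * α i)) * (1 - ‖u‖ ^ 2) ^ lam) by ring,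
    ENNReal.ofReal_mul (p := q ^ lam * q ^ ∑ i, α i) (by positivity),
    ENNReal.ofReal_mul (p := q ^ lam * q ^ ∑ i, α i) (by positivity)]
  ring

/-- The beta integral for the disc. -/
theorem lintegral_disc (a : ℕ) {τ : ℝ} (hτ : -1 < τ) :
    ∫⁻ w in Metric.ball (0 : Cn 1) 1, ENNReal.ofReal (‖w 0‖ ^ (2 * a)) *
        ENNReal.ofReal ((1 - ‖w‖ ^ 2) ^ τ) =
      ENNReal.ofReal (Real.pi * (Real.Gamma (a + 1) * Real.Gamma (τ + 1) /
        Real.Gamma (a + τ + 2))) := by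
  let e : ℂ ≃ₗᵢ[ℝ] Cn 1 :=
    { toFun := fun c => WithLp.toLp 2 fun _ => c
      invFun := fun w => w 0
      map_add' := fun x y => by ext; simp
      map_smul' := fun c x => by ext; simp
      left_inv := fun x => rfl
      right_inv := fun w => by ext i; fin_cases i; rfl
      norm_map' := fun c => by simp [EuclideanSpace.norm_eq] }
  let f : ℝ → ℝ≥0∞ := fun r => (Set.Iio (1 : ℝ)).indicator
    (fun r => ENNReal.ofReal (r ^ (2 * a)) * ENNReal.ofReal ((1 - r ^ 2) ^ τ)) r
  have hf : Measurable f := Measurable.indicator (by fun_prop) measurableSet_Iio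
  have h1 : ∫⁻ w in Metric.ball (0 : Cn 1) 1, ENNReal.ofReal (‖w 0‖ ^ (2 * a)) *
        ENNReal.ofReal ((1 - ‖w‖ ^ 2) ^ τ) = ∫⁻ c : ℂ, f ‖c‖ := by
    rw [← lintegral_indicator measurableSet_ball, ← e.measurePreserving.lintegral_comp
      (Measurable.indicator (by fun_prop) measurableSet_ball)]
    refine lintegral_congr fun c => ?_
    have hc : ‖e c‖ = ‖c‖ := e.norm_map c
    by_cases h : ‖c‖ < 1
    · rw [Set.indicator_of_mem (by rwa [mem_ball_zero_iff, hc])]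
      simp only [f]
      rw [Set.indicator_of_mem (by exact h), hc]
      rfl
    · rw [Set.indicator_of_notMem (by rwa [mem_ball_zero_iff, hc])]
      simp only [f]
      rw [Set.indicator_of_notMem (by exact h)]
  rw [h1, ← Complex.lintegral_comp_polarCoord_symm]
  have h2 : ∀ p : ℝ × ℝ, ‖Complex.polarCoord.symm p‖ = |p.1| := fun p =>
    Complex.norm_polarCoord_symm p
  have h3 : ∫⁻ p in polarCoord.target, ENNReal.ofReal p.1 • f ‖Complex.polarCoord.symm p‖ =
      ∫⁻ r in Set.Ioi (0 : ℝ), ENNReal.ofReal (2 * Real.pi) * (ENNReal.ofReal r * f |r|) := by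
    simp only [h2, polarCoord_target, Measure.volume_eq_prod, smul_eq_mul]
    rw [← Measure.prod_restrict, lintegral_prod _ (by fun_prop)]
    refine lintegral_congr fun r => ?_
    dsimp only
    rw [lintegral_const, Measure.restrict_apply_univ, Real.volume_Ioo, mul_comm]
    congr 2
    ring
  rw [h3]
  have h4 := ProbabilityTheory.lintegral_betaPDF_eq_one (α := a + 1) (β := τ + 1) (by positivity)
    (by linarith)
  have hB : 0 < ProbabilityTheory.beta (a + 1) (τ + 1) :=
    ProbabilityTheory.beta_pos (by positivity) (by linarith)
  have himg : (fun r : ℝ => r ^ 2) '' Set.Ioo 0 1 = Set.Ioo 0 1 := by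
    ext t
    constructor
    · rintro ⟨r, ⟨h0, h1⟩, rfl⟩
      exact ⟨by positivity, by simp only; nlinarith⟩
    · rintro ⟨h0, h1⟩
      refine ⟨Real.sqrt t, ⟨Real.sqrt_pos.2 h0, ?_⟩, Real.sq_sqrt h0.le⟩
      rw [Real.sqrt_lt' one_pos]
      simpa using h1
  have h5 := lintegral_image_eq_lintegral_abs_deriv_mul (s := Set.Ioo (0 : ℝ) 1)
    (f := fun r => r ^ 2) (f' := fun r => 2 * r) measurableSet_Ioo
    (fun r _ => by simpa using (hasDerivAt_pow 2 r).hasDerivWithinAt)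
    (fun x hx y hy hxy => (pow_left_inj₀ hx.1.le hy.1.le two_ne_zero).1 hxy)
    (fun x => ENNReal.ofReal (1 / ProbabilityTheory.beta (a + 1) (τ + 1) * x ^ ((a + 1 : ℝ) - 1) *
      (1 - x) ^ ((τ + 1 : ℝ) - 1)))
  rw [himg, ← ProbabilityTheory.lintegral_betaPDF, h4] at h5
  have h6 : ∫⁻ r in Set.Ioi (0 : ℝ), ENNReal.ofReal (2 * Real.pi) * (ENNReal.ofReal r * f |r|) =
      ENNReal.ofReal (Real.pi * ProbabilityTheory.beta (a + 1) (τ + 1)) * 1 := by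
    rw [h5, ← lintegral_const_mul' _ _ ENNReal.ofReal_ne_top,
      ← lintegral_indicator measurableSet_Ioi, ← lintegral_indicator measurableSet_Ioo]
    refine lintegral_congr fun r => ?_
    by_cases hr0 : 0 < r
    swap
    · rw [Set.indicator_of_notMem (by simpa using hr0),
        Set.indicator_of_notMem (fun h => hr0 h.1)]
    rw [Set.indicator_of_mem (by exact hr0)]
    by_cases hr1 : r < 1
    swap
    · rw [Set.indicator_of_notMem (fun h => hr1 h.2)]
      simp only [f]
      rw [abs_of_pos hr0, Set.indicator_of_notMem (by exact hr1), mul_zero, mul_zero]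
    rw [Set.indicator_of_mem (show r ∈ Set.Ioo 0 1 from ⟨hr0, hr1⟩)]
    simp only [f]
    rw [abs_of_pos hr0, Set.indicator_of_mem (by exact hr1), abs_of_pos (by positivity)]
    have h7 : 0 < 1 - r ^ 2 := by nlinarith
    have hpi := Real.pi_pos
    have h8 := Real.rpow_nonneg h7.le τ
    rw [← ENNReal.ofReal_mul (by positivity), ← ENNReal.ofReal_mul (by positivity),
      ← ENNReal.ofReal_mul (by positivity), ← ENNReal.ofReal_mul (by positivity),
      ← ENNReal.ofReal_mul (by positivity)]
    congr 1
    rw [add_sub_cancel_right, add_sub_cancel_right, Real.rpow_natCast, ← pow_mul]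
    field_simp
  rw [h6, mul_one, ProbabilityTheory.beta]
  congr 4
  ring

/-- One coordinate is split off: the first `ℓ` coordinates are integrated along the fibres of the
last one, and what remains is a beta integral over the disc. -/
theorem monomialIntegral_succ (ℓ : ℕ) (α : Fin (ℓ + 1) → ℕ) {lam : ℝ} (hlam : -1 < lam) :
    monomialIntegral (ℓ + 1) α lam = monomialIntegral ℓ (fun i => α i.castSucc) lam *
      ENNReal.ofReal (Real.pi * (Real.Gamma (α (Fin.last ℓ) + 1) *
        Real.Gamma (lam + (∑ i : Fin ℓ, α i.castSucc : ℕ) + ℓ + 1) /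
        Real.Gamma (α (Fin.last ℓ) + (lam + (∑ i : Fin ℓ, α i.castSucc : ℕ) + ℓ) + 2))) := by
  have hτ : -1 < lam + (∑ i : Fin ℓ, α i.castSucc : ℕ) + ℓ := by
    have : (0 : ℝ) ≤ (∑ i : Fin ℓ, α i.castSucc : ℕ) := by positivity
    have : (0 : ℝ) ≤ ℓ := by positivity
    linarith
  rw [← lintegral_disc _ hτ, ← lintegral_ball_fibration ℓ 1 (fun i => α i.castSucc) lam
    (G := fun w => ENNReal.ofReal (‖w 0‖ ^ (2 * α (Fin.last ℓ)))) (by fun_prop)]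
  refine lintegral_congr fun z => ?_
  rw [← ENNReal.ofReal_mul (by positivity), Fin.prod_univ_castSucc]
  congr 1
  change _ = ‖z (Fin.last ℓ)‖ ^ (2 * α (Fin.last ℓ)) *
    ((∏ i : Fin ℓ, ‖z i.castSucc‖ ^ (2 * α i.castSucc)) * (1 - ‖z‖ ^ 2) ^ lam)
  ring

theorem monomialIntegral_eq (ℓ : ℕ) (α : Fin ℓ → ℕ) {lam : ℝ} (hlam : -1 < lam) :
    monomialIntegral ℓ α lam = ENNReal.ofReal (Real.pi ^ ℓ * (∏ i, (α i).factorial : ℕ) *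
      Real.Gamma (lam + 1) / Real.Gamma (ℓ + (∑ i, α i : ℕ) + lam + 1)) := by
  induction ℓ with
  | zero =>
    have h1 : Real.Gamma (lam + 1) ≠ 0 := (Real.Gamma_pos_of_pos (by linarith)).ne'
    have hv : volume (Metric.ball (0 : Cn 0) 1) = 1 := by
      let e : Cn 0 ≃ₗᵢ[ℝ] EuclideanSpace ℝ (Fin 0) :=
        { (0 : Cn 0 ≃ₗ[ℝ] EuclideanSpace ℝ (Fin 0)) with
          norm_map' := fun x => by simp [Subsingleton.elim x 0] }
      have h := e.measurePreserving.measure_preimage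
        (MeasurableSet.univ.nullMeasurableSet (s := Set.univ))
      rw [volume_euclideanSpace_eq_dirac] at h
      have hb : Metric.ball (0 : Cn 0) 1 = Set.univ := by
        ext x; simp [Subsingleton.elim x 0]
      rw [hb]
      simpa using h
    rw [monomialIntegral]
    have : ∀ z : Cn 0, ENNReal.ofReal ((∏ i, ‖z i‖ ^ (2 * α i)) * (1 - ‖z‖ ^ 2) ^ lam) = 1 := by
      intro z
      simp [Subsingleton.elim z 0]
    simp only [this, lintegral_const, Measure.restrict_apply_univ, hv]
    simp [h1]
  | succ ℓ ih =>
    have hS : (0 : ℝ) ≤ (∑ i : Fin ℓ, α i.castSucc : ℕ) := by positivity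
    have hℓ : (0 : ℝ) ≤ ℓ := by positivity
    have g1 : 0 < Real.Gamma (ℓ + (∑ i : Fin ℓ, α i.castSucc : ℕ) + lam + 1) :=
      Real.Gamma_pos_of_pos (by linarith)
    have g2 : 0 < Real.Gamma (lam + 1) := Real.Gamma_pos_of_pos (by linarith)
    rw [monomialIntegral_succ ℓ α hlam, ih, ← ENNReal.ofReal_mul (by positivity)]
    congr 1
    rw [Real.Gamma_nat_eq_factorial, Fin.prod_univ_castSucc, Fin.sum_univ_castSucc,
      show lam + ((∑ i : Fin ℓ, α i.castSucc : ℕ) : ℝ) + ℓ + 1 =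
        ℓ + ((∑ i : Fin ℓ, α i.castSucc : ℕ) : ℝ) + lam + 1 by ring,
      show (α (Fin.last ℓ) : ℝ) + (lam + ((∑ i : Fin ℓ, α i.castSucc : ℕ) : ℝ) + ℓ) + 2 =
        ((ℓ + 1 : ℕ) : ℝ) + ((∑ i : Fin ℓ, α i.castSucc + α (Fin.last ℓ) : ℕ) : ℝ) + lam + 1 by
          push_cast; ring]
    have g3 := g1.ne'
    push_cast at g3 ⊢
    field_simp
    ring

end Fibration

end WeightedBergman

namespace WeightedBergman

/-! ### Elements of the Bergman space as functions, and Toeplitz operators -/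

section Functions

variable {d : ℕ} {μ : ℝ}

theorem inclusion_mem (h : Bergman d μ) : inclusion d μ h ∈ bergmanSubmodule d μ :=
  (show bergmanSubmodule d μ from h).2

/-- The holomorphic representative of an element of the Bergman space. -/
noncomputable def holoRep (h : Bergman d μ) : 𝔹 d → ℂ := (inclusion_mem h).choose

theorem holo_holoRep (h : Bergman d μ) : Holo (holoRep h) := (inclusion_mem h).choose_spec.1

theorem inclusion_ae_eq_holoRep (h : Bergman d μ) : inclusion d μ h =ᵐ[vol d μ] holoRep h :=
  (inclusion_mem h).choose_spec.2

theorem inclusion_injective : Function.Injective (inclusion d μ) :=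
  fun _ _ h => Subtype.ext (p := (· ∈ bergmanSubmodule d μ)) h

theorem memLp_of_ae_eq {h : Bergman d μ} {F : 𝔹 d → ℂ} (hF : inclusion d μ h =ᵐ[vol d μ] F) :
    MemLp F 2 (vol d μ) :=
  (memLp_congr_ae hF).1 (Lp.memLp _)

theorem inner_eq_integral {f g : Bergman d μ} {F G : 𝔹 d → ℂ}
    (hF : inclusion d μ f =ᵐ[vol d μ] F) (hG : inclusion d μ g =ᵐ[vol d μ] G) :
    inner ℂ f g = ∫ z, starRingEnd ℂ (F z) * G z ∂vol d μ := by
  have h1 : inner ℂ f g = inner ℂ (inclusion d μ f) (inclusion d μ g) := rfl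
  rw [h1, L2.inner_def]
  refine integral_congr_ae ?_
  filter_upwards [hF, hG] with z h2 h3
  rw [h2, h3, RCLike.inner_apply, mul_comm]

theorem enorm_Lp_sq (F : Lp ℂ 2 (vol d μ)) : ‖F‖ₑ ^ 2 = ∫⁻ z, ‖F z‖ₑ ^ 2 ∂vol d μ := by
  rw [Lp.enorm_def]
  have := eLpNorm_nnreal_pow_eq_lintegral (f := F) (μ := vol d μ) (p := 2) two_ne_zero
  simpa using this

theorem enorm_sq_eq_lintegral {f : Bergman d μ} {F : 𝔹 d → ℂ}
    (hF : inclusion d μ f =ᵐ[vol d μ] F) : ‖f‖ₑ ^ 2 = ∫⁻ z, ‖F z‖ₑ ^ 2 ∂vol d μ := by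
  have h1 : ‖f‖ₑ = ‖inclusion d μ f‖ₑ := rfl
  rw [h1, enorm_Lp_sq]
  refine lintegral_congr_ae ?_
  filter_upwards [hF] with z h2
  rw [h2]

theorem inner_projection (f : Bergman d μ) (F : Lp ℂ 2 (vol d μ)) :
    inner ℂ f (projection d μ F) = inner ℂ (inclusion d μ f) F :=
  Submodule.inner_orthogonalProjectionOnto_eq_of_mem_left (K := bergmanSubmodule d μ) f F

theorem projection_inclusion (f : Bergman d μ) : projection d μ (inclusion d μ f) = f :=
  Submodule.orthogonalProjectionOnto_mem_subspace_eq_self (K := bergmanSubmodule d μ) f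

theorem norm_projection_le (F : Lp ℂ 2 (vol d μ)) : ‖projection d μ F‖ ≤ ‖F‖ :=
  Submodule.norm_orthogonalProjectionOnto_apply_le (bergmanSubmodule d μ) F

theorem mul_symbol_ae_eq (c : 𝔹 d →ᵇ ℂ) (F : Lp ℂ 2 (vol d μ)) :
    ((ContinuousLinearMap.mul ℂ ℂ).holderL (vol d μ) ∞ 2 2 (symbol μ c) F : 𝔹 d → ℂ)
      =ᵐ[vol d μ] fun z => c z * F z := by
  have h1 : (ContinuousLinearMap.mul ℂ ℂ).holderL (vol d μ) ∞ 2 2 (symbol μ c) F =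
      (ContinuousLinearMap.mul ℂ ℂ).holder 2 (symbol μ c) F := rfl
  have h2 : (symbol μ c : 𝔹 d → ℂ) =ᵐ[vol d μ] c := MemLp.coeFn_toLp _
  rw [h1]
  filter_upwards [(ContinuousLinearMap.mul ℂ ℂ).coeFn_holder (r := 2) (symbol μ c) F, h2]
    with z h3 h4
  rw [h3, h4]
  rfl

theorem inner_toeplitz (c : 𝔹 d →ᵇ ℂ) {f g : Bergman d μ} {F G : 𝔹 d → ℂ}
    (hF : inclusion d μ f =ᵐ[vol d μ] F) (hG : inclusion d μ g =ᵐ[vol d μ] G) :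
    inner ℂ f (toeplitz d μ (symbol μ c) g) =
      ∫ z, c z * (starRingEnd ℂ (F z) * G z) ∂vol d μ := by
  rw [toeplitz, ContinuousLinearMap.comp_apply, inner_projection, L2.inner_def]
  refine integral_congr_ae ?_
  filter_upwards [mul_symbol_ae_eq c (inclusion d μ g), hF, hG] with z h1 h2 h3
  rw [ContinuousLinearMap.comp_apply, h1, h2, h3, RCLike.inner_apply]
  ring

theorem inner_toeplitz_star (c : 𝔹 d →ᵇ ℂ) (f g : Bergman d μ) :
    inner ℂ (toeplitz d μ (symbol μ c) f) g = inner ℂ f (toeplitz d μ (symbol μ (star c)) g) := by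
  rw [← inner_conj_symm, inner_toeplitz c (inclusion_ae_eq_holoRep g) (inclusion_ae_eq_holoRep f),
    inner_toeplitz (star c) (inclusion_ae_eq_holoRep f) (inclusion_ae_eq_holoRep g),
    ← integral_conj]
  refine integral_congr_ae (Eventually.of_forall fun z => ?_)
  simp only [map_mul, RingHomCompTriple.comp_apply, RingHom.id_apply,
    BoundedContinuousFunction.star_apply, RCLike.star_def]
  ring

theorem star_toeplitz (c : 𝔹 d →ᵇ ℂ) :
    star (toeplitz d μ (symbol μ c)) = toeplitz d μ (symbol μ (star c)) := by
  rw [ContinuousLinearMap.star_eq_adjoint]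
  symm
  rw [ContinuousLinearMap.eq_adjoint_iff]
  intro x y
  rw [inner_toeplitz_star, star_star]

/-- The distance from `T_c g` to a multiple of `g`. -/
theorem enorm_toeplitz_sub_smul_le (c : 𝔹 d →ᵇ ℂ) (a : ℂ) {g : Bergman d μ} {G : 𝔹 d → ℂ}
    (hG : inclusion d μ g =ᵐ[vol d μ] G) :
    ‖toeplitz d μ (symbol μ c) g - a • g‖ₑ ^ 2 ≤
      ∫⁻ z, ‖c z - a‖ₑ ^ 2 * ‖G z‖ₑ ^ 2 ∂vol d μ := by
  set F := (ContinuousLinearMap.mul ℂ ℂ).holderL (vol d μ) ∞ 2 2 (symbol μ c) (inclusion d μ g)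
  have h1 : toeplitz d μ (symbol μ c) g - a • g = projection d μ (F - a • inclusion d μ g) := by
    rw [map_sub, map_smul, projection_inclusion]
    rfl
  have h2 : ‖F - a • inclusion d μ g‖ₑ ^ 2 = ∫⁻ z, ‖c z - a‖ₑ ^ 2 * ‖G z‖ₑ ^ 2 ∂vol d μ := by
    rw [enorm_Lp_sq]
    refine lintegral_congr_ae ?_
    filter_upwards [mul_symbol_ae_eq c (inclusion d μ g), hG, Lp.coeFn_sub F (a • inclusion d μ g),
      Lp.coeFn_smul a (inclusion d μ g)] with z h3 h4 h5 h6
    rw [h5, Pi.sub_apply, h6, Pi.smul_apply, h3, h4, smul_eq_mul, ← sub_mul, enorm_mul, mul_pow]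
  rw [h1, ← h2]
  gcongr
  rw [← ofReal_norm, ← ofReal_norm]
  exact ENNReal.ofReal_le_ofReal (norm_projection_le _)

theorem toeplitz_mem_toeplitzAlg {c : 𝔹 d →ᵇ ℂ} (hc : c ∈ BUC d) :
    toeplitz d μ (symbol μ c) ∈ toeplitzAlg d μ :=
  StarSubalgebra.le_topologicalClosure _ (StarAlgebra.subset_adjoin ℂ _ ⟨c, hc, rfl⟩)

end Functions

/-! ### Unitary maps of the ball -/

section Unitary

variable {d : ℕ}

/-- The map of the ball induced by a real-linear isometry of `ℂ^d`. -/
noncomputable def ballMap (u : Cn d ≃ₗᵢ[ℝ] Cn d) (z : 𝔹 d) : 𝔹 d :=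
  ⟨u z, by rw [mem_ball_zero_iff, u.norm_map]; exact norm_coe_lt_one z⟩

@[simp] theorem coe_ballMap (u : Cn d ≃ₗᵢ[ℝ] Cn d) (z : 𝔹 d) : (ballMap u z : Cn d) = u z := rfl

theorem continuous_ballMap (u : Cn d ≃ₗᵢ[ℝ] Cn d) : Continuous (ballMap u) :=
  Continuous.subtype_mk (u.continuous.comp continuous_subtype_val) _

theorem lintegral_vol_ballMap (u : Cn d ≃ₗᵢ[ℝ] Cn d) (μ : ℝ) (G : 𝔹 d → ℝ≥0∞) :
    ∫⁻ z, G (ballMap u z) ∂vol d μ = ∫⁻ z, G z ∂vol d μ := by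
  classical
  let g : Cn d → ℝ≥0∞ := fun z => if h : z ∈ Metric.ball 0 1 then ENNReal.ofReal
      (volConst d μ * (1 - ‖z‖ ^ 2) ^ ((d : ℝ) + μ + 1)) * G ⟨z, h⟩ else 0
  have hg : ∀ z : 𝔹 d, ENNReal.ofReal
      (volConst d μ * (1 - ‖(z : Cn d)‖ ^ 2) ^ ((d : ℝ) + μ + 1)) * G z = g z :=
    fun z => by simp only [g, dif_pos z.2]
  have e1 : ∀ z : 𝔹 d, ENNReal.ofReal
      (volConst d μ * (1 - ‖(z : Cn d)‖ ^ 2) ^ ((d : ℝ) + μ + 1)) * G (ballMap u z) = g (u z) := by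
    intro z
    rw [show u z = (ballMap u z : Cn d) from rfl, ← hg, coe_ballMap, u.norm_map]
  rw [lintegral_vol_eq, lintegral_vol_eq, lintegral_congr e1, lintegral_congr hg,
    lintegral_invVol_coe (fun z => g (u z)), lintegral_invVol_coe g]
  have hb : u ⁻¹' Metric.ball (0 : Cn d) 1 = Metric.ball 0 1 := by
    ext z
    rw [Set.mem_preimage, mem_ball_zero_iff, mem_ball_zero_iff, u.norm_map]
  have key := u.measurePreserving.setLIntegral_comp_preimage_emb
    u.toHomeomorph.measurableEmbedding
    (fun z => ENNReal.ofReal (((1 - ‖z‖ ^ 2) ^ (d + 1))⁻¹) * g z) (Metric.ball 0 1)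
  rw [hb] at key
  rw [← key]
  simp only [u.norm_map]

theorem measurePreserving_ballMap (u : Cn d ≃ₗᵢ[ℝ] Cn d) (μ : ℝ) :
    MeasurePreserving (ballMap u) (vol d μ) (vol d μ) := by
  have hm := (continuous_ballMap u).measurable
  refine ⟨hm, ?_⟩
  ext s hs
  rw [Measure.map_apply hm hs, ← lintegral_indicator_one hs, ← lintegral_indicator_one (hm hs),
    ← lintegral_vol_ballMap u μ (s.indicator 1)]
  rfl

theorem measurableEmbedding_ballMap (u : Cn d ≃ₗᵢ[ℝ] Cn d) : MeasurableEmbedding (ballMap u) := by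
  let e : 𝔹 d ≃ₜ 𝔹 d :=
    { toFun := ballMap u
      invFun := ballMap u.symm
      left_inv := fun z => Subtype.ext (u.symm_apply_apply _)
      right_inv := fun z => Subtype.ext (u.apply_symm_apply _)
      continuous_toFun := continuous_ballMap u
      continuous_invFun := continuous_ballMap u.symm }
  exact e.measurableEmbedding

theorem integral_vol_ballMap (u : Cn d ≃ₗᵢ[ℝ] Cn d) (μ : ℝ) (G : 𝔹 d → ℂ) :
    ∫ z, G (ballMap u z) ∂vol d μ = ∫ z, G z ∂vol d μ :=
  (measurePreserving_ballMap u μ).integral_comp (measurableEmbedding_ballMap u) G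

/-- An integrand that a symmetry of `v_μ` multiplies by a constant `χ ≠ 1` has integral zero. -/
theorem integral_eq_zero_of_ballMap (u : Cn d ≃ₗᵢ[ℝ] Cn d) {μ : ℝ} {G : 𝔹 d → ℂ} {χ : ℂ}
    (hχ : χ ≠ 1) (hG : ∀ z, G (ballMap u z) = χ * G z) : ∫ z, G z ∂vol d μ = 0 := by
  have h := integral_vol_ballMap u μ G
  simp only [hG] at h
  rw [integral_const_mul] at h
  by_contra h0
  exact hχ (mul_right_cancel₀ h0 (h.trans (one_mul _).symm))

/-- The rotation of the coordinates by the unimodular numbers `c i`. -/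
noncomputable def diagRotation (c : Fin d → Circle) : Cn d ≃ₗᵢ[ℝ] Cn d :=
  LinearIsometryEquiv.piLpCongrRight 2 fun i => rotation (c i)

theorem diagRotation_apply (c : Fin d → Circle) (z : Cn d) (i : Fin d) :
    diagRotation c z i = c i * z i := by
  rw [diagRotation, LinearIsometryEquiv.piLpCongrRight_apply]
  exact rotation_apply _ _

end Unitary

/-! ### Monomials -/

section Monomials

variable {d : ℕ}

/-- The normalizing constant of the monomial `z^α`. -/
noncomputable def monomialConst (d : ℕ) (μ : ℝ) (α : Fin d → ℕ) : ℝ :=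
  Real.sqrt (Real.Gamma (d + ((∑ i, α i : ℕ) : ℝ) + μ + 1) /
    (((∏ i, (α i).factorial : ℕ) : ℝ) * Real.Gamma (d + μ + 1)))

theorem monomialFun_eq (μ : ℝ) (α : Fin d → ℕ) (z : 𝔹 d) :
    monomialFun d μ α z = monomialConst d μ α * ∏ i, (z : Cn d) i ^ α i := rfl

theorem continuous_monomialFun (μ : ℝ) (α : Fin d → ℕ) : Continuous (monomialFun d μ α) := by
  unfold monomialFun
  fun_prop

theorem Gamma_add_pos {μ : ℝ} (hμ : -1 < μ) (n : ℕ) {t : ℝ} (ht : 0 ≤ t) :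
    0 < Real.Gamma (n + t + μ + 1) :=
  Real.Gamma_pos_of_pos (by linarith [Nat.cast_nonneg (α := ℝ) n])

theorem prod_factorial_pos {n : ℕ} (α : Fin n → ℕ) :
    (0 : ℝ) < ((∏ i, (α i).factorial : ℕ) : ℝ) :=
  Nat.cast_pos.2 (Finset.prod_pos fun _ _ => Nat.factorial_pos _)

theorem monomialConst_sq {μ : ℝ} (hμ : -1 < μ) (α : Fin d → ℕ) :
    monomialConst d μ α ^ 2 = Real.Gamma (d + ((∑ i, α i : ℕ) : ℝ) + μ + 1) /
      (((∏ i, (α i).factorial : ℕ) : ℝ) * Real.Gamma (d + μ + 1)) := by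
  have h1 := Gamma_add_pos hμ d (Nat.cast_nonneg (∑ i, α i))
  have h2 := Gamma_add_pos hμ d le_rfl
  rw [add_zero] at h2
  have h3 := prod_factorial_pos α
  exact Real.sq_sqrt (by positivity)

theorem norm_monomialFun_sq (μ : ℝ) (α : Fin d → ℕ) (z : 𝔹 d) :
    ‖monomialFun d μ α z‖ ^ 2 = monomialConst d μ α ^ 2 * ∏ i, ‖(z : Cn d) i‖ ^ (2 * α i) := by
  rw [monomialFun_eq, norm_mul, mul_pow, Complex.norm_real, Real.norm_eq_abs, sq_abs, norm_prod,
    ← Finset.prod_pow]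
  simp only [norm_pow, ← pow_mul, mul_comm]

theorem enorm_monomialFun_sq (μ : ℝ) (α : Fin d → ℕ) (z : 𝔹 d) :
    ‖monomialFun d μ α z‖ₑ ^ 2 =
      ENNReal.ofReal (monomialConst d μ α ^ 2 * ∏ i, ‖(z : Cn d) i‖ ^ (2 * α i)) := by
  rw [← norm_monomialFun_sq, ENNReal.ofReal_pow (norm_nonneg _), ofReal_norm]

theorem lintegral_monomialFun_sq {μ : ℝ} (hμ : -1 < μ) (α : Fin d → ℕ) :
    ∫⁻ z, ‖monomialFun d μ α z‖ₑ ^ 2 ∂vol d μ = 1 := by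
  have hc := volConst_pos d hμ
  simp only [enorm_monomialFun_sq]
  rw [lintegral_vol (f := fun z => ENNReal.ofReal (monomialConst d μ α ^ 2 *
    ∏ i, ‖z i‖ ^ (2 * α i))) (by fun_prop)]
  have h1 : ∀ z ∈ Metric.ball (0 : Cn d) 1, ENNReal.ofReal (weight d μ z) *
      ENNReal.ofReal (monomialConst d μ α ^ 2 * ∏ i, ‖z i‖ ^ (2 * α i)) =
      ENNReal.ofReal (volConst d μ * monomialConst d μ α ^ 2) *
        ENNReal.ofReal ((∏ i, ‖z i‖ ^ (2 * α i)) * (1 - ‖z‖ ^ 2) ^ μ) := by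
    intro z hz
    have h2 : 0 < 1 - ‖z‖ ^ 2 := by
      rw [mem_ball_zero_iff] at hz
      nlinarith [norm_nonneg z]
    have h3 := Real.rpow_nonneg h2.le μ
    rw [weight_eq, ← ENNReal.ofReal_mul (by positivity), ← ENNReal.ofReal_mul (by positivity)]
    congr 1
    ring
  rw [setLIntegral_congr_fun measurableSet_ball h1, lintegral_const_mul' _ _ ENNReal.ofReal_ne_top]
  change _ * monomialIntegral d α μ = 1
  rw [monomialIntegral_eq d α hμ, ← ENNReal.ofReal_mul (by positivity), monomialConst_sq hμ,
    volConst]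
  have g1 := (Gamma_add_pos hμ d (Nat.cast_nonneg (∑ i, α i))).ne'
  have g2 := (Gamma_add_pos hμ d le_rfl).ne'
  rw [add_zero] at g2
  have g3 := (prod_factorial_pos α).ne'
  have g4 : Real.Gamma (μ + 1) ≠ 0 := (Real.Gamma_pos_of_pos (by linarith)).ne'
  rw [← ENNReal.ofReal_one]
  congr 1
  field_simp

theorem isProbabilityMeasure_vol (d : ℕ) {μ : ℝ} (hμ : -1 < μ) :
    IsProbabilityMeasure (vol d μ) := by
  have h := lintegral_monomialFun_sq (d := d) hμ 0
  have h1 : ∀ z : 𝔹 d, monomialFun d μ 0 z = 1 := by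
    intro z
    have g2 := (Gamma_add_pos hμ d le_rfl).ne'
    rw [add_zero] at g2
    simp [monomialFun, div_self g2]
  simp only [h1] at h
  exact ⟨by simpa using h⟩

theorem norm_normMonomial {μ : ℝ} (hμ : -1 < μ) (α : Fin d → ℕ) : ‖normMonomial d μ α‖ = 1 := by
  have h := enorm_sq_eq_lintegral (normMonomial_ae_eq hμ α)
  rw [lintegral_monomialFun_sq hμ, ← ofReal_norm, ← ENNReal.ofReal_pow (norm_nonneg _),
    ENNReal.ofReal_eq_one] at h
  exact (pow_eq_one_iff_of_nonneg (norm_nonneg _) two_ne_zero).1 h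

/-- Integrals of `c(z) conj(z^β) z^α` vanish if `c` does not depend on the argument of a coordinate
`z_i` with `α_i ≠ β_i`. -/
theorem integral_monomialFun_eq_zero {μ : ℝ} {α β : Fin d → ℕ} {i : Fin d} (hi : β i ≠ α i)
    {c : 𝔹 d → ℂ} (hc : ∀ (t : Circle) z,
      c (ballMap (diagRotation (Function.update 1 i t)) z) = c z) :
    ∫ z, c z * (starRingEnd ℂ (monomialFun d μ β z) * monomialFun d μ α z) ∂vol d μ = 0 := by
  have hne : (α i : ℝ) - β i ≠ 0 := sub_ne_zero.2 (by exact_mod_cast hi.symm)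
  let t : Circle := Circle.exp (Real.pi / (α i - β i))
  have ht : starRingEnd ℂ ((t : ℂ) ^ β i) * (t : ℂ) ^ α i = -1 := by
    rw [map_pow, ← Circle.coe_inv_eq_conj, ← Circle.coe_pow, ← Circle.coe_pow, ← Circle.coe_mul]
    simp only [t]
    rw [← Circle.exp_neg, Circle.coe_mul, Circle.coe_pow, Circle.coe_pow, Circle.coe_exp,
      Circle.coe_exp, ← Complex.exp_nat_mul, ← Complex.exp_nat_mul, ← Complex.exp_add,
      ← Complex.exp_pi_mul_I]
    congr 1
    have : (α i : ℂ) - β i ≠ 0 := by exact_mod_cast hne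
    push_cast
    field_simp
    ring
  have hrot : ∀ (γ : Fin d → ℕ) z, monomialFun d μ γ
      (ballMap (diagRotation (Function.update 1 i t)) z) = (t : ℂ) ^ γ i * monomialFun d μ γ z := by
    intro γ z
    rw [monomialFun_eq, monomialFun_eq, coe_ballMap]
    simp only [diagRotation_apply, mul_pow, Finset.prod_mul_distrib]
    have : ∏ j, ((Function.update (1 : Fin d → Circle) i t j : Circle) : ℂ) ^ γ j =
        (t : ℂ) ^ γ i := by
      rw [Finset.prod_eq_single i]
      · rw [Function.update_self]
      · intro j _ hj
        rw [Function.update_of_ne hj]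
        simp
      · simp
    rw [this]
    ring
  refine integral_eq_zero_of_ballMap (diagRotation (Function.update 1 i t)) (χ := -1)
    (by norm_num) fun z => ?_
  rw [hc, hrot, hrot, map_mul, ← ht]
  ring

theorem orthonormal_normMonomial {μ : ℝ} (hμ : -1 < μ) :
    Orthonormal ℂ (normMonomial d μ) := by
  refine ⟨norm_normMonomial hμ, fun β α hβα => ?_⟩
  obtain ⟨i, hi⟩ := Function.ne_iff.1 hβα
  rw [inner_eq_integral (normMonomial_ae_eq hμ β) (normMonomial_ae_eq hμ α)]
  have := integral_monomialFun_eq_zero (μ := μ) hi (c := fun _ => 1) (fun _ _ => rfl)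
  simpa using this

/-- The second moment of `v_μ`. -/
theorem lintegral_norm_sq {μ : ℝ} (hμ : -1 < μ) :
    ∫⁻ z : 𝔹 d, ENNReal.ofReal (‖(z : Cn d)‖ ^ 2) ∂vol d μ =
      ENNReal.ofReal (d / (d + μ + 1)) := by
  have hD : 0 < (d : ℝ) + μ + 1 := by linarith [Nat.cast_nonneg (α := ℝ) d]
  have h1 : ∀ i : Fin d, ∫⁻ z : 𝔹 d, ENNReal.ofReal (‖(z : Cn d) i‖ ^ 2) ∂vol d μ =
      ENNReal.ofReal (1 / (d + μ + 1)) := by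
    intro i
    have h := lintegral_monomialFun_sq (d := d) hμ (Pi.single i 1)
    have hc : monomialConst d μ (Pi.single i 1) ^ 2 = d + μ + 1 := by
      have g2 := (Gamma_add_pos hμ d le_rfl).ne'
      rw [add_zero] at g2
      have hs : ∑ j, (Pi.single i 1 : Fin d → ℕ) j = 1 := by simp
      have hf : ∏ j, ((Pi.single i 1 : Fin d → ℕ) j).factorial = 1 := by
        refine Finset.prod_eq_one fun j _ => ?_
        rcases eq_or_ne j i with rfl | hj
        · simp
        · simp [hj]
      rw [monomialConst_sq hμ, hs, hf, Nat.cast_one, one_mul,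
        show (d : ℝ) + 1 + μ + 1 = (d + μ + 1) + 1 by ring, Real.Gamma_add_one hD.ne',
        mul_div_cancel_right₀ _ g2]
    have hp : ∀ z : 𝔹 d, ∏ j, ‖(z : Cn d) j‖ ^ (2 * (Pi.single i 1 : Fin d → ℕ) j) =
        ‖(z : Cn d) i‖ ^ 2 := by
      intro z
      rw [Finset.prod_eq_single i]
      · simp
      · intro j _ hj
        simp [hj]
      · simp
    simp only [enorm_monomialFun_sq, hc, hp] at h
    simp only [ENNReal.ofReal_mul hD.le] at h
    rw [lintegral_const_mul' _ _ ENNReal.ofReal_ne_top] at h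
    rw [one_div, ENNReal.ofReal_inv_of_pos hD]
    exact ENNReal.eq_inv_of_mul_eq_one_left (by rw [mul_comm]; exact h)
  have h2 : ∀ z : 𝔹 d, ENNReal.ofReal (‖(z : Cn d)‖ ^ 2) =
      ∑ i, ENNReal.ofReal (‖(z : Cn d) i‖ ^ 2) := by
    intro z
    rw [EuclideanSpace.norm_sq_eq, ENNReal.ofReal_sum_of_nonneg fun _ _ => sq_nonneg _]
  simp only [h2]
  rw [lintegral_finsetSum _ fun i _ => by fun_prop]
  simp only [h1, Finset.sum_const, Finset.card_univ, Fintype.card_fin, nsmul_eq_mul]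
  rw [← ENNReal.ofReal_natCast, ← ENNReal.ofReal_mul (by positivity)]
  congr 1
  ring

end Monomials

end WeightedBergman

namespace WeightedBergman

/-! ### The reproducing property -/

section Reproducing

variable {d : ℕ} {μ : ℝ}

theorem ofReal_norm_sq_eq (x : ℂ) : ENNReal.ofReal (‖x‖ ^ 2) = ‖x‖ₑ ^ 2 := by
  rw [ENNReal.ofReal_pow (norm_nonneg _), ofReal_norm]

theorem holo_kernelFun (μ : ℝ) (z : 𝔹 d) : Holo (kernelFun d μ z) := by
  refine ⟨fun w => (((1 - ‖(z : Cn d)‖ ^ 2) ^ ((d + μ + 1) / 2) : ℝ) : ℂ) /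
    (1 - inner ℂ (z : Cn d) w) ^ ((d + μ + 1 : ℝ) : ℂ), fun w hw => ?_, fun _ => rfl⟩
  rw [mem_ball_zero_iff] at hw
  have hs : 1 - inner ℂ (z : Cn d) w ∈ Complex.slitPlane := by
    left
    have h1 := (Complex.re_le_norm (inner ℂ (z : Cn d) w)).trans (norm_inner_le_norm _ _)
    have h2 : ‖(z : Cn d)‖ * ‖w‖ < 1 := by
      nlinarith [norm_coe_lt_one z, norm_nonneg (z : Cn d), norm_nonneg w]
    simp only [Complex.sub_re, Complex.one_re]
    linarith
  have h1 : DifferentiableAt ℂ (fun w : Cn d => 1 - inner ℂ (z : Cn d) w) w :=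
    (differentiableAt_const _).sub (innerSL ℂ (z : Cn d)).differentiableAt
  have h2 := h1.cpow (differentiableAt_const ((d + μ + 1 : ℝ) : ℂ)) hs
  have h3 : (1 - inner ℂ (z : Cn d) w) ^ ((d + μ + 1 : ℝ) : ℂ) ≠ 0 := by
    simp [Complex.cpow_eq_zero_iff, Complex.slitPlane_ne_zero hs]
  refine DifferentiableAt.differentiableWithinAt ?_
  simpa only [div_eq_mul_inv] using (h2.fun_inv h3).const_mul _

theorem continuous_kernelFun (μ : ℝ) (z : 𝔹 d) : Continuous (kernelFun d μ z) :=
  (holo_kernelFun μ z).continuous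

theorem lintegral_kernelFun_sq (hμ : -1 < μ) (z : 𝔹 d) :
    ∫⁻ w, ‖kernelFun d μ z w‖ₑ ^ 2 ∂vol d μ = 1 := by
  have := isProbabilityMeasure_vol d hμ
  have h := lintegral_vol_ballMobius μ z (fun _ => 1)
  simpa using h

theorem norm_bergmanKernel (hμ : -1 < μ) (z : 𝔹 d) : ‖bergmanKernel d μ z‖ = 1 := by
  have h := enorm_sq_eq_lintegral (bergmanKernel_ae_eq hμ z)
  rw [lintegral_kernelFun_sq hμ, ← ofReal_norm, ← ENNReal.ofReal_pow (norm_nonneg _),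
    ENNReal.ofReal_eq_one] at h
  exact (pow_eq_one_iff_of_nonneg (norm_nonneg _) two_ne_zero).1 h

theorem map_ballMobius_withDensity (μ : ℝ) (z : 𝔹 d) :
    Measure.map (ballMobius z) ((vol d μ).withDensity fun w => ‖kernelFun d μ z w‖ₑ ^ 2) =
      vol d μ := by
  have hm := (continuous_ballMobius_right z).measurable
  have hk : Measurable fun w => ‖kernelFun d μ z w‖ₑ ^ 2 :=
    (continuous_kernelFun μ z).measurable.enorm.pow_const 2
  ext s hs
  rw [Measure.map_apply hm hs, withDensity_apply _ (hm hs), ← lintegral_indicator (hm hs),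
    ← lintegral_indicator_one hs, ← lintegral_vol_ballMobius μ z (s.indicator 1)]
  refine lintegral_congr fun w => ?_
  by_cases hw : ballMobius z w ∈ s
  · rw [Set.indicator_of_mem hw, Set.indicator_of_mem (by exact hw), Pi.one_apply, one_mul]
  · rw [Set.indicator_of_notMem hw, Set.indicator_of_notMem (by exact hw), zero_mul]

/-- The change of variables `w = φ_z(ξ)` for Bochner integrals. -/
theorem integral_vol_ballMobius (μ : ℝ) (z : 𝔹 d) {G : 𝔹 d → ℂ} (hG : Continuous G) :
    ∫ w, (‖kernelFun d μ z w‖ ^ 2 : ℝ) * G (ballMobius z w) ∂vol d μ = ∫ w, G w ∂vol d μ := by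
  have hk : Measurable fun w => ‖kernelFun d μ z w‖ₑ ^ 2 :=
    (continuous_kernelFun μ z).measurable.enorm.pow_const 2
  conv_rhs => rw [← map_ballMobius_withDensity μ z]
  rw [integral_map (continuous_ballMobius_right z).aemeasurable hG.aestronglyMeasurable,
    integral_withDensity_eq_integral_toReal_smul hk (Eventually.of_forall fun w => by finiteness)]
  refine integral_congr_ae (Eventually.of_forall fun w => ?_)
  simp only [Complex.real_smul, ENNReal.toReal_pow, toReal_enorm]

/-- The mean value property: the average over the rotations `z ↦ e^{iθ} z` is `f 0` by Cauchy's
formula. -/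
theorem integral_holo {f : 𝔹 d → ℂ} (hf : Holo f) (hμ : -1 < μ)
    (hi : Integrable f (vol d μ)) : ∫ z, f z ∂vol d μ = f (origin d) := by
  have := isProbabilityMeasure_vol d hμ
  obtain ⟨g, hg, hfg⟩ := hf
  have hfc : Continuous f := Holo.continuous ⟨g, hg, hfg⟩
  let u : ℝ → Cn d ≃ₗᵢ[ℝ] Cn d := fun θ => diagRotation fun _ => Circle.exp θ
  have hu : ∀ θ (z : Cn d), u θ z = circleMap 0 1 θ • z := by
    intro θ z
    ext i
    simp [u, diagRotation_apply, circleMap, Circle.coe_exp]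
  have hcirc : ∀ z : 𝔹 d, ∫ θ in (0 : ℝ)..2 * Real.pi, f (ballMap (u θ) z) =
      (2 * Real.pi) • f (origin d) := by
    intro z
    have hline : ∀ t ∈ Metric.closedBall (0 : ℂ) 1, t • (z : Cn d) ∈ Metric.ball (0 : Cn d) 1 := by
      intro t ht
      rw [mem_closedBall_zero_iff] at ht
      rw [mem_ball_zero_iff, norm_smul]
      nlinarith [norm_coe_lt_one z, norm_nonneg t, norm_nonneg (z : Cn d)]
    have hdiff : DiffContOnCl ℂ (fun t : ℂ => g (t • (z : Cn d))) (Metric.ball 0 |1|) := by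
      apply DifferentiableOn.diffContOnCl
      have : closure (Metric.ball (0 : ℂ) |1|) ⊆ Metric.closedBall 0 1 := by
        simpa using Metric.closure_ball_subset_closedBall (x := (0 : ℂ)) (ε := 1)
      intro t ht
      have h1 : DifferentiableAt ℂ g (t • (z : Cn d)) :=
        hg.differentiableAt (Metric.isOpen_ball.mem_nhds (hline t (this ht)))
      have h2 : DifferentiableAt ℂ (fun t : ℂ => t • (z : Cn d)) t := by fun_prop
      exact (DifferentiableAt.comp t h1 h2).differentiableWithinAt
    have havg := hdiff.circleAverage
    rw [Real.circleAverage_def] at havg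
    simp only [zero_smul] at havg
    have hpi : (0 : ℝ) < 2 * Real.pi := by positivity
    rw [hfg (origin d), coe_origin, ← havg, smul_smul, mul_inv_cancel₀ hpi.ne', one_smul]
    refine intervalIntegral.integral_congr fun θ _ => ?_
    simp only [hfg, coe_ballMap, hu]
  have hcont : Continuous fun p : 𝔹 d × ℝ => ballMap (u p.2) p.1 := by
    refine Continuous.subtype_mk ?_ _
    simp only [hu]
    have := continuous_circleMap (0 : ℂ) 1
    fun_prop
  have hpi : (0 : ℝ) < 2 * Real.pi := by positivity
  have hint : Integrable (Function.uncurry fun (z : 𝔹 d) (θ : ℝ) => f (ballMap (u θ) z))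
      ((vol d μ).prod (volume.restrict (Set.Ioc 0 (2 * Real.pi)))) := by
    have hm : AEStronglyMeasurable (Function.uncurry fun (z : 𝔹 d) (θ : ℝ) => f (ballMap (u θ) z))
        ((vol d μ).prod (volume.restrict (Set.Ioc 0 (2 * Real.pi)))) :=
      (hfc.comp hcont).aestronglyMeasurable
    rw [integrable_prod_iff' hm]
    refine ⟨Eventually.of_forall fun θ => ?_, ?_⟩
    · exact (measurePreserving_ballMap (u θ) μ).integrable_comp_of_integrable hi
    · have h1 : ∀ θ, ∫ z, ‖f (ballMap (u θ) z)‖ ∂vol d μ = ∫ z, ‖f z‖ ∂vol d μ := fun θ =>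
        (measurePreserving_ballMap (u θ) μ).integral_comp (measurableEmbedding_ballMap _)
          (fun z => ‖f z‖)
      simp only [Function.uncurry_apply_pair, h1]
      exact integrable_const _
  have hswap := integral_integral_swap hint
  have h1 : ∀ θ, ∫ z, f (ballMap (u θ) z) ∂vol d μ = ∫ z, f z ∂vol d μ := fun θ =>
    integral_vol_ballMap (u θ) μ f
  have h2 : ∀ z : 𝔹 d, ∫ θ in Set.Ioc 0 (2 * Real.pi), f (ballMap (u θ) z) =
      (2 * Real.pi) • f (origin d) := fun z => by
    rw [← hcirc z, intervalIntegral.integral_of_le hpi.le]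
  simp only [h1, h2, integral_const, probReal_univ, one_smul] at hswap
  simp only [measureReal_restrict_apply_univ, Real.volume_real_Ioc_of_le hpi.le, sub_zero] at hswap
  exact (smul_right_injective ℂ hpi.ne' hswap).symm

theorem kernelFun_ne_zero (μ : ℝ) (z w : 𝔹 d) : kernelFun d μ z w ≠ 0 := by
  have h := one_sub_inner_ne_zero (norm_coe_lt_one z) (norm_coe_lt_one w)
  have h2 := (Real.rpow_pos_of_pos (one_sub_norm_sq_pos z) ((d + μ + 1) / 2)).ne'
  unfold kernelFun
  refine div_ne_zero (by exact_mod_cast h2) ?_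
  simp [Complex.cpow_eq_zero_iff, h]

theorem Holo.comp_ballMobius {f : 𝔹 d → ℂ} (hf : Holo f) (z : 𝔹 d) :
    Holo fun w => f (ballMobius z w) := by
  obtain ⟨g, hg, hfg⟩ := hf
  refine ⟨fun w => g (mobius (z : Cn d) w), fun w hw => ?_, fun w => hfg _⟩
  rw [mem_ball_zero_iff] at hw
  have h1 := hg.differentiableAt (Metric.isOpen_ball.mem_nhds
    (mem_ball_zero_iff.2 (norm_mobius_lt_one (norm_coe_lt_one z) hw)))
  exact (DifferentiableAt.comp w h1
    (hasFDerivAt_mobius (norm_coe_lt_one z) hw).differentiableAt).differentiableWithinAt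

theorem Holo.div {f g : 𝔹 d → ℂ} (hf : Holo f) (hg : Holo g) (h0 : ∀ z, g z ≠ 0) :
    Holo fun z => f z / g z := by
  obtain ⟨f', hf', hff⟩ := hf
  obtain ⟨g', hg', hgg⟩ := hg
  have h1 : ∀ z ∈ Metric.ball (0 : Cn d) 1, g' z ≠ 0 := fun z hz => by
    rw [← hgg ⟨z, hz⟩]; exact h0 _
  refine ⟨fun z => f' z * (g' z)⁻¹, hf'.mul (hg'.fun_inv h1), fun z => ?_⟩
  simp only [hff, hgg, div_eq_mul_inv]

theorem kernelFun_self (μ : ℝ) (z : 𝔹 d) : kernelFun d μ z z =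
    (((1 - ‖(z : Cn d)‖ ^ 2) ^ ((d + μ + 1) / 2) : ℝ) : ℂ)⁻¹ := by
  have h := one_sub_norm_sq_pos z
  have h1 : (1 : ℂ) - inner ℂ (z : Cn d) (z : Cn d) = ((1 - ‖(z : Cn d)‖ ^ 2 : ℝ) : ℂ) := by
    rw [inner_self_eq_norm_sq_to_K]
    push_cast
    rfl
  rw [kernelFun, h1, ← Complex.ofReal_cpow h.le, ← Complex.ofReal_div, ← Complex.ofReal_inv]
  congr 1
  rw [div_eq_iff (Real.rpow_pos_of_pos h _).ne', ← div_eq_inv_mul,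
    eq_div_iff (Real.rpow_pos_of_pos h _).ne', ← Real.rpow_add h]
  congr 1
  ring

/-- The normalized reproducing kernels represent the point evaluations. -/
theorem inner_bergmanKernel (hμ : -1 < μ) (z : 𝔹 d) {h : Bergman d μ} {f : 𝔹 d → ℂ} (hf : Holo f)
    (hh : inclusion d μ h =ᵐ[vol d μ] f) : inner ℂ (bergmanKernel d μ z) h =
      (((1 - ‖(z : Cn d)‖ ^ 2) ^ ((d + μ + 1) / 2) : ℝ) : ℂ) * f z := by
  have hq : Holo fun w => f w / kernelFun d μ z w :=
    hf.div (holo_kernelFun μ z) (kernelFun_ne_zero μ z)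
  have hG : Holo fun w => f (ballMobius z w) / kernelFun d μ z (ballMobius z w) :=
    hq.comp_ballMobius z
  have e1 : ∀ w, (‖kernelFun d μ z w‖ ^ 2 : ℝ) * (f (ballMobius z (ballMobius z w)) /
      kernelFun d μ z (ballMobius z (ballMobius z w))) =
      starRingEnd ℂ (kernelFun d μ z w) * f w := by
    intro w
    have h1 : ((‖kernelFun d μ z w‖ ^ 2 : ℝ) : ℂ) =
        starRingEnd ℂ (kernelFun d μ z w) * kernelFun d μ z w := by
      rw [Complex.conj_mul']
      push_cast
      rfl
    rw [ballMobius_ballMobius, h1]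
    field_simp [kernelFun_ne_zero μ z w]
  have h2 := integral_vol_ballMobius μ z hG.continuous
  simp only [e1] at h2
  have hi : Integrable (fun w => f (ballMobius z w) / kernelFun d μ z (ballMobius z w))
      (vol d μ) := by
    refine ⟨hG.continuous.aestronglyMeasurable, ?_⟩
    rw [hasFiniteIntegral_iff_enorm, ← lintegral_vol_ballMobius μ z]
    have hint : Integrable (fun w => starRingEnd ℂ (kernelFun d μ z w) * f w) (vol d μ) := by
      have m1 := memLp_of_ae_eq (bergmanKernel_ae_eq hμ z)
      have m2 := memLp_of_ae_eq hh
      exact m1.star.integrable_mul m2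
    have h3 := hint.2
    rw [hasFiniteIntegral_iff_enorm] at h3
    refine lt_of_le_of_lt (le_of_eq ?_) h3
    refine lintegral_congr fun w => ?_
    rw [← e1, enorm_mul, mul_comm]
    congr 1
    rw [← ofReal_norm_sq_eq, ← ofReal_norm, Complex.norm_real,
      Real.norm_of_nonneg (by positivity)]
  rw [inner_eq_integral (bergmanKernel_ae_eq hμ z) hh, h2, integral_holo hG hμ hi,
    ballMobius_origin, kernelFun_self, div_inv_eq_mul, mul_comm]

/-- A function orthogonal to all reproducing kernels vanishes everywhere. -/
theorem eq_zero_of_inner_bergmanKernel (hμ : -1 < μ) {h : Bergman d μ}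
    (h0 : ∀ z, inner ℂ (bergmanKernel d μ z) h = 0) : h = 0 := by
  apply inclusion_injective
  rw [map_zero]
  apply Lp.ext
  filter_upwards [inclusion_ae_eq_holoRep h, Lp.coeFn_zero ℂ 2 (vol d μ)] with z h1 h2
  rw [h1, h2]
  have h3 := h0 z
  rw [inner_bergmanKernel hμ z (holo_holoRep h) (inclusion_ae_eq_holoRep h)] at h3
  have h4 := (Real.rpow_pos_of_pos (one_sub_norm_sq_pos z) ((d + μ + 1) / 2)).ne'
  exact (mul_eq_zero.1 h3).resolve_left (by exact_mod_cast h4)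

end Reproducing

/-! ### The orthonormal basis of monomials -/

section Basis

variable {d : ℕ} {μ : ℝ}

/-- By the multinomial theorem `⟨z, w⟩^n` is a combination of monomials in `w`. -/
theorem integral_inner_pow_mul_eq_zero (hμ : -1 < μ) {h : Bergman d μ}
    (h0 : ∀ α, inner ℂ (normMonomial d μ α) h = 0) (z : 𝔹 d) (n : ℕ) :
    ∫ w : 𝔹 d, starRingEnd ℂ (inner ℂ (z : Cn d) (w : Cn d) ^ n) * holoRep h w ∂vol d μ = 0 := by
  have := isProbabilityMeasure_vol d hμ
  have hm : ∀ α : Fin d → ℕ, MemLp (monomialFun d μ α) 2 (vol d μ) := fun α =>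
    memLp_of_ae_eq (normMonomial_ae_eq hμ α)
  have hc : ∀ α, (monomialConst d μ α : ℂ) ≠ 0 := by
    intro α
    have h1 := monomialConst_sq hμ α
    have h2 := Gamma_add_pos hμ d (Nat.cast_nonneg (∑ i, α i))
    have h3 := Gamma_add_pos hμ d le_rfl
    rw [add_zero] at h3
    have h4 := prod_factorial_pos α
    have h5 : 0 < monomialConst d μ α ^ 2 := by rw [h1]; positivity
    refine Complex.ofReal_ne_zero.2 fun h6 => ?_
    simp [h6] at h5
  have e1 : ∀ w : 𝔹 d, starRingEnd ℂ (inner ℂ (z : Cn d) (w : Cn d) ^ n) * holoRep h w =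
      ∑ α ∈ Finset.univ.piAntidiag n, (starRingEnd ℂ (Nat.multinomial Finset.univ α *
        (∏ i, starRingEnd ℂ ((z : Cn d) i) ^ α i) * (monomialConst d μ α : ℂ)⁻¹)) *
        (starRingEnd ℂ (monomialFun d μ α w) * holoRep h w) := by
    intro w
    have e2 : inner ℂ (z : Cn d) (w : Cn d) =
        ∑ i, starRingEnd ℂ ((z : Cn d) i) * (w : Cn d) i := by
      rw [PiLp.inner_apply]
      simp [mul_comm]
    rw [e2, Finset.sum_pow_eq_sum_piAntidiag, map_sum, Finset.sum_mul]
    refine Finset.sum_congr rfl fun α _ => ?_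
    rw [← mul_assoc, ← map_mul, monomialFun_eq]
    congr 2
    simp only [mul_pow, Finset.prod_mul_distrib]
    field_simp [hc α]
  simp only [e1]
  rw [integral_finsetSum]
  · refine Finset.sum_eq_zero fun α _ => ?_
    rw [integral_const_mul,
      ← inner_eq_integral (normMonomial_ae_eq hμ α) (inclusion_ae_eq_holoRep h), h0, mul_zero]
  · intro α _
    exact ((hm α).star.integrable_mul (memLp_of_ae_eq (inclusion_ae_eq_holoRep h))).const_mul _

/-- An element orthogonal to all monomials is orthogonal to all reproducing kernels, these being
uniform limits of polynomials. -/
theorem eq_zero_of_inner_normMonomial (hμ : -1 < μ) {h : Bergman d μ}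
    (h0 : ∀ α, inner ℂ (normMonomial d μ α) h = 0) : h = 0 := by
  have := isProbabilityMeasure_vol d hμ
  refine eq_zero_of_inner_bergmanKernel hμ fun z => ?_
  have hz := norm_coe_lt_one z
  set A : ℂ := (((1 - ‖(z : Cn d)‖ ^ 2) ^ ((d + μ + 1) / 2) : ℝ) : ℂ) with hA
  let φ : ℂ → ℂ := fun t => A / (1 - t) ^ ((d + μ + 1 : ℝ) : ℂ)
  have hφ : DifferentiableOn ℂ φ (Metric.ball 0 1) := by
    intro t ht
    rw [mem_ball_zero_iff] at ht
    have hs : 1 - t ∈ Complex.slitPlane := by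
      left
      have := Complex.re_le_norm t
      simp only [Complex.sub_re, Complex.one_re]
      linarith
    have h1 : DifferentiableAt ℂ (fun t : ℂ => 1 - t) t := by fun_prop
    have h2 := h1.cpow (differentiableAt_const ((d + μ + 1 : ℝ) : ℂ)) hs
    have h3 : (1 - t) ^ ((d + μ + 1 : ℝ) : ℂ) ≠ 0 := by
      simp [Complex.cpow_eq_zero_iff, Complex.slitPlane_ne_zero hs]
    refine DifferentiableAt.differentiableWithinAt ?_
    simpa only [φ, div_eq_mul_inv] using (h2.fun_inv h3).const_mul _
  obtain ⟨r, hzr, hr1⟩ := exists_between hz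
  obtain ⟨R, hrR, hR1⟩ := exists_between hr1
  have hr0 : 0 ≤ r := (norm_nonneg _).trans hzr.le
  have hR0 : 0 < R := hr0.trans_lt hrR
  lift r to NNReal using hr0
  lift R to NNReal using hR0.le
  have hps := (hφ.mono (Metric.closedBall_subset_ball hR1)).hasFPowerSeriesOnBall
    (by exact_mod_cast hR0)
  set p := cauchyPowerSeries φ 0 R with hp
  have hunif := hps.tendstoUniformlyOn (r' := r) (by exact_mod_cast hrR)
  have hin : ∀ w : 𝔹 d, inner ℂ (z : Cn d) (w : Cn d) ∈ Metric.ball (0 : ℂ) r := by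
    intro w
    rw [mem_ball_zero_iff]
    refine (norm_inner_le_norm _ _).trans_lt (lt_of_le_of_lt ?_ hzr)
    exact mul_le_of_le_one_right (norm_nonneg _) (norm_coe_lt_one w).le
  set I := ∫ w : 𝔹 d, starRingEnd ℂ (kernelFun d μ z w) * holoRep h w ∂vol d μ with hI
  have hinner : inner ℂ (bergmanKernel d μ z) h = I :=
    inner_eq_integral (bergmanKernel_ae_eq hμ z) (inclusion_ae_eq_holoRep h)
  rw [hinner]
  have hh := (memLp_of_ae_eq (inclusion_ae_eq_holoRep h)).integrable one_le_two
  -- integrals of the partial sums vanish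
  have hzero : ∀ N, ∫ w : 𝔹 d, starRingEnd ℂ (p.partialSum N (inner ℂ (z : Cn d) (w : Cn d))) *
      holoRep h w ∂vol d μ = 0 := by
    intro N
    have e1 : ∀ w : 𝔹 d, starRingEnd ℂ (p.partialSum N (inner ℂ (z : Cn d) (w : Cn d))) *
        holoRep h w = ∑ n ∈ Finset.range N, starRingEnd ℂ (p.coeff n) *
          (starRingEnd ℂ (inner ℂ (z : Cn d) (w : Cn d) ^ n) * holoRep h w) := by
      intro w
      rw [FormalMultilinearSeries.partialSum, map_sum, Finset.sum_mul]
      refine Finset.sum_congr rfl fun n _ => ?_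
      rw [FormalMultilinearSeries.apply_eq_pow_smul_coeff, smul_eq_mul, map_mul]
      ring
    simp only [e1]
    rw [integral_finsetSum]
    · refine Finset.sum_eq_zero fun n _ => ?_
      rw [integral_const_mul, integral_inner_pow_mul_eq_zero hμ h0, mul_zero]
    · intro n _
      refine Integrable.const_mul (hh.bdd_mul (c := 1) ?_ (Eventually.of_forall fun w => ?_)) _
      · apply Continuous.aestronglyMeasurable
        exact Complex.continuous_conj.comp (by fun_prop)
      · rw [RCLike.norm_conj, norm_pow]
        have := mem_ball_zero_iff.1 (hin w)
        exact pow_le_one₀ (norm_nonneg _) (this.le.trans hr1.le)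
  have hkey : ∀ ε > 0, ‖I‖ ≤ ε * ∫ w, ‖holoRep h w‖ ∂vol d μ := by
    intro ε hε
    obtain ⟨N, hN⟩ := (Metric.tendstoUniformlyOn_iff.1 hunif ε hε).exists
    have hdiff : ∀ w : 𝔹 d, ‖kernelFun d μ z w -
        p.partialSum N (inner ℂ (z : Cn d) (w : Cn d))‖ ≤ ε := by
      intro w
      have := hN _ (hin w)
      rw [dist_eq_norm, zero_add] at this
      exact this.le
    have hpc : Continuous fun w : 𝔹 d => p.partialSum N (inner ℂ (z : Cn d) (w : Cn d)) :=
      (p.partialSum_continuous N).comp (by fun_prop)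
    have i2 : Integrable (fun w => starRingEnd ℂ (kernelFun d μ z w -
        p.partialSum N (inner ℂ (z : Cn d) (w : Cn d))) * holoRep h w) (vol d μ) := by
      refine hh.bdd_mul (c := ε) ?_ (Eventually.of_forall fun w => ?_)
      · exact (Complex.continuous_conj.comp
          ((continuous_kernelFun μ z).sub hpc)).aestronglyMeasurable
      · rw [RCLike.norm_conj]
        exact hdiff w
    have i1 : Integrable (fun w => starRingEnd ℂ (kernelFun d μ z w) * holoRep h w) (vol d μ) :=
      (memLp_of_ae_eq (bergmanKernel_ae_eq hμ z)).star.integrable_mul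
        (memLp_of_ae_eq (inclusion_ae_eq_holoRep h))
    have e2 : I = ∫ w, starRingEnd ℂ (kernelFun d μ z w -
        p.partialSum N (inner ℂ (z : Cn d) (w : Cn d))) * holoRep h w ∂vol d μ := by
      have : I - ∫ w : 𝔹 d, starRingEnd ℂ (kernelFun d μ z w -
          p.partialSum N (inner ℂ (z : Cn d) (w : Cn d))) * holoRep h w ∂vol d μ = 0 := by
        rw [hI, ← integral_sub i1 i2, ← hzero N]
        refine integral_congr_ae (Eventually.of_forall fun w => ?_)
        simp only [map_sub]
        ring
      exact sub_eq_zero.1 this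
    rw [e2, ← integral_const_mul]
    refine (norm_integral_le_integral_norm _).trans
      (integral_mono i2.norm (hh.norm.const_mul _) fun w => ?_)
    simp only [norm_mul, RCLike.norm_conj]
    exact mul_le_mul_of_nonneg_right (hdiff w) (norm_nonneg _)
  by_contra hne
  have hpos : 0 < ‖I‖ := norm_pos_iff.2 hne
  have hM : 0 ≤ ∫ w, ‖holoRep h w‖ ∂vol d μ := integral_nonneg fun _ => norm_nonneg _
  have := hkey (‖I‖ / (2 * (∫ w, ‖holoRep h w‖ ∂vol d μ + 1))) (by positivity)
  rw [div_mul_eq_mul_div, le_div_iff₀ (by positivity)] at this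
  nlinarith

/-- The orthonormal basis of `A²_μ(𝔹^d)` formed by the normalized monomials. -/
noncomputable def monomialBasis (d : ℕ) (hμ : -1 < μ) :
    HilbertBasis (Fin d → ℕ) ℂ (Bergman d μ) :=
  HilbertBasis.mkOfOrthogonalEqBot (orthonormal_normMonomial hμ) (by
    rw [eq_bot_iff]
    intro h hh
    rw [Submodule.mem_bot]
    refine eq_zero_of_inner_normMonomial hμ fun α => ?_
    exact (Submodule.mem_orthogonal _ h).1 hh _ (Submodule.subset_span ⟨α, rfl⟩))

@[simp] theorem monomialBasis_apply (hμ : -1 < μ) (α : Fin d → ℕ) :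
    monomialBasis d hμ α = normMonomial d μ α := by
  rw [monomialBasis, HilbertBasis.coe_mkOfOrthogonalEqBot]

theorem continuousLinearMap_ext_normMonomial {E : Type*} [NormedAddCommGroup E] [NormedSpace ℂ E]
    (hμ : -1 < μ) {A B : Bergman d μ →L[ℂ] E}
    (h : ∀ α, A (normMonomial d μ α) = B (normMonomial d μ α)) : A = B := by
  refine ContinuousLinearMap.ext_on (s := Set.range (normMonomial d μ)) ?_ ?_
  · have := (monomialBasis d hμ).dense_span
    rw [show ((monomialBasis d hμ : (Fin d → ℕ) → Bergman d μ)) = normMonomial d μ from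
      funext (monomialBasis_apply hμ)] at this
    exact Submodule.dense_iff_topologicalClosure_eq_top.2 this
  · rintro _ ⟨α, rfl⟩
    exact h α

end Basis

end WeightedBergman

namespace WeightedBergman

/-! ### The isometries of the fibres into the large Bergman space -/

section Fibers

variable {ℓ d : ℕ} {lam : ℝ}

theorem neg_one_lt_fiber (hlam : -1 < lam) (ℓ p : ℕ) : -1 < lam + p + ℓ := by
  have := Nat.cast_nonneg (α := ℝ) ℓ
  have := Nat.cast_nonneg (α := ℝ) p
  linarith

theorem append_injective (α : Fin ℓ → ℕ) :
    Function.Injective fun α'' : Fin d → ℕ => Fin.append α α'' := by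
  intro x y h
  funext i
  have := congrFun h (Fin.natAdd ℓ i)
  simpa using this

theorem append_castAdd_natAdd (γ : Fin (ℓ + d) → ℕ) :
    γ = Fin.append (fun i => γ (Fin.castAdd d i)) (fun i => γ (Fin.natAdd ℓ i)) :=
  Fin.append_castAdd_natAdd.symm

/-- The isometry `W_α` of `A²_{λ+p+ℓ}(𝔹^d)` into `A²_λ(𝔹^{ℓ+d})` with `W_α e_{α''} = e_{(α,α'')}`.
For `p = |α|` it is multiplication by a multiple of `z'^α`. -/
noncomputable def fiberMap (d : ℕ) (hlam : -1 < lam) (α : Fin ℓ → ℕ) (p : ℕ) :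
    Fiber ℓ d lam p →L[ℂ] Bergman (ℓ + d) lam :=
  ((((orthonormal_normMonomial hlam).comp _
    (append_injective α)).orthogonalFamily.linearIsometry).comp
      (monomialBasis d (neg_one_lt_fiber hlam ℓ p)).repr.toLinearIsometry).toContinuousLinearMap

theorem fiberMap_normMonomial (hlam : -1 < lam) (α : Fin ℓ → ℕ) (p : ℕ) (α'' : Fin d → ℕ) :
    fiberMap d hlam α p (normMonomial d (lam + p + ℓ) α'') =
      normMonomial (ℓ + d) lam (Fin.append α α'') := by
  have h1 : (monomialBasis d (neg_one_lt_fiber hlam ℓ p)).repr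
      (normMonomial d (lam + p + ℓ) α'') = lp.single 2 α'' 1 := by
    rw [← monomialBasis_apply (neg_one_lt_fiber hlam ℓ p), HilbertBasis.repr_self]
  rw [fiberMap, LinearIsometry.coe_toContinuousLinearMap, LinearIsometry.coe_comp,
    Function.comp_apply, LinearIsometryEquiv.coe_toLinearIsometry, h1,
    OrthogonalFamily.linearIsometry_apply_single]
  simp

theorem inner_fiberMap_fiberMap (hlam : -1 < lam) (α : Fin ℓ → ℕ) (p : ℕ)
    (x y : Fiber ℓ d lam p) :
    inner ℂ (fiberMap d hlam α p x) (fiberMap d hlam α p y) = inner ℂ x y :=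
  LinearIsometry.inner_map_map _ x y

theorem norm_fiberMap (hlam : -1 < lam) (α : Fin ℓ → ℕ) (p : ℕ) (x : Fiber ℓ d lam p) :
    ‖fiberMap d hlam α p x‖ = ‖x‖ :=
  LinearIsometry.norm_map _ x

theorem inner_normMonomial_fiberMap_of_ne (hlam : -1 < lam) {α β : Fin ℓ → ℕ} (h : β ≠ α) (p : ℕ)
    (β'' : Fin d → ℕ) (x : Fiber ℓ d lam p) :
    inner ℂ (normMonomial (ℓ + d) lam (Fin.append β β'')) (fiberMap d hlam α p x) = 0 := by
  have h1 : innerSL ℂ (normMonomial (ℓ + d) lam (Fin.append β β'')) ∘L fiberMap d hlam α p = 0 := by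
    refine continuousLinearMap_ext_normMonomial (neg_one_lt_fiber hlam ℓ p) fun α'' => ?_
    rw [ContinuousLinearMap.comp_apply, fiberMap_normMonomial, innerSL_apply_apply]
    refine (orthonormal_normMonomial hlam).2 fun h2 => h ?_
    funext i
    have := congrFun h2 (Fin.castAdd d i)
    simpa using this
  exact DFunLike.congr_fun h1 x

/-- The pushforward of `|e_{(α,0)}|² v_λ` under `z ↦ z''` is `v_{λ+|α|+ℓ}`. -/
theorem lintegral_monomialFun_lastCoords (hlam : -1 < lam) (α : Fin ℓ → ℕ) {G : 𝔹 d → ℝ≥0∞}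
    (hG : Measurable G) :
    ∫⁻ z, ‖monomialFun (ℓ + d) lam (Fin.append α 0) z‖ₑ ^ 2 * G (lastCoords ℓ d z)
        ∂vol (ℓ + d) lam =
      ∫⁻ w, G w ∂vol d (lam + (∑ i, α i : ℕ) + ℓ) := by
  have hc := volConst_pos (ℓ + d) hlam
  have hp := neg_one_lt_fiber hlam ℓ (∑ i, α i)
  have hc' := volConst_pos d hp
  let g : Cn d → ℝ≥0∞ := Function.extend Subtype.val G 0
  have hgm : Measurable g :=
    (MeasurableEmbedding.subtype_coe measurableSet_ball).measurable_extend hG measurable_const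
  have hg : ∀ w : 𝔹 d, G w = g w := fun w => (Subtype.val_injective.extend_apply G 0 w).symm
  set A := monomialConst (ℓ + d) lam (Fin.append α 0)
  let F : Cn (ℓ + d) → ℝ≥0∞ := fun z => ENNReal.ofReal (A ^ 2 *
    ∏ i, ‖z (Fin.castAdd d i)‖ ^ (2 * α i)) * g (WithLp.toLp 2 fun i => z (Fin.natAdd ℓ i))
  have hF : Measurable F := by fun_prop
  have e1 : ∀ z : 𝔹 (ℓ + d), ‖monomialFun (ℓ + d) lam (Fin.append α 0) z‖ₑ ^ 2 *
      G (lastCoords ℓ d z) = F z := by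
    intro z
    rw [enorm_monomialFun_sq, hg, Fin.prod_univ_add]
    simp only [Fin.append_left, Fin.append_right, Pi.zero_apply, mul_zero, pow_zero,
      Finset.prod_const_one, mul_one]
    rfl
  rw [lintegral_congr e1, lintegral_vol (hF.comp measurable_subtype_coe), lintegral_congr hg,
    lintegral_vol (f := g) (hgm.comp measurable_subtype_coe)]
  have e2 : ∀ z ∈ Metric.ball (0 : Cn (ℓ + d)) 1, ENNReal.ofReal (weight (ℓ + d) lam z) *
      F z = ENNReal.ofReal (volConst (ℓ + d) lam * A ^ 2) *
        (g (WithLp.toLp 2 fun i => z (Fin.natAdd ℓ i)) *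
          ENNReal.ofReal ((∏ i, ‖z (Fin.castAdd d i)‖ ^ (2 * α i)) * (1 - ‖z‖ ^ 2) ^ lam)) := by
    intro z hz
    have h2 : 0 < 1 - ‖z‖ ^ 2 := by
      rw [mem_ball_zero_iff] at hz
      nlinarith [norm_nonneg z]
    have h3 := Real.rpow_nonneg h2.le lam
    simp only [F]
    rw [weight_eq, ← mul_assoc, ← ENNReal.ofReal_mul (by positivity), mul_comm (g _),
      ← mul_assoc (ENNReal.ofReal _),
      ← ENNReal.ofReal_mul (by positivity)]
    congr 2
    ring
  rw [setLIntegral_congr_fun measurableSet_ball e2, lintegral_const_mul' _ _ ENNReal.ofReal_ne_top,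
    lintegral_ball_fibration ℓ d α lam hgm, ← mul_assoc, monomialIntegral_eq ℓ α hlam,
    ← ENNReal.ofReal_mul (by positivity), ← lintegral_const_mul' _ _ ENNReal.ofReal_ne_top]
  refine setLIntegral_congr_fun measurableSet_ball fun w hw => ?_
  have h2 : 0 < 1 - ‖w‖ ^ 2 := by
    rw [mem_ball_zero_iff] at hw
    nlinarith [norm_nonneg w]
  have h3 := Real.rpow_nonneg h2.le (lam + (∑ i, α i : ℕ) + ℓ)
  have hconst : volConst (ℓ + d) lam * A ^ 2 * (Real.pi ^ ℓ * (∏ i, (α i).factorial : ℕ) *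
      Real.Gamma (lam + 1) / Real.Gamma (ℓ + (∑ i, α i : ℕ) + lam + 1)) =
      volConst d (lam + (∑ i, α i : ℕ) + ℓ) := by
    have s1 : ∑ i, Fin.append α (0 : Fin d → ℕ) i = ∑ i, α i := by
      simp [Fin.sum_univ_add]
    have s2 : ∏ i, (Fin.append α (0 : Fin d → ℕ) i).factorial = ∏ i, (α i).factorial := by
      simp [Fin.prod_univ_add]
    have g1 := (Gamma_add_pos hlam (ℓ + d) le_rfl).ne'
    rw [add_zero] at g1
    have g2 := (Gamma_add_pos hlam ℓ (Nat.cast_nonneg (∑ i, α i))).ne'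
    have g3 := (prod_factorial_pos α).ne'
    have g4 : Real.Gamma (lam + 1) ≠ 0 := (Real.Gamma_pos_of_pos (by linarith)).ne'
    rw [monomialConst_sq hlam, s1, s2, volConst, volConst,
      show (d : ℝ) + (lam + (∑ i, α i : ℕ) + ℓ) + 1 =
        ((ℓ + d : ℕ) : ℝ) + (∑ i, α i : ℕ) + lam + 1 by push_cast; ring,
      show lam + ((∑ i, α i : ℕ) : ℝ) + ℓ + 1 = ℓ + (∑ i, α i : ℕ) + lam + 1 by ring]
    generalize ((∑ i, α i : ℕ) : ℝ) = s at *
    generalize ((∏ i, (α i).factorial : ℕ) : ℝ) = t at *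
    generalize Real.Gamma (((ℓ + d : ℕ) : ℝ) + s + lam + 1) = u
    generalize Real.Gamma (((ℓ + d : ℕ) : ℝ) + lam + 1) = v at *
    field_simp
    ring
  change ENNReal.ofReal (volConst (ℓ + d) lam * A ^ 2 * (Real.pi ^ ℓ * (∏ i, (α i).factorial : ℕ) *
      Real.Gamma (lam + 1) / Real.Gamma (ℓ + (∑ i, α i : ℕ) + lam + 1))) * _ = _
  rw [hconst, weight_eq, ENNReal.ofReal_mul hc'.le]
  ring

/-- The version of `lintegral_monomialFun_lastCoords` for Bochner integrals. -/
theorem integral_monomialFun_lastCoords (hlam : -1 < lam) (α : Fin ℓ → ℕ) {G : 𝔹 d → ℂ}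
    (hG : Continuous G) :
    ∫ z, (‖monomialFun (ℓ + d) lam (Fin.append α 0) z‖ ^ 2 : ℝ) * G (lastCoords ℓ d z)
      ∂vol (ℓ + d) lam = ∫ w, G w ∂vol d (lam + (∑ i, α i : ℕ) + ℓ) := by
  have hk : Measurable fun z => ‖monomialFun (ℓ + d) lam (Fin.append α 0) z‖ₑ ^ 2 :=
    (continuous_monomialFun lam _).measurable.enorm.pow_const 2
  have hm := (lastCoords ℓ d).continuous.measurable
  have hmap : Measure.map (lastCoords ℓ d) ((vol (ℓ + d) lam).withDensity
      fun z => ‖monomialFun (ℓ + d) lam (Fin.append α 0) z‖ₑ ^ 2) =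
      vol d (lam + (∑ i, α i : ℕ) + ℓ) := by
    ext s hs
    rw [Measure.map_apply hm hs, withDensity_apply _ (hm hs), ← lintegral_indicator (hm hs),
      ← lintegral_indicator_one hs,
      ← lintegral_monomialFun_lastCoords hlam α (measurable_one.indicator hs)]
    refine lintegral_congr fun w => ?_
    by_cases hw : lastCoords ℓ d w ∈ s
    · rw [Set.indicator_of_mem hw, Set.indicator_of_mem (by exact hw), Pi.one_apply, mul_one]
    · rw [Set.indicator_of_notMem hw, Set.indicator_of_notMem (by exact hw), mul_zero]
  rw [← hmap, integral_map hm.aemeasurable hG.aestronglyMeasurable,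
    integral_withDensity_eq_integral_toReal_smul hk (Eventually.of_forall fun w => by finiteness)]
  refine integral_congr_ae (Eventually.of_forall fun w => ?_)
  simp only [Complex.real_smul, ENNReal.toReal_pow, toReal_enorm]

theorem monomialConst_nonneg (μ : ℝ) (α : Fin d → ℕ) : 0 ≤ monomialConst d μ α :=
  Real.sqrt_nonneg _

theorem monomialFun_append (hlam : -1 < lam) (α : Fin ℓ → ℕ) (α'' : Fin d → ℕ) (z : 𝔹 (ℓ + d)) :
    monomialFun (ℓ + d) lam (Fin.append α α'') z =
      monomialFun (ℓ + d) lam (Fin.append α 0) z *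
        monomialFun d (lam + (∑ i, α i : ℕ) + ℓ) α'' (lastCoords ℓ d z) := by
  have hp := neg_one_lt_fiber hlam ℓ (∑ i, α i)
  have hconst : monomialConst (ℓ + d) lam (Fin.append α α'') =
      monomialConst (ℓ + d) lam (Fin.append α 0) *
        monomialConst d (lam + (∑ i, α i : ℕ) + ℓ) α'' := by
    rw [← sq_eq_sq₀ (monomialConst_nonneg _ _)
      (mul_nonneg (monomialConst_nonneg _ _) (monomialConst_nonneg _ _)), mul_pow,
      monomialConst_sq hlam, monomialConst_sq hlam, monomialConst_sq hp]
    have g1 := (Gamma_add_pos hlam (ℓ + d) le_rfl).ne'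
    rw [add_zero] at g1
    have g2 := (Gamma_add_pos hlam (ℓ + d) (Nat.cast_nonneg (∑ i, α i))).ne'
    have g3 := (prod_factorial_pos α).ne'
    have g4 := (prod_factorial_pos α'').ne'
    simp only [Fin.sum_univ_add, Fin.prod_univ_add, Fin.append_left, Fin.append_right,
      Pi.zero_apply, Finset.sum_const_zero, add_zero, Nat.factorial_zero, Finset.prod_const_one,
      mul_one]
    rw [show (d : ℝ) + (lam + (∑ i, α i : ℕ) + ℓ) + 1 =
        ((ℓ + d : ℕ) : ℝ) + (∑ i, α i : ℕ) + lam + 1 by push_cast; ring,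
      show (d : ℝ) + (∑ i, α'' i : ℕ) + (lam + (∑ i, α i : ℕ) + ℓ) + 1 =
        ((ℓ + d : ℕ) : ℝ) + ((∑ i, α i + ∑ i, α'' i : ℕ) : ℝ) + lam + 1 by push_cast; ring,
      Nat.cast_mul]
    generalize ((∑ i, α i + ∑ i, α'' i : ℕ) : ℝ) = r
    generalize ((∑ i, α i : ℕ) : ℝ) = s at *
    generalize ((∏ i, (α i).factorial : ℕ) : ℝ) = t at *
    generalize ((∏ i, (α'' i).factorial : ℕ) : ℝ) = t' at *
    generalize Real.Gamma (((ℓ + d : ℕ) : ℝ) + s + lam + 1) = u at *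
    generalize Real.Gamma (((ℓ + d : ℕ) : ℝ) + lam + 1) = v at *
    field_simp
  rw [monomialFun_eq, monomialFun_eq, monomialFun_eq, hconst, Fin.prod_univ_add, Fin.prod_univ_add]
  simp only [Fin.append_left, Fin.append_right, Pi.zero_apply, pow_zero, Finset.prod_const_one,
    mul_one]
  push_cast
  have : ∀ i, (lastCoords ℓ d z : Cn d) i = (z : Cn (ℓ + d)) (Fin.natAdd ℓ i) := fun i => rfl
  simp only [this]
  ring

/-- A Toeplitz operator whose symbol depends on `z''` only acts on the range of `W_α` as the
Toeplitz operator with the same symbol and the weight `λ + |α| + ℓ`. -/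
theorem toeplitz_lastCoords_fiberMap (hlam : -1 < lam) (c : 𝔹 d →ᵇ ℂ) (α : Fin ℓ → ℕ) :
    toeplitz (ℓ + d) lam (symbol lam (c.compContinuous (lastCoords ℓ d))) ∘L
        fiberMap d hlam α (∑ i, α i) =
      fiberMap d hlam α (∑ i, α i) ∘L toeplitz d (lam + (∑ i, α i : ℕ) + ℓ) (symbol _ c) := by
  have hp := neg_one_lt_fiber hlam ℓ (∑ i, α i)
  refine continuousLinearMap_ext_normMonomial hp fun α'' => ?_
  rw [← sub_eq_zero]
  refine eq_zero_of_inner_normMonomial hlam fun γ => ?_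
  obtain ⟨β, β'', rfl⟩ : ∃ β β'', γ = Fin.append β β'' := ⟨_, _, append_castAdd_natAdd γ⟩
  rw [inner_sub_right, ContinuousLinearMap.comp_apply, ContinuousLinearMap.comp_apply,
    fiberMap_normMonomial, sub_eq_zero,
    inner_toeplitz _ (normMonomial_ae_eq hlam _) (normMonomial_ae_eq hlam _)]
  by_cases h : β = α
  · subst h
    rw [← fiberMap_normMonomial hlam β (∑ i, β i) β'', inner_fiberMap_fiberMap,
      inner_toeplitz c (normMonomial_ae_eq hp _) (normMonomial_ae_eq hp _),
      ← integral_monomialFun_lastCoords hlam β]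
    · refine integral_congr_ae (Eventually.of_forall fun z => ?_)
      simp only [BoundedContinuousFunction.compContinuous_apply]
      rw [monomialFun_append hlam β β'', monomialFun_append hlam β α'', map_mul]
      have h1 : ((‖monomialFun (ℓ + d) lam (Fin.append β 0) z‖ ^ 2 : ℝ) : ℂ) =
          starRingEnd ℂ (monomialFun (ℓ + d) lam (Fin.append β 0) z) *
            monomialFun (ℓ + d) lam (Fin.append β 0) z := by
        rw [Complex.conj_mul']
        push_cast
        rfl
      rw [h1]
      ring
    · have := continuous_monomialFun (d := d) (lam + (∑ i, β i : ℕ) + ℓ) β''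
      have := continuous_monomialFun (d := d) (lam + (∑ i, β i : ℕ) + ℓ) α''
      exact c.continuous.mul ((Complex.continuous_conj.comp ‹_›).mul ‹_›)
  · rw [inner_normMonomial_fiberMap_of_ne hlam h]
    obtain ⟨i, hi⟩ := Function.ne_iff.1 h
    refine integral_monomialFun_eq_zero (i := Fin.castAdd d i) (by simpa using hi)
      (c := c.compContinuous (lastCoords ℓ d)) fun t z => ?_
    rw [BoundedContinuousFunction.compContinuous_apply,
      BoundedContinuousFunction.compContinuous_apply]
    congr 1
    refine Subtype.ext ?_
    ext j
    change (diagRotation _ (z : Cn (ℓ + d))) (Fin.natAdd ℓ j) = (z : Cn (ℓ + d)) (Fin.natAdd ℓ j)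
    rw [diagRotation_apply, Function.update_of_ne]
    · simp
    · intro h2
      have := congrArg Fin.val h2
      simp only [Fin.val_natAdd, Fin.val_castAdd] at this
      omega

end Fibers

end WeightedBergman

namespace WeightedBergman

/-! ### Degrees of groups of coordinates -/

section GroupDegree

variable {ℓ m : ℕ}

theorem sum_groupDegree {k : Fin m → ℕ} (hk : ∑ j, k j = ℓ) (α : Fin ℓ → ℕ) :
    ∑ j, groupDegree k α j = ∑ i, α i := by
  classical
  let K : ℕ → ℕ := fun n => if h : n < m then k ⟨n, h⟩ else 0
  let P : ℕ → ℕ := fun n => ∑ a ∈ Finset.range n, K a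
  have hK : ∀ a : Fin m, K a = k a := fun a => by simp [K]
  have h1 : ∀ j : Fin m, ∑ a with a < j, k a = P j := by
    intro j
    refine Finset.sum_bij (fun a _ => (a : ℕ)) ?_ ?_ ?_ fun a _ => (hK a).symm
    · intro a ha
      simpa using ha
    · intro a _ b _ h
      exact Fin.ext h
    · intro n hn
      have hn' := Finset.mem_range.1 hn
      exact ⟨⟨n, hn'.trans j.2⟩, Finset.mem_filter.2 ⟨Finset.mem_univ _, hn'⟩, rfl⟩
  have h2 : ∀ j : Fin m, ∑ a with a ≤ j, k a = P (j + 1) := by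
    intro j
    refine Finset.sum_bij (fun a _ => (a : ℕ)) ?_ ?_ ?_ fun a _ => (hK a).symm
    · intro a ha
      have : a ≤ j := by simpa using ha
      exact Finset.mem_range.2 (Nat.lt_succ_of_le this)
    · intro a _ b _ h
      exact Fin.ext h
    · intro n hn
      have hn' := Nat.lt_succ_iff.1 (Finset.mem_range.1 hn)
      exact ⟨⟨n, hn'.trans_lt j.2⟩, Finset.mem_filter.2 ⟨Finset.mem_univ _, hn'⟩, rfl⟩
  have h3 : P m = ℓ := by
    rw [← hk]
    simp only [P]
    rw [Finset.sum_range]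
    exact Finset.sum_congr rfl fun a _ => hK a
  have h4 : ∀ i : Fin ℓ, ∑ j : Fin m, (if P j ≤ i.val ∧ i.val < P (j + 1) then 1 else 0) = 1 := by
    intro i
    have hmono : Monotone P := monotone_nat_of_le_succ fun n => by
      simp only [P, Finset.sum_range_succ]
      omega
    have h5 : ∀ n : ℕ, ((if P n ≤ i.val ∧ i.val < P (n + 1) then 1 else 0 : ℕ) : ℤ) =
        (if i.val < P (n + 1) then 1 else 0) - (if i.val < P n then 1 else 0) := by
      intro n
      have := hmono (Nat.le_add_right n 1)
      split_ifs <;> first | rfl | omega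
    rw [← Nat.cast_inj (R := ℤ), Nat.cast_sum, Nat.cast_one,
      Finset.sum_congr rfl fun (j : Fin m) _ => h5 j,
      ← Finset.sum_range (fun n => (if i.val < P (n + 1) then (1 : ℤ) else 0) -
        (if i.val < P n then 1 else 0)),
      Finset.sum_range_sub (fun n => if i.val < P n then (1 : ℤ) else 0), h3]
    simp [P]
  unfold groupDegree
  simp only [h1, h2, Finset.sum_filter]
  rw [Finset.sum_comm]
  refine Finset.sum_congr rfl fun i _ => ?_
  have h7 := h4 i
  calc ∑ j : Fin m, (if P j ≤ i.val ∧ i.val < P (j + 1) then α i else 0)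
      = ∑ j : Fin m, α i * (if P j ≤ i.val ∧ i.val < P (j + 1) then 1 else 0) := by
        refine Finset.sum_congr rfl fun j _ => ?_
        split_ifs <;> simp
    _ = α i := by rw [← Finset.mul_sum, h7, mul_one]

theorem finite_groupDegree_eq {k : Fin m → ℕ} (hk : ∑ j, k j = ℓ) (ρ : Fin m → ℕ) :
    {α : Fin ℓ → ℕ | groupDegree k α = ρ}.Finite := by
  refine (Set.finite_Iic (fun _ : Fin ℓ => ∑ j, ρ j)).subset fun α hα i => ?_
  have hα : groupDegree k α = ρ := hα
  rw [← hα, sum_groupDegree hk]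
  exact Finset.single_le_sum (f := α) (fun _ _ => Nat.zero_le _) (Finset.mem_univ i)

theorem exists_sum_groupDegree_eq (hℓ : 1 ≤ ℓ) {k : Fin m → ℕ} (hk : ∑ j, k j = ℓ) (p : ℕ) :
    ∃ α : Fin ℓ → ℕ, ∑ j, groupDegree k α j = p := by
  refine ⟨Pi.single ⟨0, hℓ⟩ p, ?_⟩
  rw [sum_groupDegree hk]
  simp

end GroupDegree

/-! ### The unitary operator onto the direct sum -/

section Tensor

theorem lp_single_smul {ι : Type*} [DecidableEq ι] {E : ι → Type*} [∀ i, NormedAddCommGroup (E i)]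
    [∀ i, InnerProductSpace ℂ (E i)] (i : ι) (c : ℂ) (x : E i) :
    lp.single 2 i (c • x) = c • lp.single 2 i x :=
  lp.single_smul 2 i c x

/-- No completion of the tensor product is needed when one factor is finite-dimensional. -/
theorem completeSpace_tensorProduct (E F : Type*) [NormedAddCommGroup E] [InnerProductSpace ℂ E]
    [FiniteDimensional ℂ E] [NormedAddCommGroup F] [InnerProductSpace ℂ F] [CompleteSpace F] :
    CompleteSpace (E ⊗[ℂ] F) := by
  let b := stdOrthonormalBasis ℂ E
  let Ψ : PiLp 2 (fun _ : Fin (Module.finrank ℂ E) => F) →ₗ[ℂ] E ⊗[ℂ] F :=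
    { toFun := fun h => ∑ i, b i ⊗ₜ[ℂ] h i
      map_add' := fun x y => by simp [TensorProduct.tmul_add, Finset.sum_add_distrib]
      map_smul' := fun c x => by simp [TensorProduct.tmul_smul, Finset.smul_sum] }
  have hΨ : ∀ x y, inner ℂ (Ψ x) (Ψ y) = inner ℂ x y := by
    intro x y
    change inner ℂ (∑ i, b i ⊗ₜ[ℂ] x i) (∑ i, b i ⊗ₜ[ℂ] y i) = _
    rw [sum_inner, PiLp.inner_apply]
    refine Finset.sum_congr rfl fun i _ => ?_
    rw [inner_sum, Finset.sum_eq_single i]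
    · rw [TensorProduct.inner_tmul, orthonormal_iff_ite.1 b.orthonormal i i, if_pos rfl, one_mul]
    · intro j _ hj
      rw [TensorProduct.inner_tmul, b.orthonormal.2 hj.symm, zero_mul]
    · simp
  have hsurj : Function.Surjective Ψ := by
    intro t
    induction t using TensorProduct.induction_on with
    | zero => exact ⟨0, map_zero _⟩
    | add x y hx hy =>
      obtain ⟨x', rfl⟩ := hx
      obtain ⟨y', rfl⟩ := hy
      exact ⟨x' + y', map_add _ _ _⟩
    | tmul a h =>
      refine ⟨WithLp.toLp 2 fun i => inner ℂ (b i) a • h, ?_⟩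
      change ∑ i, b i ⊗ₜ[ℂ] (inner ℂ (b i) a • h) = _
      conv_rhs => rw [← b.sum_repr' a, TensorProduct.sum_tmul]
      exact Finset.sum_congr rfl fun i _ => by
        rw [TensorProduct.tmul_smul, TensorProduct.smul_tmul']
  exact ((Ψ.isometryOfInner hΨ).isometry.isUniformInducing.completeSpace_congr hsurj).1
    inferInstance

theorem inner_tmul_lTensor {E F : Type*} [NormedAddCommGroup E] [InnerProductSpace ℂ E]
    [NormedAddCommGroup F] [InnerProductSpace ℂ F] [CompleteSpace F] (A : F →L[ℂ] F) (a : E) (h : F)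
    (t : E ⊗[ℂ] F) :
    inner ℂ (a ⊗ₜ[ℂ] h) (LinearMap.lTensor E A.toLinearMap t) =
      inner ℂ (a ⊗ₜ[ℂ] (star A) h) t := by
  induction t using TensorProduct.induction_on with
  | zero => simp
  | add x y hx hy => rw [map_add, inner_add_right, inner_add_right, hx, hy]
  | tmul b g =>
    rw [LinearMap.lTensor_tmul, TensorProduct.inner_tmul, TensorProduct.inner_tmul,
      ContinuousLinearMap.star_eq_adjoint, ContinuousLinearMap.adjoint_inner_left]
    rfl

end Tensor

section Splitting

variable {ℓ d m : ℕ} {lam : ℝ} {k : Fin m → ℕ}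

/-- The monomial `e_α` as an element of the level space containing it. -/
noncomputable def levelVec (lam : ℝ) (α : Fin ℓ → ℕ) {ρ : Fin m → ℕ}
    (h : groupDegree k α = ρ) : levelSpace ℓ lam k ρ :=
  ⟨normMonomial ℓ lam α, Submodule.subset_span ⟨α, h, rfl⟩⟩

theorem inner_levelVec (hlam : -1 < lam) {α β : Fin ℓ → ℕ} {ρ : Fin m → ℕ}
    (hα : groupDegree k α = ρ) (hβ : groupDegree k β = ρ) :
    inner ℂ (levelVec lam α hα) (levelVec lam β hβ) = if α = β then 1 else 0 := by
  rw [Submodule.coe_inner]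
  exact orthonormal_iff_ite.1 (orthonormal_normMonomial hlam) α β

theorem finiteDimensional_levelSpace (hk : ∑ j, k j = ℓ) (ρ : Fin m → ℕ) :
    FiniteDimensional ℂ (levelSpace ℓ lam k ρ) := by
  refine FiniteDimensional.span_of_finite ℂ ?_
  refine ((finite_groupDegree_eq hk ρ).image (normMonomial ℓ lam)).subset ?_
  rintro f ⟨α, hα, rfl⟩
  exact ⟨α, hα, rfl⟩

/-- An element of a summand is determined by its inner products with the tensors `e_α ⊗ h`. -/
theorem summand_ext {ρ : Fin m → ℕ} {x y : Summand ℓ d lam k ρ}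
    (h : ∀ α (hα : groupDegree k α = ρ) (g : Fiber ℓ d lam (∑ j, ρ j)),
      inner ℂ (levelVec lam α hα ⊗ₜ[ℂ] g) x = inner ℂ (levelVec lam α hα ⊗ₜ[ℂ] g) y) : x = y := by
  rw [TensorProduct.ext_iff_inner_left]
  rintro ⟨a, ha⟩ g
  unfold levelSpace at ha
  induction ha using Submodule.span_induction with
  | mem f hf =>
    obtain ⟨α, hα, rfl⟩ := hf
    exact h α hα g
  | zero =>
    have : (⟨0, Submodule.zero_mem _⟩ : levelSpace ℓ lam k ρ) = 0 := rfl
    rw [this, TensorProduct.zero_tmul, inner_zero_left, inner_zero_left]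
  | add u v hu hv h1 h2 =>
    have : (⟨u + v, Submodule.add_mem _ hu hv⟩ : levelSpace ℓ lam k ρ) = ⟨u, hu⟩ + ⟨v, hv⟩ := rfl
    rw [this, TensorProduct.add_tmul, inner_add_left, inner_add_left]
    exact congrArg₂ _ h1 h2
  | smul c u hu h1 =>
    have : (⟨c • u, Submodule.smul_mem _ c hu⟩ : levelSpace ℓ lam k ρ) = c • ⟨u, hu⟩ := rfl
    rw [this, ← TensorProduct.smul_tmul', inner_smul_left, inner_smul_left]
    exact congrArg _ h1

/-- The vector `e_α ⊗ e_{α''}` of the summand with index `ρ`. -/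
noncomputable def splitVec (d : ℕ) (lam : ℝ) {α : Fin ℓ → ℕ} (α'' : Fin d → ℕ) {ρ : Fin m → ℕ}
    (h : groupDegree k α = ρ) : DirectSumSpace ℓ d lam k :=
  lp.single 2 ρ (levelVec lam α h ⊗ₜ[ℂ] (normMonomial d (lam + ((∑ j, ρ j : ℕ) : ℝ) + ℓ) α'' :
    Fiber ℓ d lam (∑ j, ρ j)))

theorem inner_splitVec {α : Fin ℓ → ℕ} (α'' : Fin d → ℕ) {ρ : Fin m → ℕ}
    (h : groupDegree k α = ρ) (x : DirectSumSpace ℓ d lam k) :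
    inner ℂ (splitVec d lam α'' h) x =
      inner ℂ (levelVec lam α h ⊗ₜ[ℂ] (normMonomial d (lam + ((∑ j, ρ j : ℕ) : ℝ) + ℓ) α'' :
        Fiber ℓ d lam (∑ j, ρ j))) (x ρ) :=
  lp.inner_single_left _ _ _

theorem orthonormal_splitVec (hlam : -1 < lam) : Orthonormal ℂ fun γ : Fin (ℓ + d) → ℕ =>
    splitVec (k := k) d lam (α := fun i => γ (Fin.castAdd d i))
      (fun i => γ (Fin.natAdd ℓ i)) rfl := by
  rw [orthonormal_iff_ite]
  intro γ δ
  have key : ∀ {α β : Fin ℓ → ℕ} (α'' β'' : Fin d → ℕ) {ρ σ : Fin m → ℕ}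
      (hα : groupDegree k α = ρ) (hβ : groupDegree k β = σ),
      inner ℂ (splitVec d lam α'' hα) (splitVec d lam β'' hβ) =
        if α = β ∧ α'' = β'' then 1 else 0 := by
    intro α β α'' β'' ρ σ hα hβ
    rw [inner_splitVec, splitVec]
    by_cases hρ : ρ = σ
    · subst hρ
      rw [lp.single_apply_self, TensorProduct.inner_tmul, inner_levelVec hlam,
        orthonormal_iff_ite.1 (orthonormal_normMonomial (neg_one_lt_fiber hlam ℓ _))]
      split_ifs <;> simp_all
    · rw [lp.single_apply_ne _ _ _ hρ, if_neg]
      · exact inner_zero_right (𝕜 := ℂ) (E := Summand ℓ d lam k ρ) _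
      · rintro ⟨rfl, -⟩
        exact hρ (hα.symm.trans hβ)
  rw [key]
  congr 1
  rw [eq_iff_iff]
  constructor
  · rintro ⟨h1, h2⟩
    rw [append_castAdd_natAdd γ, append_castAdd_natAdd δ, h1, h2]
  · rintro rfl
    exact ⟨rfl, rfl⟩

/-- The unitary operator `U` exists. -/
theorem exists_isSplitting (hlam : -1 < lam) (hk : ∑ j, k j = ℓ) :
    ∃ U : Bergman (ℓ + d) lam ≃ₗᵢ[ℂ] DirectSumSpace ℓ d lam k, IsSplitting ℓ d lam k U := by
  have : ∀ ρ, CompleteSpace (Summand ℓ d lam k ρ) := fun ρ => by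
    have := finiteDimensional_levelSpace (lam := lam) hk ρ
    exact completeSpace_tensorProduct _ _
  let B : HilbertBasis (Fin (ℓ + d) → ℕ) ℂ (DirectSumSpace ℓ d lam k) :=
    HilbertBasis.mkOfOrthogonalEqBot (orthonormal_splitVec hlam) (by
      rw [eq_bot_iff]
      intro x hx
      rw [Submodule.mem_bot]
      refine lp.ext (funext fun ρ => summand_ext fun α hα g => ?_)
      have h1 : ∀ α'', inner ℂ (splitVec d lam α'' hα) x = 0 := by
        intro α''
        refine (Submodule.mem_orthogonal _ x).1 hx _
          (Submodule.subset_span ⟨Fin.append α α'', ?_⟩)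
        subst hα
        have e2 : (fun i => Fin.append α α'' (Fin.natAdd ℓ i)) = α'' := by funext i; simp
        simp only [e2]
        congr 1 <;> simp
      let A : Fiber ℓ d lam (∑ j, ρ j) →L[ℂ] ℂ :=
        innerSL ℂ (x ρ) ∘L TensorProduct.mkL ℂ _ _ (levelVec lam α hα)
      have hA : A = 0 := continuousLinearMap_ext_normMonomial (neg_one_lt_fiber hlam ℓ _)
        fun α'' => by
          have h2 := h1 α''
          rw [inner_splitVec] at h2
          exact (inner_eq_zero_symm (𝕜 := ℂ) (E := Summand ℓ d lam k ρ)).1 h2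
      have h3 : inner ℂ (x ρ) (levelVec lam α hα ⊗ₜ[ℂ] g) = 0 := DFunLike.congr_fun hA g
      exact ((inner_eq_zero_symm (𝕜 := ℂ) (E := Summand ℓ d lam k ρ)).1 h3).trans
        (inner_zero_right (𝕜 := ℂ) (E := Summand ℓ d lam k ρ) _).symm)
  refine ⟨(monomialBasis (ℓ + d) hlam).repr.trans B.repr.symm, fun α' α'' => ?_⟩
  have h1 : (monomialBasis (ℓ + d) hlam).repr (normMonomial (ℓ + d) lam (Fin.append α' α'')) =
      lp.single 2 (Fin.append α' α'') 1 := by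
    rw [← monomialBasis_apply hlam, HilbertBasis.repr_self]
  rw [LinearIsometryEquiv.trans_apply, h1, HilbertBasis.repr_symm_single]
  simp only [B, HilbertBasis.coe_mkOfOrthogonalEqBot]
  have key : ∀ {α : Fin ℓ → ℕ} (_ : α = α'), splitVec (k := k) d lam (α := α) α'' rfl =
      splitVec d lam (α := α') α'' rfl := by
    rintro α rfl
    rfl
  have e1 : (fun i => Fin.append α' α'' (Fin.castAdd d i)) = α' := by funext i; simp
  have e2 : (fun i => Fin.append α' α'' (Fin.natAdd ℓ i)) = α'' := by funext i; simp
  rw [e2]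
  exact key e1

/-- Under `U` the isometry `W_α` becomes `g ↦ e_α ⊗ g`. -/
theorem IsSplitting.apply_fiberMap (hlam : -1 < lam)
    {U : Bergman (ℓ + d) lam ≃ₗᵢ[ℂ] DirectSumSpace ℓ d lam k} (hU : IsSplitting ℓ d lam k U)
    {α : Fin ℓ → ℕ} {ρ : Fin m → ℕ} (hα : groupDegree k α = ρ)
    (g : Fiber ℓ d lam (∑ j, ρ j)) :
    U (fiberMap d hlam α _ g) = lp.single 2 ρ (levelVec lam α hα ⊗ₜ[ℂ] g) := by
  subst hα
  let A : Fiber ℓ d lam (∑ j, groupDegree k α j) →L[ℂ] DirectSumSpace ℓ d lam k :=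
    U.toContinuousLinearEquiv.toContinuousLinearMap ∘L fiberMap d hlam α _
  let B : Fiber ℓ d lam (∑ j, groupDegree k α j) →L[ℂ] DirectSumSpace ℓ d lam k :=
    { toFun := fun g => lp.single 2 (groupDegree k α) (levelVec lam α rfl ⊗ₜ[ℂ] g)
      map_add' := fun x y => by rw [TensorProduct.tmul_add, lp.single_add]
      map_smul' := fun c x => by
        rw [TensorProduct.tmul_smul]
        exact lp_single_smul (E := fun ρ => Summand ℓ d lam k ρ) _ c _
      cont := (lp.isometry_single _).continuous.comp
        (TensorProduct.mkL ℂ _ _ (levelVec lam α rfl)).continuous }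
  have hAB : A = B := continuousLinearMap_ext_normMonomial (neg_one_lt_fiber hlam ℓ _) fun α'' => by
    change U (fiberMap d hlam α _ _) = lp.single 2 _ _
    rw [fiberMap_normMonomial, hU]
    rfl
  exact DFunLike.congr_fun hAB g

end Splitting

end WeightedBergman

namespace WeightedBergman

/-! ### Operators that decompose along the fibres -/

section Decomposable

variable {ℓ d : ℕ} {lam : ℝ}

theorem adjoint_fiberMap_comp (hlam : -1 < lam) (α : Fin ℓ → ℕ) (p : ℕ) :
    ContinuousLinearMap.adjoint (fiberMap d hlam α p) ∘L fiberMap d hlam α p = 1 := by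
  ext x
  refine ext_inner_left ℂ fun y => ?_
  rw [ContinuousLinearMap.comp_apply, ContinuousLinearMap.adjoint_inner_right,
    inner_fiberMap_fiberMap]
  rfl

/-- The operator `W_α^* T W_α` for a multi-index `α` with `|α| = p`. -/
noncomputable def compress (hlam : -1 < lam) (hℓ : 1 ≤ ℓ)
    (T : Bergman (ℓ + d) lam →L[ℂ] Bergman (ℓ + d) lam) (p : ℕ) :
    Fiber ℓ d lam p →L[ℂ] Fiber ℓ d lam p :=
  ContinuousLinearMap.adjoint (fiberMap d hlam (Pi.single ⟨0, hℓ⟩ p) p) ∘L T ∘L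
    fiberMap d hlam (Pi.single ⟨0, hℓ⟩ p) p

theorem sum_single_eq (hℓ : 1 ≤ ℓ) (p : ℕ) : ∑ i, (Pi.single ⟨0, hℓ⟩ p : Fin ℓ → ℕ) i = p := by
  simp

variable (hlam : -1 < lam) (hℓ : 1 ≤ ℓ)
  {T T' : Bergman (ℓ + d) lam →L[ℂ] Bergman (ℓ + d) lam}

theorem compress_add (p : ℕ) :
    compress hlam hℓ (T + T') p = compress hlam hℓ T p + compress hlam hℓ T' p := by
  simp [compress, ContinuousLinearMap.add_comp, ContinuousLinearMap.comp_add]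

theorem compress_sub (p : ℕ) :
    compress hlam hℓ (T - T') p = compress hlam hℓ T p - compress hlam hℓ T' p := by
  simp [compress, ContinuousLinearMap.sub_comp, ContinuousLinearMap.comp_sub]

theorem compress_algebraMap (c : ℂ) (p : ℕ) :
    compress hlam hℓ (algebraMap ℂ (Bergman (ℓ + d) lam →L[ℂ] Bergman (ℓ + d) lam) c) p =
      algebraMap ℂ _ c := by
  rw [Algebra.algebraMap_eq_smul_one, Algebra.algebraMap_eq_smul_one, compress,
    ContinuousLinearMap.smul_comp, ContinuousLinearMap.comp_smul,
    ← adjoint_fiberMap_comp hlam (Pi.single ⟨0, hℓ⟩ p) p]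
  rfl

theorem compress_star (p : ℕ) :
    compress hlam hℓ (star T) p = star (compress hlam hℓ T p) := by
  rw [compress, compress, ContinuousLinearMap.star_eq_adjoint, ContinuousLinearMap.star_eq_adjoint,
    ContinuousLinearMap.adjoint_comp, ContinuousLinearMap.adjoint_comp,
    ContinuousLinearMap.adjoint_adjoint, ContinuousLinearMap.comp_assoc]

theorem norm_compress_apply_le (p : ℕ) (x : Fiber ℓ d lam p) :
    ‖compress hlam hℓ T p x‖ ≤ ‖T‖ * ‖x‖ := by
  have h1 : ‖ContinuousLinearMap.adjoint (fiberMap d hlam (Pi.single ⟨0, hℓ⟩ p) p)‖ ≤ 1 := by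
    rw [LinearIsometryEquiv.norm_map]
    exact ContinuousLinearMap.opNorm_le_bound _ zero_le_one fun y => by
      rw [norm_fiberMap, one_mul]
  calc ‖compress hlam hℓ T p x‖
      ≤ 1 * ‖T (fiberMap d hlam (Pi.single ⟨0, hℓ⟩ p) p x)‖ :=
        ContinuousLinearMap.le_of_opNorm_le _ h1 _
    _ ≤ ‖T‖ * ‖x‖ := by
        rw [one_mul, ← norm_fiberMap hlam (Pi.single ⟨0, hℓ⟩ p) p x]
        exact T.le_opNorm _

theorem norm_compress_le (p : ℕ) : ‖compress hlam hℓ T p‖ ≤ ‖T‖ :=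
  ContinuousLinearMap.opNorm_le_bound _ (norm_nonneg _) (norm_compress_apply_le hlam hℓ p)

theorem continuous_compress (p : ℕ) :
    Continuous fun T : Bergman (ℓ + d) lam →L[ℂ] Bergman (ℓ + d) lam => compress hlam hℓ T p := by
  refine LipschitzWith.continuous (K := 1) (LipschitzWith.of_dist_le_mul fun T T' => ?_)
  rw [dist_eq_norm, dist_eq_norm, ← compress_sub, NNReal.coe_one, one_mul]
  exact norm_compress_le hlam hℓ p

/-- `T` acts on the range of every `W_α` as one and the same operator, depending on `|α|` only. -/
def Decomposes (T : Bergman (ℓ + d) lam →L[ℂ] Bergman (ℓ + d) lam) : Prop :=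
  ∀ (α : Fin ℓ → ℕ) (p : ℕ), ∑ i, α i = p →
    T ∘L fiberMap d hlam α p = fiberMap d hlam α p ∘L compress hlam hℓ T p

/-- Compression is multiplicative as soon as the right factor leaves the ranges of the `W_α`
invariant. -/
theorem compress_mul (h : Decomposes hlam hℓ T') (p : ℕ) :
    compress hlam hℓ (T * T') p = compress hlam hℓ T p * compress hlam hℓ T' p := by
  have h1 := h (Pi.single ⟨0, hℓ⟩ p) p (sum_single_eq hℓ p)
  rw [compress, compress, ContinuousLinearMap.mul_def, ContinuousLinearMap.mul_def,
    ContinuousLinearMap.comp_assoc, h1]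
  rfl

theorem toeplitz_comp_fiberMap (c : 𝔹 d →ᵇ ℂ) {α : Fin ℓ → ℕ} {p : ℕ} (h : ∑ i, α i = p) :
    toeplitz (ℓ + d) lam (symbol lam (c.compContinuous (lastCoords ℓ d))) ∘L fiberMap d hlam α p =
      fiberMap d hlam α p ∘L toeplitz d (lam + p + ℓ) (symbol _ c) := by
  subst h
  exact toeplitz_lastCoords_fiberMap hlam c α

theorem compress_toeplitz (c : 𝔹 d →ᵇ ℂ) (p : ℕ) :
    compress hlam hℓ (toeplitz (ℓ + d) lam (symbol lam (c.compContinuous (lastCoords ℓ d)))) p =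
      toeplitz d (lam + p + ℓ) (symbol _ c) := by
  rw [compress, toeplitz_comp_fiberMap hlam c (sum_single_eq hℓ p),
    ← ContinuousLinearMap.comp_assoc,
    adjoint_fiberMap_comp]
  rfl

end Decomposable

/-! ### Asymptotic symbols -/

section Symbols

/-- As the weight grows, the reproducing kernels become approximate eigenvectors of the Toeplitz
operators with uniformly continuous symbols, since `v_μ` concentrates at the origin. -/
theorem exists_norm_toeplitz_bergmanKernel_sub_le {d : ℕ} {c : 𝔹 d →ᵇ ℂ} (hc : c ∈ BUC d) {ε : ℝ}
    (hε : 0 < ε) : ∃ M : ℝ, ∀ μ, -1 < μ → M ≤ μ → ∀ z : 𝔹 d,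
      ‖toeplitz d μ (symbol μ c) (bergmanKernel d μ z) - c z • bergmanKernel d μ z‖ ≤ ε := by
  obtain ⟨δ, hδ, hcδ⟩ := hc (ε / 2) (by positivity)
  have ht : 0 < Real.tanh δ := by
    rw [Real.tanh_eq_sinh_div_cosh]
    exact div_pos (Real.sinh_pos_iff.2 hδ) (Real.cosh_pos _)
  set K : ℝ := 4 * ‖c‖ ^ 2 / Real.tanh δ ^ 2 with hK
  have hK0 : 0 ≤ K := by positivity
  refine ⟨2 * K * d / ε ^ 2, fun μ hμ hM z => ?_⟩
  have hD : 0 < (d : ℝ) + μ + 1 := by linarith [Nat.cast_nonneg (α := ℝ) d]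
  have := isProbabilityMeasure_vol d hμ
  have h1 := enorm_toeplitz_sub_smul_le c (c z) (bergmanKernel_ae_eq hμ z)
  rw [← lintegral_vol_comp_ballMobius μ z (fun w => ‖c w - c z‖ₑ ^ 2)] at h1
  have h2 : ∀ w : 𝔹 d, ‖c (ballMobius z w) - c z‖ₑ ^ 2 ≤
      ENNReal.ofReal (ε ^ 2 / 4) + ENNReal.ofReal K * ENNReal.ofReal (‖(w : Cn d)‖ ^ 2) := by
    intro w
    rw [← ofReal_norm_sq_eq, ← ENNReal.ofReal_mul hK0, ← ENNReal.ofReal_add (by positivity)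
      (by positivity)]
    apply ENNReal.ofReal_le_ofReal
    -- uniform continuity near the origin, the bound `2 ‖c‖` elsewhere
    by_cases hw : ‖(w : Cn d)‖ < Real.tanh δ
    · have h3 : bergmanDist z (ballMobius z w) < δ := by
        rw [bergmanDist_self_ballMobius, ← bergmanDist_origin]
        exact (norm_lt_tanh_iff w δ).1 hw
      have h4 := hcδ _ _ h3
      rw [norm_sub_rev] at h4
      have : 0 ≤ K * ‖(w : Cn d)‖ ^ 2 := by positivity
      nlinarith [norm_nonneg (c (ballMobius z w) - c z)]
    · have h3 : ‖c (ballMobius z w) - c z‖ ≤ 2 * ‖c‖ := by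
        rw [two_mul]
        exact (norm_sub_le _ _).trans (add_le_add (c.norm_coe_le_norm _) (c.norm_coe_le_norm _))
      have h4 : ‖c (ballMobius z w) - c z‖ ^ 2 ≤ (2 * ‖c‖) ^ 2 := by gcongr
      have h5 : Real.tanh δ ^ 2 ≤ ‖(w : Cn d)‖ ^ 2 := by
        rw [not_lt] at hw
        gcongr
      have h6 : 4 * ‖c‖ ^ 2 ≤ K * ‖(w : Cn d)‖ ^ 2 := by
        rw [hK, div_mul_eq_mul_div, le_div_iff₀ (by positivity)]
        gcongr
      have : 0 ≤ ε ^ 2 / 4 := by positivity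
      linarith [mul_pow 2 ‖c‖ 2]
  have h3 := h1.trans (lintegral_mono h2)
  rw [lintegral_add_left measurable_const, lintegral_const, measure_univ, mul_one,
    lintegral_const_mul' _ _ ENNReal.ofReal_ne_top, lintegral_norm_sq hμ,
    ← ENNReal.ofReal_mul hK0, ← ENNReal.ofReal_add (by positivity) (by positivity),
    ← ofReal_norm, ← ENNReal.ofReal_pow (norm_nonneg _),
    ENNReal.ofReal_le_ofReal_iff (by positivity)] at h3
  have h4 : K * (d / (d + μ + 1)) ≤ ε ^ 2 / 2 := by
    rw [div_le_iff₀ (by positivity)] at hM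
    rw [← mul_div_assoc, div_le_iff₀ hD]
    have : 0 ≤ ε ^ 2 * (d + 1) := by positivity
    nlinarith
  refine (sq_le_sq₀ (norm_nonneg _) hε.le).1 ?_
  nlinarith

variable {ℓ d : ℕ} {lam : ℝ} (hlam : -1 < lam) (hℓ : 1 ≤ ℓ)
  {T T' : Bergman (ℓ + d) lam →L[ℂ] Bergman (ℓ + d) lam} {a b : 𝔹 d →ᵇ ℂ}

/-- The reproducing kernels are asymptotically eigenvectors of the components of `T`, with
eigenvalues given by the function `a`. -/
def HasSymbol (T : Bergman (ℓ + d) lam →L[ℂ] Bergman (ℓ + d) lam) (a : 𝔹 d →ᵇ ℂ) : Prop :=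
  ∀ ε > 0, ∃ P : ℕ, ∀ p ≥ P, ∀ z : 𝔹 d, ‖compress hlam hℓ T p (bergmanKernel d (lam + p + ℓ) z) -
    a z • bergmanKernel d (lam + p + ℓ) z‖ ≤ ε

variable {hlam hℓ}

/-- The asymptotic symbol depends contractively on the operator, since the kernels are unit vectors.
-/
theorem HasSymbol.norm_sub_le (h : HasSymbol hlam hℓ T a) (h' : HasSymbol hlam hℓ T' b) :
    ‖a - b‖ ≤ ‖T - T'‖ := by
  refine le_of_forall_pos_le_add fun ε hε => ?_
  obtain ⟨P, hP⟩ := h (ε / 2) (by positivity)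
  obtain ⟨Q, hQ⟩ := h' (ε / 2) (by positivity)
  refine (BoundedContinuousFunction.norm_le (by positivity)).2 fun z => ?_
  set p := max P Q
  have h1 := hP p (le_max_left _ _) z
  have h2 := hQ p (le_max_right _ _) z
  have hp := neg_one_lt_fiber hlam ℓ p
  set κ := bergmanKernel d (lam + p + ℓ) z
  have hκ : ‖κ‖ = 1 := norm_bergmanKernel hp z
  have h3 := norm_compress_apply_le hlam hℓ (T := T - T') p κ
  rw [hκ, mul_one, compress_sub] at h3
  have h4 : (a z - b z) • κ = (compress hlam hℓ T p - compress hlam hℓ T' p) κ -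
      (compress hlam hℓ T p κ - a z • κ) + (compress hlam hℓ T' p κ - b z • κ) := by
    rw [sub_apply, sub_smul]
    abel
  calc ‖(a - b) z‖ = ‖(a z - b z) • κ‖ := by
        rw [norm_smul, hκ, mul_one, BoundedContinuousFunction.sub_apply]
    _ ≤ ‖T - T'‖ + ε / 2 + ε / 2 := by
        rw [h4]
        refine (norm_add_le _ _).trans (add_le_add ((_root_.norm_sub_le _ _).trans ?_) h2)
        exact add_le_add h3 h1
    _ = _ := by ring

theorem HasSymbol.unique (h : HasSymbol hlam hℓ T a) (h' : HasSymbol hlam hℓ T b) : a = b := by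
  have := h.norm_sub_le h'
  rw [sub_self, norm_zero] at this
  exact sub_eq_zero.1 (norm_le_zero_iff.1 this)

theorem HasSymbol.add (h : HasSymbol hlam hℓ T a) (h' : HasSymbol hlam hℓ T' b) :
    HasSymbol hlam hℓ (T + T') (a + b) := by
  intro ε hε
  obtain ⟨P, hP⟩ := h (ε / 2) (by positivity)
  obtain ⟨Q, hQ⟩ := h' (ε / 2) (by positivity)
  refine ⟨max P Q, fun p hp z => ?_⟩
  have h1 := hP p ((le_max_left _ _).trans hp) z
  have h2 := hQ p ((le_max_right _ _).trans hp) z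
  rw [compress_add, add_apply, BoundedContinuousFunction.add_apply, add_smul, add_sub_add_comm]
  exact (norm_add_le _ _).trans (by linarith)

/-- Approximate eigenvalues multiply: this makes `ν` a homomorphism. -/
theorem HasSymbol.mul (hd : Decomposes hlam hℓ T') (h : HasSymbol hlam hℓ T a)
    (h' : HasSymbol hlam hℓ T' b) : HasSymbol hlam hℓ (T * T') (a * b) := by
  intro ε hε
  obtain ⟨P, hP⟩ := h (ε / 2 / (‖b‖ + 1)) (by positivity)
  obtain ⟨Q, hQ⟩ := h' (ε / 2 / (‖T‖ + 1)) (by positivity)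
  refine ⟨max P Q, fun p hp z => ?_⟩
  have h1 := hP p ((le_max_left _ _).trans hp) z
  have h2 := hQ p ((le_max_right _ _).trans hp) z
  rw [compress_mul hlam hℓ hd, BoundedContinuousFunction.mul_apply]
  set κ := bergmanKernel d (lam + p + ℓ) z
  have h3 := norm_compress_apply_le hlam hℓ (T := T) p (compress hlam hℓ T' p κ - b z • κ)
  have h4 : (compress hlam hℓ T p * compress hlam hℓ T' p) κ - (a z * b z) • κ =
      compress hlam hℓ T p (compress hlam hℓ T' p κ - b z • κ) +
        b z • (compress hlam hℓ T p κ - a z • κ) := by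
    rw [map_sub, map_smul, smul_sub, smul_smul, mul_comm (a z)]
    have h5 : (compress hlam hℓ T p * compress hlam hℓ T' p) κ =
      compress hlam hℓ T p (compress hlam hℓ T' p κ) := rfl
    rw [h5]
    abel
  rw [le_div_iff₀ (by positivity)] at h1 h2
  rw [h4]
  refine (norm_add_le _ _).trans ?_
  rw [norm_smul]
  have h5 := b.norm_coe_le_norm z
  have h6 := norm_nonneg (compress hlam hℓ T' p κ - b z • κ)
  have h7 := norm_nonneg (compress hlam hℓ T p κ - a z • κ)
  nlinarith [norm_nonneg (b z)]

theorem HasSymbol.algebraMap (c : ℂ) : HasSymbol (d := d) hlam hℓ (algebraMap ℂ _ c)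
    (algebraMap ℂ (𝔹 d →ᵇ ℂ) c) := by
  intro ε hε
  refine ⟨0, fun p _ z => ?_⟩
  rw [compress_algebraMap, Algebra.algebraMap_eq_smul_one]
  simp [hε.le]

/-- The asymptotic symbol of a Toeplitz operator is its symbol. -/
theorem HasSymbol.toeplitz (ha : a ∈ BUC d) : HasSymbol hlam hℓ
    (toeplitz (ℓ + d) lam (symbol lam (a.compContinuous (lastCoords ℓ d)))) a := by
  intro ε hε
  obtain ⟨M, hM⟩ := exists_norm_toeplitz_bergmanKernel_sub_le ha hε
  obtain ⟨P, hP⟩ := exists_nat_ge M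
  refine ⟨P + 1, fun p hp z => ?_⟩
  rw [compress_toeplitz]
  refine hM _ (neg_one_lt_fiber hlam ℓ p) ?_ z
  have h1 : ((P + 1 : ℕ) : ℝ) ≤ p := by exact_mod_cast hp
  push_cast at h1
  linarith [Nat.cast_nonneg (α := ℝ) ℓ]

/-- The Berezin transforms of the components converge uniformly to the asymptotic symbol. -/
theorem HasSymbol.norm_berezin_sub_le (h : HasSymbol hlam hℓ T a) {ε : ℝ} (hε : 0 < ε) :
    ∃ P : ℕ, ∀ p ≥ P, ∀ z : 𝔹 d, ‖berezin (compress hlam hℓ T p) z - a z‖ ≤ ε := by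
  obtain ⟨P, hP⟩ := h ε hε
  refine ⟨P, fun p hp z => ?_⟩
  have hκ := norm_bergmanKernel (neg_one_lt_fiber hlam ℓ p) z
  have h1 : berezin (compress hlam hℓ T p) z - a z = inner ℂ (bergmanKernel d (lam + p + ℓ) z)
      (compress hlam hℓ T p (bergmanKernel d (lam + p + ℓ) z) -
        a z • bergmanKernel d (lam + p + ℓ) z) := by
    rw [inner_sub_right, inner_smul_right, inner_self_eq_norm_sq_to_K, hκ]
    simp [berezin]
  rw [h1]
  refine (norm_inner_le_norm _ _).trans ?_
  rw [hκ, one_mul]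
  exact hP p hp z

/-- Berezin transforms, hence their limits, are compatible with adjoints. -/
theorem HasSymbol.star_eq (h : HasSymbol hlam hℓ T a) (h' : HasSymbol hlam hℓ (star T) b) :
    b = star a := by
  ext z
  rw [BoundedContinuousFunction.star_apply, ← sub_eq_zero, ← norm_le_zero_iff]
  refine le_of_forall_pos_le_add fun ε hε => ?_
  obtain ⟨P, hP⟩ := h.norm_berezin_sub_le (ε := ε / 2) (by positivity)
  obtain ⟨Q, hQ⟩ := h'.norm_berezin_sub_le (ε := ε / 2) (by positivity)
  have h1 := hP (max P Q) (le_max_left _ _) z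
  have h2 := hQ (max P Q) (le_max_right _ _) z
  have h3 : berezin (compress hlam hℓ (star T) (max P Q)) z =
      star (berezin (compress hlam hℓ T (max P Q)) z) := by
    rw [compress_star, berezin, berezin, ContinuousLinearMap.star_eq_adjoint,
      ContinuousLinearMap.adjoint_inner_right]
    exact (inner_conj_symm _ _).symm
  rw [h3] at h2
  rw [← norm_star, star_sub] at h1
  have h4 : b z - star (a z) = (star (berezin (compress hlam hℓ T (max P Q)) z) - star (a z)) -
      (star (berezin (compress hlam hℓ T (max P Q)) z) - b z) := by ring
  rw [h4]
  refine (_root_.norm_sub_le _ _).trans ?_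
  linarith

end Symbols

section SymbolAlgebra

variable {ℓ d : ℕ} {lam : ℝ} (hlam : -1 < lam) (hℓ : 1 ≤ ℓ)

/-- Decomposable operators with components in the Toeplitz algebras and a uniformly continuous
asymptotic symbol. -/
def IsSymbolic (T : Bergman (ℓ + d) lam →L[ℂ] Bergman (ℓ + d) lam) : Prop :=
  Decomposes hlam hℓ T ∧ (∀ p : ℕ, compress hlam hℓ T p ∈ toeplitzAlg d (lam + p + ℓ)) ∧
    ∃ a ∈ BUC d, HasSymbol hlam hℓ T a

/-- The symbols of a convergent sequence of operators form a Cauchy sequence. -/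
theorem isClosed_isSymbolic : IsClosed {T | IsSymbolic (d := d) hlam hℓ T} := by
  rw [← isSeqClosed_iff_isClosed]
  intro F T hF hT
  choose hdec hmem a ha hsym using hF
  refine ⟨fun α p hα => ?_, fun p => ?_, ?_⟩
  · have h1 : Tendsto (fun n => F n ∘L fiberMap d hlam α p) atTop (𝓝 (T ∘L fiberMap d hlam α p)) :=
      ((ContinuousLinearMap.precomp _ (fiberMap d hlam α p)).continuous.tendsto T).comp hT
    have h2 : Tendsto (fun n => fiberMap d hlam α p ∘L compress hlam hℓ (F n) p) atTop
        (𝓝 (fiberMap d hlam α p ∘L compress hlam hℓ T p)) :=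
      ((ContinuousLinearMap.postcomp _ (fiberMap d hlam α p)).continuous.tendsto _).comp
        (((continuous_compress hlam hℓ p).tendsto T).comp hT)
    simp only [fun n => hdec n α p hα] at h1
    exact tendsto_nhds_unique h1 h2
  · exact (StarSubalgebra.isClosed_topologicalClosure _).mem_of_tendsto
      (((continuous_compress hlam hℓ p).tendsto T).comp hT) (Eventually.of_forall fun n => hmem n p)
  · have hcau : CauchySeq a := by
      rw [Metric.cauchySeq_iff]
      intro ε hε
      obtain ⟨N, hN⟩ := Metric.cauchySeq_iff.1 hT.cauchySeq ε hε
      refine ⟨N, fun i hi j hj => lt_of_le_of_lt ?_ (hN i hi j hj)⟩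
      rw [dist_eq_norm, dist_eq_norm]
      exact (hsym i).norm_sub_le (hsym j)
    obtain ⟨b, hb⟩ := cauchySeq_tendsto_of_complete hcau
    refine ⟨b, (isClosed_BUC d).mem_of_tendsto hb (Eventually.of_forall ha), fun ε hε => ?_⟩
    obtain ⟨n, h1, h2⟩ := ((Metric.tendsto_nhds.1 hT (ε / 3) (by positivity)).and
      (Metric.tendsto_nhds.1 hb (ε / 3) (by positivity))).exists
    obtain ⟨P, hP⟩ := hsym n (ε / 3) (by positivity)
    refine ⟨P, fun p hp z => ?_⟩
    have h3 := hP p hp z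
    have hκ := norm_bergmanKernel (neg_one_lt_fiber hlam ℓ p) z
    set κ := bergmanKernel d (lam + p + ℓ) z
    have h4 : compress hlam hℓ T p κ - b z • κ = (compress hlam hℓ (F n) p κ - a n z • κ) -
        (compress hlam hℓ (F n) p - compress hlam hℓ T p) κ + (a n z - b z) • κ := by
      rw [sub_apply, sub_smul]
      abel
    have h5 := norm_compress_apply_le hlam hℓ (T := F n - T) p κ
    rw [hκ, mul_one, compress_sub] at h5
    have h6 : ‖(a n z - b z) • κ‖ ≤ ε / 3 := by
      rw [norm_smul, hκ, mul_one, ← dist_eq_norm]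
      exact ((a n).dist_coe_le_dist z).trans h2.le
    rw [dist_eq_norm] at h1
    rw [h4]
    refine (norm_add_le _ _).trans ?_
    have := norm_sub_le (compress hlam hℓ (F n) p κ - a n z • κ)
      ((compress hlam hℓ (F n) p - compress hlam hℓ T p) κ)
    linarith

variable {hlam hℓ}

theorem IsSymbolic.add {T T' : Bergman (ℓ + d) lam →L[ℂ] Bergman (ℓ + d) lam}
    (h : IsSymbolic hlam hℓ T) (h' : IsSymbolic hlam hℓ T') : IsSymbolic hlam hℓ (T + T') := by
  obtain ⟨h1, h2, a, ha, h3⟩ := h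
  obtain ⟨h1', h2', b, hb, h3'⟩ := h'
  refine ⟨fun α p hα => ?_, fun p => ?_, a + b, add_mem ha hb, h3.add h3'⟩
  · rw [compress_add, ContinuousLinearMap.add_comp, ContinuousLinearMap.comp_add, h1 α p hα,
      h1' α p hα]
  · rw [compress_add]
    exact add_mem (h2 p) (h2' p)

theorem IsSymbolic.mul {T T' : Bergman (ℓ + d) lam →L[ℂ] Bergman (ℓ + d) lam}
    (h : IsSymbolic hlam hℓ T) (h' : IsSymbolic hlam hℓ T') : IsSymbolic hlam hℓ (T * T') := by
  obtain ⟨h1, h2, a, ha, h3⟩ := h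
  obtain ⟨h1', h2', b, hb, h3'⟩ := h'
  refine ⟨fun α p hα => ?_, fun p => ?_, a * b, mul_mem ha hb, HasSymbol.mul h1' h3 h3'⟩
  · rw [compress_mul hlam hℓ h1', ContinuousLinearMap.mul_def, ContinuousLinearMap.mul_def,
      ContinuousLinearMap.comp_assoc, h1' α p hα, ← ContinuousLinearMap.comp_assoc, h1 α p hα,
      ContinuousLinearMap.comp_assoc]
  · rw [compress_mul hlam hℓ h1']
    exact mul_mem (h2 p) (h2' p)

theorem IsSymbolic.algebraMap (c : ℂ) :
    IsSymbolic (d := d) hlam hℓ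
      (algebraMap ℂ (Bergman (ℓ + d) lam →L[ℂ] Bergman (ℓ + d) lam) c) := by
  refine ⟨fun α p _ => ?_, fun p => ?_, _, algebraMap_mem _ c, HasSymbol.algebraMap c⟩
  · rw [compress_algebraMap, Algebra.algebraMap_eq_smul_one, Algebra.algebraMap_eq_smul_one,
      ContinuousLinearMap.smul_comp, ContinuousLinearMap.comp_smul]
    rfl
  · rw [compress_algebraMap]
    exact algebraMap_mem _ c

theorem IsSymbolic.toeplitz {c : 𝔹 d →ᵇ ℂ} (hc : c ∈ BUC d) : IsSymbolic hlam hℓ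
    (toeplitz (ℓ + d) lam (symbol lam (c.compContinuous (lastCoords ℓ d)))) := by
  refine ⟨fun α p hα => ?_, fun p => ?_, c, hc, HasSymbol.toeplitz hc⟩
  · rw [compress_toeplitz, toeplitz_comp_fiberMap hlam c hα]
  · rw [compress_toeplitz]
    exact toeplitz_mem_toeplitzAlg hc

/-- The operators `T` such that `T` and its adjoint are symbolic form a `*`-algebra. -/
def symbolicAlg (d : ℕ) (hlam : -1 < lam) (hℓ : 1 ≤ ℓ) :
    StarSubalgebra ℂ (Bergman (ℓ + d) lam →L[ℂ] Bergman (ℓ + d) lam) where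
  carrier := {T | IsSymbolic hlam hℓ T ∧ IsSymbolic hlam hℓ (star T)}
  mul_mem' := by
    rintro T T' ⟨h1, h2⟩ ⟨h1', h2'⟩
    exact ⟨h1.mul h1', by rw [star_mul]; exact h2'.mul h2⟩
  add_mem' := by
    rintro T T' ⟨h1, h2⟩ ⟨h1', h2'⟩
    exact ⟨h1.add h1', by rw [star_add]; exact h2.add h2'⟩
  algebraMap_mem' := fun c =>
    ⟨IsSymbolic.algebraMap c, by rw [← algebraMap_star_comm]; exact IsSymbolic.algebraMap _⟩
  star_mem' := by
    rintro T ⟨h1, h2⟩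
    exact ⟨h2, by rw [star_star]; exact h1⟩

theorem mem_symbolicAlg {T : Bergman (ℓ + d) lam →L[ℂ] Bergman (ℓ + d) lam} :
    T ∈ symbolicAlg d hlam hℓ ↔ IsSymbolic hlam hℓ T ∧ IsSymbolic hlam hℓ (star T) := Iff.rfl

theorem toeplitz_mem_symbolicAlg {c : 𝔹 d →ᵇ ℂ} (hc : c ∈ BUC d) :
    toeplitz (ℓ + d) lam (symbol lam (c.compContinuous (lastCoords ℓ d))) ∈
      symbolicAlg d hlam hℓ := by
  have h : star (toeplitz (ℓ + d) lam (symbol lam (c.compContinuous (lastCoords ℓ d)))) =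
      toeplitz (ℓ + d) lam (symbol lam ((star c).compContinuous (lastCoords ℓ d))) :=
    star_toeplitz _
  rw [mem_symbolicAlg, h]
  exact ⟨IsSymbolic.toeplitz hc, IsSymbolic.toeplitz (star_mem hc)⟩

theorem isClosed_symbolicAlg : IsClosed
    (symbolicAlg d hlam hℓ : Set (Bergman (ℓ + d) lam →L[ℂ] Bergman (ℓ + d) lam)) := by
  have h1 := isClosed_isSymbolic (d := d) hlam hℓ
  exact h1.inter (h1.preimage continuous_star)

theorem bigToeplitzAlg_le_symbolicAlg : bigToeplitzAlg ℓ d lam ≤ symbolicAlg d hlam hℓ := by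
  refine StarSubalgebra.topologicalClosure_minimal (StarAlgebra.adjoin_le ?_) isClosed_symbolicAlg
  rintro T ⟨c, hc, h⟩
  rw [h]
  exact toeplitz_mem_symbolicAlg hc

end SymbolAlgebra

end WeightedBergman

namespace WeightedBergman

/-! ### The asymptotic symbol homomorphism -/

theorem lp_inner_map_map {ι H : Type*} {E : ι → Type*} [∀ i, NormedAddCommGroup (E i)]
    [∀ i, InnerProductSpace ℂ (E i)] [NormedAddCommGroup H] [InnerProductSpace ℂ H]
    (U : H ≃ₗᵢ[ℂ] lp E 2) (x y : H) : inner ℂ (U x) (U y) = inner ℂ x y := by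
  refine LinearIsometry.inner_map_map (𝕜 := ℂ) (E := H) (E' := lp E 2)
    ⟨U.toLinearEquiv.toLinearMap, U.norm_map⟩ x y

section DirectSum

variable {ℓ d m : ℕ} {lam : ℝ} {k : Fin m → ℕ} (hlam : -1 < lam) (hℓ : 1 ≤ ℓ)
  {T : Bergman (ℓ + d) lam →L[ℂ] Bergman (ℓ + d) lam}

theorem isDirectSumOf_compress (hk : ∑ j, k j = ℓ) (hT : T ∈ symbolicAlg d hlam hℓ) :
    IsDirectSumOf k T (compress hlam hℓ T) := by
  obtain ⟨U, hU⟩ := exists_isSplitting (ℓ := ℓ) (d := d) (k := k) hlam hk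
  have hdec : Decomposes hlam hℓ (star T) := hT.2.1
  refine ⟨U, hU, fun f ρ => summand_ext fun α hα g => ?_⟩
  have hα' : ∑ i, α i = ∑ j, ρ j := by rw [← sum_groupDegree hk α, hα]
  have key : ∀ (g : Fiber ℓ d lam (∑ j, ρ j)) (f : Bergman (ℓ + d) lam),
      inner ℂ (levelVec lam α hα ⊗ₜ[ℂ] g) ((U f : ∀ ρ, Summand ℓ d lam k ρ) ρ) =
        inner ℂ (fiberMap d hlam α _ g) f := by
    intro g f
    refine Eq.trans ?_ (lp_inner_map_map (E := fun ρ => Summand ℓ d lam k ρ) U _ _)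
    rw [hU.apply_fiberMap hlam hα]
    exact (lp.inner_single_left (𝕜 := ℂ) (G := fun ρ => Summand ℓ d lam k ρ) _ _ _).symm
  refine (key g (T f)).trans (Eq.trans ?_ (inner_tmul_lTensor _ _ _ _).symm)
  refine Eq.trans ?_ (key _ f).symm
  have h1 := DFunLike.congr_fun (hdec α _ hα') g
  rw [ContinuousLinearMap.comp_apply, ContinuousLinearMap.comp_apply, compress_star] at h1
  rw [← h1, ContinuousLinearMap.star_eq_adjoint, ContinuousLinearMap.adjoint_inner_left]

/-- The components of an operator are its compressions, hence are unique. -/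
theorem IsDirectSumOf.eq_compress (hk : ∑ j, k j = ℓ) (hT : T ∈ symbolicAlg d hlam hℓ)
    {S : ∀ p : ℕ, Fiber ℓ d lam p →L[ℂ] Fiber ℓ d lam p} (hS : IsDirectSumOf k T S) :
    S = compress hlam hℓ T := by
  obtain ⟨U, hU, h⟩ := hS
  funext p
  obtain ⟨α, rfl⟩ := exists_sum_groupDegree_eq hℓ hk p
  have hdec : Decomposes hlam hℓ T := hT.1.1
  have hα : ∑ i, α i = ∑ j, groupDegree k α j := (sum_groupDegree hk α).symm
  ext g
  have h1 := h (fiberMap d hlam α _ g) (groupDegree k α)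
  have h2 := DFunLike.congr_fun (hdec α _ hα) g
  rw [ContinuousLinearMap.comp_apply, ContinuousLinearMap.comp_apply] at h2
  rw [h2, hU.apply_fiberMap hlam rfl, hU.apply_fiberMap hlam rfl, lp.single_apply_self,
    lp.single_apply_self] at h1
  have h3 : levelVec (k := k) lam α rfl ⊗ₜ[ℂ] (compress hlam hℓ T _ g - S _ g) = 0 := by
    rw [TensorProduct.tmul_sub, h1]
    exact sub_self _
  have h4 : ‖levelVec (k := k) lam α rfl‖ = 1 := norm_normMonomial hlam α
  have h5 : ‖levelVec (k := k) lam α rfl ⊗ₜ[ℂ] (compress hlam hℓ T _ g - S _ g)‖ = 0 := by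
    rw [h3]
    exact norm_zero (E := Summand ℓ d lam k (groupDegree k α))
  rw [TensorProduct.norm_tmul, h4, one_mul, norm_eq_zero] at h5
  exact (sub_eq_zero.1 h5).symm

theorem exists_hasSymbol (T : bigToeplitzAlg ℓ d lam) :
    ∃ a : BUC d, HasSymbol hlam hℓ (T : Bergman (ℓ + d) lam →L[ℂ] Bergman (ℓ + d) lam) a := by
  obtain ⟨a, ha, h⟩ := (bigToeplitzAlg_le_symbolicAlg (hlam := hlam) (hℓ := hℓ) T.2).1.2.2
  exact ⟨⟨a, ha⟩, h⟩

/-- The symbol of an element of the `C*`-algebra generated by the Toeplitz operators. -/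
noncomputable def symbolOf (T : bigToeplitzAlg ℓ d lam) : BUC d :=
  (exists_hasSymbol hlam hℓ T).choose

theorem hasSymbol_symbolOf (T : bigToeplitzAlg ℓ d lam) :
    HasSymbol hlam hℓ (T : Bergman (ℓ + d) lam →L[ℂ] Bergman (ℓ + d) lam)
      (symbolOf hlam hℓ T : 𝔹 d →ᵇ ℂ) :=
  (exists_hasSymbol hlam hℓ T).choose_spec

theorem symbolOf_eq {T : bigToeplitzAlg ℓ d lam} {a : BUC d}
    (h : HasSymbol hlam hℓ (T : Bergman (ℓ + d) lam →L[ℂ] Bergman (ℓ + d) lam) (a : 𝔹 d →ᵇ ℂ)) :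
    symbolOf hlam hℓ T = a :=
  Subtype.ext ((hasSymbol_symbolOf hlam hℓ T).unique h)

/-- The homomorphism `ν` that maps an operator to its asymptotic symbol. -/
noncomputable def symbolHom (d : ℕ) (hlam : -1 < lam) (hℓ : 1 ≤ ℓ) :
    bigToeplitzAlg ℓ d lam →⋆ₐ[ℂ] BUC d where
  toFun := symbolOf hlam hℓ
  map_one' := symbolOf_eq hlam hℓ (by
    have := HasSymbol.algebraMap (d := d) (hlam := hlam) (hℓ := hℓ) 1
    rwa [map_one, map_one] at this)
  map_mul' T T' := symbolOf_eq hlam hℓ (HasSymbol.mul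
    (bigToeplitzAlg_le_symbolicAlg (hlam := hlam) (hℓ := hℓ) T'.2).1.1
    (hasSymbol_symbolOf hlam hℓ T) (hasSymbol_symbolOf hlam hℓ T'))
  map_zero' := symbolOf_eq hlam hℓ (by
    have := HasSymbol.algebraMap (d := d) (hlam := hlam) (hℓ := hℓ) 0
    rwa [map_zero, map_zero] at this)
  map_add' T T' := symbolOf_eq hlam hℓ
    ((hasSymbol_symbolOf hlam hℓ T).add (hasSymbol_symbolOf hlam hℓ T'))
  commutes' c := symbolOf_eq hlam hℓ (HasSymbol.algebraMap c)
  map_star' T := Subtype.ext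
    ((hasSymbol_symbolOf hlam hℓ T).star_eq (hasSymbol_symbolOf hlam hℓ (star T)))

theorem hasSymbol_symbolHom (T : bigToeplitzAlg ℓ d lam) :
    HasSymbol hlam hℓ (T : Bergman (ℓ + d) lam →L[ℂ] Bergman (ℓ + d) lam)
      (symbolHom d hlam hℓ T : 𝔹 d →ᵇ ℂ) :=
  hasSymbol_symbolOf hlam hℓ T

theorem continuous_symbolHom : Continuous (symbolHom d hlam hℓ) := by
  refine LipschitzWith.continuous (K := 1) (LipschitzWith.of_dist_le_mul fun T T' => ?_)
  rw [NNReal.coe_one, one_mul, Subtype.dist_eq, Subtype.dist_eq, dist_eq_norm, dist_eq_norm]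
  exact (hasSymbol_symbolHom hlam hℓ T).norm_sub_le (hasSymbol_symbolHom hlam hℓ T')

theorem surjective_symbolHom : Function.Surjective (symbolHom d hlam hℓ) := by
  rintro ⟨c, hc⟩
  refine ⟨⟨toeplitz (ℓ + d) lam (symbol lam (c.compContinuous (lastCoords ℓ d))), ?_⟩, ?_⟩
  · exact StarSubalgebra.le_topologicalClosure _ (StarAlgebra.subset_adjoin ℂ _ ⟨c, hc, rfl⟩)
  · exact symbolOf_eq hlam hℓ (a := ⟨c, hc⟩) (HasSymbol.toeplitz hc)

theorem tendstoUniformly_berezin (T : bigToeplitzAlg ℓ d lam) :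
    TendstoUniformly (fun (ρ : Fin m → ℕ) (z : 𝔹 d) => berezin (compress hlam hℓ
        (T : Bergman (ℓ + d) lam →L[ℂ] Bergman (ℓ + d) lam) (∑ j, ρ j)) z)
      (fun z => (symbolHom d hlam hℓ T : 𝔹 d →ᵇ ℂ) z)
      (comap (fun ρ : Fin m → ℕ => ∑ j, ρ j) atTop) := by
  rw [Metric.tendstoUniformly_iff]
  intro ε hε
  obtain ⟨P, hP⟩ := (hasSymbol_symbolHom hlam hℓ T).norm_berezin_sub_le (ε := ε / 2) (by positivity)
  refine (eventually_ge_atTop P).comap _ |>.mono fun ρ hρ z => ?_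
  rw [dist_comm, dist_eq_norm]
  exact (hP _ hρ z).trans_lt (by linarith)

/-- Evaluation at a character of `BUC`, as a representation of the large algebra. -/
theorem exists_character (η : WeakDual.characterSpace ℂ (BUC d)) :
    ∃ νη : bigToeplitzAlg ℓ d lam →⋆ₐ[ℂ] ℂ, Continuous νη ∧
      ∀ T, νη T = gelfandStarTransform (BUC d) (symbolHom d hlam hℓ T) η := by
  refine ⟨((ContinuousMap.evalStarAlgHom ℂ ℂ η).comp
    (gelfandStarTransform (BUC d) : BUC d →⋆ₐ[ℂ] C(WeakDual.characterSpace ℂ (BUC d), ℂ))).comp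
      (symbolHom d hlam hℓ), ?_, fun T => rfl⟩
  exact (map_continuous η).comp (continuous_symbolHom hlam hℓ)

end DirectSum

end WeightedBergman

namespace WeightedBergman

/-! ### Local estimates for holomorphic functions -/

section Local

variable {d : ℕ} {μ : ℝ}

/-- The open ball of radius `t` about `x` in the Bergman metric. -/
def bergmanBall (x : 𝔹 d) (t : ℝ) : Set (𝔹 d) := {w | bergmanDist x w < t}

theorem isOpen_bergmanBall (x : 𝔹 d) (t : ℝ) : IsOpen (bergmanBall x t) :=
  isOpen_lt (continuous_bergmanDist_right x) continuous_const

theorem measurableSet_bergmanBall (x : 𝔹 d) (t : ℝ) : MeasurableSet (bergmanBall x t) :=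
  (isOpen_bergmanBall x t).measurableSet

theorem ballMobius_mem_bergmanBall {x w : 𝔹 d} {t : ℝ} :
    ballMobius x w ∈ bergmanBall x t ↔ w ∈ bergmanBall (origin d) t := by
  have h := bergmanDist_ballMobius x (origin d) w
  rw [ballMobius_origin] at h
  change bergmanDist _ _ < t ↔ bergmanDist _ _ < t
  rw [h]

theorem tanh_strictMono : StrictMono Real.tanh := fun s t h => by
  rw [← Real.artanh_lt_artanh_iff ⟨Real.neg_one_lt_tanh s, Real.tanh_lt_one s⟩
    ⟨Real.neg_one_lt_tanh t, Real.tanh_lt_one t⟩]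
  rwa [Real.artanh_tanh, Real.artanh_tanh]

theorem bergmanBall_origin (t : ℝ) :
    bergmanBall (origin d) t = {w : 𝔹 d | ‖(w : Cn d)‖ < Real.tanh t} := by
  ext w
  exact (norm_lt_tanh_iff w t).symm

/-- By the mean value inequality, point values on a ball are dominated by the `L²`-norm on a larger
one. -/
theorem exists_eval_bound_ball (hμ : -1 < μ) {R R₁ : ℝ} (hR : R < R₁) (hR₁ : R₁ < 1) :
    ∃ C : ℝ, 0 ≤ C ∧ ∀ g : Cn d → ℂ, DifferentiableOn ℂ g (Metric.ball 0 1) →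
      ∀ z : Cn d, ‖z‖ ≤ R → ‖g z‖ₑ ^ 2 ≤
        ENNReal.ofReal C * ∫⁻ w in {w : 𝔹 d | ‖(w : Cn d)‖ < R₁}, ‖g w‖ₑ ^ 2 ∂vol d μ := by
  set r : ℝ := R₁ - R with hr
  have hr0 : 0 < r := sub_pos.2 hR
  obtain ⟨δ, hδ, hw⟩ := exists_weight_ge (d := d) (volConst_pos d hμ) hR₁
  set V := volume (Metric.ball (0 : Cn d) r) with hV
  have hV0 : V ≠ 0 := (Metric.measure_ball_pos _ _ hr0).ne'
  have hVt : V ≠ ∞ := measure_ball_lt_top.ne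
  have hδ0 : ENNReal.ofReal δ ≠ 0 := by simpa using hδ
  have hCt : (ENNReal.ofReal δ)⁻¹ * V⁻¹ ≠ ∞ :=
    ENNReal.mul_ne_top (by simpa using hδ) (by simpa using hV0)
  refine ⟨((ENNReal.ofReal δ)⁻¹ * V⁻¹).toReal, ENNReal.toReal_nonneg, fun g hg z hz => ?_⟩
  rw [ENNReal.ofReal_toReal hCt]
  have hsub : ∀ w ∈ Metric.ball z r, ‖w‖ < R₁ := by
    intro w hw
    have : ‖w‖ ≤ ‖w - z‖ + ‖z‖ := by simpa using norm_add_le (w - z) z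
    rw [mem_ball_iff_norm] at hw
    linarith
  have hsub' : Metric.ball z r ⊆ Metric.ball (0 : Cn d) 1 := by
    intro w hw
    have := hsub w hw
    rw [mem_ball_zero_iff]; linarith
  have h1 := enorm_mul_volume_le (hg.pow 2) hsub'
  have hset : MeasurableSet {w : 𝔹 d | ‖(w : Cn d)‖ < R₁} :=
    measurableSet_lt (by fun_prop) measurable_const
  have hm : Measurable fun w : 𝔹 d => ‖g w‖ₑ ^ 2 :=
    ((continuous_enorm.comp (Holo.continuous ⟨g, hg, fun _ => rfl⟩)).measurable).pow_const 2
  have h2 : ∫⁻ w in {w : 𝔹 d | ‖(w : Cn d)‖ < R₁}, ‖g w‖ₑ ^ 2 ∂vol d μ =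
      ∫⁻ w in Metric.ball (0 : Cn d) 1, ENNReal.ofReal (weight d μ w) *
        ({w : Cn d | ‖w‖ < R₁}.indicator (fun w => ‖g w‖ₑ ^ 2) w) := by
    rw [← lintegral_indicator hset]
    exact lintegral_vol (f := {w : Cn d | ‖w‖ < R₁}.indicator (fun w => ‖g w‖ₑ ^ 2))
      (hm.indicator hset)
  have h3 : ENNReal.ofReal δ * ∫⁻ w in Metric.ball z r, ‖g w‖ₑ ^ 2 ≤
      ∫⁻ w in {w : 𝔹 d | ‖(w : Cn d)‖ < R₁}, ‖g w‖ₑ ^ 2 ∂vol d μ := by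
    rw [h2, ← lintegral_const_mul' _ _ ENNReal.ofReal_ne_top]
    refine le_trans ?_ (lintegral_mono_set hsub')
    refine setLIntegral_mono' measurableSet_ball fun w hw' => ?_
    rw [Set.indicator_of_mem (show w ∈ {w : Cn d | ‖w‖ < R₁} from hsub w hw')]
    gcongr
    exact hw w (hsub w hw').le
  calc ‖g z‖ₑ ^ 2 = V⁻¹ * (‖g z ^ 2‖ₑ * V) := by
        rw [enorm_pow, mul_comm _ V, ← mul_assoc, ENNReal.inv_mul_cancel hV0 hVt, one_mul]
    _ ≤ V⁻¹ * ∫⁻ w in Metric.ball z r, ‖g w‖ₑ ^ 2 := by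
        gcongr
        simpa [enorm_pow] using h1
    _ = (ENNReal.ofReal δ)⁻¹ * V⁻¹ *
          (ENNReal.ofReal δ * ∫⁻ w in Metric.ball z r, ‖g w‖ₑ ^ 2) := by
        rw [mul_comm _ V⁻¹, mul_assoc, ← mul_assoc _ (ENNReal.ofReal δ),
          ENNReal.inv_mul_cancel hδ0 ENNReal.ofReal_ne_top, one_mul]
    _ ≤ _ := by gcongr

/-- The integral of `|f|²` with respect to `v_μ` over a ball of the Bergman metric. -/
noncomputable def localMass (μ : ℝ) (f : 𝔹 d → ℂ) (x : 𝔹 d) (t : ℝ) : ℝ≥0∞ :=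
  ∫⁻ w in bergmanBall x t, ‖f w‖ₑ ^ 2 ∂vol d μ

/-- The function `(1 - |z|²)^{d+μ+1} |f(z)|²`, which is `|⟨k_z, f⟩|²` when `f ∈ A²_μ`. -/
noncomputable def kernelSq (μ : ℝ) (f : 𝔹 d → ℂ) (z : 𝔹 d) : ℝ :=
  (1 - ‖(z : Cn d)‖ ^ 2) ^ ((d : ℝ) + μ + 1) * ‖f z‖ ^ 2

/-- The function `(f ∘ φ_x) k_x`: the image of `f` under the unitary operator on `A²_μ` induced by
the automorphism `φ_x`. -/
noncomputable def pullback (μ : ℝ) (x : 𝔹 d) (f : 𝔹 d → ℂ) : 𝔹 d → ℂ := fun w =>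
  kernelFun d μ x w * f (ballMobius x w)

theorem Holo.mul {f g : 𝔹 d → ℂ} (hf : Holo f) (hg : Holo g) : Holo fun z => f z * g z := by
  obtain ⟨F, hF, hfF⟩ := hf
  obtain ⟨G, hG, hgG⟩ := hg
  exact ⟨fun z => F z * G z, hF.mul hG, fun z => by simp only [hfF, hgG]⟩

theorem Holo.pullback {f : 𝔹 d → ℂ} (hf : Holo f) (μ : ℝ) (x : 𝔹 d) :
    Holo (WeightedBergman.pullback μ x f) :=
  (holo_kernelFun μ x).mul (hf.comp_ballMobius x)

/-- By this lemma and the next, estimates near a point `x` reduce to estimates near the origin. -/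
theorem localMass_pullback (f : 𝔹 d → ℂ) (x : 𝔹 d) (t : ℝ) :
    localMass μ (pullback μ x f) (origin d) t = localMass μ f x t := by
  rw [localMass, localMass, ← lintegral_indicator (measurableSet_bergmanBall _ _),
    ← lintegral_indicator (measurableSet_bergmanBall _ _),
    ← lintegral_vol_ballMobius μ x (Set.indicator (bergmanBall x t) _)]
  refine lintegral_congr fun w => ?_
  by_cases h : w ∈ bergmanBall (origin d) t
  · rw [Set.indicator_of_mem h, Set.indicator_of_mem (ballMobius_mem_bergmanBall.2 h), pullback,
      enorm_mul, mul_pow, mul_comm]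
  · rw [Set.indicator_of_notMem h,
      Set.indicator_of_notMem (fun h' => h (ballMobius_mem_bergmanBall.1 h')), zero_mul]

theorem kernelSq_pullback (f : 𝔹 d → ℂ) (x ξ : 𝔹 d) :
    kernelSq μ (pullback μ x f) ξ = kernelSq μ f (ballMobius x ξ) := by
  rw [kernelSq, kernelSq, one_sub_norm_ballMobius_rpow, pullback, norm_mul]
  ring

theorem kernelSq_nonneg (f : 𝔹 d → ℂ) (z : 𝔹 d) : 0 ≤ kernelSq μ f z :=
  mul_nonneg (Real.rpow_nonneg (one_sub_norm_sq_pos z).le _) (sq_nonneg _)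

theorem norm_sq_le_of_enorm_sq_le {a : ℂ} {C : ℝ} (hC : 0 ≤ C) {L : ℝ≥0∞} (hL : L ≠ ∞)
    (h : ‖a‖ₑ ^ 2 ≤ ENNReal.ofReal C * L) : ‖a‖ ^ 2 ≤ C * L.toReal := by
  have h1 := ENNReal.toReal_mono (ENNReal.mul_ne_top ENNReal.ofReal_ne_top hL) h
  rwa [ENNReal.toReal_pow, toReal_enorm, ENNReal.toReal_mul, ENNReal.toReal_ofReal hC] at h1

/-- The functions `|⟨k_x, f⟩|²` are dominated by the mass of `f` near `x`, uniformly in `x`. -/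
theorem exists_kernelSq_le (d : ℕ) (hμ : -1 < μ) : ∃ C : ℝ, 0 ≤ C ∧ ∀ f : 𝔹 d → ℂ, Holo f →
    ∀ x : 𝔹 d, localMass μ f x 1 ≠ ∞ → kernelSq μ f x ≤ C * (localMass μ f x 1).toReal := by
  obtain ⟨C, hC, h⟩ := exists_eval_bound_ball (d := d) hμ (R := 0) (R₁ := Real.tanh 1)
    (by simpa using tanh_strictMono one_pos) (Real.tanh_lt_one 1)
  refine ⟨C, hC, fun f hf x hfin => ?_⟩
  obtain ⟨g, hg, hgf⟩ := hf.pullback μ x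
  have h1 := h g hg 0 (by simp)
  rw [← bergmanBall_origin] at h1
  have h2 : ∫⁻ w in bergmanBall (origin d) 1, ‖g w‖ₑ ^ 2 ∂vol d μ = localMass μ f x 1 := by
    rw [← localMass_pullback]
    exact lintegral_congr fun w => by rw [hgf]
  rw [h2] at h1
  have h3 := kernelSq_pullback (μ := μ) f x (origin d)
  rw [ballMobius_origin, kernelSq, coe_origin, hgf, coe_origin] at h3
  rw [← h3]
  simpa using norm_sq_le_of_enorm_sq_le hC hfin h1

/-- The family of the functions `(1 - |ξ|²)^{d+μ+1} |f(ξ)|²` with `f` bounded in `L²` near the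
origin is uniformly equicontinuous, by the Schwarz lemma. -/
theorem exists_modulus_ball (hμ : -1 < μ) {R R₁ : ℝ} (hR : R < R₁) (hR₁ : R₁ < 1) {ε : ℝ}
    (hε : 0 < ε) :
    ∃ δ > 0, ∀ f : 𝔹 d → ℂ, Holo f →
      ∫⁻ w in {w : 𝔹 d | ‖(w : Cn d)‖ < R₁}, ‖f w‖ₑ ^ 2 ∂vol d μ ≠ ∞ →
      ∀ ξ ξ' : 𝔹 d, ‖(ξ : Cn d)‖ ≤ R → ‖(ξ' : Cn d)‖ ≤ R → ‖(ξ : Cn d) - ξ'‖ < δ →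
        |kernelSq μ f ξ - kernelSq μ f ξ'| ≤
          ε * (∫⁻ w in {w : 𝔹 d | ‖(w : Cn d)‖ < R₁}, ‖f w‖ₑ ^ 2 ∂vol d μ).toReal := by
  set r : ℝ := (R₁ - R) / 2 with hr
  have hr0 : 0 < r := by rw [hr]; linarith
  obtain ⟨C, hC, hev⟩ := exists_eval_bound_ball (d := d) hμ (R := R + r) (R₁ := R₁)
    (by rw [hr]; linarith) hR₁
  have hD : 0 ≤ (d : ℝ) + μ + 1 := by linarith [Nat.cast_nonneg (α := ℝ) d]
  set W : Cn d → ℝ := fun z => (1 - ‖z‖ ^ 2) ^ ((d : ℝ) + μ + 1) with hW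
  have hWc : ContinuousOn W (Metric.closedBall 0 R) := by
    refine ContinuousOn.rpow_const (by fun_prop) fun z _ => Or.inr hD
  obtain ⟨δ₀, hδ₀, hunif⟩ := Metric.uniformContinuousOn_iff.1
    ((isCompact_closedBall (0 : Cn d) R).uniformContinuousOn_of_continuous hWc)
    (ε / (2 * (C + 1))) (by positivity)
  refine ⟨min (min δ₀ r) (ε * r / (8 * (C + 1))), by positivity, fun f hf hfin ξ ξ' hξ hξ' hd => ?_⟩
  set L := (∫⁻ w in {w : 𝔹 d | ‖(w : Cn d)‖ < R₁}, ‖f w‖ₑ ^ 2 ∂vol d μ).toReal with hL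
  have hL0 : 0 ≤ L := ENNReal.toReal_nonneg
  obtain ⟨g, hg, hgf⟩ := hf
  simp only [hgf] at hfin hL
  set M := Real.sqrt (C * L) with hM
  have hMsq : M ^ 2 = C * L := Real.sq_sqrt (by positivity)
  have hbound : ∀ z : Cn d, ‖z‖ ≤ R + r → ‖g z‖ ≤ M := by
    intro z hz
    refine Real.le_sqrt_of_sq_le ?_
    rw [hL]
    exact norm_sq_le_of_enorm_sq_le hC hfin (hev g hg z hz)
  have hd1 : ‖(ξ : Cn d) - ξ'‖ < r := hd.trans_le ((min_le_left _ _).trans (min_le_right _ _))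
  have hd2 : ‖(ξ : Cn d) - ξ'‖ < δ₀ := hd.trans_le ((min_le_left _ _).trans (min_le_left _ _))
  have hd3 : ‖(ξ : Cn d) - ξ'‖ < ε * r / (8 * (C + 1)) := hd.trans_le (min_le_right _ _)
  have hnear : ∀ z ∈ Metric.ball (ξ' : Cn d) r, ‖z‖ ≤ R + r := by
    intro z hz
    rw [mem_ball_iff_norm] at hz
    have : ‖z‖ ≤ ‖z - ξ'‖ + ‖(ξ' : Cn d)‖ := by simpa using norm_add_le (z - ξ') (ξ' : Cn d)
    linarith
  have hRr : R + r < 1 := by rw [hr]; linarith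
  -- on the ball of radius `r` about `ξ'` the function `g` differs from `g ξ'` by at most `2 M`
  have hschwarz := Complex.dist_le_div_mul_dist_of_mapsTo_ball (f := g) (c := (ξ' : Cn d))
    (R₁ := r) (R₂ := 2 * M) (z := ξ)
    (hg.mono fun z hz => mem_ball_zero_iff.2 ((hnear z hz).trans_lt hRr))
    (fun z hz => by
      rw [mem_closedBall_iff_norm]
      have h1 := hbound z (hnear z hz)
      have h2 := hbound ξ' (by linarith)
      have h3 := norm_sub_le (g z) (g ξ')
      linarith) (mem_ball_iff_norm.2 hd1)
  rw [dist_eq_norm, dist_eq_norm] at hschwarz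
  have hwdiff := hunif ξ (mem_closedBall_zero_iff.2 hξ) ξ' (mem_closedBall_zero_iff.2 hξ')
    (by rwa [dist_eq_norm])
  rw [Real.dist_eq] at hwdiff
  have hW0 : 0 ≤ W ξ := Real.rpow_nonneg (one_sub_norm_sq_pos ξ).le _
  have hW1 : W ξ ≤ 1 :=
    Real.rpow_le_one (one_sub_norm_sq_pos ξ).le (by nlinarith [sq_nonneg ‖(ξ : Cn d)‖]) hD
  have hM0 : 0 ≤ M := Real.sqrt_nonneg _
  have b1 := hbound ξ (by linarith)
  have b2 := hbound ξ' (by linarith)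
  have hsq : |‖g ξ‖ ^ 2 - ‖g ξ'‖ ^ 2| ≤ ε / 2 * L := by
    have e1 : ‖g ξ‖ ^ 2 - ‖g ξ'‖ ^ 2 = (‖g ξ‖ - ‖g ξ'‖) * (‖g ξ‖ + ‖g ξ'‖) := by ring
    rw [e1, abs_mul, abs_of_nonneg (a := ‖g ξ‖ + ‖g ξ'‖) (by positivity)]
    have e2 : |‖g ξ‖ - ‖g ξ'‖| ≤ 2 * M / r * ‖(ξ : Cn d) - ξ'‖ :=
      (abs_norm_sub_norm_le _ _).trans hschwarz
    calc |‖g ξ‖ - ‖g ξ'‖| * (‖g ξ‖ + ‖g ξ'‖)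
        ≤ (2 * M / r * ‖(ξ : Cn d) - ξ'‖) * (2 * M) := by
          refine mul_le_mul e2 (by linarith) (by positivity) (by positivity)
      _ = 4 * (C * L) / r * ‖(ξ : Cn d) - ξ'‖ := by rw [← hMsq]; ring
      _ ≤ 4 * (C * L) / r * (ε * r / (8 * (C + 1))) := by gcongr
      _ = ε / 2 * L * (C / (C + 1)) := by
          field_simp
          ring
      _ ≤ ε / 2 * L * 1 := by
          gcongr
          rw [div_le_one (by positivity)]
          linarith
      _ = _ := mul_one _
  have hsq' : ‖g ξ'‖ ^ 2 ≤ C * L := by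
    rw [← hMsq]
    gcongr
  have hmain : |W ξ * ‖g ξ‖ ^ 2 - W ξ' * ‖g ξ'‖ ^ 2| ≤ ε * L := by
    have e1 : W ξ * ‖g ξ‖ ^ 2 - W ξ' * ‖g ξ'‖ ^ 2 =
        W ξ * (‖g ξ‖ ^ 2 - ‖g ξ'‖ ^ 2) + (W ξ - W ξ') * ‖g ξ'‖ ^ 2 := by ring
    rw [e1]
    refine (abs_add_le _ _).trans ?_
    rw [abs_mul, abs_mul, abs_of_nonneg hW0, abs_of_nonneg (sq_nonneg ‖g ξ'‖)]
    have e2 : W ξ * |‖g ξ‖ ^ 2 - ‖g ξ'‖ ^ 2| ≤ 1 * (ε / 2 * L) :=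
      mul_le_mul hW1 hsq (abs_nonneg _) zero_le_one
    have e3 : |W ξ - W ξ'| * ‖g ξ'‖ ^ 2 ≤ ε / (2 * (C + 1)) * (C * L) :=
      mul_le_mul hwdiff.le hsq' (sq_nonneg _) (by positivity)
    have e4 : ε / (2 * (C + 1)) * (C * L) ≤ ε / 2 * L := by
      have : ε / (2 * (C + 1)) * (C * L) = ε / 2 * L * (C / (C + 1)) := by field_simp
      rw [this]
      refine mul_le_of_le_one_right (by positivity) ?_
      rw [div_le_one (by positivity)]
      linarith
    linarith
  simpa only [kernelSq, hgf, hW] using hmain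

/-- The functions `|⟨k_{φ_x(ξ)}, f⟩|²` of `ξ` are equicontinuous on compact sets, relative to the
mass of `f` near `x` and uniformly in `x`. -/
theorem exists_modulus (hμ : -1 < μ) (t : ℝ) {ε : ℝ} (hε : 0 < ε) :
    ∃ δ > 0, ∀ f : 𝔹 d → ℂ, Holo f → ∀ x : 𝔹 d, localMass μ f x (t + 1) ≠ ∞ →
      ∀ ξ ξ' : 𝔹 d, ‖(ξ : Cn d)‖ ≤ Real.tanh t → ‖(ξ' : Cn d)‖ ≤ Real.tanh t →
        ‖(ξ : Cn d) - ξ'‖ < δ →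
          |kernelSq μ f (ballMobius x ξ) - kernelSq μ f (ballMobius x ξ')| ≤
            ε * (localMass μ f x (t + 1)).toReal := by
  obtain ⟨δ, hδ, h⟩ := exists_modulus_ball (d := d) hμ (R := Real.tanh t)
    (R₁ := Real.tanh (t + 1)) (tanh_strictMono (lt_add_one t)) (Real.tanh_lt_one _) hε
  refine ⟨δ, hδ, fun f hf x hfin ξ ξ' hξ hξ' hd => ?_⟩
  have h1 := h _ (hf.pullback μ x)
  rw [← bergmanBall_origin] at h1
  change localMass μ _ _ _ ≠ ∞ → ∀ ξ ξ', _ → _ → _ → _ ≤ ε * (localMass μ _ _ _).toReal at h1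
  simp only [localMass_pullback, kernelSq_pullback] at h1
  exact h1 hfin ξ ξ' hξ hξ' hd

end Local

end WeightedBergman

namespace WeightedBergman

/-! ### Separated families and almost orthogonality of kernels -/

section Separated

variable {d : ℕ} {μ : ℝ} {ι : Type*}

/-- A family of points of the ball with mutual Bergman distances at least `R`. -/
def Separated (R : ℝ) (y : ι → 𝔹 d) : Prop := ∀ i j, i ≠ j → R ≤ bergmanDist (y i) (y j)

theorem Separated.mono {R R' : ℝ} {y : ι → 𝔹 d} (h : Separated R y) (hR : R' ≤ R) :
    Separated R' y := fun i j hij => hR.trans (h i j hij)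

theorem Separated.disjoint {t : ℝ} {y : ι → 𝔹 d} (h : Separated (2 * t) y) :
    Pairwise fun i j => Disjoint (bergmanBall (y i) t) (bergmanBall (y j) t) := by
  intro i j hij
  rw [Set.disjoint_left]
  intro w (hi : bergmanDist (y i) w < t) (hj : bergmanDist (y j) w < t)
  have h1 := bergmanDist_triangle (y i) w (y j)
  rw [bergmanDist_comm w] at h1
  linarith [h i j hij]

theorem Separated.sum_localMass_le {t : ℝ} {y : ι → 𝔹 d} (h : Separated (2 * t) y) (f : 𝔹 d → ℂ)
    (s : Finset ι) : ∑ i ∈ s, localMass μ f (y i) t ≤ ∫⁻ w, ‖f w‖ₑ ^ 2 ∂vol d μ := by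
  unfold localMass
  rw [← lintegral_biUnion_finset (fun i _ j _ hij => h.disjoint hij)
    fun i _ => measurableSet_bergmanBall _ _]
  exact setLIntegral_le_lintegral _ _

theorem localMass_le (f : 𝔹 d → ℂ) (x : 𝔹 d) (t : ℝ) :
    localMass μ f x t ≤ ∫⁻ w, ‖f w‖ₑ ^ 2 ∂vol d μ :=
  setLIntegral_le_lintegral _ _

theorem Separated.sum_toReal_localMass_le {t : ℝ} {y : ι → 𝔹 d} (h : Separated (2 * t) y)
    {f : 𝔹 d → ℂ} (hf : ∫⁻ w, ‖f w‖ₑ ^ 2 ∂vol d μ ≠ ∞) (s : Finset ι) :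
    ∑ i ∈ s, (localMass μ f (y i) t).toReal ≤ (∫⁻ w, ‖f w‖ₑ ^ 2 ∂vol d μ).toReal := by
  rw [← ENNReal.toReal_sum fun i _ => ne_top_of_le_ne_top hf (localMass_le f _ _)]
  exact ENNReal.toReal_mono hf (h.sum_localMass_le f s)

/-- Kernels at separated points form a Bessel sequence. -/
theorem exists_bessel (d : ℕ) (hμ : -1 < μ) : ∃ C : ℝ, 0 ≤ C ∧ ∀ {ι : Type} (y : ι → 𝔹 d),
    Separated 2 y → ∀ f : 𝔹 d → ℂ, Holo f → ∫⁻ w, ‖f w‖ₑ ^ 2 ∂vol d μ ≠ ∞ → ∀ s : Finset ι,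
      ∑ i ∈ s, kernelSq μ f (y i) ≤ C * (∫⁻ w, ‖f w‖ₑ ^ 2 ∂vol d μ).toReal := by
  obtain ⟨C, hC, h⟩ := exists_kernelSq_le d hμ
  refine ⟨C, hC, fun y hy f hf hfin s => ?_⟩
  have hy' : Separated (2 * 1) y := by rwa [mul_one]
  calc ∑ i ∈ s, kernelSq μ f (y i) ≤ ∑ i ∈ s, C * (localMass μ f (y i) 1).toReal :=
        Finset.sum_le_sum fun i _ => h f hf _ (ne_top_of_le_ne_top hfin (localMass_le f _ _))
    _ = C * ∑ i ∈ s, (localMass μ f (y i) 1).toReal := by rw [Finset.mul_sum]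
    _ ≤ _ := mul_le_mul_of_nonneg_left (hy'.sum_toReal_localMass_le hfin s) hC

/-- On the part `u/4 < s < u/2` of the range, where `u = |1 - q|`, the integrand is at
least a multiple of `u^{b-2D}`. -/
theorem rpow_neg_le_lintegral {D b : ℝ} (hD : 0 ≤ D) (hb : 0 ≤ b) {q : ℂ} (hq : ‖q‖ < 1) :
    ENNReal.ofReal (‖1 - q‖ ^ (b + 1 - 2 * D)) ≤
      ENNReal.ofReal (4 ^ (b + 1) * (3 / 2) ^ (2 * D)) *
        ∫⁻ s in Set.Ioo (0 : ℝ) 1, ENNReal.ofReal (s ^ b * ‖1 - (1 - s : ℝ) * q‖ ^ (-(2 * D))) := by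
  set u := ‖1 - q‖ with hu
  have hu0 : 0 < u := by
    rw [hu, norm_pos_iff, sub_ne_zero]
    rintro rfl
    simp at hq
  have hu2 : u < 2 := by
    have := norm_sub_le (1 : ℂ) q
    rw [norm_one] at this
    linarith
  have hlow : ENNReal.ofReal ((u / 4) ^ b * (3 / 2 * u) ^ (-(2 * D)) * (u / 4)) ≤
      ∫⁻ s in Set.Ioo (0 : ℝ) 1, ENNReal.ofReal (s ^ b * ‖1 - (1 - s : ℝ) * q‖ ^ (-(2 * D))) := by
    calc ENNReal.ofReal ((u / 4) ^ b * (3 / 2 * u) ^ (-(2 * D)) * (u / 4))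
        = ∫⁻ _ in Set.Ioo (u / 4) (u / 2),
            ENNReal.ofReal ((u / 4) ^ b * (3 / 2 * u) ^ (-(2 * D))) := by
          rw [setLIntegral_const, Real.volume_Ioo, ← ENNReal.ofReal_mul (by positivity)]
          congr 2
          ring
      _ ≤ ∫⁻ s in Set.Ioo (u / 4) (u / 2),
            ENNReal.ofReal (s ^ b * ‖1 - (1 - s : ℝ) * q‖ ^ (-(2 * D))) := by
          refine setLIntegral_mono' measurableSet_Ioo fun s hs => ENNReal.ofReal_le_ofReal ?_
          have hs0 : 0 < s := (by positivity : 0 < u / 4).trans hs.1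
          have hs1 : s < 1 := by linarith [hs.2]
          have h1 : ‖1 - (1 - s : ℝ) * q‖ ≤ 3 / 2 * u := by
            have e : 1 - ((1 - s : ℝ) : ℂ) * q = (1 - q) + (s : ℂ) * q := by push_cast; ring
            rw [e]
            refine (norm_add_le _ _).trans ?_
            rw [norm_mul, Complex.norm_real, Real.norm_of_nonneg hs0.le, ← hu]
            nlinarith [hs.2, norm_nonneg q]
          have h2 : 0 < ‖1 - ((1 - s : ℝ) : ℂ) * q‖ := by
            rw [norm_pos_iff, sub_ne_zero]
            intro h
            have := congrArg norm h
            rw [norm_one, norm_mul, Complex.norm_real, Real.norm_of_nonneg (by linarith)] at this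
            nlinarith [norm_nonneg q]
          refine mul_le_mul (Real.rpow_le_rpow (by positivity) hs.1.le hb)
            (Real.rpow_le_rpow_of_nonpos h2 h1 (by linarith)) (by positivity) (by positivity)
      _ ≤ _ := lintegral_mono_set
          (Set.Ioo_subset_Ioo (by positivity) (by linarith))
  refine le_trans (le_of_eq ?_) (mul_le_mul_right hlow _)
  rw [← ENNReal.ofReal_mul (by positivity)]
  congr 1
  rw [Real.div_rpow hu0.le (by norm_num), Real.mul_rpow (by norm_num) hu0.le,
    Real.rpow_neg (by norm_num), Real.rpow_neg hu0.le, Real.rpow_sub hu0, Real.rpow_add hu0,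
    Real.rpow_add (by norm_num : (0 : ℝ) < 4), Real.rpow_one, Real.rpow_one]
  have h4 : (0 : ℝ) < 4 ^ b := by positivity
  have h5 : (0 : ℝ) < (3 / 2) ^ (2 * D) := by positivity
  field_simp

/-- The integrals of `|1 - ⟨a, ξ⟩|^{-d}` with respect to `v_μ` are bounded uniformly in `a`. The
integrand is dominated by an integral over `s ∈ (0, 1)` of the normalized kernels at the points
`(1 - s) a`, whose norms are explicitly known. -/
theorem exists_lintegral_rpow_neg_le (hd : 1 ≤ d) (hμ : -1 < μ) : ∃ C : ℝ≥0∞, C ≠ ∞ ∧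
    ∀ a : 𝔹 d, ∫⁻ ξ : 𝔹 d, ENNReal.ofReal (‖1 - inner ℂ (a : Cn d) ξ‖ ^ (-(d : ℝ))) ∂vol d μ ≤
      C := by
  have hd1 : (1 : ℝ) ≤ d := by exact_mod_cast hd
  set D : ℝ := d + μ + 1 with hD
  set b : ℝ := d + 1 + 2 * μ with hb
  have hb0 : 0 ≤ b := by rw [hb]; linarith
  have hD0 : 0 < D := by rw [hD]; linarith
  have := isProbabilityMeasure_vol d hμ
  set K := ENNReal.ofReal (4 ^ (b + 1) * (3 / 2) ^ (2 * D)) with hK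
  have hfin : ∫⁻ s in Set.Ioo (0 : ℝ) 1, ENNReal.ofReal (s ^ μ) ≠ ∞ := by
    have h1 : IntegrableOn (fun s : ℝ => s ^ μ) (Set.Ioo 0 1) :=
      (intervalIntegral.integrableOn_Ioo_rpow_iff one_pos).2 hμ
    exact h1.lintegral_lt_top.ne
  refine ⟨K * ∫⁻ s in Set.Ioo (0 : ℝ) 1, ENNReal.ofReal (s ^ μ),
    ENNReal.mul_ne_top ENNReal.ofReal_ne_top hfin, fun a => ?_⟩
  have hq : ∀ ξ : 𝔹 d, ‖inner ℂ (a : Cn d) (ξ : Cn d)‖ < 1 := fun ξ => by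
    have h1 := norm_inner_le_norm (𝕜 := ℂ) (a : Cn d) ξ
    nlinarith [norm_coe_lt_one a, norm_coe_lt_one ξ, norm_nonneg (a : Cn d),
      norm_nonneg (ξ : Cn d)]
  have hexp : -(d : ℝ) = b + 1 - 2 * D := by rw [hb, hD]; ring
  have hmeas : Measurable (Function.uncurry fun (ξ : 𝔹 d) (s : ℝ) => ENNReal.ofReal
      (s ^ b * ‖1 - (1 - s : ℝ) * inner ℂ (a : Cn d) (ξ : Cn d)‖ ^ (-(2 * D)))) := by
    unfold Function.uncurry
    have h1 : Measurable fun p : 𝔹 d × ℝ => ‖1 - ((1 - p.2 : ℝ) : ℂ) *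
        inner ℂ (a : Cn d) (p.1 : Cn d)‖ := by
      refine Continuous.measurable ?_
      fun_prop
    exact ((measurable_snd.pow_const b).mul (h1.pow_const _)).ennreal_ofReal
  calc ∫⁻ ξ : 𝔹 d, ENNReal.ofReal (‖1 - inner ℂ (a : Cn d) ξ‖ ^ (-(d : ℝ))) ∂vol d μ
      ≤ ∫⁻ ξ : 𝔹 d, (K * ∫⁻ s in Set.Ioo (0 : ℝ) 1, ENNReal.ofReal
          (s ^ b * ‖1 - (1 - s : ℝ) * inner ℂ (a : Cn d) (ξ : Cn d)‖ ^ (-(2 * D)))) ∂vol d μ := by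
        refine lintegral_mono fun ξ => ?_
        rw [hexp]
        exact rpow_neg_le_lintegral hD0.le hb0 (hq ξ)
    _ = K * ∫⁻ s in Set.Ioo (0 : ℝ) 1, (∫⁻ ξ : 𝔹 d, ENNReal.ofReal
          (s ^ b * ‖1 - (1 - s : ℝ) * inner ℂ (a : Cn d) (ξ : Cn d)‖ ^ (-(2 * D))) ∂vol d μ) := by
        rw [lintegral_const_mul' _ _ ENNReal.ofReal_ne_top,
          lintegral_lintegral_swap hmeas.aemeasurable]
    _ ≤ K * ∫⁻ s in Set.Ioo (0 : ℝ) 1, ENNReal.ofReal (s ^ μ) := by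
        refine mul_le_mul_right (setLIntegral_mono' measurableSet_Ioo fun s hs => ?_) _
        have hs1 : 0 < 1 - s := by linarith [hs.2]
        have hn : ‖((1 - s : ℝ) : ℂ) • (a : Cn d)‖ = (1 - s) * ‖(a : Cn d)‖ := by
          rw [norm_smul, Complex.norm_real, Real.norm_of_nonneg hs1.le]
        have hlt : ‖((1 - s : ℝ) : ℂ) • (a : Cn d)‖ < 1 := by
          rw [hn]
          nlinarith [norm_coe_lt_one a, hs.1]
        set z : 𝔹 d := ⟨((1 - s : ℝ) : ℂ) • (a : Cn d), mem_ball_zero_iff.2 hlt⟩ with hz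
        have hz2 := one_sub_norm_sq_pos z
        have hker : ∀ ξ : 𝔹 d, ENNReal.ofReal
            (s ^ b * ‖1 - (1 - s : ℝ) * inner ℂ (a : Cn d) (ξ : Cn d)‖ ^ (-(2 * D))) =
            ENNReal.ofReal (s ^ b * (1 - ‖(z : Cn d)‖ ^ 2) ^ (-D)) *
              ‖kernelFun d μ z ξ‖ₑ ^ 2 := by
          intro ξ
          have e : inner ℂ (z : Cn d) (ξ : Cn d) =
              (1 - s : ℝ) * inner ℂ (a : Cn d) (ξ : Cn d) := by
            rw [hz, inner_smul_left, Complex.conj_ofReal]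
          have hne := norm_pos_iff.2 (one_sub_inner_ne_zero (norm_coe_lt_one z) (norm_coe_lt_one ξ))
          rw [← ofReal_norm_sq_eq, ← ENNReal.ofReal_mul
            (mul_nonneg (Real.rpow_nonneg hs.1.le _) (Real.rpow_nonneg hz2.le _)),
            norm_kernelFun_sq, e, ← hD, Real.rpow_neg hz2.le, Real.rpow_neg (norm_nonneg _)]
          congr 1
          have := (Real.rpow_pos_of_pos hz2 D).ne'
          field_simp
        rw [lintegral_congr hker, lintegral_const_mul' _ _ ENNReal.ofReal_ne_top,
          lintegral_kernelFun_sq hμ, mul_one]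
        refine ENNReal.ofReal_le_ofReal ?_
        have h1 : s ≤ 1 - ‖(z : Cn d)‖ ^ 2 := by
          have e : ‖(z : Cn d)‖ = (1 - s) * ‖(a : Cn d)‖ := hn
          rw [e]
          have h2 : ((1 - s) * ‖(a : Cn d)‖) ^ 2 ≤ (1 - s) ^ 2 := by
            rw [mul_pow]
            refine mul_le_of_le_one_right (sq_nonneg _) ?_
            nlinarith [norm_coe_lt_one a, norm_nonneg (a : Cn d)]
          nlinarith [hs.1]
        calc s ^ b * (1 - ‖(z : Cn d)‖ ^ 2) ^ (-D) ≤ s ^ b * s ^ (-D) :=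
              mul_le_mul_of_nonneg_left
                (Real.rpow_le_rpow_of_nonpos hs.1 h1 (by linarith)) (Real.rpow_nonneg hs.1.le _)
          _ = s ^ μ := by
              rw [← Real.rpow_add hs.1]
              congr 1
              rw [hb, hD]; ring

end Separated

end WeightedBergman

namespace WeightedBergman

section AlmostOrthogonal

variable {d : ℕ} {μ : ℝ}

open Classical in
/-- Schur's test for the Gram matrix of a family of unit vectors. -/
theorem abs_norm_sum_sq_sub_le {H ι : Type*} [NormedAddCommGroup H] [InnerProductSpace ℂ H]
    {v : ι → H} (hv : ∀ i, ‖v i‖ = 1) {w : ι → ℝ} (hw : ∀ i, 0 < w i) {η : ℝ} {s : Finset ι}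
    (h : ∀ i ∈ s, ∑ j ∈ s with j ≠ i, ‖inner ℂ (v i) (v j)‖ * w j ≤ η * w i) (a : ι → ℂ) :
    |‖∑ i ∈ s, a i • v i‖ ^ 2 - ∑ i ∈ s, ‖a i‖ ^ 2| ≤ η * ∑ i ∈ s, ‖a i‖ ^ 2 := by
  set G : ι → ι → ℝ := fun i j => if j ≠ i then ‖inner ℂ (v i) (v j)‖ else 0 with hG
  have hG0 : ∀ i j, 0 ≤ G i j := fun i j => by
    simp only [hG]; split_ifs <;> positivity
  have hGs : ∀ i j, G i j = G j i := fun i j => by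
    simp only [hG, norm_inner_symm (v i), ne_comm (a := i)]
  have hrow : ∀ i ∈ s, ∑ j ∈ s, G i j * w j ≤ η * w i := fun i hi => by
    refine le_of_eq_of_le ?_ (h i hi)
    rw [Finset.sum_filter]
    refine Finset.sum_congr rfl fun j _ => ?_
    simp only [hG, ite_mul, zero_mul]
  have hexp : ((‖∑ i ∈ s, a i • v i‖ ^ 2 - ∑ i ∈ s, ‖a i‖ ^ 2 : ℝ) : ℂ) =
      ∑ i ∈ s, ∑ j ∈ s, if j ≠ i then starRingEnd ℂ (a i) * a j * inner ℂ (v i) (v j) else 0 := by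
    have e1 : ((‖∑ i ∈ s, a i • v i‖ ^ 2 : ℝ) : ℂ) =
        ∑ i ∈ s, ∑ j ∈ s, starRingEnd ℂ (a i) * a j * inner ℂ (v i) (v j) := by
      have h1 := inner_self_eq_norm_sq_to_K (𝕜 := ℂ) (∑ i ∈ s, a i • v i)
      rw [Complex.ofReal_pow]
      refine h1.symm.trans ?_
      rw [sum_inner]
      refine Finset.sum_congr rfl fun i _ => ?_
      rw [inner_sum]
      refine Finset.sum_congr rfl fun j _ => ?_
      rw [inner_smul_left, inner_smul_right]
      ring
    have e2 : ((∑ i ∈ s, ‖a i‖ ^ 2 : ℝ) : ℂ) = ∑ i ∈ s, ∑ j ∈ s,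
        if j = i then starRingEnd ℂ (a i) * a j * inner ℂ (v i) (v j) else 0 := by
      rw [Complex.ofReal_sum]
      refine Finset.sum_congr rfl fun i hi => ?_
      rw [Finset.sum_ite_eq' s i, if_pos hi, inner_self_eq_norm_sq_to_K, hv]
      rw [Complex.conj_mul']
      simp
    rw [Complex.ofReal_sub, e1, e2, ← Finset.sum_sub_distrib]
    refine Finset.sum_congr rfl fun i _ => ?_
    rw [← Finset.sum_sub_distrib]
    refine Finset.sum_congr rfl fun j _ => ?_
    by_cases hij : j = i <;> simp [hij]
  -- the inequality of the arithmetic and geometric means, weighted by `w j / w i`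
  have hterm : ∀ i j, ‖(if j ≠ i then starRingEnd ℂ (a i) * a j * inner ℂ (v i) (v j) else 0 : ℂ)‖ ≤
      (‖a i‖ ^ 2 / w i * (G i j * w j) + ‖a j‖ ^ 2 / w j * (G j i * w i)) / 2 := by
    intro i j
    have e : ‖(if j ≠ i then starRingEnd ℂ (a i) * a j * inner ℂ (v i) (v j) else 0 : ℂ)‖ =
        ‖a i‖ * ‖a j‖ * G i j := by
      by_cases hij : j = i
      · simp [hG, hij]
      · simp [hG, hij]
    rw [e, hGs j i]
    have h1 := hw i
    have h2 := hw j
    have h3 : 2 * (‖a i‖ * ‖a j‖) ≤ ‖a i‖ ^ 2 / w i * w j + ‖a j‖ ^ 2 / w j * w i := by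
      have h4 : ‖a i‖ ^ 2 / w i * w j + ‖a j‖ ^ 2 / w j * w i - 2 * (‖a i‖ * ‖a j‖) =
          (‖a i‖ * w j - ‖a j‖ * w i) ^ 2 / (w i * w j) := by
        field_simp
        ring
      have h5 : 0 ≤ (‖a i‖ * w j - ‖a j‖ * w i) ^ 2 / (w i * w j) := by positivity
      linarith
    nlinarith [mul_le_mul_of_nonneg_right h3 (hG0 i j)]
  rw [← Real.norm_eq_abs, ← Complex.norm_real, hexp]
  calc ‖∑ i ∈ s, ∑ j ∈ s, if j ≠ i then starRingEnd ℂ (a i) * a j * inner ℂ (v i) (v j) else 0‖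
      ≤ ∑ i ∈ s, ∑ j ∈ s,
          (‖a i‖ ^ 2 / w i * (G i j * w j) + ‖a j‖ ^ 2 / w j * (G j i * w i)) / 2 :=
        norm_sum_le_of_le _ fun i _ => norm_sum_le_of_le _ fun j _ => hterm i j
    _ = ∑ i ∈ s, ‖a i‖ ^ 2 / w i * ∑ j ∈ s, G i j * w j := by
        have e1 : ∑ i ∈ s, ∑ j ∈ s, ‖a j‖ ^ 2 / w j * (G j i * w i) =
            ∑ i ∈ s, ∑ j ∈ s, ‖a i‖ ^ 2 / w i * (G i j * w j) := Finset.sum_comm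
        simp only [← Finset.sum_div, Finset.sum_add_distrib]
        rw [e1, add_self_div_two]
        simp only [Finset.mul_sum]
    _ ≤ ∑ i ∈ s, ‖a i‖ ^ 2 / w i * (η * w i) := by
        refine Finset.sum_le_sum fun i hi => mul_le_mul_of_nonneg_left (hrow i hi) ?_
        have := hw i
        positivity
    _ = η * ∑ i ∈ s, ‖a i‖ ^ 2 := by
        rw [Finset.mul_sum]
        refine Finset.sum_congr rfl fun i _ => ?_
        have := (hw i).ne'
        field_simp

/-- The change of variables `w = φ_x(ξ)` leads to `exists_lintegral_rpow_neg_le`. -/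
theorem exists_lintegral_kernelFun_le (hd : 1 ≤ d) {κ : ℝ} (hκ : -1 < κ) : ∃ C : ℝ, 0 ≤ C ∧
    ∀ x : 𝔹 d, ∫⁻ w, ‖kernelFun d (κ - d / 2) x w‖ₑ ^ 2 ∂vol d κ ≤
      ENNReal.ofReal (C * (1 - ‖(x : Cn d)‖ ^ 2) ^ ((d : ℝ) / 2)) := by
  obtain ⟨C, hC, h⟩ := exists_lintegral_rpow_neg_le hd hκ
  refine ⟨C.toReal, ENNReal.toReal_nonneg, fun x => ?_⟩
  have hx := one_sub_norm_sq_pos x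
  rw [mul_comm, ENNReal.ofReal_mul (Real.rpow_nonneg hx.le _), ENNReal.ofReal_toReal hC,
    ← lintegral_vol_ballMobius κ x]
  have key : ∀ ξ : 𝔹 d, ‖kernelFun d (κ - d / 2) x (ballMobius x ξ)‖ₑ ^ 2 *
      ‖kernelFun d κ x ξ‖ₑ ^ 2 = ENNReal.ofReal ((1 - ‖(x : Cn d)‖ ^ 2) ^ ((d : ℝ) / 2)) *
        ENNReal.ofReal (‖1 - inner ℂ (x : Cn d) ξ‖ ^ (-(d : ℝ))) := by
    intro ξ
    have hu := norm_pos_iff.2 (one_sub_inner_ne_zero (norm_coe_lt_one x) (norm_coe_lt_one ξ))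
    have e1 : ‖1 - inner ℂ (x : Cn d) (ballMobius x ξ : Cn d)‖ =
        (1 - ‖(x : Cn d)‖ ^ 2) / ‖1 - inner ℂ (x : Cn d) (ξ : Cn d)‖ := by
      rw [coe_ballMobius, one_sub_inner_mobius (norm_coe_lt_one x) (norm_coe_lt_one ξ), norm_div,
        ← ofReal_sqrt_sq (norm_coe_lt_one x), norm_pow, Complex.norm_real, Real.norm_eq_abs,
        sq_abs, Real.sq_sqrt hx.le]
    rw [← ofReal_norm_sq_eq, ← ofReal_norm_sq_eq, ← ENNReal.ofReal_mul (sq_nonneg _),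
      ← ENNReal.ofReal_mul (Real.rpow_nonneg hx.le _), norm_kernelFun_sq, norm_kernelFun_sq, e1]
    congr 1
    rw [Real.rpow_def_of_pos hx, Real.rpow_def_of_pos hx, Real.rpow_def_of_pos hx,
      Real.rpow_def_of_pos hu, Real.rpow_def_of_pos hu, Real.rpow_def_of_pos (div_pos hx hu),
      Real.log_div hx.ne' hu.ne', ← Real.exp_sub, ← Real.exp_sub, ← Real.exp_add, ← Real.exp_add]
    congr 1
    ring
  rw [lintegral_congr key, lintegral_const_mul' _ _ ENNReal.ofReal_ne_top]
  exact mul_le_mul_right (h x) _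

/-- The row estimate for Schur's test, with the weights `(1 - |y|²)^{d/2}`. It is the Bessel
inequality for the weight `κ`, applied to the kernel at `x` for the weight `κ - d/2`. -/
theorem exists_sum_rpow_le (hd : 1 ≤ d) {κ : ℝ} (hκ : -1 < κ) : ∃ C : ℝ, 0 ≤ C ∧
    ∀ {ι : Type} (y : ι → 𝔹 d), Separated 2 y → ∀ (x : 𝔹 d) (s : Finset ι),
      ∑ j ∈ s, (1 - ‖(ballMobius x (y j) : Cn d)‖ ^ 2) ^ ((d : ℝ) / 2 + κ + 1) *
        (1 - ‖(y j : Cn d)‖ ^ 2) ^ ((d : ℝ) / 2) ≤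
          C * (1 - ‖(x : Cn d)‖ ^ 2) ^ ((d : ℝ) / 2) := by
  obtain ⟨C₁, hC₁, h₁⟩ := exists_bessel d hκ
  obtain ⟨C₂, hC₂, h₂⟩ := exists_lintegral_kernelFun_le hd hκ
  refine ⟨C₁ * C₂, by positivity, fun y hy x s => ?_⟩
  have hx := one_sub_norm_sq_pos x
  have hfin := ne_top_of_le_ne_top ENNReal.ofReal_ne_top (h₂ x)
  have hle := ENNReal.toReal_mono ENNReal.ofReal_ne_top (h₂ x)
  rw [ENNReal.toReal_ofReal (mul_nonneg hC₂ (Real.rpow_nonneg hx.le _))] at hle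
  rw [mul_assoc]
  refine le_trans (le_of_eq ?_) ((h₁ y hy _ (holo_kernelFun (κ - d / 2) x) hfin s).trans
    (mul_le_mul_of_nonneg_left hle hC₁))
  refine Finset.sum_congr rfl fun j _ => ?_
  have hy := one_sub_norm_sq_pos (y j)
  have e1 := one_sub_norm_ballMobius_rpow (κ - d / 2) x (y j)
  rw [show (d : ℝ) + (κ - d / 2) + 1 = d / 2 + κ + 1 by ring] at e1
  have e2 := Real.rpow_add hy ((d : ℝ) / 2 + κ + 1) (d / 2)
  rw [show (d : ℝ) / 2 + κ + 1 + d / 2 = d + κ + 1 by ring] at e2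
  rw [e1, kernelSq, e2]
  exact mul_right_comm _ _ _

theorem norm_ballMobius_comm (x y : 𝔹 d) :
    ‖(ballMobius x y : Cn d)‖ = ‖(ballMobius y x : Cn d)‖ := by
  have h1 := bergmanDist_self_ballMobius x (ballMobius x y)
  have h2 := bergmanDist_self_ballMobius y (ballMobius y x)
  rw [ballMobius_ballMobius] at h1 h2
  rw [bergmanDist_comm, h1] at h2
  exact Real.artanh_injOn ⟨by linarith [norm_nonneg (ballMobius x y : Cn d)], norm_coe_lt_one _⟩
    ⟨by linarith [norm_nonneg (ballMobius y x : Cn d)], norm_coe_lt_one _⟩ h2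

theorem tanh_le_norm_ballMobius {x y : 𝔹 d} {R : ℝ} (h : R ≤ bergmanDist x y) :
    Real.tanh R ≤ ‖(ballMobius x y : Cn d)‖ := by
  by_contra! hlt
  rw [norm_lt_tanh_iff, ← bergmanDist_ballMobius x, ballMobius_ballMobius, ballMobius_origin] at hlt
  exact hlt.not_ge h

theorem norm_inner_bergmanKernel (hμ : -1 < μ) (x y : 𝔹 d) :
    ‖inner ℂ (bergmanKernel d μ x) (bergmanKernel d μ y)‖ =
      (1 - ‖(ballMobius x y : Cn d)‖ ^ 2) ^ (((d : ℝ) + μ + 1) / 2) := by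
  have hx := one_sub_norm_sq_pos x
  have h1 := one_sub_norm_sq_pos (ballMobius y x)
  rw [inner_bergmanKernel hμ x (holo_kernelFun μ y) (bergmanKernel_ae_eq hμ y), norm_mul,
    Complex.norm_real, Real.norm_of_nonneg (Real.rpow_nonneg hx.le _), norm_ballMobius_comm]
  refine (pow_left_inj₀ (mul_nonneg (Real.rpow_nonneg hx.le _) (norm_nonneg _))
    (Real.rpow_nonneg h1.le _) two_ne_zero).1 ?_
  rw [mul_pow, ← Real.rpow_mul_natCast hx.le, ← Real.rpow_mul_natCast h1.le]
  push_cast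
  rw [div_mul_cancel₀ _ two_ne_zero, one_sub_norm_ballMobius_rpow μ y x]

theorem exists_one_sub_tanh_sq_rpow_le {e : ℝ} (he : 0 < e) {η : ℝ} (hη : 0 < η) :
    ∃ R : ℝ, 2 ≤ R ∧ 0 ≤ Real.tanh R ∧ (1 - Real.tanh R ^ 2) ^ e ≤ η := by
  set δ := min (η ^ (1 / e)) 1 with hδ
  have hδ0 : 0 < δ := lt_min (Real.rpow_pos_of_pos hη _) one_pos
  have hδ1 : δ ≤ 1 := min_le_right _ _
  have hs : (1 - δ / 2) ∈ Set.Ioo (-1 : ℝ) 1 := ⟨by linarith, by linarith⟩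
  set R := max 2 (Real.artanh (1 - δ / 2)) with hR
  have h1 : 1 - δ / 2 ≤ Real.tanh R := by
    rw [← Real.tanh_artanh hs]
    exact tanh_strictMono.monotone (le_max_right _ _)
  have h2 := Real.tanh_lt_one R
  refine ⟨R, le_max_left _ _, by linarith, ?_⟩
  calc (1 - Real.tanh R ^ 2) ^ e ≤ (η ^ (1 / e)) ^ e := by
        refine Real.rpow_le_rpow (by nlinarith) ?_ he.le
        refine le_trans ?_ (min_le_left _ 1)
        nlinarith
    _ = η := by
        rw [← Real.rpow_mul hη.le, one_div, inv_mul_cancel₀ he.ne', Real.rpow_one]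

/-- The normalized kernels at points that are sufficiently far apart are almost orthonormal. -/
theorem exists_separated_almost_orthonormal (hd : 1 ≤ d) (hμ : -1 < μ) {η : ℝ} (hη : 0 < η) :
    ∃ R : ℝ, 2 ≤ R ∧ ∀ {ι : Type} (y : ι → 𝔹 d), Separated R y → ∀ (s : Finset ι) (a : ι → ℂ),
      |‖∑ i ∈ s, a i • bergmanKernel d μ (y i)‖ ^ 2 - ∑ i ∈ s, ‖a i‖ ^ 2| ≤
        η * ∑ i ∈ s, ‖a i‖ ^ 2 := by
  classical
  -- an exponent between the exponent `d` of the volume growth and `d + μ + 1`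
  set κ : ℝ := (μ + 1) / 4 - 1 with hκdef
  have hκ : -1 < κ := by rw [hκdef]; linarith
  obtain ⟨C, hC, hsum⟩ := exists_sum_rpow_le hd hκ
  obtain ⟨R, hR2, hR0, hR⟩ := exists_one_sub_tanh_sq_rpow_le (e := (μ + 1) / 4) (by linarith)
    (η := η / (C + 1)) (by positivity)
  refine ⟨R, hR2, fun y hy s a => abs_norm_sum_sq_sub_le (fun i => norm_bergmanKernel hμ _)
    (w := fun i => (1 - ‖(y i : Cn d)‖ ^ 2) ^ ((d : ℝ) / 2))
    (fun i => Real.rpow_pos_of_pos (one_sub_norm_sq_pos _) _) (fun i hi => ?_) a⟩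
  have hw := fun j => (Real.rpow_pos_of_pos (one_sub_norm_sq_pos (y j)) ((d : ℝ) / 2)).le
  have hq : 0 ≤ (1 - Real.tanh R ^ 2) ^ ((μ + 1) / 4) :=
    Real.rpow_nonneg (by nlinarith [Real.tanh_lt_one R]) _
  calc ∑ j ∈ s with j ≠ i, ‖inner ℂ (bergmanKernel d μ (y i)) (bergmanKernel d μ (y j))‖ *
        (1 - ‖(y j : Cn d)‖ ^ 2) ^ ((d : ℝ) / 2)
      ≤ ∑ j ∈ s with j ≠ i, (1 - Real.tanh R ^ 2) ^ ((μ + 1) / 4) *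
          ((1 - ‖(ballMobius (y i) (y j) : Cn d)‖ ^ 2) ^ ((d : ℝ) / 2 + κ + 1) *
            (1 - ‖(y j : Cn d)‖ ^ 2) ^ ((d : ℝ) / 2)) := by
        refine Finset.sum_le_sum fun j hj => ?_
        have hji : i ≠ j := fun h => (Finset.mem_filter.1 hj).2 h.symm
        have hpos := one_sub_norm_sq_pos (ballMobius (y i) (y j))
        rw [← mul_assoc]
        refine mul_le_mul_of_nonneg_right ?_ (hw j)
        rw [norm_inner_bergmanKernel hμ, show ((d : ℝ) + μ + 1) / 2 =
          (μ + 1) / 4 + (d / 2 + κ + 1) by rw [hκdef]; ring, Real.rpow_add hpos]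
        refine mul_le_mul_of_nonneg_right ?_ (Real.rpow_nonneg hpos.le _)
        refine Real.rpow_le_rpow hpos.le ?_ (by linarith)
        have := tanh_le_norm_ballMobius (hy i j hji)
        gcongr
    _ ≤ (1 - Real.tanh R ^ 2) ^ ((μ + 1) / 4) *
          (C * (1 - ‖(y i : Cn d)‖ ^ 2) ^ ((d : ℝ) / 2)) := by
        rw [← Finset.mul_sum]
        exact mul_le_mul_of_nonneg_left (hsum y (hy.mono hR2) _ _) hq
    _ ≤ η / (C + 1) * (C * (1 - ‖(y i : Cn d)‖ ^ 2) ^ ((d : ℝ) / 2)) :=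
        mul_le_mul_of_nonneg_right hR (mul_nonneg hC (hw i))
    _ = η * (1 - ‖(y i : Cn d)‖ ^ 2) ^ ((d : ℝ) / 2) * (C / (C + 1)) := by
        field_simp
    _ ≤ η * (1 - ‖(y i : Cn d)‖ ^ 2) ^ ((d : ℝ) / 2) := by
        refine mul_le_of_le_one_right (mul_nonneg hη.le (hw i)) ?_
        rw [div_le_one (by positivity)]
        linarith

end AlmostOrthogonal

end WeightedBergman

namespace WeightedBergman

/-! ### Frame operators -/

section Frame

variable {H ι : Type*} [NormedAddCommGroup H] [InnerProductSpace ℂ H]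

/-- The selfadjoint operator `S` is the frame operator `h ↦ ∑ i, ⟨v i, h⟩ v i` of the family `v`,
which is expressed by its quadratic form. -/
def IsFrameOp [CompleteSpace H] (v : ι → H) (S : H →L[ℂ] H) : Prop :=
  IsSelfAdjoint S ∧ ∀ h, HasSum (fun i => ‖inner ℂ (v i) h‖ ^ 2) (inner ℂ h (S h)).re

/-- The Bessel inequality for almost orthonormal families. -/
theorem sum_norm_inner_sq_le {v : ι → H} {η : ℝ}
    (hv : ∀ (s : Finset ι) (a : ι → ℂ),
      |‖∑ i ∈ s, a i • v i‖ ^ 2 - ∑ i ∈ s, ‖a i‖ ^ 2| ≤ η * ∑ i ∈ s, ‖a i‖ ^ 2) (hη : 0 ≤ η)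
    (h : H) (s : Finset ι) : ∑ i ∈ s, ‖inner ℂ (v i) h‖ ^ 2 ≤ (1 + η) * ‖h‖ ^ 2 := by
  set A := ∑ i ∈ s, ‖inner ℂ (v i) h‖ ^ 2 with hA
  set g := ∑ i ∈ s, inner ℂ (v i) h • v i with hg
  have hA0 : 0 ≤ A := Finset.sum_nonneg fun _ _ => sq_nonneg _
  have h1 := (abs_le.1 (hv s fun i => inner ℂ (v i) h)).2
  have h2 : inner ℂ g h = (A : ℂ) := by
    rw [hg, sum_inner, hA, Complex.ofReal_sum]
    refine Finset.sum_congr rfl fun i _ => ?_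
    rw [inner_smul_left, Complex.conj_mul']
    push_cast
    rfl
  have h3 : A ≤ ‖g‖ * ‖h‖ := by
    have := norm_inner_le_norm (𝕜 := ℂ) g h
    rwa [h2, Complex.norm_real, Real.norm_of_nonneg hA0] at this
  have h4 : A ^ 2 ≤ ‖g‖ ^ 2 * ‖h‖ ^ 2 := by
    rw [← mul_pow]
    gcongr
  rcases hA0.eq_or_lt with h0 | h0
  · rw [← h0]; positivity
  · have h5 : A * A ≤ A * ((1 + η) * ‖h‖ ^ 2) := by nlinarith [sq_nonneg ‖h‖]
    exact le_of_mul_le_mul_left h5 h0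

variable [CompleteSpace H]

/-- An almost orthonormal family has a frame operator, which is almost an orthogonal projection. -/
theorem exists_isFrameOp {v : ι → H} {η : ℝ} (hη : 0 ≤ η)
    (hv : ∀ (s : Finset ι) (a : ι → ℂ),
      |‖∑ i ∈ s, a i • v i‖ ^ 2 - ∑ i ∈ s, ‖a i‖ ^ 2| ≤ η * ∑ i ∈ s, ‖a i‖ ^ 2) :
    ∃ S : H →L[ℂ] H, IsFrameOp v S ∧ (∀ h, (1 - η) * (inner ℂ h (S h)).re ≤ ‖S h‖ ^ 2) ∧
      ∀ h, (inner ℂ h (S h)).re ≤ (1 + η) * ‖h‖ ^ 2 := by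
  classical
  have h2 : (2 : ℝ≥0∞).toReal = 2 := by norm_num
  have hb := sum_norm_inner_sq_le hv hη
  have hmem : ∀ h : H, Memℓp (fun i => inner ℂ (v i) h) 2 := fun h =>
    memℓp_gen' (C := (1 + η) * ‖h‖ ^ 2) fun s => by
      simpa only [h2, Real.rpow_two] using hb h s
  set L : H →ₗ[ℂ] lp (fun _ : ι => ℂ) 2 :=
    { toFun := fun h => ⟨fun i => inner ℂ (v i) h, hmem h⟩
      map_add' := fun f g => by ext i; exact inner_add_right _ _ _
      map_smul' := fun c f => by ext i; exact inner_smul_right _ _ _ } with hL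
  set V : H →L[ℂ] lp (fun _ : ι => ℂ) 2 := L.mkContinuous (Real.sqrt (1 + η)) fun h => by
    refine lp.norm_le_of_forall_sum_le (by rw [h2]; norm_num) (by positivity) fun s => ?_
    simp only [h2, Real.rpow_two]
    rw [mul_pow, Real.sq_sqrt (by linarith)]
    exact hb h s with hV
  have hVi : ∀ h i, V h i = inner ℂ (v i) h := fun h i => rfl
  have hform : ∀ h, (inner ℂ h ((V.adjoint ∘L V) h)).re = ‖V h‖ ^ 2 := fun h => by
    rw [ContinuousLinearMap.comp_apply, ContinuousLinearMap.adjoint_inner_right]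
    exact inner_self_eq_norm_sq (𝕜 := ℂ) (V h)
  have hsq : ∀ a : lp (fun _ : ι => ℂ) 2, HasSum (fun i => ‖a i‖ ^ 2) (‖a‖ ^ 2) := fun a => by
    have := lp.hasSum_norm (p := 2) (by rw [h2]; norm_num) a
    simpa only [h2, Real.rpow_two] using this
  have hsingle : ∀ i c, V.adjoint (lp.single 2 i c) = c • v i := fun i c => by
    refine ext_inner_right ℂ fun h => ?_
    rw [ContinuousLinearMap.adjoint_inner_left, lp.inner_single_left, hVi, inner_smul_left]
    exact mul_comm _ _
  have hlow : ∀ a, (1 - η) * ‖a‖ ^ 2 ≤ ‖V.adjoint a‖ ^ 2 := fun a => by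
    have t1 : Tendsto (fun s : Finset ι => ‖∑ i ∈ s, a i • v i‖ ^ 2) atTop
        (𝓝 (‖V.adjoint a‖ ^ 2)) := by
      have := (V.adjoint.hasSum (lp.hasSum_single (by norm_num) a)).norm.pow 2
      refine this.congr fun s => ?_
      simp only [hsingle]
    have t2 : Tendsto (fun s : Finset ι => (1 - η) * ∑ i ∈ s, ‖a i‖ ^ 2) atTop
        (𝓝 ((1 - η) * ‖a‖ ^ 2)) := Tendsto.const_mul _ (hsq a)
    refine le_of_tendsto_of_tendsto' t2 t1 fun s => ?_
    have := (abs_le.1 (hv s fun i => a i)).1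
    linarith
  -- the frame operator is `V* V` for the analysis operator `V h = (⟨v i, h⟩)_i`
  refine ⟨V.adjoint ∘L V, ⟨?_, fun h => ?_⟩, fun h => ?_, fun h => ?_⟩
  · exact (ContinuousLinearMap.isPositive_adjoint_comp_self V).isSelfAdjoint
  · rw [hform]
    exact hsq (V h)
  · rw [hform]
    exact hlow (V h)
  · rw [hform]
    exact hasSum_le_of_sum_le (hsq (V h)) (hb h)

/-- A selfadjoint operator is bounded by its quadratic form. -/
theorem norm_le_of_isSelfAdjoint {T : H →L[ℂ] H} (hT : IsSelfAdjoint T) {C : ℝ} (hC : 0 ≤ C)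
    (h : ∀ x, |(inner ℂ x (T x)).re| ≤ C * ‖x‖ ^ 2) : ‖T‖ ≤ C := by
  rw [ContinuousLinearMap.norm_eq_iSup_rayleighQuotient T hT.isSymmetric]
  refine Real.iSup_le (fun x => ?_) hC
  rw [ContinuousLinearMap.rayleighQuotient, abs_div, abs_of_nonneg (sq_nonneg ‖x‖)]
  refine div_le_of_le_mul₀ (sq_nonneg _) hC ?_
  rw [ContinuousLinearMap.reApplyInnerSelf_apply, ← inner_re_symm]
  exact h x

end Frame

/-! ### Characters of the Toeplitz algebra -/

section Character

variable {d : ℕ} {μ : ℝ}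

/-- Characters are contractive, being homomorphisms of C*-algebras. -/
theorem norm_character_le (π : toeplitzAlg d μ →⋆ₙₐ[ℂ] ℂ) (T : toeplitzAlg d μ) :
    ‖π T‖ ≤ ‖(T : Bergman d μ →L[ℂ] Bergman d μ)‖ := by
  have : IsClosed (toeplitzAlg d μ : Set (Bergman d μ →L[ℂ] Bergman d μ)) :=
    StarSubalgebra.isClosed_topologicalClosure _
  let := StarSubalgebra.cstarAlgebra (toeplitzAlg d μ)
  exact NonUnitalStarAlgHom.norm_apply_le π T

/-- A unital character is positive. -/
theorem le_re_character {π : toeplitzAlg d μ →⋆ₙₐ[ℂ] ℂ} (hπ : π 1 = 1) {T : toeplitzAlg d μ}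
    (hT : IsSelfAdjoint (T : Bergman d μ →L[ℂ] Bergman d μ)) {c : ℝ}
    (h : ∀ x, c * ‖x‖ ^ 2 ≤ (inner ℂ x ((T : Bergman d μ →L[ℂ] Bergman d μ) x)).re) :
    c ≤ (π T).re := by
  set A : Bergman d μ →L[ℂ] Bergman d μ := T.1 with hA
  -- for large `K` the operator `K - A` has norm at most `K - c`
  set K : ℝ := ‖A‖ + |c| with hK
  have hcK : 0 ≤ K - c := by linarith [norm_nonneg A, le_abs_self c]
  have h1 : ‖((K : ℂ) • (1 : Bergman d μ →L[ℂ] Bergman d μ)) - A‖ ≤ K - c := by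
    refine norm_le_of_isSelfAdjoint (IsSelfAdjoint.sub ?_ hT) hcK fun x => ?_
    · exact IsSelfAdjoint.smul (Complex.conj_ofReal K) (IsSelfAdjoint.one _)
    · have e : (inner ℂ x ((((K : ℂ) • (1 : Bergman d μ →L[ℂ] Bergman d μ)) - A) x)).re =
          K * ‖x‖ ^ 2 - (inner ℂ x (A x)).re := by
        rw [sub_apply, inner_sub_right, smul_apply, inner_smul_right, Complex.sub_re,
          Complex.re_ofReal_mul]
        congr 2
        exact inner_self_eq_norm_sq (𝕜 := ℂ) x
      have h2 : |(inner ℂ x (A x)).re| ≤ ‖A‖ * ‖x‖ ^ 2 := by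
        refine (Complex.abs_re_le_norm _).trans ((norm_inner_le_norm _ _).trans ?_)
        have := A.le_opNorm x
        nlinarith [norm_nonneg x]
      rw [e, abs_le]
      have h3 := abs_le.1 h2
      have h4 := h x
      have h5 := mul_nonneg (abs_nonneg c) (sq_nonneg ‖x‖)
      have h6 := mul_nonneg hcK (sq_nonneg ‖x‖)
      constructor <;> nlinarith
  have h2 := norm_character_le π ((K : ℂ) • 1 - T)
  rw [map_sub, map_smul, hπ] at h2
  have h3 := (Complex.re_le_norm _).trans (h2.trans h1)
  rw [Complex.sub_re, smul_eq_mul, mul_one, Complex.ofReal_re] at h3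
  linarith

theorem re_character_le {π : toeplitzAlg d μ →⋆ₙₐ[ℂ] ℂ} (hπ : π 1 = 1) {T : toeplitzAlg d μ}
    (hT : IsSelfAdjoint (T : Bergman d μ →L[ℂ] Bergman d μ)) {c : ℝ}
    (h : ∀ x, (inner ℂ x ((T : Bergman d μ →L[ℂ] Bergman d μ) x)).re ≤ c * ‖x‖ ^ 2) :
    (π T).re ≤ c := by
  have h1 := le_re_character hπ (T := -T) (c := -c) hT.neg fun x => by
    have e : inner ℂ x ((((-T : toeplitzAlg d μ) : Bergman d μ →L[ℂ] Bergman d μ)) x) =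
        -inner ℂ x ((T : Bergman d μ →L[ℂ] Bergman d μ) x) := by
      rw [← inner_neg_right]; rfl
    rw [e, Complex.neg_re]
    linarith [h x]
  rw [map_neg, Complex.neg_re] at h1
  linarith

theorem im_character_eq_zero (π : toeplitzAlg d μ →⋆ₙₐ[ℂ] ℂ) {T : toeplitzAlg d μ}
    (hT : IsSelfAdjoint (T : Bergman d μ →L[ℂ] Bergman d μ)) : (π T).im = 0 := by
  have h1 : star T = T := Subtype.ext hT
  have h2 := map_star π T
  rw [h1] at h2
  exact Complex.conj_eq_iff_im.1 h2.symm

/-- A character maps an operator that is almost a projection to an almost idempotent number. -/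
theorem re_character_eq_zero_or_le {π : toeplitzAlg d μ →⋆ₙₐ[ℂ] ℂ} (hπ : π 1 = 1)
    {T : toeplitzAlg d μ} (hT : IsSelfAdjoint (T : Bergman d μ →L[ℂ] Bergman d μ)) {c : ℝ}
    (hpos : ∀ x, 0 ≤ (inner ℂ x ((T : Bergman d μ →L[ℂ] Bergman d μ) x)).re)
    (h : ∀ x, c * (inner ℂ x ((T : Bergman d μ →L[ℂ] Bergman d μ) x)).re ≤
      ‖(T : Bergman d μ →L[ℂ] Bergman d μ) x‖ ^ 2) :
    (π T).re = 0 ∨ c ≤ (π T).re := by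
  have h0 : 0 ≤ (π T).re := le_re_character hπ hT fun x => by simpa using hpos x
  have him := im_character_eq_zero π hT
  have hTT : IsSelfAdjoint ((T * T - (c : ℂ) • T : toeplitzAlg d μ) :
      Bergman d μ →L[ℂ] Bergman d μ) := by
    refine IsSelfAdjoint.sub ?_ (IsSelfAdjoint.smul (Complex.conj_ofReal c) hT)
    exact (IsSelfAdjoint.commute_iff hT hT).1 (Commute.refl _)
  -- the operator `T² - c T` is positive
  have h1 := le_re_character hπ (T := T * T - (c : ℂ) • T) (c := 0) hTT fun x => by
    have e : (inner ℂ x (((T * T - (c : ℂ) • T : toeplitzAlg d μ) :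
        Bergman d μ →L[ℂ] Bergman d μ) x)).re =
        ‖(T : Bergman d μ →L[ℂ] Bergman d μ) x‖ ^ 2 -
          c * (inner ℂ x ((T : Bergman d μ →L[ℂ] Bergman d μ) x)).re := by
      set A : Bergman d μ →L[ℂ] Bergman d μ := T.1 with hA
      change (inner ℂ x (A (A x) - (c : ℂ) • A x)).re = _
      rw [inner_sub_right, inner_smul_right, Complex.sub_re, Complex.re_ofReal_mul]
      congr 1
      have e1 : inner ℂ x (A (A x)) = inner ℂ (A x) (A x) := by
        rw [← ContinuousLinearMap.adjoint_inner_left, ← ContinuousLinearMap.star_eq_adjoint,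
          hT.star_eq]
      rw [e1]
      exact inner_self_eq_norm_sq (𝕜 := ℂ) _
    rw [e, zero_mul]
    linarith [h x]
  rw [map_sub, map_mul, map_smul, smul_eq_mul, Complex.sub_re, Complex.mul_re,
    Complex.re_ofReal_mul, him] at h1
  by_contra! hcon
  have h2 : 0 < (π T).re := lt_of_le_of_ne h0 (Ne.symm hcon.1)
  nlinarith [hcon.2]

end Character

end WeightedBergman

namespace WeightedBergman

/-! ### Tent functions and frame operators in the Toeplitz algebra -/

section Bump

variable {d : ℕ} {μ : ℝ}

theorem norm_inner_bergmanKernel_sq (hμ : -1 < μ) (x : 𝔹 d) (h : Bergman d μ) :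
    ‖inner ℂ (bergmanKernel d μ x) h‖ ^ 2 = kernelSq μ (holoRep h) x := by
  have hx := one_sub_norm_sq_pos x
  rw [inner_bergmanKernel hμ x (holo_holoRep h) (inclusion_ae_eq_holoRep h), norm_mul,
    Complex.norm_real, Real.norm_of_nonneg (Real.rpow_nonneg hx.le _), mul_pow, rpow_sq hx.le,
    mul_div_cancel₀ _ two_ne_zero, kernelSq]

theorem lintegral_holoRep_sq (h : Bergman d μ) :
    ∫⁻ w, ‖holoRep h w‖ₑ ^ 2 ∂vol d μ = ENNReal.ofReal (‖h‖ ^ 2) := by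
  rw [← enorm_sq_eq_lintegral (inclusion_ae_eq_holoRep h), ENNReal.ofReal_pow (norm_nonneg _),
    ofReal_norm]

/-- A tent function of height `1` that vanishes at distances `≥ r`. -/
noncomputable def tent (r s : ℝ) : ℝ := max 0 (1 - s / r)

theorem tent_nonneg (r s : ℝ) : 0 ≤ tent r s := le_max_left _ _

theorem tent_le_one {r s : ℝ} (hr : 0 < r) (hs : 0 ≤ s) : tent r s ≤ 1 :=
  max_le zero_le_one (by have : 0 ≤ s / r := by positivity
                         linarith)

theorem tent_eq_zero {r s : ℝ} (hr : 0 < r) (hs : r ≤ s) : tent r s = 0 :=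
  max_eq_left (by rw [sub_nonpos, le_div_iff₀ hr]; linarith)

theorem tent_le_add {r s s' t : ℝ} (hr : 0 < r) (ht : 0 ≤ t) (h : s' ≤ s + t) :
    tent r s ≤ tent r s' + t / r := by
  have h1 : 0 ≤ t / r := by positivity
  have h2 : s' / r ≤ s / r + t / r := by rw [← add_div]; gcongr
  refine max_le (by linarith [tent_nonneg r s']) ?_
  have h3 : 1 - s' / r ≤ tent r s' := le_max_right _ _
  linarith

theorem continuous_tent (r : ℝ) : Continuous (tent r) := by
  unfold tent
  fun_prop

/-- The function with a tent of radius `r` over each point of the family. -/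
noncomputable def tentSum {ι : Type*} (r : ℝ) (y : ι → 𝔹 d) (w : 𝔹 d) : ℝ :=
  ⨆ i, tent r (bergmanDist (y i) w)

section

variable {ι : Type*} {r : ℝ} {y : ι → 𝔹 d}

theorem bddAbove_tent (hr : 0 < r) (w : 𝔹 d) :
    BddAbove (Set.range fun i => tent r (bergmanDist (y i) w)) :=
  ⟨1, by rintro _ ⟨i, rfl⟩; exact tent_le_one hr (bergmanDist_nonneg _ _)⟩

theorem tentSum_nonneg (w : 𝔹 d) : 0 ≤ tentSum r y w :=
  Real.iSup_nonneg fun _ => tent_nonneg _ _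

theorem tentSum_le_one (hr : 0 < r) (w : 𝔹 d) : tentSum r y w ≤ 1 :=
  Real.iSup_le (fun _ => tent_le_one hr (bergmanDist_nonneg _ _)) zero_le_one

theorem tentSum_le_add (hr : 0 < r) (w w' : 𝔹 d) :
    tentSum r y w ≤ tentSum r y w' + bergmanDist w w' / r := by
  have h0 := bergmanDist_nonneg w w'
  refine Real.iSup_le (fun i => ?_) (add_nonneg (tentSum_nonneg _) (by positivity))
  refine (tent_le_add hr h0 (bergmanDist_triangle (y i) w w')).trans ?_
  gcongr
  exact le_ciSup (bddAbove_tent hr w') i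

theorem abs_tentSum_sub_le (hr : 0 < r) (w w' : 𝔹 d) :
    |tentSum r y w - tentSum r y w'| ≤ bergmanDist w w' / r := by
  have h1 := tentSum_le_add (y := y) hr w w'
  have h2 := tentSum_le_add (y := y) hr w' w
  rw [bergmanDist_comm w'] at h2
  rw [abs_le]
  constructor <;> linarith

theorem tentSum_eq (hr : 0 < r) (hy : Separated (2 * r) y) (i : ι) {w : 𝔹 d}
    (hw : w ∈ bergmanBall (y i) r) : tentSum r y w = tent r (bergmanDist (y i) w) := by
  refine le_antisymm (Real.iSup_le (fun j => ?_) (tent_nonneg _ _))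
    (le_ciSup (bddAbove_tent hr w) i)
  rcases eq_or_ne i j with rfl | hij
  · exact le_rfl
  · rw [tent_eq_zero hr (s := bergmanDist (y j) w)]
    · exact tent_nonneg _ _
    · by_contra! hlt
      exact (Set.disjoint_left.1 (hy.disjoint hij)) hw hlt

theorem tentSum_eq_zero (hr : 0 < r) {w : 𝔹 d} (hw : w ∉ ⋃ i, bergmanBall (y i) r) :
    tentSum r y w = 0 := by
  refine le_antisymm (Real.iSup_le (fun i => ?_) le_rfl) (tentSum_nonneg w)
  refine (tent_eq_zero hr ?_).le
  by_contra! hlt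
  exact hw (Set.mem_iUnion.2 ⟨i, hlt⟩)

theorem continuous_tentSum (hr : 0 < r) : Continuous (tentSum r y) := by
  rw [continuous_iff_continuousAt]
  intro w
  have h1 : Tendsto (fun w' => bergmanDist w w' / r) (𝓝 w) (𝓝 0) := by
    have := ((continuous_bergmanDist_right w).div_const r).tendsto w
    rwa [bergmanDist_self, zero_div] at this
  refine tendsto_iff_norm_sub_tendsto_zero.2
    (squeeze_zero (fun _ => norm_nonneg _) (fun w' => ?_) h1)
  rw [norm_sub_rev]
  exact abs_tentSum_sub_le hr w w'

/-- The tents as an element of `BUC`. -/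
noncomputable def tentSymbol (hr : 0 < r) (y : ι → 𝔹 d) : 𝔹 d →ᵇ ℂ :=
  BoundedContinuousFunction.ofNormedAddCommGroup (fun w => (tentSum r y w : ℂ))
    (Complex.continuous_ofReal.comp (continuous_tentSum hr)) 1 fun w => by
      rw [Complex.norm_real, Real.norm_of_nonneg (tentSum_nonneg w)]
      exact tentSum_le_one hr w

theorem tentSymbol_mem_BUC (hr : 0 < r) (y : ι → 𝔹 d) : tentSymbol hr y ∈ BUC d := by
  intro ε hε
  refine ⟨ε * r, by positivity, fun z w hzw => ?_⟩
  change ‖(tentSum r y z : ℂ) - tentSum r y w‖ < ε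
  rw [← Complex.ofReal_sub, Complex.norm_real]
  refine (abs_tentSum_sub_le hr z w).trans_lt ?_
  rwa [div_lt_iff₀ hr]

theorem isSelfAdjoint_toeplitz_tentSymbol (hr : 0 < r) (y : ι → 𝔹 d) :
    IsSelfAdjoint (toeplitz d μ (symbol μ (tentSymbol hr y))) := by
  have h : star (tentSymbol hr y) = tentSymbol hr y := by
    ext w
    exact Complex.conj_ofReal _
  rw [IsSelfAdjoint, star_toeplitz, h]

/-- The quadratic form of the Toeplitz operator with the tents as symbol. -/
theorem re_inner_toeplitz_tentSymbol (hr : 0 < r) (y : ι → 𝔹 d) (h : Bergman d μ) :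
    (inner ℂ h (toeplitz d μ (symbol μ (tentSymbol hr y)) h)).re =
      (∫⁻ w, ENNReal.ofReal (tentSum r y w) * ‖holoRep h w‖ₑ ^ 2 ∂vol d μ).toReal := by
  rw [inner_toeplitz _ (inclusion_ae_eq_holoRep h) (inclusion_ae_eq_holoRep h)]
  have e : ∀ w, tentSymbol hr y w * (starRingEnd ℂ (holoRep h w) * holoRep h w) =
      ((tentSum r y w * ‖holoRep h w‖ ^ 2 : ℝ) : ℂ) := fun w => by
    rw [Complex.conj_mul']
    push_cast
    rfl
  simp only [e]
  rw [integral_complex_ofReal, Complex.ofReal_re, integral_eq_lintegral_of_nonneg_ae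
    (Eventually.of_forall fun w => mul_nonneg (tentSum_nonneg w) (sq_nonneg _))
    ((continuous_tentSum hr).mul ((holo_holoRep h).continuous.norm.pow 2)).aestronglyMeasurable]
  congr 1
  refine lintegral_congr fun w => ?_
  rw [ENNReal.ofReal_mul (tentSum_nonneg w), ofReal_norm_sq_eq]

end

theorem setLIntegral_vol_eq {s : Set (𝔹 d)} (hs : MeasurableSet s) (G : 𝔹 d → ℝ≥0∞) :
    ∫⁻ z in s, G z ∂vol d μ = ∫⁻ z in s, ENNReal.ofReal
      (volConst d μ * (1 - ‖(z : Cn d)‖ ^ 2) ^ ((d : ℝ) + μ + 1)) * G z ∂invVol d := by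
  rw [← lintegral_indicator hs, ← lintegral_indicator hs, lintegral_vol_eq]
  refine lintegral_congr fun z => ?_
  by_cases h : z ∈ s
  · rw [Set.indicator_of_mem h, Set.indicator_of_mem h]
  · rw [Set.indicator_of_notMem h, Set.indicator_of_notMem h, mul_zero]

/-- The integral of a tent of radius `r` against the invariant measure, multiplied by the
normalizing constant of `v_μ`. -/
noncomputable def tentMass (d : ℕ) (μ r : ℝ) : ℝ≥0∞ :=
  ∫⁻ w in bergmanBall (origin d) r, ENNReal.ofReal
    (volConst d μ * tent r (bergmanDist (origin d) w)) ∂invVol d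

/-- All tents of the same radius have the same integral, by the invariance of the measure. -/
theorem setLIntegral_tent (μ r : ℝ) (x : 𝔹 d) :
    ∫⁻ w in bergmanBall x r, ENNReal.ofReal
      (volConst d μ * tent r (bergmanDist x w)) ∂invVol d = tentMass d μ r := by
  rw [tentMass, ← lintegral_indicator (measurableSet_bergmanBall _ _),
    ← lintegral_indicator (measurableSet_bergmanBall _ _),
    ← lintegral_invVol_ballMobius x (Set.indicator (bergmanBall x r) _)]
  refine lintegral_congr fun w => ?_
  have e : bergmanDist x (ballMobius x w) = bergmanDist (origin d) w := by
    have h := bergmanDist_ballMobius x (origin d) w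
    rwa [ballMobius_origin] at h
  by_cases h : w ∈ bergmanBall (origin d) r
  · rw [Set.indicator_of_mem h, Set.indicator_of_mem (ballMobius_mem_bergmanBall.2 h), e]
  · rw [Set.indicator_of_notMem h,
      Set.indicator_of_notMem (fun h' => h (ballMobius_mem_bergmanBall.1 h'))]

theorem tentMass_eq (hμ : -1 < μ) (r : ℝ) : tentMass d μ r =
    ∫⁻ w in bergmanBall (origin d) r, ENNReal.ofReal (tent r (bergmanDist (origin d) w) *
      (1 - ‖(w : Cn d)‖ ^ 2) ^ (-((d : ℝ) + μ + 1))) ∂vol d μ := by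
  rw [setLIntegral_vol_eq (measurableSet_bergmanBall _ _), tentMass]
  refine lintegral_congr fun w => ?_
  have hw := one_sub_norm_sq_pos w
  have hw' := Real.rpow_pos_of_pos hw ((d : ℝ) + μ + 1)
  rw [← ENNReal.ofReal_mul (mul_nonneg (volConst_pos d hμ).le hw'.le), Real.rpow_neg hw.le]
  congr 1
  field_simp

theorem tentMass_ne_top (hμ : -1 < μ) {r : ℝ} (hr : 0 < r) : tentMass d μ r ≠ ∞ := by
  have := isProbabilityMeasure_vol d hμ
  have hD : 0 ≤ (d : ℝ) + μ + 1 := by linarith [Nat.cast_nonneg (α := ℝ) d]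
  have ht : 0 < 1 - Real.tanh r ^ 2 := by
    nlinarith [Real.tanh_lt_one r, Real.neg_one_lt_tanh r]
  have h : tentMass d μ r ≤ ENNReal.ofReal ((1 - Real.tanh r ^ 2) ^ (-((d : ℝ) + μ + 1))) := by
    rw [tentMass_eq hμ]
    calc _ ≤ ∫⁻ w in bergmanBall (origin d) r,
          ENNReal.ofReal ((1 - Real.tanh r ^ 2) ^ (-((d : ℝ) + μ + 1))) ∂vol d μ := by
          refine setLIntegral_mono' (measurableSet_bergmanBall _ _) fun w hw => ?_
          rw [bergmanBall_origin] at hw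
          have hw : ‖(w : Cn d)‖ < Real.tanh r := hw
          refine ENNReal.ofReal_le_ofReal ?_
          rw [← one_mul ((1 - Real.tanh r ^ 2) ^ _)]
          refine mul_le_mul (tent_le_one hr (bergmanDist_nonneg _ _))
            (Real.rpow_le_rpow_of_nonpos ht ?_ (by linarith))
            (Real.rpow_nonneg (one_sub_norm_sq_pos w).le _) zero_le_one
          gcongr
      _ ≤ ∫⁻ _, ENNReal.ofReal ((1 - Real.tanh r ^ 2) ^ (-((d : ℝ) + μ + 1))) ∂vol d μ :=
          setLIntegral_le_lintegral _ _
      _ = _ := by rw [lintegral_const, measure_univ, mul_one]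
  exact ne_top_of_le_ne_top ENNReal.ofReal_ne_top h

theorem tentMass_ne_zero (hμ : -1 < μ) {r : ℝ} (hr : 0 < r) : tentMass d μ r ≠ 0 := by
  have hD : 0 ≤ (d : ℝ) + μ + 1 := by linarith [Nat.cast_nonneg (α := ℝ) d]
  obtain ⟨C, hC, h⟩ := exists_eval_bound_ball (d := d) hμ (R := 0) (R₁ := Real.tanh (r / 2))
    (by simpa using tanh_strictMono (half_pos hr)) (Real.tanh_lt_one _)
  have h1 := h (fun _ => 1) (differentiableOn_const _) 0 (by simp)
  rw [← bergmanBall_origin] at h1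
  simp only [enorm_one, one_pow] at h1
  have h2 : ENNReal.ofReal (1 / 2) * ∫⁻ _ in bergmanBall (origin d) (r / 2), 1 ∂vol d μ ≤
      tentMass d μ r := by
    rw [tentMass_eq hμ, ← lintegral_const_mul' _ _ ENNReal.ofReal_ne_top]
    refine (setLIntegral_mono' (measurableSet_bergmanBall _ _) fun w hw => ?_).trans
      (lintegral_mono_set fun w (hw : bergmanDist _ w < r / 2) =>
        (show bergmanDist _ w < r by linarith))
    have hw : bergmanDist (origin d) w < r / 2 := hw
    have hw2 := one_sub_norm_sq_pos w
    rw [mul_one]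
    refine ENNReal.ofReal_le_ofReal ?_
    rw [← mul_one (1 / 2 : ℝ)]
    refine mul_le_mul ?_ ?_ zero_le_one (tent_nonneg _ _)
    · refine le_trans ?_ (le_max_right _ _)
      have : bergmanDist (origin d) w / r ≤ 1 / 2 := by
        rw [div_le_iff₀ hr]; linarith
      linarith
    · exact Real.one_le_rpow_of_pos_of_le_one_of_nonpos hw2 (by nlinarith [sq_nonneg ‖(w : Cn d)‖])
        (by linarith)
  intro h0
  rw [h0, nonpos_iff_eq_zero, mul_eq_zero] at h2
  rcases h2 with h2 | h2
  · rw [ENNReal.ofReal_eq_zero] at h2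
    norm_num at h2
  · rw [h2, mul_zero] at h1
    simp at h1

end Bump

end WeightedBergman

namespace WeightedBergman

section FrameMem

variable {d : ℕ} {μ : ℝ}

theorem exists_tanh_lt {δ : ℝ} (hδ : 0 < δ) : ∃ r : ℝ, 0 < r ∧ r ≤ 1 ∧ Real.tanh r < δ := by
  have h : Tendsto Real.tanh (𝓝[>] 0) (𝓝 0) := by
    have h1 : Continuous Real.tanh := by
      have : Real.tanh = fun x => Real.sinh x / Real.cosh x := funext Real.tanh_eq_sinh_div_cosh
      rw [this]
      exact Real.continuous_sinh.div Real.continuous_cosh fun x => (Real.cosh_pos x).ne'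
    have := h1.tendsto 0
    rw [Real.tanh_zero] at this
    exact this.mono_left nhdsWithin_le_nhds
  obtain ⟨r, h1, h2⟩ := ((h.eventually_lt_const hδ).and (Ioc_mem_nhdsGT one_pos)).exists
  exact ⟨r, h2.1, h2.2, h1⟩

variable {f : 𝔹 d → ℂ} {x : 𝔹 d} {r η : ℝ}

theorem setLIntegral_tent_mul (hμ : -1 < μ) (r : ℝ) (f : 𝔹 d → ℂ) (x : 𝔹 d) :
    ∫⁻ w in bergmanBall x r, ENNReal.ofReal (tent r (bergmanDist x w)) * ‖f w‖ₑ ^ 2 ∂vol d μ =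
      ∫⁻ w in bergmanBall x r, ENNReal.ofReal (volConst d μ * tent r (bergmanDist x w)) *
        ENNReal.ofReal (kernelSq μ f w) ∂invVol d := by
  rw [setLIntegral_vol_eq (measurableSet_bergmanBall _ _)]
  refine lintegral_congr fun w => ?_
  have hw := Real.rpow_nonneg (one_sub_norm_sq_pos w).le ((d : ℝ) + μ + 1)
  have hc := (volConst_pos d hμ).le
  rw [← ofReal_norm_sq_eq, ← ENNReal.ofReal_mul (tent_nonneg _ _),
    ← ENNReal.ofReal_mul (mul_nonneg hc hw),
    ← ENNReal.ofReal_mul (mul_nonneg hc (tent_nonneg _ _)), kernelSq]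
  congr 1
  ring

/-- The mass of `f` under a tent is at most the integral of the tent times a bound for `|⟨k_w,
f⟩|²`. -/
theorem setLIntegral_tent_mul_le (hμ : -1 < μ) {c : ℝ}
    (h : ∀ w ∈ bergmanBall x r, kernelSq μ f w ≤ c) :
    ∫⁻ w in bergmanBall x r, ENNReal.ofReal (tent r (bergmanDist x w)) * ‖f w‖ₑ ^ 2 ∂vol d μ ≤
      tentMass d μ r * ENNReal.ofReal c := by
  rw [setLIntegral_tent_mul hμ, ← setLIntegral_tent μ r x,
    ← lintegral_mul_const' _ _ ENNReal.ofReal_ne_top]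
  refine setLIntegral_mono' (measurableSet_bergmanBall _ _) fun w hw => ?_
  gcongr
  exact h w hw

/-- The mass of `f` under a tent is close to a multiple of `|⟨k_x, f⟩|²` if `|⟨k_w, f⟩|²` varies
little. -/
theorem le_setLIntegral_tent_mul (hμ : -1 < μ) (hη : 0 ≤ η)
    (h : ∀ w ∈ bergmanBall x r, |kernelSq μ f w - kernelSq μ f x| ≤ η) :
    tentMass d μ r * ENNReal.ofReal (kernelSq μ f x) ≤
      ∫⁻ w in bergmanBall x r, ENNReal.ofReal (tent r (bergmanDist x w)) * ‖f w‖ₑ ^ 2 ∂vol d μ +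
        tentMass d μ r * ENNReal.ofReal η := by
  have hm : Measurable fun w => ENNReal.ofReal (volConst d μ * tent r (bergmanDist x w)) *
      ENNReal.ofReal η :=
    ((((continuous_tent r).comp (continuous_bergmanDist_right x)).const_mul _ |>.measurable
      |>.ennreal_ofReal).mul_const _)
  rw [setLIntegral_tent_mul hμ, ← setLIntegral_tent μ r x,
    ← lintegral_mul_const' _ _ ENNReal.ofReal_ne_top,
    ← lintegral_mul_const' _ _ ENNReal.ofReal_ne_top, ← lintegral_add_right _ hm]
  refine setLIntegral_mono' (measurableSet_bergmanBall _ _) fun w hw => ?_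
  rw [← mul_add, ← ENNReal.ofReal_add (kernelSq_nonneg _ _) hη]
  gcongr
  linarith [(abs_le.1 (h w hw)).1]

theorem IsFrameOp.ofReal_eq {ι : Type*} (hμ : -1 < μ) {y : ι → 𝔹 d}
    {S : Bergman d μ →L[ℂ] Bergman d μ} (hS : IsFrameOp (fun i => bergmanKernel d μ (y i)) S)
    (h : Bergman d μ) : ENNReal.ofReal (inner ℂ h (S h)).re =
      ∑' i, ENNReal.ofReal (kernelSq μ (holoRep h) (y i)) := by
  have h1 := hS.2 h
  simp only [norm_inner_bergmanKernel_sq hμ] at h1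
  rw [← h1.tsum_eq, ENNReal.ofReal_tsum_of_nonneg (fun i => kernelSq_nonneg _ _) h1.summable]

theorem IsFrameOp.re_inner_nonneg {H ι : Type*} [NormedAddCommGroup H] [InnerProductSpace ℂ H]
    [CompleteSpace H] {v : ι → H} {S : H →L[ℂ] H} (hS : IsFrameOp v S) (h : H) :
    0 ≤ (inner ℂ h (S h)).re :=
  (hS.2 h).nonneg fun _ => sq_nonneg _

/-- The frame operator of the kernels at separated points is a limit of multiples of Toeplitz
operators whose symbols are tents over these points. -/
theorem IsFrameOp.mem_toeplitzAlg {ι : Type} [Countable ι] (hμ : -1 < μ) {y : ι → 𝔹 d}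
    (hy : Separated 4 y) {S : Bergman d μ →L[ℂ] Bergman d μ}
    (hS : IsFrameOp (fun i => bergmanKernel d μ (y i)) S) : S ∈ toeplitzAlg d μ := by
  have hclosed : IsClosed (toeplitzAlg d μ : Set (Bergman d μ →L[ℂ] Bergman d μ)) :=
    StarSubalgebra.isClosed_topologicalClosure _
  refine hclosed.closure_subset (Metric.mem_closure_iff.2 fun ε' hε' => ?_)
  set ε := ε' / 2 with hε
  have hε0 : 0 < ε := by positivity
  obtain ⟨δ, hδ, hmod⟩ := exists_modulus (d := d) hμ 1 hε0
  obtain ⟨r, hr0, hr1, hrδ⟩ := exists_tanh_lt hδ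
  have hyr : Separated (2 * r) y := hy.mono (by linarith)
  have hy2 : Separated (2 * 2) y := hy.mono (by norm_num)
  set V := tentMass d μ r with hV
  have hV0 : V ≠ 0 := tentMass_ne_zero hμ hr0
  have hVt : V ≠ ∞ := tentMass_ne_top hμ hr0
  have hVr : 0 < V.toReal := ENNReal.toReal_pos hV0 hVt
  set T := toeplitz d μ (symbol μ (tentSymbol hr0 y)) with hT
  refine ⟨((V.toReal⁻¹ : ℝ) : ℂ) • T, ?_, ?_⟩
  · exact (toeplitzAlg d μ).smul_mem (toeplitz_mem_toeplitzAlg (tentSymbol_mem_BUC hr0 y)) _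
  rw [dist_eq_norm]
  refine lt_of_le_of_lt (norm_le_of_isSelfAdjoint (C := ε) ?_ hε0.le fun h => ?_) (half_lt_self hε')
  · exact hS.1.sub (IsSelfAdjoint.smul (Complex.conj_ofReal _)
      (isSelfAdjoint_toeplitz_tentSymbol hr0 y))
  set f := holoRep h with hf
  have hfh : Holo f := holo_holoRep h
  have hL := lintegral_holoRep_sq h
  have hLt : ∫⁻ w, ‖f w‖ₑ ^ 2 ∂vol d μ ≠ ∞ := by rw [hL]; exact ENNReal.ofReal_ne_top
  set m : ι → ℝ := fun i => (localMass μ f (y i) 2).toReal with hm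
  -- `|⟨k_w, f⟩|²` varies little on the small ball about `y i`
  have hvar : ∀ i, ∀ w ∈ bergmanBall (y i) r, |kernelSq μ f w - kernelSq μ f (y i)| ≤ ε * m i := by
    intro i w hw
    have hξ : ‖(ballMobius (y i) w : Cn d)‖ < Real.tanh r := by
      rw [norm_lt_tanh_iff]
      have : ballMobius (y i) w ∈ bergmanBall (origin d) r := by
        rw [← ballMobius_mem_bergmanBall (x := y i), ballMobius_ballMobius]
        exact hw
      exact this
    have h1 := hmod f hfh (y i) (ne_top_of_le_ne_top hLt (localMass_le _ _ _))
      (ballMobius (y i) w) (origin d) (hξ.le.trans (tanh_strictMono.monotone hr1))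
      (by rw [coe_origin, norm_zero, ← Real.tanh_zero]
          exact tanh_strictMono.monotone zero_le_one)
      (by rw [coe_origin, sub_zero]; exact hξ.trans hrδ)
    rw [ballMobius_ballMobius, ballMobius_origin, show (1 : ℝ) + 1 = 2 by norm_num] at h1
    exact h1
  have hεm : ∀ i, 0 ≤ ε * m i := fun i => mul_nonneg hε0.le ENNReal.toReal_nonneg
  set J := ∫⁻ w, ENNReal.ofReal (tentSum r y w) * ‖f w‖ₑ ^ 2 ∂vol d μ with hJ
  set I : ι → ℝ≥0∞ := fun i => ∫⁻ w in bergmanBall (y i) r,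
    ENNReal.ofReal (tent r (bergmanDist (y i) w)) * ‖f w‖ₑ ^ 2 ∂vol d μ with hI
  have hJI : J = ∑' i, I i := by
    have hU : MeasurableSet (⋃ i, bergmanBall (y i) r) :=
      MeasurableSet.iUnion fun i => measurableSet_bergmanBall _ _
    have h1 : J = ∫⁻ w in ⋃ i, bergmanBall (y i) r,
        ENNReal.ofReal (tentSum r y w) * ‖f w‖ₑ ^ 2 ∂vol d μ := by
      rw [hJ, ← lintegral_indicator hU]
      refine lintegral_congr fun w => ?_
      by_cases hw : w ∈ ⋃ i, bergmanBall (y i) r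
      · rw [Set.indicator_of_mem hw]
      · rw [Set.indicator_of_notMem hw, tentSum_eq_zero hr0 hw, ENNReal.ofReal_zero, zero_mul]
    rw [h1, lintegral_iUnion (fun i => measurableSet_bergmanBall _ _) hyr.disjoint]
    refine tsum_congr fun i => setLIntegral_congr_fun (measurableSet_bergmanBall _ _) fun w hw => ?_
    simp only [tentSum_eq hr0 hyr i hw]
  -- the errors are summable, since the balls of radius `2` about the points are disjoint
  have hE : ∑' i, ENNReal.ofReal (ε * m i) ≤ ENNReal.ofReal (ε * ‖h‖ ^ 2) := by
    refine ENNReal.summable.tsum_le_of_sum_le fun s => ?_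
    rw [← ENNReal.ofReal_sum_of_nonneg fun i _ => hεm i, ← Finset.mul_sum]
    refine ENNReal.ofReal_le_ofReal (mul_le_mul_of_nonneg_left ?_ hε0.le)
    have := hy2.sum_toReal_localMass_le hLt s
    rwa [hL, ENNReal.toReal_ofReal (sq_nonneg _)] at this
  set Q := (inner ℂ h (S h)).re with hQdef
  have hQ0 : 0 ≤ Q := hS.re_inner_nonneg h
  have hQ := hS.ofReal_eq hμ h
  have hup : J ≤ ENNReal.ofReal (V.toReal * (Q + ε * ‖h‖ ^ 2)) := by
    rw [ENNReal.ofReal_mul hVr.le, ENNReal.ofReal_toReal hVt,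
      ENNReal.ofReal_add hQ0 (by positivity), hQ, hJI]
    calc ∑' i, I i ≤ ∑' i, V * (ENNReal.ofReal (kernelSq μ f (y i)) + ENNReal.ofReal (ε * m i)) :=
          ENNReal.tsum_le_tsum fun i => by
            rw [← ENNReal.ofReal_add (kernelSq_nonneg _ _) (hεm i)]
            exact setLIntegral_tent_mul_le hμ fun w hw => by linarith [(abs_le.1 (hvar i w hw)).2]
      _ = V * (∑' i, ENNReal.ofReal (kernelSq μ f (y i)) + ∑' i, ENNReal.ofReal (ε * m i)) := by
          rw [ENNReal.tsum_mul_left, ENNReal.tsum_add]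
      _ ≤ _ := by gcongr
  have hJt : J ≠ ∞ := ne_top_of_le_ne_top ENNReal.ofReal_ne_top hup
  have hlow : ENNReal.ofReal (V.toReal * Q) ≤
      ENNReal.ofReal (J.toReal + V.toReal * (ε * ‖h‖ ^ 2)) := by
    rw [ENNReal.ofReal_mul hVr.le, ENNReal.ofReal_add ENNReal.toReal_nonneg (by positivity),
      ENNReal.ofReal_mul hVr.le, ENNReal.ofReal_toReal hVt, ENNReal.ofReal_toReal hJt, hQ, hJI]
    calc V * ∑' i, ENNReal.ofReal (kernelSq μ f (y i))
        = ∑' i, V * ENNReal.ofReal (kernelSq μ f (y i)) := ENNReal.tsum_mul_left.symm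
      _ ≤ ∑' i, (I i + V * ENNReal.ofReal (ε * m i)) :=
          ENNReal.tsum_le_tsum fun i => le_setLIntegral_tent_mul hμ (hεm i) (hvar i)
      _ = ∑' i, I i + V * ∑' i, ENNReal.ofReal (ε * m i) := by
          rw [ENNReal.tsum_add, ENNReal.tsum_mul_left]
      _ ≤ _ := by gcongr
  have hup' : J.toReal ≤ V.toReal * (Q + ε * ‖h‖ ^ 2) :=
    ENNReal.toReal_le_of_le_ofReal (by positivity) hup
  have hlow' := (ENNReal.ofReal_le_ofReal_iff (by positivity)).1 hlow
  have hform : (inner ℂ h ((S - ((V.toReal⁻¹ : ℝ) : ℂ) • T) h)).re = Q - V.toReal⁻¹ * J.toReal := by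
    rw [sub_apply, inner_sub_right, smul_apply, inner_smul_right, Complex.sub_re,
      Complex.re_ofReal_mul, hT, re_inner_toeplitz_tentSymbol]
  rw [hform]
  have hJV : J.toReal = V.toReal * (V.toReal⁻¹ * J.toReal) := by
    rw [← mul_assoc, mul_inv_cancel₀ hVr.ne', one_mul]
  rw [hJV] at hup' hlow'
  rw [← mul_add] at hlow'
  have h1 := le_of_mul_le_mul_left hup' hVr
  have h2 := le_of_mul_le_mul_left hlow' hVr
  rw [abs_le]
  constructor <;> linarith

end FrameMem

end WeightedBergman

namespace WeightedBergman

/-! ### Characters at frame operators of kernels -/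

section Move

variable {d : ℕ} {μ R : ℝ} {ι : Type}

/-- Families of points with mutual distances at least `R` have almost orthonormal kernels, with a
fixed small error. -/
def IsSparseRadius (d : ℕ) (μ R : ℝ) : Prop :=
  4 ≤ R ∧ ∀ {ι : Type} (y : ι → 𝔹 d), Separated R y → ∀ (s : Finset ι) (a : ι → ℂ),
    |‖∑ i ∈ s, a i • bergmanKernel d μ (y i)‖ ^ 2 - ∑ i ∈ s, ‖a i‖ ^ 2| ≤
      1 / 8 * ∑ i ∈ s, ‖a i‖ ^ 2

theorem exists_isSparseRadius (hd : 1 ≤ d) (hμ : -1 < μ) : ∃ R, IsSparseRadius d μ R := by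
  obtain ⟨R, -, h⟩ := exists_separated_almost_orthonormal hd hμ (η := 1 / 8) (by norm_num)
  exact ⟨max R 4, le_max_right _ _, fun y hy => h y (hy.mono (le_max_left _ _))⟩

/-- The quadratic form determines a selfadjoint operator. -/
theorem IsFrameOp.unique {H ι : Type*} [NormedAddCommGroup H] [InnerProductSpace ℂ H]
    [CompleteSpace H] {v : ι → H} {S S' : H →L[ℂ] H} (hS : IsFrameOp v S) (hS' : IsFrameOp v S') :
    S = S' := by
  refine sub_eq_zero.1 (norm_eq_zero.1 (le_antisymm ?_ (norm_nonneg _)))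
  refine norm_le_of_isSelfAdjoint (hS.1.sub hS'.1) le_rfl fun h => ?_
  rw [sub_apply, inner_sub_right, Complex.sub_re, (hS.2 h).unique (hS'.2 h)]
  simp

/-- Frame operators of kernels at separated points exist as elements of the Toeplitz algebra. -/
theorem IsSparseRadius.exists_frameOp [Countable ι] (hR : IsSparseRadius d μ R) (hμ : -1 < μ)
    {y : ι → 𝔹 d} (hy : Separated R y) : ∃ S : toeplitzAlg d μ,
      IsFrameOp (fun i => bergmanKernel d μ (y i)) (S : Bergman d μ →L[ℂ] Bergman d μ) := by
  obtain ⟨S, hS, -⟩ := exists_isFrameOp (by norm_num) (hR.2 y hy)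
  exact ⟨⟨S, hS.mem_toeplitzAlg hμ (hy.mono hR.1)⟩, hS⟩

/-- The values of unital characters at frame operators have a gap, since the latter are almost
projections. -/
theorem IsSparseRadius.re_character_eq_zero_or_le (hR : IsSparseRadius d μ R)
    {y : ι → 𝔹 d} (hy : Separated R y) {S : toeplitzAlg d μ}
    (hS : IsFrameOp (fun i => bergmanKernel d μ (y i)) (S : Bergman d μ →L[ℂ] Bergman d μ))
    {π : toeplitzAlg d μ →⋆ₙₐ[ℂ] ℂ} (hπ : π 1 = 1) : (π S).re = 0 ∨ 7 / 8 ≤ (π S).re := by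
  obtain ⟨S', hS', h1, -⟩ := exists_isFrameOp (by norm_num) (hR.2 y hy)
  obtain rfl := hS.unique hS'
  refine WeightedBergman.re_character_eq_zero_or_le hπ hS.1 hS.re_inner_nonneg fun x => ?_
  have := h1 x
  norm_num at this ⊢
  exact this

/-- Moving every point by a distance at most `t` reduces the separation by at most `2t`. -/
theorem Separated.ballMobius {t : ℝ} {y ξ : ι → 𝔹 d} (hy : Separated (R + 2 * t) y)
    (hξ : ∀ i, ‖(ξ i : Cn d)‖ ≤ Real.tanh t) :
    Separated R fun i => WeightedBergman.ballMobius (y i) (ξ i) := by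
  have h : ∀ i, bergmanDist (y i) (WeightedBergman.ballMobius (y i) (ξ i)) ≤ t := fun i => by
    rw [bergmanDist_self_ballMobius]
    have h1 := Real.artanh_le_artanh (x := ‖(ξ i : Cn d)‖) (y := Real.tanh t)
      (by linarith [norm_nonneg (ξ i : Cn d)]) (Real.tanh_lt_one t) (hξ i)
    rwa [Real.artanh_tanh] at h1
  intro i j hij
  have h1 := bergmanDist_triangle (y i) (WeightedBergman.ballMobius (y i) (ξ i)) (y j)
  have h2 := bergmanDist_triangle (WeightedBergman.ballMobius (y i) (ξ i))
    (WeightedBergman.ballMobius (y j) (ξ j)) (y j)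
  rw [bergmanDist_comm (WeightedBergman.ballMobius (y j) (ξ j)) (y j)] at h2
  change R ≤ bergmanDist (WeightedBergman.ballMobius (y i) (ξ i))
    (WeightedBergman.ballMobius (y j) (ξ j))
  linarith [hy i j hij, h i, h j]

/-- A small common displacement of the points of a separated family changes the value of a unital
character at the frame operator by at most `1/2`. -/
theorem exists_abs_re_character_sub_le (hμ : -1 < μ) (t : ℝ) : ∃ δ > 0, ∀ {ι : Type} {y : ι → 𝔹 d},
    Separated (2 * (t + 1)) y → ∀ ξ ξ' : 𝔹 d, ‖(ξ : Cn d)‖ ≤ Real.tanh t →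
      ‖(ξ' : Cn d)‖ ≤ Real.tanh t → ‖(ξ : Cn d) - ξ'‖ < δ → ∀ S S' : toeplitzAlg d μ,
        IsFrameOp (fun i => bergmanKernel d μ (ballMobius (y i) ξ))
          (S : Bergman d μ →L[ℂ] Bergman d μ) →
        IsFrameOp (fun i => bergmanKernel d μ (ballMobius (y i) ξ'))
          (S' : Bergman d μ →L[ℂ] Bergman d μ) →
        ∀ π : toeplitzAlg d μ →⋆ₙₐ[ℂ] ℂ, π 1 = 1 → (π S).re - (π S').re ≤ 1 / 2 := by
  obtain ⟨δ, hδ, hmod⟩ := exists_modulus (d := d) hμ t (ε := 1 / 2) (by norm_num)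
  refine ⟨δ, hδ, fun {ι y} hy ξ ξ' hξ hξ' hd S S' hS hS' π hπ => ?_⟩
  have hsub : IsSelfAdjoint ((S - S' : toeplitzAlg d μ) : Bergman d μ →L[ℂ] Bergman d μ) :=
    hS.1.sub hS'.1
  have := re_character_le hπ (T := S - S') (c := 1 / 2) hsub fun h => by
    have e : (inner ℂ h (((S - S' : toeplitzAlg d μ) : Bergman d μ →L[ℂ] Bergman d μ) h)).re =
        (inner ℂ h ((S : Bergman d μ →L[ℂ] Bergman d μ) h)).re -
          (inner ℂ h ((S' : Bergman d μ →L[ℂ] Bergman d μ) h)).re := by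
      rw [← Complex.sub_re, ← inner_sub_right]
      rfl
    rw [e]
    refine hasSum_le_of_sum_le ((hS.2 h).sub (hS'.2 h)) fun s => ?_
    have hL := lintegral_holoRep_sq h
    have hLt : ∫⁻ w, ‖holoRep h w‖ₑ ^ 2 ∂vol d μ ≠ ∞ := by rw [hL]; exact ENNReal.ofReal_ne_top
    have hm := hy.sum_toReal_localMass_le hLt s
    rw [hL, ENNReal.toReal_ofReal (sq_nonneg _)] at hm
    refine le_trans (Finset.sum_le_sum fun i _ => ?_)
      (le_of_eq_of_le (Finset.mul_sum _ _ _).symm (mul_le_mul_of_nonneg_left hm (by norm_num)))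
    rw [norm_inner_bergmanKernel_sq hμ, norm_inner_bergmanKernel_sq hμ]
    exact (le_abs_self _).trans (hmod _ (holo_holoRep h) _
      (ne_top_of_le_ne_top hLt (localMass_le _ _ _)) ξ ξ' hξ hξ' hd)
  rwa [map_sub, Complex.sub_re] at this

/-- Unital characters vanish on frame operators of kernels at sufficiently separated points: if the
value were not `0`, it would remain close to `1` while all the points are moved by the same
distance, but the points and the moved points together form a separated family. -/
theorem IsSparseRadius.re_character_eq_zero [Countable ι] (hd : 1 ≤ d) (hμ : -1 < μ)
    (hR : IsSparseRadius d μ R) {y : ι → 𝔹 d} (hy : Separated (R + 2 * R) y) {S : toeplitzAlg d μ}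
    (hS : IsFrameOp (fun i => bergmanKernel d μ (y i)) (S : Bergman d μ →L[ℂ] Bergman d μ))
    {π : toeplitzAlg d μ →⋆ₙₐ[ℂ] ℂ} (hπ : π 1 = 1) : (π S).re = 0 := by
  have hR4 := hR.1
  by_contra hne
  set T := Real.tanh R with hT
  have hT0 : 0 ≤ T := by
    have := tanh_strictMono.monotone (show 0 ≤ R by linarith)
    rwa [Real.tanh_zero] at this
  have hT1 : T < 1 := Real.tanh_lt_one R
  set e : Cn d := EuclideanSpace.single ⟨0, hd⟩ 1 with he
  have hen : ‖e‖ = 1 := by simp [he]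
  obtain ⟨δ, hδ, hmove⟩ := exists_abs_re_character_sub_le (d := d) hμ R
  obtain ⟨n, hn⟩ := exists_nat_one_div_lt hδ
  have hn1 : (0 : ℝ) < n + 1 := by positivity
  -- points `ξ k` that move from the origin to distance `R` in `n + 1` steps shorter than `δ`
  set c : ℕ → ℝ := fun k => min ((k : ℝ) / (n + 1)) 1 with hc
  have hc0 : ∀ k, 0 ≤ c k := fun k => le_min (by positivity) zero_le_one
  have hnorm : ∀ k : ℕ, ‖((c k * T : ℝ) : ℂ) • e‖ = c k * T := fun k => by
    rw [norm_smul, hen, mul_one, Complex.norm_real, Real.norm_of_nonneg (mul_nonneg (hc0 k) hT0)]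
  have hle : ∀ k : ℕ, ‖((c k * T : ℝ) : ℂ) • e‖ ≤ T := fun k => by
    rw [hnorm]
    exact mul_le_of_le_one_left hT0 (min_le_right _ _)
  set ξ : ℕ → 𝔹 d := fun k => ⟨((c k * T : ℝ) : ℂ) • e,
    mem_ball_zero_iff.2 ((hle k).trans_lt hT1)⟩ with hξ
  have hξle : ∀ k, ‖(ξ k : Cn d)‖ ≤ T := hle
  have hstep : ∀ k, ‖(ξ k : Cn d) - ξ (k + 1)‖ < δ := fun k => by
    have e1 : (ξ k : Cn d) - ξ (k + 1) = (((c k - c (k + 1)) * T : ℝ) : ℂ) • e := by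
      simp only [hξ]
      rw [← sub_smul, ← Complex.ofReal_sub, sub_mul]
    rw [e1, norm_smul, hen, mul_one, Complex.norm_real, Real.norm_eq_abs, abs_mul,
      abs_of_nonneg hT0]
    have e2 : |c k - c (k + 1)| ≤ 1 / (n + 1) := by
      refine (abs_min_sub_min_le_max _ _ _ _).trans ?_
      rw [sub_self, abs_zero]
      refine max_le ?_ (by positivity)
      rw [← sub_div, abs_div, abs_of_pos hn1]
      push_cast
      gcongr
      simp
    nlinarith [abs_nonneg (c k - c (k + 1))]
  have hsep : ∀ k, Separated R fun i => ballMobius (y i) (ξ k) := fun k =>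
    hy.ballMobius (ξ := fun _ => ξ k) fun _ => hξle k
  have hy' : Separated (2 * (R + 1)) y := hy.mono (by linarith)
  have h0 : ξ 0 = origin d := Subtype.ext (by simp [hξ, hc])
  -- the values lie in `{0} ∪ [7/8, ∞)` and change by at most `1/2` in each step
  have hind : ∀ k : ℕ, ∀ S' : toeplitzAlg d μ,
      IsFrameOp (fun i => bergmanKernel d μ (ballMobius (y i) (ξ k)))
        (S' : Bergman d μ →L[ℂ] Bergman d μ) → 7 / 8 ≤ (π S').re := by
    intro k
    induction k with
    | zero =>
      intro S' hS'
      refine (hR.re_character_eq_zero_or_le (hsep 0) hS' hπ).resolve_left ?_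
      rw [h0] at hS'
      simp only [ballMobius_origin] at hS'
      rwa [← Subtype.ext (hS.unique hS')]
    | succ k ih =>
      intro S' hS'
      obtain ⟨S'', hS''⟩ := hR.exists_frameOp hμ (hsep k)
      have h1 := ih S'' hS''
      have h2 := hmove hy' (ξ k) (ξ (k + 1)) (hξle k) (hξle _) (hstep k) S'' S' hS'' hS' π hπ
      refine (hR.re_character_eq_zero_or_le (hsep (k + 1)) hS' hπ).resolve_left fun h3 => ?_
      rw [h3] at h2
      linarith
  obtain ⟨S₁, hS₁⟩ := hR.exists_frameOp hμ (hsep (n + 1))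
  have hπ₁ := hind _ S₁ hS₁
  have hπ₀ : 7 / 8 ≤ (π S).re := by
    have := hind 0 S
    rw [h0] at this
    simp only [ballMobius_origin] at this
    exact this hS
  have hξT : ‖(ξ (n + 1) : Cn d)‖ = T := by
    have h1 : c (n + 1) = 1 := by
      simp only [hc]
      push_cast
      rw [div_self hn1.ne', min_self]
    rw [show ‖(ξ (n + 1) : Cn d)‖ = _ from hnorm _, h1, one_mul]
  -- the points and the moved points together
  set z : ι ⊕ ι → 𝔹 d := Sum.elim y fun i => ballMobius (y i) (ξ (n + 1)) with hz
  have hdist : ∀ i, bergmanDist (y i) (ballMobius (y i) (ξ (n + 1))) = R := fun i => by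
    rw [bergmanDist_self_ballMobius, hξT, hT, Real.artanh_tanh]
  have hcross : ∀ i j, R ≤ bergmanDist (y i) (ballMobius (y j) (ξ (n + 1))) := fun i j => by
    rcases eq_or_ne i j with rfl | hij
    · exact (hdist i).ge
    · have h1 := bergmanDist_triangle (y i) (ballMobius (y j) (ξ (n + 1))) (y j)
      rw [bergmanDist_comm (ballMobius (y j) (ξ (n + 1))) (y j), hdist] at h1
      linarith [hy i j hij]
  have hzsep : Separated R z := by
    rintro (i | i) (j | j) hij
    · exact (hy.mono (by linarith)) i j fun h => hij (h ▸ rfl)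
    · exact hcross i j
    · change R ≤ bergmanDist (ballMobius (y i) (ξ (n + 1))) (y j)
      rw [bergmanDist_comm]
      exact hcross j i
    · exact hsep (n + 1) i j fun h => hij (h ▸ rfl)
  -- the two frame operators add up to the frame operator of the joint family
  have hup := re_character_le hπ (T := S + S₁) (c := 9 / 8) (hS.1.add hS₁.1) fun h => by
    have e : (inner ℂ h (((S + S₁ : toeplitzAlg d μ) : Bergman d μ →L[ℂ] Bergman d μ) h)).re =
        (inner ℂ h ((S : Bergman d μ →L[ℂ] Bergman d μ) h)).re +
          (inner ℂ h ((S₁ : Bergman d μ →L[ℂ] Bergman d μ) h)).re := by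
      rw [← Complex.add_re, ← inner_add_right]
      rfl
    rw [e, ← le_sub_iff_add_le]
    refine hasSum_le_of_sum_le (hS.2 h) fun s => ?_
    rw [le_sub_comm]
    refine hasSum_le_of_sum_le (hS₁.2 h) fun s' => ?_
    rw [le_sub_iff_add_le, add_comm]
    have h1 := sum_norm_inner_sq_le (hR.2 z hzsep) (by norm_num) h (s.disjSum s')
    rw [Finset.sum_disjSum] at h1
    norm_num at h1 ⊢
    exact h1
  rw [map_add, Complex.add_re] at hup
  linarith

end Move

end WeightedBergman

namespace WeightedBergman

/-! ### Coverings of the ball and the absence of characters -/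

section Covering

variable {d : ℕ} {μ : ℝ}

/-- Maximal separated subsets are nets. -/
theorem exists_maximal_separated (W : Set (𝔹 d)) {ρ : ℝ} (hρ : 0 < ρ) : ∃ X ⊆ W,
    Separated ρ (fun x : X => (x : 𝔹 d)) ∧ ∀ w ∈ W, ∃ x ∈ X, bergmanDist x w < ρ := by
  obtain ⟨X, hX⟩ := zorn_subset
    {X : Set (𝔹 d) | X ⊆ W ∧ ∀ x ∈ X, ∀ x' ∈ X, x ≠ x' → ρ ≤ bergmanDist x x'} fun c hc hchain => by
      refine ⟨⋃₀ c, ⟨Set.sUnion_subset fun X hX => (hc hX).1, ?_⟩,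
        fun s hs => Set.subset_sUnion_of_mem hs⟩
      rintro x ⟨A, hA, hxA⟩ x' ⟨A', hA', hxA'⟩ hne
      rcases hchain.total hA hA' with h | h
      · exact (hc hA').2 x (h hxA) x' hxA' hne
      · exact (hc hA).2 x hxA x' (h hxA') hne
  refine ⟨X, hX.1.1, fun x x' h => hX.1.2 x x.2 x' x'.2 fun h' => h (Subtype.ext h'),
    fun w hw => ?_⟩
  by_contra! hfar
  have hins : insert w X ⊆ X := by
    refine hX.2 ⟨Set.insert_subset hw hX.1.1, ?_⟩ (Set.subset_insert _ _)
    rintro x (rfl | hx) x' (rfl | hx') hne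
    · exact absurd rfl hne
    · rw [bergmanDist_comm]
      exact hfar x' hx'
    · exact hfar x hx
    · exact hX.1.2 x hx x' hx' hne
  have := hfar w (hins (Set.mem_insert _ _))
  rw [bergmanDist_self] at this
  exact hρ.not_ge this

theorem mem_bergmanBall_self (x : 𝔹 d) {t : ℝ} (ht : 0 < t) : x ∈ bergmanBall x t := by
  change bergmanDist x x < t
  rwa [bergmanDist_self]

theorem Separated.countable {ι : Type*} {y : ι → 𝔹 d} (hy : Separated 2 y) : Countable ι := by
  have hy' : Separated (2 * 1) y := by rwa [mul_one]
  exact hy'.disjoint.countable_of_isOpen_disjoint (fun i => isOpen_bergmanBall (y i) 1)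
    fun i => ⟨y i, mem_bergmanBall_self _ one_pos⟩

/-- A ball of the Bergman metric of given radius contains a bounded number of separated points. -/
theorem exists_card_le_of_separated (d : ℕ) (ρ : ℝ) : ∃ N : ℕ, ∀ {ι : Type} (y : ι → 𝔹 d),
    Separated 2 y → ∀ (z : 𝔹 d) (s : Finset ι), (∀ i ∈ s, bergmanDist z (y i) < ρ) →
      s.card ≤ N := by
  obtain ⟨C, hC, hbessel⟩ := exists_bessel (μ := 0) d (by norm_num)
  -- the Bessel inequality is applied to the kernel at `z`, for the weight `0`
  set e : ℝ := (1 - Real.tanh ρ ^ 2) ^ ((d : ℝ) + 0 + 1) with he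
  have ht := Real.tanh_sq_lt_one ρ
  have he0 : 0 < e := Real.rpow_pos_of_pos (by linarith) _
  obtain ⟨N, hN⟩ := exists_nat_ge (C / e)
  refine ⟨N, fun y hy z s hs => ?_⟩
  have hone : ∫⁻ w, ‖kernelFun d 0 z w‖ₑ ^ 2 ∂vol d 0 = 1 := lintegral_kernelFun_sq (by norm_num) z
  have h1 := hbessel y hy (kernelFun d 0 z) (holo_kernelFun 0 z) (by simp [hone]) s
  rw [hone, ENNReal.toReal_one, mul_one] at h1
  have h2 : s.card * e ≤ C := by
    refine le_trans ?_ h1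
    rw [← nsmul_eq_mul]
    refine Finset.card_nsmul_le_sum _ _ _ fun i hi => ?_
    rw [kernelSq, ← one_sub_norm_ballMobius_rpow]
    have h3 : ‖(ballMobius z (y i) : Cn d)‖ < Real.tanh ρ := by
      rw [norm_lt_tanh_iff, ← bergmanDist_ballMobius z, ballMobius_ballMobius, ballMobius_origin]
      exact hs i hi
    refine Real.rpow_le_rpow (by linarith) ?_ (by positivity)
    gcongr
  have h4 : (s.card : ℝ) ≤ N := ((le_div_iff₀ he0).2 h2).trans hN
  exact_mod_cast h4

/-- The ball is covered by the Bergman balls of radius `2` about the points of finitely many sets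
that are separated by any prescribed distance. -/
theorem exists_finite_separated_cover (d : ℕ) {ρ : ℝ} (hρ : 0 < ρ) :
    ∃ (N : ℕ) (X : Fin N → Set (𝔹 d)), (∀ k, Separated ρ fun x : X k => (x : 𝔹 d)) ∧
      ∀ w, ∃ k, ∃ x ∈ X k, w ∈ bergmanBall x 2 := by
  obtain ⟨Z, -, hZ, hcov⟩ := exists_maximal_separated (d := d) Set.univ two_pos
  obtain ⟨N, hN⟩ := exists_card_le_of_separated d ρ
  -- successive extraction of maximal separated subsets
  choose F hFsub hFsep hFcov using fun W : Set (𝔹 d) => exists_maximal_separated W hρ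
  set W : ℕ → Set (𝔹 d) := fun k => (fun A => A \ F A)^[k] Z with hW
  have hWs : ∀ k, W (k + 1) = W k \ F (W k) := fun k => Function.iterate_succ_apply' _ _ _
  have hanti : Antitone W := antitone_nat_of_succ_le fun k => by
    rw [hWs]
    exact Set.sdiff_subset
  refine ⟨N + 1, fun k => F (W k), fun k => hFsep _, fun w => ?_⟩
  obtain ⟨z, hz, hzw⟩ := hcov w trivial
  suffices h : z ∉ W (N + 1) by
    have h' : ∀ k, z ∉ W k → ∃ j < k, z ∈ F (W j) := by
      intro k
      induction k with
      | zero => exact fun h => absurd hz h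
      | succ k ih =>
        intro hk
        by_cases hzk : z ∈ W k
        · refine ⟨k, k.lt_succ_self, ?_⟩
          by_contra hzF
          exact hk (hWs k ▸ ⟨hzk, hzF⟩)
        · obtain ⟨j, hj, hzj⟩ := ih hzk
          exact ⟨j, hj.trans k.lt_succ_self, hzj⟩
    obtain ⟨j, hj, hzj⟩ := h' _ h
    exact ⟨⟨j, hj⟩, z, hzj, hzw⟩
  -- otherwise `z` would be close to `N + 1` distinct points of `Z`
  intro hmem
  have hx : ∀ k : Fin (N + 1), ∃ x ∈ F (W k), bergmanDist x z < ρ := fun k =>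
    hFcov _ z (hanti k.2.le hmem)
  choose x hxF hxz using hx
  have hxZ : ∀ k, x k ∈ Z := fun k => hanti (Nat.zero_le _) (hFsub _ (hxF k))
  have hlt : ∀ j k : Fin (N + 1), j < k → x j ≠ x k := fun j k hjk he => by
    have h1 : x k ∈ W (j + 1) := hanti (Nat.succ_le_of_lt hjk) (hFsub _ (hxF k))
    rw [hWs] at h1
    exact h1.2 (he ▸ hxF j)
  have hinj : ∀ j k, j ≠ k → x j ≠ x k := fun j k hjk => by
    rcases lt_or_gt_of_ne hjk with h | h
    · exact hlt j k h
    · exact (hlt k j h).symm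
  have := hN x (fun j k hjk => hZ ⟨x j, hxZ j⟩ ⟨x k, hxZ k⟩ fun h => hinj j k hjk
    (congrArg Subtype.val h)) z Finset.univ fun k _ => by
      rw [bergmanDist_comm]
      exact hxz k
  rw [Finset.card_univ, Fintype.card_fin] at this
  exact this.not_gt N.lt_succ_self

theorem exists_finite_net (d : ℕ) (t : ℝ) {δ : ℝ} (hδ : 0 < δ) : ∃ P : Finset (𝔹 d),
    (∀ p ∈ P, ‖(p : Cn d)‖ ≤ Real.tanh t) ∧
      ∀ ξ : 𝔹 d, ‖(ξ : Cn d)‖ ≤ Real.tanh t → ∃ p ∈ P, ‖(ξ : Cn d) - p‖ < δ := by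
  obtain ⟨A, hAsub, hAfin, hA⟩ :=
    (isCompact_closedBall (0 : Cn d) (Real.tanh t)).finite_cover_balls hδ
  have hfin : {p : 𝔹 d | (p : Cn d) ∈ A}.Finite := hAfin.preimage Subtype.val_injective.injOn
  refine ⟨hfin.toFinset, fun p hp => ?_, fun ξ hξ => ?_⟩
  · exact mem_closedBall_zero_iff.1 (hAsub (hfin.mem_toFinset.1 hp))
  · obtain ⟨p, hpA, hp⟩ := Set.mem_iUnion₂.1 (hA (mem_closedBall_zero_iff.2 hξ))
    exact ⟨⟨p, mem_ball_zero_iff.2 ((mem_closedBall_zero_iff.1 (hAsub hpA)).trans_lt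
      (Real.tanh_lt_one t))⟩, hfin.mem_toFinset.2 hpA, mem_ball_iff_norm.1 hp⟩

/-- The mass of a holomorphic function near `x` is controlled by its values at finitely many points
near `x`, up to a small multiple of its mass on a larger ball. -/
theorem exists_localMass_le (hμ : -1 < μ) {ε : ℝ} (hε : 0 < ε) : ∃ P : Finset (𝔹 d),
    (∀ p ∈ P, ‖(p : Cn d)‖ ≤ Real.tanh 4) ∧ ∀ f : 𝔹 d → ℂ, Holo f → ∀ x : 𝔹 d,
      localMass μ f x 5 ≠ ∞ → localMass μ f x 2 ≤ 2 * tentMass d μ 4 *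
        (∑ p ∈ P, ENNReal.ofReal (kernelSq μ f (ballMobius x p)) +
          ENNReal.ofReal ε * localMass μ f x 5) := by
  obtain ⟨δ, hδ, hmod⟩ := exists_modulus (d := d) hμ 4 hε
  obtain ⟨P, hP, hnet⟩ := exists_finite_net d 4 hδ
  refine ⟨P, hP, fun f hf x hx => ?_⟩
  set c : ℝ := ∑ p ∈ P, kernelSq μ f (ballMobius x p) + ε * (localMass μ f x 5).toReal with hc
  have hup := setLIntegral_tent_mul_le (x := x) (r := 4) (f := f) hμ (c := c) fun w hw => by
    have hξ : ‖(ballMobius x w : Cn d)‖ < Real.tanh 4 := by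
      rw [norm_lt_tanh_iff, ← bergmanDist_ballMobius x, ballMobius_ballMobius, ballMobius_origin]
      exact hw
    obtain ⟨p, hp, hpξ⟩ := hnet _ hξ.le
    have h1 := hmod f hf x (by norm_num; exact hx) _ p hξ.le (hP p hp) hpξ
    rw [ballMobius_ballMobius, show (4 : ℝ) + 1 = 5 by norm_num] at h1
    have h2 := Finset.single_le_sum (f := fun p => kernelSq μ f (ballMobius x p))
      (fun q _ => kernelSq_nonneg f _) hp
    linarith [(abs_le.1 h1).2]
  have hlow : localMass μ f x 2 ≤ 2 * ∫⁻ w in bergmanBall x 4,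
      ENNReal.ofReal (tent 4 (bergmanDist x w)) * ‖f w‖ₑ ^ 2 ∂vol d μ := by
    have hsub : bergmanBall x 2 ⊆ bergmanBall x 4 := fun w (hw : bergmanDist x w < 2) =>
      show bergmanDist x w < 4 by linarith
    rw [← lintegral_const_mul' _ _ ENNReal.ofNat_ne_top]
    refine le_trans ?_ (lintegral_mono_set hsub)
    refine setLIntegral_mono' (measurableSet_bergmanBall _ _) fun w hw => ?_
    have hw2 : bergmanDist x w < 2 := hw
    have h1 : (1 : ℝ) ≤ 2 * tent 4 (bergmanDist x w) := by
      have := le_max_right 0 (1 - bergmanDist x w / 4)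
      rw [tent]
      linarith
    have h2 : (1 : ℝ≥0∞) ≤ 2 * ENNReal.ofReal (tent 4 (bergmanDist x w)) := by
      rw [show (2 : ℝ≥0∞) = ENNReal.ofReal 2 by simp, ← ENNReal.ofReal_mul (by norm_num)]
      exact ENNReal.one_le_ofReal.2 h1
    rw [← mul_assoc]
    exact le_mul_of_one_le_left' h2
  refine hlow.trans ?_
  rw [mul_assoc]
  refine mul_le_mul_right (hup.trans (mul_le_mul_right (le_of_eq ?_) _)) _
  rw [hc, ENNReal.ofReal_add (Finset.sum_nonneg fun p _ => kernelSq_nonneg f _)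
    (by positivity), ENNReal.ofReal_sum_of_nonneg fun p _ => kernelSq_nonneg f _,
    ENNReal.ofReal_mul hε.le, ENNReal.ofReal_toReal hx]

/-- The estimate `hloc` for the local masses, summed over a separated set: the sums of the point
values become quadratic forms of frame operators, and the local masses on the balls of radius `5`,
which are disjoint, add up to at most `‖h‖²`. -/
theorem tsum_localMass_le {X : Set (𝔹 d)} (hX : Separated (2 * 5) fun x : X => (x : 𝔹 d))
    (hμ : -1 < μ) {P : Finset (𝔹 d)} {V ε : ℝ} {h : Bergman d μ}
    (hloc : ∀ x : 𝔹 d, localMass μ (holoRep h) x 2 ≤ ENNReal.ofReal V *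
      (∑ p ∈ P, ENNReal.ofReal (kernelSq μ (holoRep h) (ballMobius x p)) +
        ENNReal.ofReal ε * localMass μ (holoRep h) x 5))
    {S : P → (Bergman d μ →L[ℂ] Bergman d μ)}
    (hS : ∀ p : P, IsFrameOp (fun x : X => bergmanKernel d μ (ballMobius x (p : 𝔹 d))) (S p)) :
    ∑' x : X, localMass μ (holoRep h) x 2 ≤ ENNReal.ofReal V *
      (∑ p : P, ENNReal.ofReal (inner ℂ h (S p h)).re +
        ENNReal.ofReal ε * ENNReal.ofReal (‖h‖ ^ 2)) := by
  have h5 : ∑' x : X, localMass μ (holoRep h) x 5 ≤ ENNReal.ofReal (‖h‖ ^ 2) := by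
    rw [ENNReal.tsum_eq_iSup_sum, ← lintegral_holoRep_sq]
    exact iSup_le fun s => hX.sum_localMass_le _ s
  calc ∑' x : X, localMass μ (holoRep h) x 2 ≤ ∑' x : X, ENNReal.ofReal V *
        (∑ p ∈ P, ENNReal.ofReal (kernelSq μ (holoRep h) (ballMobius x p)) +
          ENNReal.ofReal ε * localMass μ (holoRep h) x 5) := ENNReal.tsum_le_tsum fun x => hloc x
    _ = ENNReal.ofReal V * (∑ p : P, ∑' x : X,
          ENNReal.ofReal (kernelSq μ (holoRep h) (ballMobius x p)) +
            ENNReal.ofReal ε * ∑' x : X, localMass μ (holoRep h) x 5) := by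
        rw [ENNReal.tsum_mul_left, ENNReal.tsum_add, ENNReal.tsum_mul_left]
        congr 2
        rw [← Summable.tsum_finsetSum fun _ _ => ENNReal.summable]
        exact tsum_congr fun x => (Finset.sum_coe_sort P
          fun p => ENNReal.ofReal (kernelSq μ (holoRep h) (ballMobius x p))).symm
    _ ≤ _ := by
        refine mul_le_mul_right (add_le_add (le_of_eq ?_) (mul_le_mul_right h5 _)) _
        exact Finset.sum_congr rfl fun p _ => ((hS p).ofReal_eq hμ h).symm

theorem lintegral_le_sum_tsum_localMass {N : ℕ} {X : Fin N → Set (𝔹 d)} {t : ℝ}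
    [∀ k, Countable (X k)] (hcov : ∀ w, ∃ k, ∃ x ∈ X k, w ∈ bergmanBall x t) (f : 𝔹 d → ℂ) :
    ∫⁻ w, ‖f w‖ₑ ^ 2 ∂vol d μ ≤ ∑ k, ∑' x : X k, localMass μ f x t := by
  have hU : (⋃ k, ⋃ x : X k, bergmanBall (x : 𝔹 d) t) = Set.univ :=
    Set.eq_univ_of_forall fun w => by
      obtain ⟨k, x, hx, hw⟩ := hcov w
      exact Set.mem_iUnion.2 ⟨k, Set.mem_iUnion.2 ⟨⟨x, hx⟩, hw⟩⟩
  rw [← setLIntegral_univ, ← hU, ← tsum_fintype (L := .unconditional _)]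
  exact (lintegral_iUnion_le _ _).trans (ENNReal.tsum_le_tsum fun k => lintegral_iUnion_le _ _)

/-- The value of `ε` is such that the error terms amount to at most `a / 2`. -/
theorem le_sum_of_ofReal_le {N : ℕ} {ι : Type*} [Fintype ι] {a V ε : ℝ} (ha : 0 ≤ a) (hV : 0 < V)
    (hε : ε = 1 / (2 * V * (N + 1))) {b : Fin N → ι → ℝ} (hb : ∀ k p, 0 ≤ b k p)
    (h : ENNReal.ofReal a ≤ ∑ k, ENNReal.ofReal V *
      (∑ p, ENNReal.ofReal (b k p) + ENNReal.ofReal ε * ENNReal.ofReal a)) :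
    1 / (2 * V) * a ≤ ∑ k, ∑ p, b k p := by
  have hε0 : 0 < ε := by rw [hε]; positivity
  have hpos : ∀ k, 0 ≤ ∑ p, b k p := fun k => Finset.sum_nonneg fun p _ => hb k p
  have hpos' : ∀ k, 0 ≤ V * (∑ p, b k p + ε * a) := fun k =>
    mul_nonneg hV.le (add_nonneg (hpos k) (by positivity))
  have hreal : a ≤ ∑ k, V * (∑ p, b k p + ε * a) := by
    rw [← ENNReal.ofReal_le_ofReal_iff (Finset.sum_nonneg fun k _ => hpos' k),
      ENNReal.ofReal_sum_of_nonneg fun k _ => hpos' k]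
    refine h.trans (Finset.sum_le_sum fun k _ => le_of_eq ?_)
    rw [ENNReal.ofReal_mul hV.le, ENNReal.ofReal_add (hpos k) (by positivity),
      ENNReal.ofReal_sum_of_nonneg fun p _ => hb k p, ENNReal.ofReal_mul hε0.le]
  rw [← Finset.mul_sum, Finset.sum_add_distrib, Finset.sum_const, Finset.card_univ,
    Fintype.card_fin, nsmul_eq_mul] at hreal
  have h1 : V * (N * ε) ≤ 1 / 2 := by
    rw [hε]
    field_simp
    linarith
  rw [div_mul_eq_mul_div, div_le_iff₀ (by positivity)]
  nlinarith [mul_le_mul_of_nonneg_right h1 ha]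

/-- There are finitely many separated families whose frame operators have a sum that is bounded
below by a positive multiple of the identity. -/
theorem exists_frame (d : ℕ) (hμ : -1 < μ) {ρ : ℝ} (hρ : 2 ≤ ρ) :
    ∃ (ι : Type) (_ : Fintype ι) (J : ι → Type) (y : ∀ i, J i → 𝔹 d) (c : ℝ), 0 < c ∧
      (∀ i, Separated ρ (y i)) ∧ ∀ S : ι → Bergman d μ →L[ℂ] Bergman d μ,
        (∀ i, IsFrameOp (fun j => bergmanKernel d μ (y i j)) (S i)) →
        ∀ h : Bergman d μ, c * ‖h‖ ^ 2 ≤ (inner ℂ h ((∑ i, S i) h)).re := by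
  -- the summand `2 * 4` leaves room for moving the points by distances up to `4`
  obtain ⟨N, X, hX, hcov⟩ := exists_finite_separated_cover d (ρ := ρ + 2 * 4) (by linarith)
  set V : ℝ := (2 * tentMass d μ 4).toReal with hV
  have hVt : 2 * tentMass d μ 4 ≠ ∞ :=
    ENNReal.mul_ne_top ENNReal.ofNat_ne_top (tentMass_ne_top hμ (by norm_num))
  have hV0 : 0 < V := ENNReal.toReal_pos
    (mul_ne_zero two_ne_zero (tentMass_ne_zero hμ (by norm_num))) hVt
  have hVe : 2 * tentMass d μ 4 = ENNReal.ofReal V := (ENNReal.ofReal_toReal hVt).symm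
  obtain ⟨P, hP, hloc⟩ := exists_localMass_le (d := d) hμ
    (ε := 1 / (2 * V * (N + 1))) (by positivity)
  refine ⟨Fin N × P, inferInstance, fun i => X i.1, fun i x => ballMobius x i.2, 1 / (2 * V),
    by positivity, ?_, fun S hS h => ?_⟩
  · rintro ⟨k, p⟩
    exact (hX k).ballMobius (ξ := fun _ => (p : 𝔹 d)) fun _ => hP _ p.2
  have hL := lintegral_holoRep_sq h
  have hXc : ∀ k, Countable (X k) := fun k => ((hX k).mono (by linarith)).countable
  have hk : ∀ k, _ := fun k => tsum_localMass_le (P := P) (V := V)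
    (ε := 1 / (2 * V * (N + 1))) (h := h) ((hX k).mono (by linarith)) hμ
    (fun x => by
      rw [← hVe]
      refine hloc _ (holo_holoRep h) x (ne_top_of_le_ne_top ?_ (localMass_le _ _ _))
      rw [hL]
      exact ENNReal.ofReal_ne_top) (S := fun p => S (k, p)) fun p => hS (k, p)
  have hfin := (lintegral_le_sum_tsum_localMass (μ := μ) hcov (holoRep h)).trans
    (Finset.sum_le_sum fun k _ => hk k)
  rw [hL] at hfin
  have := le_sum_of_ofReal_le (sq_nonneg ‖h‖) hV0 rfl
    (fun k p => (hS (k, p)).re_inner_nonneg h) hfin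
  rwa [sum_apply, inner_sum, Complex.re_sum, Fintype.sum_prod_type]

/-- The frame operators of finitely many separated families add up to an operator bounded below,
whereas a unital character would vanish on each of them. -/
theorem character_eq_zero (hd : 1 ≤ d) (hμ : -1 < μ) (π : toeplitzAlg d μ →⋆ₙₐ[ℂ] ℂ)
    (T : toeplitzAlg d μ) : π T = 0 := by
  have hidem : π 1 * π 1 = π 1 := by rw [← map_mul, mul_one]
  suffices h : π 1 ≠ 1 by
    have h0 : π 1 = 0 := by
      by_contra h0
      exact h (mul_left_cancel₀ h0 (hidem.trans (mul_one _).symm))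
    rw [← mul_one T, map_mul, h0, mul_zero]
  intro hπ
  obtain ⟨R, hR⟩ := exists_isSparseRadius hd hμ
  have hR4 := hR.1
  obtain ⟨ι, _, J, y, c, hc, hy, hframe⟩ := exists_frame d hμ (ρ := R + 2 * R) (by linarith)
  have hJ : ∀ i, Countable (J i) := fun i => ((hy i).mono (by linarith)).countable
  choose S hS using fun i => hR.exists_frameOp hμ ((hy i).mono (by linarith))
  have hsum : ((∑ i, S i : toeplitzAlg d μ) : Bergman d μ →L[ℂ] Bergman d μ) =
      ∑ i, (S i : Bergman d μ →L[ℂ] Bergman d μ) := AddSubmonoidClass.coe_finsetSum _ _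
  have h1 := le_re_character hπ (T := ∑ i, S i) (c := c)
    (by rw [hsum]; exact isSelfAdjoint_sum _ fun i _ => (hS i).1)
    (by rw [hsum]; exact hframe _ hS)
  rw [map_sum, Complex.re_sum, Finset.sum_eq_zero fun i _ =>
    hR.re_character_eq_zero hd hμ (hy i) (hS i) hπ] at h1
  linarith

end Covering

end WeightedBergman

theorem mainTheorem6 (ℓ d m : ℕ) (hℓ : 1 ≤ ℓ) (hd : 1 ≤ d)
    (k : Fin m → ℕ) (hk : ∀ j, 1 ≤ k j) (hkℓ : ∑ j, k j = ℓ) (lam : ℝ) (hlam : -1 < lam) :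
    (∃ ν : bigToeplitzAlg ℓ d lam →⋆ₐ[ℂ] BUC d,
      (∀ T : bigToeplitzAlg ℓ d lam,
        (∃! S : ∀ p : ℕ, Fiber ℓ d lam p →L[ℂ] Fiber ℓ d lam p,
          IsDirectSumOf k (T : Bergman (ℓ + d) lam →L[ℂ] Bergman (ℓ + d) lam) S) ∧
        ∀ S : ∀ p : ℕ, Fiber ℓ d lam p →L[ℂ] Fiber ℓ d lam p,
          IsDirectSumOf k (T : Bergman (ℓ + d) lam →L[ℂ] Bergman (ℓ + d) lam) S →
            (∀ p : ℕ, S p ∈ toeplitzAlg d (lam + p + ℓ)) ∧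
            TendstoUniformly (fun (ρ : Fin m → ℕ) (z : 𝔹 d) => berezin (S (∑ j, ρ j)) z)
              (fun z => (ν T : 𝔹 d →ᵇ ℂ) z) (comap (fun ρ : Fin m → ℕ => ∑ j, ρ j) atTop)) ∧
      Continuous ν ∧
      Function.Surjective ν ∧
      Function.Surjective (fun T => gelfandStarTransform (BUC d) (ν T)) ∧
      ∀ η : WeakDual.characterSpace ℂ (BUC d), ∃ νη : bigToeplitzAlg ℓ d lam →⋆ₐ[ℂ] ℂ,
        Continuous νη ∧ ∀ T, νη T = gelfandStarTransform (BUC d) (ν T) η) ∧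
    ∀ μ : ℝ, -1 < μ → ∀ π : toeplitzAlg d μ →⋆ₙₐ[ℂ] ℂ, ∀ T, π T = 0 := by
  refine ⟨⟨symbolHom d hlam hℓ, fun T => ⟨⟨compress hlam hℓ T,
      isDirectSumOf_compress hlam hℓ hkℓ (bigToeplitzAlg_le_symbolicAlg T.2),
      fun S hS => hS.eq_compress hlam hℓ hkℓ (bigToeplitzAlg_le_symbolicAlg T.2)⟩,
      fun S hS => ?_⟩, continuous_symbolHom hlam hℓ, surjective_symbolHom hlam hℓ,
      (gelfandStarTransform (BUC d)).surjective.comp (surjective_symbolHom hlam hℓ),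
      exists_character hlam hℓ⟩, fun μ hμ π T => ?_⟩
  · obtain rfl := hS.eq_compress hlam hℓ hkℓ (bigToeplitzAlg_le_symbolicAlg T.2)
    exact ⟨fun p => (bigToeplitzAlg_le_symbolicAlg (hlam := hlam) (hℓ := hℓ) T.2).1.2.1 p,
      tendstoUniformly_berezin hlam hℓ T⟩
  · exact character_eq_zero hd hμ π T
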